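/- **Setup.** Fix $q,d\in\mathbb C^\times$ and put $q_1=q^{-1}d$, $q_2=q^2$, $q_3=q^{-1}d^{-1}$, so $q_1q_2q_3=1$. Assume that $q_1^{n_1}q_2^{n_2}q_3^{n_3}=1$ with $n_i\in\mathbb Z$ only if $n_1=n_2=n_3$. Let $m\ge 1$; the color index $i$ is read modulo $m$. *Shuffle algebra.* For $N\ge0$ let $Sh^0_{m,N}=Sh^0_{m,N}(q_1,q_2,q_3)$ be the space of rational functions $F(x_1;\dots;x_m)$, $x_i=(x_{i,1},\dots,x_{i,N})$, symmetric in each group $x_i$, of the form $F=f/\prod_{i=1}^m\prod_{a,b}(x_{i,a}-x_{i+1,b})$ (for $m=1$: $F=f/\prod_{a<b}(x_a-x_b)^2$) with a Laurent polynomial $f$, which vanish (equivalently, $f$ vanishes) whenever $x_{i,b}=q_3x_{i-1,a}$, $x_{i,c}=q_2x_{i,b}$, and whenever $x_{i,b}=q_2x_{i,a}$, $x_{i+1,c}=q_3x_{i,b}$, for some $i,a,b,c$. The shuffle product of $F\in Sh^0_{m,M}$ and $G\in Sh^0_{m,N}$ is $$(F*G)(x)=\sum_{I_i\sqcup J_i=\{1,\dots,M+N\},\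 |I_i|=M,\ |J_i|=N} F(x_{1,I_1};\dots;x_{m,I_m})\,G(x_{1,J_1};\dots;x_{m,J_m})\prod_{i,j}\prod_{a\in I_i,\,b\in J_j}\omega_{i,j}(x_{i,a},x_{j,b}),$$ where for $m\ge3$: $\omega_{i,i}(x,y)=\frac{x-q_2y}{x-y}$, $\omega_{i-1,i}(x,y)=\frac{x-q_1y}{x-y}$, $\omega_{i,i-1}(x,y)=d\,\frac{x-q_3y}{x-y}$, and $\omega_{i,j}=1$ otherwise; for $m=2$: $\omega_{i,i}(x,y)=\frac{x-q_2y}{x-y}$, $\omega_{i,i-1}(x,y)=\frac{(x-q_1y)(x-q_3y)}{(x-y)^2}$; for $m=1$: $\omega_{1,1}(x,y)=\frac{(x-q_1y)(x-q_2y)(x-q_3y)}{(x-y)^3}$. For other parameters of the form $(q_1',q_2,q_3')$ with $q_1'q_2q_3'=1$ the number $q$ is unchanged and $d$ is replaced by $d'=q\,q_1'$. *Bethe algebra.* Let $s=(s_1,\dots,s_m)\in(\mathbb C^\times)^m$ with $\prod_i s_i=1$. It is generic if $q_1^{a_1}q_2^{a_2}\prod_{i=1}^{m-1}s_i^{b_i}=1$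 with integer exponents holds only if all exponents are $0$. Let $\mathcal B_{m,N}(s)$ be the set of $F\in Sh^0_{m,N}$ such that, for all $0\le k_1,\dots,k_m\le N$, the function $F$ with $x_{i,a}$ replaced by $\xi x_{i,a}$ for $1\le i\le m$, $1\le a\le k_i$, has limits $F^{\mathbf k}_0$ as $\xi\to0$ and $F^{\mathbf k}_\infty$ as $\xi\to\infty$, and $F^{\mathbf k}_\infty=F^{\mathbf k}_0\prod_i s_i^{k_i}$. Put $\mathcal B_m(s)=\bigoplus_{N\ge0}\mathcal B_{m,N}(s)$; for $m=1$, where $s=(1)$, write $\mathcal B_1$. *Elements $G$.* Put $t_i(s)=s_1\cdots s_{i-1}\prod_{a=1}^N x_{i-1,a}/x_{i,a}$ and $P^m_N=\prod_{i=1}^m\prod_{a,b}\frac{x_{i,a}-q_2x_{i,b}}{x_{i,a}-x_{i+1,b}}$ for $m\ge2$, $P^1_N=\prod_{a<b}\frac{(x_a-q_2x_b)(x_a-q_2^{-1}x_b)}{(x_a-x_b)^2}$. Let $G^m_{r,N}(s)=P^m_N\,e_r(t_1(s),\dots,t_m(s))$, with $e_r$ the $r$-th elementary symmetric polynomial. *Fusion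 map.* Let $m\ge2$, fix a value of $\log q_1$ and put $q_1^r=e^{r\log q_1}$ for $r\in\mathbb Q$; put $\tilde q_1=q_1q_1^{1/(m-1)}$, $\tilde q_3=q_3q_1^{-1/(m-1)}$. For $F\in Sh^0_{m,N}$ and $0\le L\le N$ substitute, for $1\le i\le m$, $x_{i,a}=q_1^{-(m-i)/(m-1)}y_{i,a}$ for $1\le a\le L$, with $y_{m,a}=y_{1,a}$, and $x_{i,b}=q_3^{i-1}z_b$ for $L+1\le b\le N$. Divide the result by $A_Y A_Z A_{YZ}$ to get $\tilde F_{N,L}(y_1;\dots;y_{m-1}|z)$. Here, with $\delta=d$ if $m\ge3$ and $\delta=1$ if $m=2$, and all indices $a,b$ of $y$ in $\{1,\dots,L\}$ and of $z$ in $\{L+1,\dots,N\}$, $$A_Z=\prod_{a<b}\Bigl(\delta\tfrac{(z_a-q_2z_b)(z_a-q_2^{-1}z_b)}{(z_a-q_3z_b)(z_a-q_3^{-1}z_b)}\Bigr)^{m-1}\,\delta\,\tfrac{(z_a-z_b)^2}{(z_a-q_3^{m-1}z_b)(z_a-q_3^{-m+1}z_b)},$$ $$A_{YZ}=\prod_{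a,b}\Bigl(\prod_{i=2}^{m-1}d\,\tfrac{(Y_{i,a}-q_1q_3^iz_b)(Y_{i,a}-q_1^{-1}q_3^{i-2}z_b)}{(Y_{i,a}-q_3^iz_b)(Y_{i,a}-q_3^{i-2}z_b)}\Bigr)\delta^2\tfrac{(y_{1,a}-q_1^2q_3z_b)(y_{1,a}-q_3^{-1}z_b)(y_{1,a}-q_1^{-1}q_3^{m-2}z_b)(y_{1,a}-q_1q_3^mz_b)}{(y_{1,a}-q_1q_3z_b)(y_{1,a}-z_b)(y_{1,a}-q_3^{m-2}z_b)(y_{1,a}-q_1q_3^{m-1}z_b)},$$ with $Y_{i,a}=q_1^{-(m-i)/(m-1)}y_{i,a}$; for $m\ge3$ $$A_Y=\prod_{a<b}d\,\tfrac{(y_{1,a}-q_2y_{1,b})(y_{1,a}-q_2^{-1}y_{1,b})}{(y_{1,a}-q_1y_{1,b})(y_{1,a}-q_1^{-1}y_{1,b})}\ \prod_{a,b}\Bigl(\kappa\prod_{i=1}^{m-1}\tfrac{y_{i,a}-y_{i+1,b}}{y_{i,a}-q_1^{1/(m-1)}y_{i+1,b}}\Bigr),$$ with $\kappa=d\,q_1^{1/2}$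 if $m=3$ and $\kappa=1$ if $m\ge4$; and for $m=2$ $$A_Y=\prod_{a<b}\tfrac{(y_{1,a}-q_2y_{1,b})(y_{1,a}-q_2^{-1}y_{1,b})(y_{1,a}-y_{1,b})^2}{(y_{1,a}-q_1y_{1,b})^2(y_{1,a}-q_1^{-1}y_{1,b})^2}.$$ Put $\pi_m^{m-1}(F)=\sum_{L=0}^N\tilde F_{N,L}$, where $f\otimes g$ is identified with the function $f(y)g(z)$. **Theorem.** Let $m\ge1$ and let $s$ be generic. Then $\mathcal B_m(s)$ is closed under the shuffle product, and: (i) The elements $G^m_{r,N}(s)$, $0\le r\le m-1$, $N\ge0$, generate the algebra $\mathcal B_m(s)$. (ii) If $m\ge2$, the restriction of $\pi_m^{m-1}$ to $\mathcal B_m(s)$ is an isomorphism of $\mathbb Z_{\ge0}$-graded algebras $$\mathcal B_m(q_1,q_2,q_3;s)\ \longrightarrow\ \mathcal B_{m-1}(\tilde q_1,q_2,\tilde q_3;\tilde s)\otimes\mathcal B_1(q_1q_3^{-m+1},q_2,q_3^m),$$ where $\tilde s=(\tilde s_1,\dots,\tilde s_{m-1})$, $\tilde s_1=(s_2\cdots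 s_{m-1})^{-1}$ and $\tilde s_i=s_i$ for $2\le i\le m-1$; the two factors on the right are likewise closed under the shuffle product. (iii) The algebra $\mathcal B_m(s)$ is commutative and is isomorphic, as a graded algebra, to the polynomial algebra $\mathcal R_m=\mathbb C[T_{i,\nu}\mid 1\le i\le m,\ \nu\in\mathbb Z_{>0}]$ with $\deg T_{i,\nu}=\nu$. -/

import Mathlib

open Filter Topology
open scoped TensorProduct

noncomputable section

/-! ### Parameters -/

/-- The two basic parameters `q, d`; they determine `q₁, q₂, q₃` with `q₁ q₂ q₃ = 1`. -/
structure QParam where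
  q : ℂ
  d : ℂ

namespace QParam

/-- `q₁ = q⁻¹ d`. -/
def q1 (P : QParam) : ℂ := P.q⁻¹ * P.d

/-- `q₂ = q²`. -/
def q2 (P : QParam) : ℂ := P.q ^ 2

/-- `q₃ = q⁻¹ d⁻¹`. -/
def q3 (P : QParam) : ℂ := P.q⁻¹ * P.d⁻¹

/-- The standing assumption: `q, d` are nonzero, and `q₁^n₁ q₂^n₂ q₃^n₃ = 1` with integer
exponents holds only if `n₁ = n₂ = n₃`. -/
structure Admissible (P : QParam) : Prop where
  q_ne : P.q ≠ 0
  d_ne : P.d ≠ 0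
  indep : ∀ n₁ n₂ n₃ : ℤ, P.q1 ^ n₁ * P.q2 ^ n₂ * P.q3 ^ n₃ = 1 → n₁ = n₂ ∧ n₂ = n₃

/-- The parameters of the first tensor factor of the fusion map for `m` colors (`ℓ` is the chosen
value of `log q₁`): the same `q`, and `d` replaced by `d q₁^{1/(m-1)}`, so that
`q̃₁ = q₁ q₁^{1/(m-1)}`, `q̃₂ = q₂`, `q̃₃ = q₃ q₁^{-1/(m-1)}`. -/
def tilde (P : QParam) (ℓ : ℂ) (m : ℕ) : QParam where
  q := P.q
  d := P.d * Complex.exp (ℓ / ((m : ℂ) - 1))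

/-- The parameters `(q₁ q₃^{-(m-1)}, q₂, q₃^m)` of the second tensor factor of the fusion map. -/
def second (P : QParam) (m : ℕ) : QParam where
  q := P.q
  d := P.d * P.q3 ^ (-((m : ℤ) - 1))

theorem tilde_q1 (P : QParam) (ℓ : ℂ) (m : ℕ) :
    (P.tilde ℓ m).q1 = P.q1 * Complex.exp (ℓ / ((m : ℂ) - 1)) := by
  simp only [q1, tilde]; ring

theorem tilde_q2 (P : QParam) (ℓ : ℂ) (m : ℕ) : (P.tilde ℓ m).q2 = P.q2 := rfl

theorem tilde_q3 (P : QParam) (ℓ : ℂ) (m : ℕ) :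
    (P.tilde ℓ m).q3 = P.q3 * Complex.exp (-(ℓ / ((m : ℂ) - 1))) := by
  simp only [q3, tilde, Complex.exp_neg, mul_inv]; ring

theorem second_q1 (P : QParam) (m : ℕ) :
    (P.second m).q1 = P.q1 * P.q3 ^ (-((m : ℤ) - 1)) := by
  simp only [q1, second]; ring

theorem second_q2 (P : QParam) (m : ℕ) : (P.second m).q2 = P.q2 := rfl

theorem second_q3 (P : QParam) (hP : P.Admissible) (m : ℕ) :
    (P.second m).q3 = P.q3 ^ m := by
  have h3 : P.q3 ≠ 0 := mul_ne_zero (inv_ne_zero hP.q_ne) (inv_ne_zero hP.d_ne)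
  have h : (P.second m).q3 = P.q3 * P.q3 ^ ((m : ℤ) - 1) := by
    simp only [q3, second, mul_inv, zpow_neg, inv_inv]; ring
  rw [h, ← zpow_one_add₀ h3]
  simp

end QParam

/-! ### Colors

The colors `1, …, m` are the elements `0, …, m - 1` of `Fin m`, in this order, read cyclically. -/

/-- The color `i + 1`, read modulo `m`. -/
def nextColor {m : ℕ} (i : Fin m) : Fin m := ⟨((i : ℕ) + 1) % m, Nat.mod_lt _ i.pos⟩

/-- The color `i - 1`, read modulo `m`. -/
def prevColor {m : ℕ} (i : Fin m) : Fin m := ⟨((i : ℕ) + (m - 1)) % m, Nat.mod_lt _ i.pos⟩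

/-! ### Configurations of colored points

A rational function in the variables `x_i = (x_{i,a})_a`, symmetric in each group `x_i`, with poles
only along coordinate hyperplanes and diagonals, is the same thing as the function that it defines
on the (Zariski dense) set of points with nonzero and pairwise distinct coordinates, and, by
symmetry, its value depends only on the set of coordinates of each color. -/

/-- A finite set of colored points is generic if its points are nonzero and pairwise distinct (also
for different colors). -/
def GenericSet {m : ℕ} (T : Finset (Fin m × ℂ)) : Prop :=
  (∀ p ∈ T, p.2 ≠ 0) ∧ Set.InjOn Prod.snd (T : Set (Fin m × ℂ))

theorem GenericSet.mono {m : ℕ} {S T : Finset (Fin m × ℂ)} (hT : GenericSet T) (h : S ⊆ T) :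
    GenericSet S :=
  ⟨fun p hp => hT.1 p (h hp), hT.2.mono (by exact_mod_cast h)⟩

/-- Generic finite configurations of points in `ℂ`, colored by `m` colors. -/
def Conf (m : ℕ) : Type := {T : Finset (Fin m × ℂ) // GenericSet T}

open Classical in
/-- The part of the configuration `T` that lies in `I`. -/
def Conf.restrict {m : ℕ} (T : Conf m) (I : Finset (Fin m × ℂ)) : Conf m :=
  ⟨T.1 ∩ I, T.2.mono Finset.inter_subset_left⟩

/-! ### The shuffle product -/

/-- The structure functions `ω_{i,j}(x, y)` of the shuffle algebra with `m` colors, evaluated at two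
colored points `u = (i, x)`, `v = (j, y)`. -/
def omega (P : QParam) (m : ℕ) (u v : Fin m × ℂ) : ℂ :=
  let x := u.2
  let y := v.2
  if m = 1 then
    (x - P.q1 * y) * (x - P.q2 * y) * (x - P.q3 * y) / (x - y) ^ 3
  else if m = 2 then
    if u.1 = v.1 then (x - P.q2 * y) / (x - y)
    else (x - P.q1 * y) * (x - P.q3 * y) / (x - y) ^ 2
  else
    if u.1 = v.1 then (x - P.q2 * y) / (x - y)
    else if v.1 = nextColor u.1 then (x - P.q1 * y) / (x - y)
    else if u.1 = nextColor v.1 then P.d * ((x - P.q3 * y) / (x - y))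
    else 1

/-- The ambient algebra: all functions on generic configurations of `m`-colored points. Its
multiplication is the shuffle product. The shuffle algebra and the Bethe algebra are made of the
elements of it that come from suitable rational functions. -/
def ShuffleAmbient (_P : QParam) (m : ℕ) : Type := Conf m → ℂ

namespace ShuffleAmbient

variable {P : QParam} {m : ℕ}

instance : AddCommGroup (ShuffleAmbient P m) := inferInstanceAs (AddCommGroup (Conf m → ℂ))

instance : Module ℂ (ShuffleAmbient P m) := inferInstanceAs (Module ℂ (Conf m → ℂ))

/-- The unit: the constant function `1` in no variables. -/
instance : One (ShuffleAmbient P m) := ⟨fun T => open Classical in if T.1 = ∅ then 1 else 0⟩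

open Classical in
/-- The shuffle product
`(F * G)(T) = ∑ F(I) G(J) ∏_{u ∈ I, v ∈ J} ω(u, v)`, the sum over all decompositions
`T = I ⊔ J`. -/
instance : Mul (ShuffleAmbient P m) :=
  ⟨fun F G T => ∑ I ∈ T.1.powerset, F (T.restrict I) * G (T.restrict (T.1 \ I)) *
    ∏ u ∈ I, ∏ v ∈ T.1 \ I, omega P m u v⟩

/-! The algebra axioms are proved by extending functions by zero to all finite sets. -/

open Classical in
/-- The product on functions of all finite subsets of a type. -/
def conv {α : Type} (w : α → α → ℂ) (f g : Finset α → ℂ) (T : Finset α) : ℂ :=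
  ∑ I ∈ T.powerset, f I * g (T \ I) * ∏ u ∈ I, ∏ v ∈ T \ I, w u v

open Classical in
/-- Extension by zero from generic configurations to all finite sets. -/
def ext0 (F : Conf m → ℂ) (T : Finset (Fin m × ℂ)) : ℂ :=
  if h : GenericSet T then F ⟨T, h⟩ else 0

open Classical in
theorem conv_assoc {α : Type} (w : α → α → ℂ) (f g h : Finset α → ℂ) (T : Finset α) :
    conv w (conv w f g) h T = conv w f (conv w g h) T := by
  unfold conv
  simp_rw [Finset.sum_mul, Finset.mul_sum, Finset.sum_mul]
  rw [Finset.sum_sigma', Finset.sum_sigma']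
  refine Finset.sum_bij' (fun p _ => ⟨p.2, p.1 \ p.2⟩) (fun p _ => ⟨p.1 ∪ p.2, p.1⟩) ?_ ?_ ?_ ?_ ?_
  · rintro ⟨L, I⟩ hp
    simp only [Finset.mem_sigma, Finset.mem_powerset] at hp ⊢
    exact ⟨hp.2.trans hp.1, Finset.sdiff_subset_sdiff hp.1 le_rfl⟩
  · rintro ⟨I, K⟩ hp
    simp only [Finset.mem_sigma, Finset.mem_powerset] at hp ⊢
    exact ⟨Finset.union_subset hp.1 (hp.2.trans Finset.sdiff_subset), Finset.subset_union_left⟩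
  · rintro ⟨L, I⟩ hp
    simp only [Finset.mem_sigma, Finset.mem_powerset] at hp ⊢
    simp [Finset.union_sdiff_of_subset hp.2]
  · rintro ⟨I, K⟩ hp
    simp only [Finset.mem_sigma, Finset.mem_powerset] at hp ⊢
    have : Disjoint K I := Finset.disjoint_of_subset_left hp.2 Finset.sdiff_disjoint
    simp [Finset.union_sdiff_left, Finset.sdiff_eq_self_of_disjoint this]
  · rintro ⟨L, I⟩ hp
    simp only [Finset.mem_sigma, Finset.mem_powerset] at hp ⊢
    obtain ⟨hL, hI⟩ := hp
    have e1 : (T \ I) \ (L \ I) = T \ L := by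
      ext a; have := @hI a; simp only [Finset.mem_sdiff]; tauto
    have e2 : ∏ u ∈ L, ∏ v ∈ T \ L, w u v =
        (∏ u ∈ L \ I, ∏ v ∈ T \ L, w u v) * ∏ u ∈ I, ∏ v ∈ T \ L, w u v :=
      (Finset.prod_sdiff hI).symm
    have e3 : ∏ u ∈ I, ∏ v ∈ T \ I, w u v =
        (∏ u ∈ I, ∏ v ∈ T \ L, w u v) * ∏ u ∈ I, ∏ v ∈ L \ I, w u v := by
      rw [← Finset.prod_mul_distrib]
      refine Finset.prod_congr rfl fun u _ => ?_
      rw [← e1]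
      exact (Finset.prod_sdiff (Finset.sdiff_subset_sdiff hL le_rfl)).symm
    rw [e1, e2, e3]
    ring

open Classical in
theorem conv_congr {α : Type} (w : α → α → ℂ) {f f' g g' : Finset α → ℂ} {T : Finset α}
    (hf : ∀ I ⊆ T, f I = f' I) (hg : ∀ I ⊆ T, g I = g' I) : conv w f g T = conv w f' g' T := by
  refine Finset.sum_congr rfl fun I hI => ?_
  rw [hf I (Finset.mem_powerset.1 hI), hg _ Finset.sdiff_subset]

open Classical in
theorem mul_apply' (F G : ShuffleAmbient P m) (T : Conf m) :
    (F * G) T = ∑ I ∈ T.1.powerset, F (T.restrict I) * G (T.restrict (T.1 \ I)) *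
      ∏ u ∈ I, ∏ v ∈ T.1 \ I, omega P m u v := rfl

open Classical in
theorem restrict_eq (F : Conf m → ℂ) (T : Conf m) {I : Finset (Fin m × ℂ)} (h : I ⊆ T.1) :
    F (T.restrict I) = ext0 F I := by
  have e : T.1 ∩ I = I := Finset.inter_eq_right.2 h
  have hI : GenericSet I := T.2.mono h
  rw [ext0, dif_pos hI]
  congr 1
  exact Subtype.ext e

theorem mul_eq_conv (F G : ShuffleAmbient P m) (T : Conf m) :
    (F * G) T = conv (omega P m) (ext0 F) (ext0 G) T.1 := by
  classical
  rw [mul_apply', conv]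
  refine Finset.sum_congr (by congr!) fun I hI => ?_
  have hI' : I ⊆ T.1 := by simpa using hI
  rw [restrict_eq F T hI', restrict_eq G T Finset.sdiff_subset]
  congr!

theorem ext0_mul (F G : ShuffleAmbient P m) {T : Finset (Fin m × ℂ)} (h : GenericSet T) :
    ext0 (F * G : ShuffleAmbient P m) T = conv (omega P m) (ext0 F) (ext0 G) T := by
  have e : ext0 (F * G : ShuffleAmbient P m) T = (F * G : ShuffleAmbient P m) ⟨T, h⟩ := dif_pos h
  exact e.trans (mul_eq_conv F G ⟨T, h⟩)

theorem add_apply' (F G : ShuffleAmbient P m) (T : Conf m) : (F + G) T = F T + G T := rfl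

theorem smul_apply' (c : ℂ) (F : ShuffleAmbient P m) (T : Conf m) : (c • F) T = c * F T := rfl

theorem zero_apply' (T : Conf m) : (0 : ShuffleAmbient P m) T = 0 := rfl

open Classical in
theorem one_apply' (T : Conf m) : (1 : ShuffleAmbient P m) T = if T.1 = ∅ then 1 else 0 := rfl

instance : Ring (ShuffleAmbient P m) :=
  { (inferInstance : AddCommGroup (ShuffleAmbient P m)),
    (inferInstance : Mul (ShuffleAmbient P m)),
    (inferInstance : One (ShuffleAmbient P m)) with
    left_distrib := fun F G H => by
      funext T
      simp only [mul_apply', add_apply', ← Finset.sum_add_distrib]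
      exact Finset.sum_congr rfl fun I _ => by ring
    right_distrib := fun F G H => by
      funext T
      simp only [mul_apply', add_apply', ← Finset.sum_add_distrib]
      exact Finset.sum_congr rfl fun I _ => by ring
    zero_mul := fun F => by
      funext T; simp [mul_apply', zero_apply']
    mul_zero := fun F => by
      funext T; simp [mul_apply', zero_apply']
    mul_assoc := fun F G H => by
      funext T
      rw [mul_eq_conv, mul_eq_conv]
      rw [conv_congr (omega P m) (T := T.1) (fun I hI => ext0_mul F G (T.2.mono hI))
          (fun I _ => rfl), conv_assoc]
      exact (conv_congr (omega P m) (T := T.1) (fun I _ => rfl)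
          (fun I hI => ext0_mul G H (T.2.mono hI))).symm
    one_mul := fun F => by
      classical
      funext T
      rw [mul_apply', Finset.sum_eq_single ∅]
      · have e : T.restrict (T.1 \ ∅) = T := Subtype.ext (by simp [Conf.restrict])
        have e' : (1 : ShuffleAmbient P m) (T.restrict ∅) = 1 := by
          rw [one_apply', if_pos (by simp [Conf.restrict])]
        rw [e, e']
        simp
      · intro I hI hne
        have e : (T.restrict I).1 = I := Finset.inter_eq_right.2 (by simpa using hI)
        rw [one_apply', if_neg (by rwa [e])]
        simp
      · simp
    mul_one := fun F => by
      classical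
      funext T
      rw [mul_apply', Finset.sum_eq_single T.1]
      · have e : T.restrict T.1 = T := Subtype.ext (by simp [Conf.restrict])
        have e' : (1 : ShuffleAmbient P m) (T.restrict (T.1 \ T.1)) = 1 := by
          rw [one_apply', if_pos (by simp [Conf.restrict])]
        rw [e, e']
        simp
      · intro I hI hne
        have hI' : I ⊆ T.1 := by simpa using hI
        have e : (T.restrict (T.1 \ I)).1 ≠ ∅ := by
          have e0 : (T.restrict (T.1 \ I)).1 = T.1 \ I :=
            Finset.inter_eq_right.2 Finset.sdiff_subset
          rw [e0]
          intro h0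
          exact hne (hI'.antisymm (Finset.sdiff_eq_empty_iff_subset.1 h0))
        have e' : (1 : ShuffleAmbient P m) (T.restrict (T.1 \ I)) = 0 := by
          rw [one_apply', if_neg e]
        rw [e', mul_zero, zero_mul]
      · simp }

instance : Algebra ℂ (ShuffleAmbient P m) :=
  Algebra.ofModule
    (fun c F G => by
      funext T
      simp only [mul_apply', smul_apply', Finset.mul_sum]
      exact Finset.sum_congr rfl fun I _ => by ring)
    (fun c F G => by
      funext T
      simp only [mul_apply', smul_apply', Finset.mul_sum]
      exact Finset.sum_congr rfl fun I _ => by ring)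

end ShuffleAmbient

/-! ### Values at tuples of coordinates -/

/-- The coordinates `x_{i,a}` are nonzero and pairwise distinct. -/
def GenericTuple {m N : ℕ} (x : Fin m → Fin N → ℂ) : Prop :=
  (∀ i a, x i a ≠ 0) ∧ Function.Injective fun v : Fin m × Fin N => x v.1 v.2

open Classical in
/-- The set of colored points `x_{i,a}` (of color `i`). -/
def tupleSet {m N : ℕ} (x : Fin m → Fin N → ℂ) : Finset (Fin m × ℂ) :=
  Finset.univ.image fun v : Fin m × Fin N => (v.1, x v.1 v.2)

theorem GenericTuple.genericSet {m N : ℕ} {x : Fin m → Fin N → ℂ} (hx : GenericTuple x) :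
    GenericSet (tupleSet x) := by
  classical
  constructor
  · intro p hp
    simp only [tupleSet, Finset.mem_image, Finset.mem_univ, true_and] at hp
    obtain ⟨v, rfl⟩ := hp
    exact hx.1 _ _
  · intro p hp r hr h
    simp only [tupleSet, Finset.coe_image, Finset.coe_univ, Set.image_univ, Set.mem_range] at hp hr
    obtain ⟨v, rfl⟩ := hp
    obtain ⟨u, rfl⟩ := hr
    have : v = u := hx.2 h
    rw [this]

namespace ShuffleAmbient

variable {P : QParam} {m : ℕ}

open Classical in
/-- The value `F(x_1; …; x_m)` at a generic tuple with `N` coordinates of each color, as a linear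
functional of `F`; it is `0` by convention at the other tuples, which are never used. -/
def eval {N : ℕ} (x : Fin m → Fin N → ℂ) : ShuffleAmbient P m →ₗ[ℂ] ℂ where
  toFun F := if h : GenericTuple x then F ⟨tupleSet x, h.genericSet⟩ else 0
  map_add' F G := by
    by_cases h : GenericTuple x
    · simp only [dif_pos h]; rfl
    · simp [h]
  map_smul' c F := by
    by_cases h : GenericTuple x
    · simp only [dif_pos h]; rfl
    · simp [h]

open Classical in
/-- The element of degree `(N, …, N)` given by an expression `g`, symmetric in each group of
variables `x_i`: its value at a configuration with `N` points of each color is the value of `g` at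
an enumeration of the configuration. -/
def ofSymmetric (P : QParam) {m : ℕ} (N : ℕ) (g : (Fin m → Fin N → ℂ) → ℂ) : ShuffleAmbient P m :=
  fun T => if h : ∃ x : Fin m → Fin N → ℂ, GenericTuple x ∧ tupleSet x = T.1 then g h.choose else 0

end ShuffleAmbient

/-! ### The shuffle algebra in degrees `(N, …, N)` -/

/-- The denominator in the pole condition: `∏_i ∏_{a,b} (x_{i,a} - x_{i+1,b})` if `m ≥ 2`, and
`∏_{a<b} (x_a - x_b)²` if `m = 1`. -/
def poleDenominator {m N : ℕ} (x : Fin m → Fin N → ℂ) : ℂ :=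
  if m = 1 then ∏ i, ∏ a : Fin N, ∏ b ∈ Finset.Ioi a, (x i a - x i b) ^ 2
  else ∏ i, ∏ a, ∏ b, (x i a - x (nextColor i) b)

/-- The points on which the wheel conditions impose vanishing:
(a) `x_{i,b} = q₃ x_{i-1,a}`, `x_{i,c} = q₂ x_{i,b}` (written with `i - 1` as `i`);
(b) `x_{i,b} = q₂ x_{i,a}`, `x_{i+1,c} = q₃ x_{i,b}`. -/
def OnWheel (P : QParam) {m N : ℕ} (x : Fin m → Fin N → ℂ) : Prop :=
  ∃ (i : Fin m) (a b c : Fin N),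
    (x (nextColor i) b = P.q3 * x i a ∧ x (nextColor i) c = P.q2 * x (nextColor i) b) ∨
    (x i b = P.q2 * x i a ∧ x (nextColor i) c = P.q3 * x i b)

/-- `F` is the rational function `f / poleDenominator`, where the Laurent polynomial
`f = p / (∏ x_{i,a})^e` vanishes on the wheels. -/
def IsShuffleElement (P : QParam) {m : ℕ} (N : ℕ) (F : ShuffleAmbient P m) : Prop :=
  ∃ (p : MvPolynomial (Fin m × Fin N) ℂ) (e : ℕ),
    (∀ x : Fin m → Fin N → ℂ, GenericTuple x →
      ShuffleAmbient.eval x F = MvPolynomial.eval (fun v => x v.1 v.2) p /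
        (∏ i, ∏ a, x i a) ^ e / poleDenominator x) ∧
    (∀ x : Fin m → Fin N → ℂ, (∀ i a, x i a ≠ 0) → OnWheel P x →
      MvPolynomial.eval (fun v => x v.1 v.2) p = 0)

open Classical in
/-- `T` has `N` points of each color. -/
def HasDegree {m : ℕ} (N : ℕ) (T : Conf m) : Prop := ∀ i, (T.1.filter fun u => u.1 = i).card = N

/-- The component `Sh_{m,(N,…,N)}` of the shuffle algebra: homogeneous of degree `(N, …, N)` with the
pole condition and the wheel conditions (symmetry is built in). -/
def shuffleComponent (P : QParam) (m N : ℕ) : Submodule ℂ (ShuffleAmbient P m) where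
  carrier := {F | (∀ T : Conf m, ¬ HasDegree N T → F T = 0) ∧ IsShuffleElement P N F}
  zero_mem' := ⟨fun _ _ => rfl, 0, 0, by simp, by simp⟩
  add_mem' := by
    rintro F G ⟨hF, p, e, hp, hp'⟩ ⟨hG, r, e', hr, hr'⟩
    refine ⟨fun T hT => by rw [ShuffleAmbient.add_apply', hF T hT, hG T hT, add_zero],
      p * (∏ v, MvPolynomial.X v) ^ e' + r * (∏ v, MvPolynomial.X v) ^ e, e + e', ?_, ?_⟩
    · intro x hx
      have h0 : (∏ i, ∏ a, x i a) ≠ 0 :=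
        Finset.prod_ne_zero_iff.2 fun i _ => Finset.prod_ne_zero_iff.2 fun a _ => hx.1 i a
      have h1 : (∏ v : Fin m × Fin N, x v.1 v.2) = ∏ i, ∏ a, x i a := Fintype.prod_prod_type _
      rw [map_add, hp x hx, hr x hx]
      simp only [map_add, map_mul, map_pow, map_prod, MvPolynomial.eval_X, h1]
      rw [← add_div]
      congr 1
      rw [div_add_div _ _ (pow_ne_zero _ h0) (pow_ne_zero _ h0), pow_add]
      ring
    · intro x hx hw
      simp [hp' x hx hw, hr' x hx hw]
  smul_mem' := by
    rintro c F ⟨hF, p, e, hp, hp'⟩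
    refine ⟨fun T hT => by rw [ShuffleAmbient.smul_apply', hF T hT, mul_zero],
      MvPolynomial.C c * p, e, ?_, ?_⟩
    · intro x hx
      rw [map_smul, hp x hx, smul_eq_mul, map_mul, MvPolynomial.eval_C]
      ring
    · intro x hx hw
      simp [hp' x hx hw]

/-! ### The Bethe algebra -/

/-- The substitution `x_{i,a} ↦ ξ x_{i,a}` for `a ≤ k_i`. -/
def scaleTuple {m N : ℕ} (k : Fin m → ℕ) (ξ : ℂ) (x : Fin m → Fin N → ℂ) : Fin m → Fin N → ℂ :=
  fun i a => if (a : ℕ) < k i then ξ * x i a else x i a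

/-- The subspace `B_{m,N}(s)`: for all `k` with `0 ≤ k_i ≤ N` the limits of
`F(ξ x'_1, x''_1; …; ξ x'_m, x''_m)` as `ξ → 0` and `ξ → ∞` exist, and the second is
`∏ s_i^{k_i}` times the first. -/
def betheComponent (P : QParam) {m : ℕ} (s : Fin m → ℂ) (N : ℕ) :
    Submodule ℂ (ShuffleAmbient P m) where
  carrier := {F | F ∈ shuffleComponent P m N ∧
    ∀ k : Fin m → ℕ, (∀ i, k i ≤ N) → ∀ x : Fin m → Fin N → ℂ, GenericTuple x →
      ∃ F₀ : ℂ,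
        Tendsto (fun ξ : ℂ => ShuffleAmbient.eval (scaleTuple k ξ x) F) (𝓝[≠] 0) (𝓝 F₀) ∧
        Tendsto (fun ξ : ℂ => ShuffleAmbient.eval (scaleTuple k ξ x) F) (Bornology.cobounded ℂ)
          (𝓝 (F₀ * ∏ i, s i ^ k i))}
  zero_mem' := ⟨Submodule.zero_mem _, fun k _ x _ => ⟨0, by simp, by simp⟩⟩
  add_mem' := by
    rintro F G ⟨hF, hF'⟩ ⟨hG, hG'⟩
    refine ⟨Submodule.add_mem _ hF hG, fun k hk x hx => ?_⟩
    obtain ⟨a, ha, ha'⟩ := hF' k hk x hx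
    obtain ⟨b, hb, hb'⟩ := hG' k hk x hx
    refine ⟨a + b, ?_, ?_⟩
    · simpa only [map_add] using ha.add hb
    · simpa only [map_add, add_mul] using ha'.add hb'
  smul_mem' := by
    rintro c F ⟨hF, hF'⟩
    refine ⟨Submodule.smul_mem _ c hF, fun k hk x hx => ?_⟩
    obtain ⟨a, ha, ha'⟩ := hF' k hk x hx
    refine ⟨c * a, ?_, ?_⟩
    · simpa only [map_smul, smul_eq_mul] using ha.const_mul c
    · simpa only [map_smul, smul_eq_mul, mul_assoc] using ha'.const_mul c

/-- The subspace `B_m(s) = ⨁_N B_{m,N}(s)`. -/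
def betheSpace (P : QParam) {m : ℕ} (s : Fin m → ℂ) : Submodule ℂ (ShuffleAmbient P m) :=
  ⨆ N, betheComponent P s N

/-- `B_m(s)` as an algebra, defined as the subalgebra generated by the subspace `B_m(s)`. That it
equals this subspace, that is, that `B_m(s)` is closed under the shuffle product, is not built in. -/
def betheAlgebra (P : QParam) {m : ℕ} (s : Fin m → ℂ) : Subalgebra ℂ (ShuffleAmbient P m) :=
  Algebra.adjoin ℂ (betheSpace P s : Set (ShuffleAmbient P m))

/-- `s ∈ (ℂ^×)^m` with `∏ s_i = 1` is generic: `q₁^{a₁} q₂^{a₂} ∏_{i<m} s_i^{b_i} = 1` with integer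
exponents only if all exponents vanish. -/
structure IsGeneric (P : QParam) {m : ℕ} (s : Fin m → ℂ) : Prop where
  ne_zero : ∀ i, s i ≠ 0
  prod_eq_one : ∏ i, s i = 1
  indep : ∀ (a₁ a₂ : ℤ) (b : Fin m → ℤ), (∀ i : Fin m, (i : ℕ) + 1 = m → b i = 0) →
    P.q1 ^ a₁ * P.q2 ^ a₂ * ∏ i, s i ^ b i = 1 → a₁ = 0 ∧ a₂ = 0 ∧ ∀ i, b i = 0

/-! ### The elements `G_{r,N}(s)` -/

/-- The prefactor `P^m_N`. -/
def prefactorP (P : QParam) {m N : ℕ} (x : Fin m → Fin N → ℂ) : ℂ :=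
  if m = 1 then
    ∏ i, ∏ a : Fin N, ∏ b ∈ Finset.Ioi a,
      ((x i a - P.q2 * x i b) * (x i a - P.q2⁻¹ * x i b)) / (x i a - x i b) ^ 2
  else ∏ i, ∏ a, ∏ b, (x i a - P.q2 * x i b) / (x i a - x (nextColor i) b)

/-- `t_i(s) = s_1 ⋯ s_{i-1} · (∏_a x_{i-1,a}) / (∏_a x_{i,a})`. -/
def tFun {m N : ℕ} (s : Fin m → ℂ) (x : Fin m → Fin N → ℂ) (i : Fin m) : ℂ :=
  (∏ j ∈ Finset.Iio i, s j) * ((∏ a, x (prevColor i) a) / ∏ a, x i a)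

/-- `G^m_{r,N}(s) = P^m_N · e_r(t_1(s), …, t_m(s))`, where `e_r` is the elementary symmetric
polynomial. -/
def gElement (P : QParam) {m : ℕ} (s : Fin m → ℂ) (r N : ℕ) : ShuffleAmbient P m :=
  ShuffleAmbient.ofSymmetric P N fun x =>
    prefactorP P x * ∑ A ∈ Finset.powersetCard r Finset.univ, ∏ i ∈ A, tFun s x i

/-! ### The fusion map for `m = n + 2` colors -/

/-- The factor `q₁^{-(m-i)/(m-1)}` for the color number `i = 1, …, m = n + 2`. -/
def fusionScale (ℓ : ℂ) (n i : ℕ) : ℂ :=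
  Complex.exp (-(((n + 2 : ℂ) - i) / (n + 1)) * ℓ)

/-- The specialization: for the color number `i = 1, …, m`,
`x_{i,a} = q₁^{-(m-i)/(m-1)} y_{i,a}` for the first `L` indices, with `y_m = y_1`, and
`x_{i,b} = q₃^{i-1} z_b` for the last `M` indices. -/
def fusionPoint (P : QParam) (ℓ : ℂ) {n L M : ℕ} (y : Fin (n + 1) → Fin L → ℂ)
    (z : Fin 1 → Fin M → ℂ) : Fin (n + 2) → Fin (L + M) → ℂ :=
  fun i => Fin.append
    (fun a => fusionScale ℓ n ((i : ℕ) + 1) * y (Fin.ofNat (n + 1) (i : ℕ)) a)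
    (fun b => P.q3 ^ (i : ℕ) * z 0 b)

/-- The part of the normalizing factor that depends on the variables `y` only. The structure
functions for `1` and `2` colors differ from the general ones (in particular they contain no `d`),
which changes the constants for `m = 2` (`n = 0`) and `m = 3` (`n = 1`). -/
def fusionFactorY (P : QParam) (ℓ : ℂ) {n L : ℕ} (y : Fin (n + 1) → Fin L → ℂ) : ℂ :=
  if n = 0 then
    ∏ a : Fin L, ∏ b ∈ Finset.Ioi a,
      ((y 0 a - P.q2 * y 0 b) * (y 0 a - P.q2⁻¹ * y 0 b) * (y 0 a - y 0 b) ^ 2) /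
        ((y 0 a - P.q1 * y 0 b) ^ 2 * (y 0 a - P.q1⁻¹ * y 0 b) ^ 2)
  else
    (∏ a : Fin L, ∏ b ∈ Finset.Ioi a,
      P.d * (((y 0 a - P.q2 * y 0 b) * (y 0 a - P.q2⁻¹ * y 0 b)) /
        ((y 0 a - P.q1 * y 0 b) * (y 0 a - P.q1⁻¹ * y 0 b)))) *
    ∏ a : Fin L, ∏ b : Fin L, ((if n = 1 then (P.tilde ℓ 3).d else 1) *
      ∏ i : Fin (n + 1), (y i a - y (nextColor i) b) /
        (y i a - Complex.exp (ℓ / (n + 1)) * y (nextColor i) b))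

/-- The part of the normalizing factor that depends on the variables `z` only. -/
def fusionFactorZ (P : QParam) (n : ℕ) {M : ℕ} (z : Fin M → ℂ) : ℂ :=
  let δ : ℂ := if n = 0 then 1 else P.d
  ∏ a : Fin M, ∏ b ∈ Finset.Ioi a,
    (δ * (((z a - P.q2 * z b) * (z a - P.q2⁻¹ * z b)) /
      ((z a - P.q3 * z b) * (z a - P.q3⁻¹ * z b)))) ^ (n + 1) *
    (δ * ((z a - z b) ^ 2 /
      ((z a - P.q3 ^ (n + 1) * z b) * (z a - (P.q3 ^ (n + 1))⁻¹ * z b))))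

/-- The mixed part of the normalizing factor; in the inner product `i` is the color number
`2, …, m - 1`. -/
def fusionFactorYZ (P : QParam) (ℓ : ℂ) {n L M : ℕ} (y : Fin (n + 1) → Fin L → ℂ)
    (z : Fin M → ℂ) : ℂ :=
  let δ : ℂ := if n = 0 then 1 else P.d
  ∏ a : Fin L, ∏ b : Fin M,
    (∏ i ∈ Finset.Icc 2 (n + 1),
      P.d *
        ((fusionScale ℓ n i * y (Fin.ofNat (n + 1) (i - 1)) a - P.q1 * P.q3 ^ i * z b) /
          (fusionScale ℓ n i * y (Fin.ofNat (n + 1) (i - 1)) a - P.q3 ^ i * z b)) *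
        ((fusionScale ℓ n i * y (Fin.ofNat (n + 1) (i - 1)) a - P.q1⁻¹ * P.q3 ^ (i - 2) * z b) /
          (fusionScale ℓ n i * y (Fin.ofNat (n + 1) (i - 1)) a - P.q3 ^ (i - 2) * z b))) *
    (δ ^ 2 *
      (((y 0 a - P.q1 ^ 2 * P.q3 * z b) * (y 0 a - P.q3⁻¹ * z b)) /
        ((y 0 a - P.q1 * P.q3 * z b) * (y 0 a - z b))) *
      (((y 0 a - P.q1⁻¹ * P.q3 ^ n * z b) * (y 0 a - P.q1 * P.q3 ^ (n + 2) * z b)) /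
        ((y 0 a - P.q3 ^ n * z b) * (y 0 a - P.q1 * P.q3 ^ (n + 1) * z b))))

/-- The normalizing factor of the fusion map. -/
def fusionFactor (P : QParam) (ℓ : ℂ) {n L M : ℕ} (y : Fin (n + 1) → Fin L → ℂ)
    (z : Fin 1 → Fin M → ℂ) : ℂ :=
  fusionFactorY P ℓ y * fusionFactorZ P n (z 0) * fusionFactorYZ P ℓ y (z 0)

/-- The (Zariski dense) set of points `(y, z)` at which the fusion map is evaluated. -/
def FusionGeneric (P : QParam) (ℓ : ℂ) {n L M : ℕ} (y : Fin (n + 1) → Fin L → ℂ)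
    (z : Fin 1 → Fin M → ℂ) : Prop :=
  GenericTuple y ∧ GenericTuple z ∧ GenericTuple (fusionPoint P ℓ y z) ∧ fusionFactor P ℓ y z ≠ 0

/-- The fusion map `F ↦ F̃_{N,L}(y | z)`, `N = L + M`: the specialization of `F`, divided by the
normalizing factor. -/
def fusion (P : QParam) (ℓ : ℂ) {n L M : ℕ} (F : ShuffleAmbient P (n + 2))
    (y : Fin (n + 1) → Fin L → ℂ) (z : Fin 1 → Fin M → ℂ) : ℂ :=
  ShuffleAmbient.eval (fusionPoint P ℓ y z) F / fusionFactor P ℓ y z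

/-- The value at `(y, z)` of an element of a tensor product of two algebras of functions:
`f ⊗ g ↦ f(y) g(z)`. -/
def evalTensor {P P' : QParam} {m m' L M : ℕ} (A : Subalgebra ℂ (ShuffleAmbient P m))
    (B : Subalgebra ℂ (ShuffleAmbient P' m')) (y : Fin m → Fin L → ℂ) (z : Fin m' → Fin M → ℂ) :
    A ⊗[ℂ] B →ₗ[ℂ] ℂ :=
  LinearMap.mul' ℂ ℂ ∘ₗ TensorProduct.map
    (ShuffleAmbient.eval y ∘ₗ A.val.toLinearMap) (ShuffleAmbient.eval z ∘ₗ B.val.toLinearMap)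

/-- The parameters `s̃`: `s̃_1 = (s_2 ⋯ s_{m-1})⁻¹` and `s̃_i = s_i` for `2 ≤ i ≤ m - 1`. -/
def sTilde {n : ℕ} (s : Fin (n + 2) → ℂ) : Fin (n + 1) → ℂ :=
  fun i => if i = 0 then (∏ j : Fin n, s j.succ.castSucc)⁻¹ else s i.castSucc

/-- The component of degree `N` of `B_{m'}(s') ⊗ B_{m''}(s'')`, which is
`⨁_{L + M = N} B_{m',L}(s') ⊗ B_{m'',M}(s'')`. -/
def tensorComponent {P P' : QParam} {m m' : ℕ} (s : Fin m → ℂ) (s' : Fin m' → ℂ) (N : ℕ) :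
    Submodule ℂ (betheAlgebra P s ⊗[ℂ] betheAlgebra P' s') :=
  Submodule.span ℂ {X | ∃ L M : ℕ, L + M = N ∧
    ∃ (f : betheAlgebra P s) (g : betheAlgebra P' s'),
      (f : ShuffleAmbient P m) ∈ betheComponent P s L ∧
      (g : ShuffleAmbient P' m') ∈ betheComponent P' s' M ∧ X = f ⊗ₜ[ℂ] g}

end

noncomputable section

open Finset ShuffleAmbient
open Complex (exp log exp_ne_zero exp_add exp_neg exp_sub exp_zero exp_log exp_sum exp_int_mul)

open Classical in
/-- The image of a finite set. -/
def img {α β : Type} (φ : β → α) (S : Finset β) : Finset α := S.image φ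

section Img

variable {α β : Type} {φ : β → α}

theorem mem_img {S : Finset β} {a : α} : a ∈ img φ S ↔ ∃ b ∈ S, φ b = a := by
  classical
  simp [img]

theorem img_subset (S : Finset β) {T : Finset β} (h : S ⊆ T) : img φ S ⊆ img φ T := by
  intro a; simp [mem_img]; grind

theorem prod_img {M : Type} [CommMonoid M] (hφ : Function.Injective φ) (S : Finset β) (f : α → M) :
    ∏ a ∈ img φ S, f a = ∏ b ∈ S, f (φ b) := by
  classical
  exact prod_image fun _ _ _ _ h => hφ h

theorem card_img (hφ : Function.Injective φ) (S : Finset β) : (img φ S).card = S.card := by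
  classical
  exact card_image_of_injective _ hφ

theorem img_img {γ : Type} (ψ : γ → β) (S : Finset γ) : img φ (img ψ S) = img (φ ∘ ψ) S := by
  classical
  exact image_image

theorem img_injective (hφ : Function.Injective φ) : Function.Injective (img φ) := by
  intro S T h; ext b; have := Finset.ext_iff.1 h (φ b); simp [mem_img] at this
  grind

open Classical in
theorem img_sdiff (hφ : Function.Injective φ) (S T : Finset β) :
    img φ (S \ T) = img φ S \ img φ T := by
  grind [mem_img]

open Classical in
theorem exists_img_eq {S : Finset β} {I : Finset α} (h : I ⊆ img φ S) : ∃ J ⊆ S, img φ J = I := by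
  refine ⟨S.filter fun b => φ b ∈ I, filter_subset _ _, ?_⟩; ext a
  simp [mem_img]
  constructor
  · grind
  · intro ha; obtain ⟨b, hb, rfl⟩ := mem_img.1 (h ha); grind

open Classical in
theorem ShuffleAmbient.conv_img (w : α → α → ℂ) (f g : Finset α → ℂ) (hφ : Function.Injective φ)
    (S : Finset β) :
    ShuffleAmbient.conv w f g (img φ S) =
      ∑ I ∈ S.powerset, f (img φ I) * g (img φ (S \ I)) * ∏ u ∈ I, ∏ v ∈ S \ I, w (φ u) (φ v) := by
  symm
  refine sum_bij (fun I _ => img φ I) ?_ ?_ ?_ ?_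
  · grind [img_subset]
  · grind [img_injective]
  · simp_all [exists_img_eq, mem_powerset]
  · intro I _; rw [← img_sdiff hφ, prod_img hφ]; congr 1
    refine prod_congr rfl fun u _ => ?_; rw [prod_img hφ]

theorem ShuffleAmbient.exists_of_conv_ne_zero [DecidableEq α] {w : α → α → ℂ}
    {f g : Finset α → ℂ} {T : Finset α} (h : ShuffleAmbient.conv w f g T ≠ 0) :
    ∃ I J : Finset α, Disjoint I J ∧ I ∪ J = T ∧ f I ≠ 0 ∧ g J ≠ 0 ∧
      ∀ u ∈ I, ∀ v ∈ J, w u v ≠ 0 := by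
  obtain ⟨I, hI, hne⟩ := exists_ne_zero_of_sum_ne_zero h
  have e : (fun a b => Classical.propDecidable (a = b)) = ‹DecidableEq α› := Subsingleton.elim _ _
  grind [disjoint_sdiff, union_sdiff_of_subset, prod_eq_zero, mul_zero]

end Img

/-- The colored point `x_{i,a}`. -/
def pt {m N : ℕ} (x : Fin m → Fin N → ℂ) (v : Fin m × Fin N) : Fin m × ℂ := (v.1, x v.1 v.2)

/-- `I` has `M` elements of each color. -/
def ColorBalanced {m : ℕ} {γ : Type} (M : ℕ) (I : Finset (Fin m × γ)) : Prop :=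
  ∀ i, (I.filter fun u => u.1 = i).card = M

section Tuples

variable {m N : ℕ} {x : Fin m → Fin N → ℂ}

theorem tupleSet_eq_img (x : Fin m → Fin N → ℂ) : tupleSet x = img (pt x) univ := by
  ext a; simp [tupleSet, mem_img, pt]

theorem GenericTuple.pt_injective (hx : GenericTuple x) : Function.Injective (pt x) := by
  intro u v h; exact hx.2 (congrArg Prod.snd h)

theorem GenericTuple.genericSet_img (hx : GenericTuple x) (S : Finset (Fin m × Fin N)) :
    GenericSet (img (pt x) S) := by
  refine hx.genericSet.mono ?_; simp [tupleSet_eq_img, img_subset, subset_univ]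

theorem GenericTuple.comp (hx : GenericTuple x) {M : ℕ} {e : Fin m → Fin M → Fin N}
    (he : ∀ i, Function.Injective (e i)) : GenericTuple fun i a => x i (e i a) := by
  refine ⟨fun i a => hx.1 _ _, ?_⟩; rintro ⟨i, a⟩ ⟨j, b⟩ h
  have h' : ((i, e i a) : Fin m × Fin N) = (j, e j b) := hx.2 h; grind

open Classical in
theorem colorBalanced_img {β : Type} {φ : β → Fin m × ℂ} (hφ : Function.Injective φ) {M : ℕ}
    {I : Finset β} :
    ColorBalanced M (img φ I) ↔ ∀ i, (I.filter fun b => (φ b).1 = i).card = M := by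
  refine forall_congr' fun i => ?_
  have : (img φ I).filter (fun u => u.1 = i) = img φ (I.filter fun b => (φ b).1 = i) := by
    grind [mem_img]
  rw [this, card_img hφ]

theorem colorBalanced_img_pt (hx : GenericTuple x) {M : ℕ} {I : Finset (Fin m × Fin N)} :
    ColorBalanced M (img (pt x) I) ↔ ColorBalanced M I := by
  classical
  rw [colorBalanced_img hx.pt_injective]
  aesop

theorem colorBalanced_univ (m N : ℕ) : ColorBalanced N (univ : Finset (Fin m × Fin N)) := by
  classical
  intro i
  have : (univ.filter fun u : Fin m × Fin N => u.1 = i) = univ.image fun a : Fin N => (i, a) := by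
    grind
  simp_all [card_image_of_injective, Prod.mk_right_injective]

theorem ColorBalanced.sdiff {M K : ℕ} {γ : Type} [DecidableEq (Fin m × γ)] {I S : Finset (Fin m × γ)}
    (hI : ColorBalanced M I) (hS : ColorBalanced (M + K) S) (h : I ⊆ S) : ColorBalanced K (S \ I) := by
  intro i
  have h1 : ((S \ I).filter fun u => u.1 = i) =
      (S.filter fun u => u.1 = i) \ (I.filter fun u => u.1 = i) := by
    grind
  rw [h1, card_sdiff_of_subset (filter_subset_filter _ h), hS i, hI i]; omega

theorem hasDegree_iff {M : ℕ} (T : Conf m) : HasDegree M T ↔ ColorBalanced M T.1 := by aesop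

theorem ColorBalanced.exists_enum {M : ℕ} {γ : Type} {I : Finset (Fin m × γ)} (h : ColorBalanced M I) :
    ∃ e : Fin m → Fin M → γ, (∀ i, Function.Injective (e i)) ∧
      I = img (fun v : Fin m × Fin M => (v.1, e v.1 v.2)) univ := by
  classical
  have key : ∀ i, ∃ e : Fin M → γ, Function.Injective e ∧ ∀ c, (i, c) ∈ I ↔ ∃ a, e a = c := by
    intro i
    have hc : ((I.filter fun u => u.1 = i).image Prod.snd).card = M := by
      rw [← h i]; apply card_image_of_injOn; rintro ⟨a, b⟩ ha ⟨a', b'⟩ hb hh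
      grind
    have eq := (equivFinOfCardEq hc).symm
    refine ⟨fun a => (eq a).1, fun a b hab => eq.injective (Subtype.ext hab), fun c => ?_⟩
    constructor
    · intro hic; refine ⟨eq.symm ⟨c, by simpa using hic⟩, by simp⟩
    grind
  choose e he hm using key
  refine ⟨e, he, ?_⟩; ext ⟨i, c⟩; rw [hm, mem_img]
  constructor
  · rintro ⟨a, rfl⟩; exact ⟨(i, a), mem_univ _, rfl⟩
  grind

theorem ColorBalanced.exists_tuple {T : Finset (Fin m × ℂ)} (hT : GenericSet T) (h : ColorBalanced N T) :
    ∃ x : Fin m → Fin N → ℂ, GenericTuple x ∧ tupleSet x = T := by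
  obtain ⟨e, he, hI⟩ := h.exists_enum
  refine ⟨e, ⟨fun i a => ?_, ?_⟩, ?_⟩
  · exact hT.1 (i, e i a) (by rw [hI]; exact mem_img.2 ⟨(i, a), mem_univ _, rfl⟩)
  · rintro ⟨i, a⟩ ⟨j, b⟩ hab
    have h1 : (i, e i a) ∈ T := by rw [hI]; exact mem_img.2 ⟨(i, a), mem_univ _, rfl⟩
    have h2 : (j, e j b) ∈ T := by rw [hI]; exact mem_img.2 ⟨(j, b), mem_univ _, rfl⟩
    obtain ⟨rfl, h3⟩ := Prod.mk.inj (hT.2 h1 h2 hab); rw [he i h3]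
  · rw [tupleSet_eq_img, hI]; rfl

theorem tupleSet_perm (e : Fin m → Equiv.Perm (Fin N)) :
    tupleSet (fun i a => x i (e i a)) = tupleSet x := by
  ext p; simp only [tupleSet_eq_img, mem_img, mem_univ, true_and, pt]
  constructor
  · rintro ⟨v, rfl⟩; exact ⟨(v.1, e v.1 v.2), rfl⟩
  · rintro ⟨v, rfl⟩; exact ⟨(v.1, (e v.1).symm v.2), by simp⟩

end Tuples

namespace ShuffleAmbient

variable {P : QParam} {m : ℕ}

/-- The value of `F` at a finite set of colored points, `0` if the set is not generic. -/
def value (F : ShuffleAmbient P m) (T : Finset (Fin m × ℂ)) : ℂ := ext0 F T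

theorem value_of (F : ShuffleAmbient P m) {T : Finset (Fin m × ℂ)} (h : GenericSet T) :
    value F T = F ⟨T, h⟩ := dif_pos h

theorem value_of_not (F : ShuffleAmbient P m) {T : Finset (Fin m × ℂ)} (h : ¬ GenericSet T) :
    value F T = 0 := dif_neg h

theorem value_mul (F G : ShuffleAmbient P m) {T : Finset (Fin m × ℂ)} (h : GenericSet T) :
    value (F * G) T = conv (omega P m) (value F) (value G) T := ext0_mul F G h

theorem eval_eq_value {N : ℕ} {x : Fin m → Fin N → ℂ} (hx : GenericTuple x)
    (F : ShuffleAmbient P m) : eval x F = value F (img (pt x) univ) := by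
  have h1 : eval x F = F ⟨tupleSet x, hx.genericSet⟩ := dif_pos hx
  have h2 : value F (tupleSet x) = F ⟨tupleSet x, hx.genericSet⟩ := dif_pos hx.genericSet
  rw [h1, ← tupleSet_eq_img, h2]

theorem eval_of_not {N : ℕ} {x : Fin m → Fin N → ℂ} (hx : ¬ GenericTuple x)
    (F : ShuffleAmbient P m) : eval x F = 0 := dif_neg hx

theorem value_add (F G : ShuffleAmbient P m) (T : Finset (Fin m × ℂ)) :
    value (F + G) T = value F T + value G T := by
  by_cases h : GenericSet T
  · rw [value_of _ h, value_of _ h, value_of _ h]; rfl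
  grind [value_of_not, add_zero]

theorem value_smul (c : ℂ) (F : ShuffleAmbient P m) (T : Finset (Fin m × ℂ)) :
    value (c • F) T = c * value F T := by
  by_cases h : GenericSet T
  · rw [value_of _ h, value_of _ h]; rfl
  grind [value_of_not, mul_zero]

theorem value_zero (T : Finset (Fin m × ℂ)) : value (0 : ShuffleAmbient P m) T = 0 := by
  by_cases h : GenericSet T
  · rw [value_of _ h]; rfl
  · simp [value_of_not _ h]

theorem value_coe (F : ShuffleAmbient P m) (T : Conf m) : value F T.1 = F T := dif_pos T.2

theorem value_one {T : Finset (Fin m × ℂ)} : 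
    value (1 : ShuffleAmbient P m) T = open Classical in if T = ∅ then 1 else 0 := by
  by_cases h : GenericSet T
  · rw [value_of _ h]; exact one_apply' _
  · rw [value_of_not _ h, if_neg]; rintro rfl; exact h ⟨by simp, by simp⟩

open Classical in
theorem eval_mul {N : ℕ} {x : Fin m → Fin N → ℂ} (hx : GenericTuple x) (F G : ShuffleAmbient P m) :
    eval x (F * G) = ∑ I : Finset (Fin m × Fin N), value F (img (pt x) I) * value G (img (pt x) Iᶜ) *
      ∏ u ∈ I, ∏ v ∈ Iᶜ, omega P m (pt x u) (pt x v) := by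
  rw [eval_eq_value hx, value_mul F G (hx.genericSet_img _), conv_img _ _ _ hx.pt_injective,
    powerset_univ]
  simp [compl_eq_univ_sdiff]; congr!

end ShuffleAmbient

/-- `F` is supported on configurations with `N` points of each color. -/
def HasSupport {P : QParam} {m : ℕ} (N : ℕ) (F : ShuffleAmbient P m) : Prop :=
  ∀ T : Finset (Fin m × ℂ), ¬ ColorBalanced N T → value F T = 0

section Support

variable {P : QParam} {m N : ℕ}

theorem hasSupport_iff {F : ShuffleAmbient P m} :
    HasSupport N F ↔ ∀ T : Conf m, ¬ HasDegree N T → F T = 0 := by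
  constructor
  · intro h T hT; rw [← value_coe F T]; aesop
  · intro h T hT
    by_cases hg : GenericSet T
    · rw [value_of _ hg]; aesop
    · rw [value_of_not _ hg]

theorem HasSupport.ext {F G : ShuffleAmbient P m} (hF : HasSupport N F) (hG : HasSupport N G)
    (h : ∀ x : Fin m → Fin N → ℂ, GenericTuple x → eval x F = eval x G) : F = G := by
  funext T; rw [← value_coe F T, ← value_coe G T]
  by_cases hT : ColorBalanced N T.1
  · obtain ⟨x, hx, e⟩ := hT.exists_tuple T.2
    grind [eval_eq_value, tupleSet_eq_img]
  · rw [hF _ hT, hG _ hT]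

theorem HasSupport.mul {M K : ℕ} {F G : ShuffleAmbient P m} (hF : HasSupport M F)
    (hG : HasSupport K G) : HasSupport (M + K) (F * G) := by
  classical
  intro T hT
  by_cases hg : GenericSet T
  · rw [value_mul F G hg]; by_contra hne
    obtain ⟨I, J, hd, rfl, h1, h2, -⟩ := exists_of_conv_ne_zero hne
    refine hT fun i => ?_; have h3 := not_imp_comm.1 (hF I) h1 i
    have h4 := not_imp_comm.1 (hG J) h2 i
    grind [card_union_of_disjoint, disjoint_filter_filter, filter_union]
  · rw [value_of_not _ hg]

theorem hasSupport_of_mem {s : Fin m → ℂ} {F : ShuffleAmbient P m} (h : F ∈ betheComponent P s N) :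
    HasSupport N F := hasSupport_iff.2 h.1.1

theorem ofSymmetric_hasSupport (g : (Fin m → Fin N → ℂ) → ℂ) :
    HasSupport N (ofSymmetric P N g) := by
  rw [hasSupport_iff]; intro T hT; refine dif_neg ?_
  grind [hasDegree_iff, tupleSet_eq_img, colorBalanced_img_pt, colorBalanced_univ]

theorem value_img_pt {x : Fin m → Fin N → ℂ} (hx : GenericTuple x) {M : ℕ}
    {e : Fin m → Fin M → Fin N} (he : ∀ i, Function.Injective (e i)) (F : ShuffleAmbient P m) :
    value F (img (pt x) (img (fun v : Fin m × Fin M => (v.1, e v.1 v.2))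
      univ)) = eval (fun i a => x i (e i a)) F := by
  rw [eval_eq_value (hx.comp he), img_img]; rfl

end Support

/-! ### Scaling arbitrary subsets -/

open Classical in
/-- The tuple `x` with the coordinates in `U` multiplied by `ξ`. -/
def scaleOn {m N : ℕ} (U : Finset (Fin m × Fin N)) (ξ : ℂ) (x : Fin m → Fin N → ℂ) :
    Fin m → Fin N → ℂ := fun i a => if (i, a) ∈ U then ξ * x i a else x i a

/-- `F` has limits as the coordinates in `U` are scaled to `0` and to `∞`, with ratio
`∏ s_i ^ #U_i`. -/
def HasBetheLimits {P : QParam} {m : ℕ} (s : Fin m → ℂ) (N : ℕ) (F : ShuffleAmbient P m) : Prop :=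
  ∀ (U : Finset (Fin m × Fin N)) (x : Fin m → Fin N → ℂ), GenericTuple x →
    ∃ F₀ : ℂ, Tendsto (fun ξ : ℂ => eval (scaleOn U ξ x) F) (𝓝[≠] 0) (𝓝 F₀) ∧
      Tendsto (fun ξ : ℂ => eval (scaleOn U ξ x) F) (Bornology.cobounded ℂ)
        (𝓝 (F₀ * ∏ i, s i ^ (U.filter fun u => u.1 = i).card))

section Scaling

variable {P : QParam} {m N : ℕ}

theorem eval_perm (F : ShuffleAmbient P m) (x : Fin m → Fin N → ℂ)
    (e : Fin m → Equiv.Perm (Fin N)) :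
    eval (fun i a => x i (e i a)) F = eval x F := by
  by_cases hx : GenericTuple x
  · have hx' : GenericTuple fun i a => x i (e i a) := hx.comp fun i => (e i).injective
    rw [eval_eq_value hx, eval_eq_value hx', ← tupleSet_eq_img, ← tupleSet_eq_img, tupleSet_perm]
  · rw [eval_of_not hx, eval_of_not]; intro h; apply hx
    have := h.comp (e := fun i => (e i).symm) fun i => (e i).symm.injective
    simpa using this

theorem exists_perm_lt (A : Finset (Fin N)) :
    ∃ e : Equiv.Perm (Fin N), ∀ a : Fin N, (a : ℕ) < A.card ↔ e a ∈ A := by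
  classical
  have hc : Fintype.card {a : Fin N // (a : ℕ) < A.card} = Fintype.card {a // a ∈ A} := by
    have hA : A.card ≤ N := by simpa using A.card_le_univ
    rw [Fintype.card_coe, Fintype.card_subtype]
    have : (univ.filter fun a : Fin N => (a : ℕ) < A.card) =
        (univ : Finset (Fin A.card)).map (Fin.castLEEmb hA) := by
      ext a; simp
      constructor
      · intro h; exact ⟨⟨a, h⟩, by simp⟩
      aesop
    simp_all
  refine ⟨(Fintype.equivOfCardEq hc).extendSubtype, fun a => ?_⟩
  grind [Equiv.extendSubtype_mem, Equiv.extendSubtype_not_mem]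

theorem mem_betheComponent_iff {s : Fin m → ℂ} {F : ShuffleAmbient P m} :
    F ∈ betheComponent P s N ↔ F ∈ shuffleComponent P m N ∧ HasBetheLimits s N F := by
  classical
  refine and_congr_right fun _ => ?_
  constructor
  · intro h U x hx
    choose e he using fun i : Fin m => exists_perm_lt ((U.filter fun u => u.1 = i).image Prod.snd)
    have hcard : ∀ i, ((U.filter fun u => u.1 = i).image Prod.snd).card =
        (U.filter fun u => u.1 = i).card := by
      intro i; apply card_image_of_injOn; rintro ⟨a, b⟩ ha ⟨a', b'⟩ hb hh; grind
    have hmem : ∀ i (a : Fin N), (a : ℕ) < (U.filter fun u => u.1 = i).card ↔ (i, e i a) ∈ U := by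
      intro i a; rw [← hcard, he i a]; simp
    obtain ⟨F₀, h0, h1⟩ := h (fun i => (U.filter fun u => u.1 = i).card) (fun i => by
      rw [← hcard]; exact (card_le_univ _).trans (by simp)) (fun i a => x i (e i a))
      (hx.comp fun i => (e i).injective)
    have hs : ∀ ξ : ℂ, eval (scaleTuple
        (fun i => (U.filter fun u => u.1 = i).card) ξ (fun i a => x i (e i a))) F =
        eval (scaleOn U ξ x) F := by
      intro ξ; rw [← eval_perm F (scaleOn U ξ x) e]; congr 1; congr 1
      grind [scaleTuple, scaleOn]
    simp [hs] at h0 h1; grind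
  · intro h k hk x hx
    obtain ⟨F₀, h0, h1⟩ := h (univ.filter fun u => (u.2 : ℕ) < k u.1) x hx
    have hs : ∀ ξ : ℂ, scaleTuple k ξ x = scaleOn (univ.filter fun u => (u.2 : ℕ) < k u.1) ξ x := by
      grind [scaleTuple, scaleOn]
    have hc : ∀ i, ((univ.filter fun u : Fin m × Fin N => (u.2 : ℕ) < k u.1).filter
        fun u => u.1 = i).card = k i := by
      intro i
      have : ((univ.filter fun u : Fin m × Fin N => (u.2 : ℕ) < k u.1).filter
        fun u => u.1 = i) = (univ : Finset (Fin (k i))).image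
          fun a => (i, Fin.castLE (hk i) a) := by
        ext ⟨j, a⟩
        simp only [mem_filter, mem_univ, true_and, mem_image, Prod.mk.injEq]
        constructor
        · rintro ⟨h1, rfl⟩; exact ⟨⟨a, h1⟩, rfl, rfl⟩
        grind
      rw [this, card_image_of_injective]
      · simp
      · intro a b hab; simpa using hab
    simp [hs]; grind

end Scaling

/-! ### Linear forms and vanishing of polynomials -/

section LinearForms

open MvPolynomial

variable {σ : Type}

theorem X_sub_dvd_sub_aeval [DecidableEq σ] (u : σ) (L p : MvPolynomial σ ℂ) :
    X u - L ∣ p - aeval (Function.update X u L) p := by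
  induction p using MvPolynomial.induction_on with
  | C a => simp [algebraMap_eq]
  | add p q hp hq => grind [add_sub_add_comm, dvd_add]
  | mul_X p v hp =>
    have e : p * X v - aeval (Function.update X u L) (p * X v) =
        (p - aeval (Function.update X u L) p) * X v +
          aeval (Function.update X u L) p * (X v - Function.update X u L v) := by
      rw [map_mul, aeval_X]; ring
    rw [e]
    refine dvd_add (dvd_mul_of_dvd_left hp _) (dvd_mul_of_dvd_right ?_ _)
    by_cases h : v = u
    · subst h; simp
    · simp [h]

theorem X_sub_dvd_iff [DecidableEq σ] {u : σ} {L : MvPolynomial σ ℂ} (hL : aeval (Function.update X u L) L = L)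
    {p : MvPolynomial σ ℂ} : X u - L ∣ p ↔ aeval (Function.update X u L) p = 0 := by
  constructor
  · rintro ⟨r, rfl⟩; simp_all
  grind [X_sub_dvd_sub_aeval]

theorem X_sub_prime [DecidableEq σ] {u : σ} {L : MvPolynomial σ ℂ} (hL : aeval (Function.update X u L) L = L)
    (hne : X u ≠ L) : Prime (X u - L) := by
  refine ⟨sub_ne_zero.2 hne, fun h => ?_, fun a b h => ?_⟩
  · have := (X_sub_dvd_iff (p := 1) hL).1 h.dvd; simp at this
  simp_all [X_sub_dvd_iff, map_mul, mul_eq_zero]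

theorem X_sub_dvd_of_eval [DecidableEq σ] {u : σ} {L : MvPolynomial σ ℂ}
    (hL : aeval (Function.update X u L) L = L) {p : MvPolynomial σ ℂ}
    (h : ∀ a : σ → ℂ, a u = eval a L → eval a p = 0) : X u - L ∣ p := by
  rw [X_sub_dvd_iff hL]
  have key : ∀ (a : σ → ℂ) (r : MvPolynomial σ ℂ), eval a (aeval (Function.update X u L) r) =
      eval (Function.update a u (eval a L)) r := by
    intro a r
    induction r using MvPolynomial.induction_on with
    | C a => simp [algebraMap_eq]
    | add p q hp hq => simpa using congrArg₂ (· + ·) hp hq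
    | mul_X p v hp =>
      simp at hp ⊢; rw [hp]; congr 1
      by_cases h : v = u
      · subst h; simp
      · simp [h]
  refine MvPolynomial.funext fun a => ?_; grind

theorem aeval_update_C_mul_X [DecidableEq σ] {u v : σ} (h : v ≠ u) (c : ℂ) :
    aeval (Function.update X u (C c * X v : MvPolynomial σ ℂ)) (C c * X v : MvPolynomial σ ℂ) =
      C c * X v := by
  simp [h, algebraMap_eq]

theorem aeval_update_C [DecidableEq σ] (u : σ) (c : ℂ) :
    aeval (Function.update X u (C c : MvPolynomial σ ℂ)) (C c : MvPolynomial σ ℂ) = C c := by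
  simp [algebraMap_eq]

theorem X_ne_C_mul_X [DecidableEq σ] {u v : σ} (h : v ≠ u) (c : ℂ) : (X u : MvPolynomial σ ℂ) ≠ C c * X v := by
  intro e; have := congrArg (eval (Function.update 0 u 1)) e; simp [h] at this

theorem X_ne_C (u : σ) (c : ℂ) : (X u : MvPolynomial σ ℂ) ≠ C c := by
  intro e; have := congrArg (MvPolynomial.eval fun _ => c + 1) e; simp at this

theorem prod_pow_dvd_of_prime {ι : Type} (s : Finset ι) (f : ι → MvPolynomial σ ℂ) (k : ℕ)
    {p : MvPolynomial σ ℂ} (hp : ∀ i ∈ s, Prime (f i))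
    (hne : ∀ i ∈ s, ∀ j ∈ s, i ≠ j → ∃ a, eval a (f i) = 0 ∧ eval a (f j) ≠ 0)
    (hd : ∀ i ∈ s, f i ^ k ∣ p) : ∏ i ∈ s, f i ^ k ∣ p := by
  refine prod_dvd_of_isRelPrime ?_ hd; intro i hi j hj hij
  refine IsRelPrime.pow ((hp i hi).irreducible.isRelPrime_iff_not_dvd.2 ?_)
  rintro ⟨r, hr⟩; grind

theorem eq_zero_of_eval_generic {p r : MvPolynomial σ ℂ} (hr : r ≠ 0)
    (h : ∀ a, eval a r ≠ 0 → eval a p = 0) : p = 0 := by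
  have : p * r = 0 := by
    refine MvPolynomial.funext fun a => ?_
    simp [map_mul, map_zero]; grind
  simp_all

theorem exists_eval_ne_zero_fin (n : ℕ) {ι : Type} [Countable ι] (p : ι → MvPolynomial (Fin n) ℂ)
    (hp : ∀ i, p i ≠ 0) : ∃ a, ∀ i, eval a (p i) ≠ 0 := by
  induction n with
  | zero =>
    refine ⟨0, fun i h => hp i ?_⟩; refine MvPolynomial.funext fun a => ?_
    rw [Subsingleton.elim a 0, h, map_zero]
  | succ n ih =>
    obtain ⟨b, hb⟩ := ih (fun i => (finSuccEquiv ℂ n (p i)).leadingCoeff) fun i h => by simp_all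
    have hpol : ∀ i, Polynomial.map (eval b) (finSuccEquiv ℂ n (p i)) ≠ 0 := by
      intro i h; apply hb i
      have := congrArg (fun r => Polynomial.coeff r (finSuccEquiv ℂ n (p i)).natDegree) h
      simpa [Polynomial.coeff_map] using this
    have hc : (⋃ i, ((Polynomial.map (eval b) (finSuccEquiv ℂ n (p i))).rootSet ℂ)).Countable :=
      Set.countable_iUnion fun i => (Polynomial.rootSet_finite _ _).countable
    obtain ⟨t, ht⟩ : ∃ t, t ∉ ⋃ i, ((Polynomial.map (eval b) (finSuccEquiv ℂ n (p i))).rootSet ℂ) := by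
      by_contra hcon; push Not at hcon
      simp_all [not_countable_complex, Set.eq_univ_of_forall]
    refine ⟨Fin.cons t b, fun i h => ht (Set.mem_iUnion.2 ⟨i, ?_⟩)⟩
    simp_all [Polynomial.mem_rootSet, eval_eq_eval_mv_eval', Polynomial.aeval_def,
      Polynomial.eval_map]

theorem exists_eval_ne_zero [Finite σ] {ι : Type} [Countable ι] (p : ι → MvPolynomial σ ℂ)
    (hp : ∀ i, p i ≠ 0) : ∃ a, ∀ i, eval a (p i) ≠ 0 := by
  obtain ⟨n, ⟨e⟩⟩ := Finite.exists_equiv_fin σ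
  obtain ⟨a, ha⟩ := exists_eval_ne_zero_fin n (fun i => rename e (p i)) fun i h =>
    hp i (rename_injective e e.injective (by rw [h, map_zero]))
  refine ⟨a ∘ e, fun i => ?_⟩; rw [← eval_rename]; exact ha i

end LinearForms

/-! ### Products over pairs -/

section PairProd

variable {β M : Type} [CommMonoid M]

open Classical in
/-- The product of `h u v` over all ordered pairs of distinct elements of `S`. -/
def pairProd (h : β → β → M) (S : Finset β) : M := ∏ p ∈ S.offDiag, h p.1 p.2

theorem pairProd_def [DecidableEq β] (h : β → β → M) (S : Finset β) :
    pairProd h S = ∏ p ∈ S.offDiag, h p.1 p.2 := by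
  aesop

theorem pairProd_img {α : Type} {φ : β → α} (hφ : Function.Injective φ) (h : α → α → M)
    (S : Finset β) : pairProd h (img φ S) = pairProd (fun u v => h (φ u) (φ v)) S := by
  classical
  symm
  refine prod_bij (fun p _ => (φ p.1, φ p.2)) ?_ ?_ ?_ ?_
  · grind [mem_img]
  · grind
  · rintro ⟨a, b⟩ hp; simp [mem_img] at hp
    obtain ⟨⟨u, hu, rfl⟩, ⟨v, hv, rfl⟩, hne⟩ := hp
    exact ⟨(u, v), mem_offDiag.2 ⟨hu, hv, fun e => hne (congrArg φ e)⟩, rfl⟩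
  · intros; rfl

theorem pairProd_union [DecidableEq β] (h : β → β → M) {I J : Finset β} (hd : Disjoint I J) :
    pairProd h (I ∪ J) = pairProd h I * pairProd h J * ∏ u ∈ I, ∏ v ∈ J, (h u v * h v u) := by
  simp [pairProd_def]
  have hIJ : ∀ u ∈ I, u ∉ J := fun u h1 h2 => disjoint_left.1 hd h1 h2
  rw [offDiag_union hd, prod_union, prod_union, prod_union,
    prod_product, prod_product_right, mul_assoc, ← prod_mul_distrib]
  · congr 1; refine prod_congr rfl fun u _ => ?_; rw [prod_mul_distrib]
  · rw [disjoint_left]; grind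
  · rw [disjoint_left]; grind
  · rw [disjoint_left]; grind

theorem pairProd_mul (h k : β → β → M) (S : Finset β) :
    pairProd (fun u v => h u v * k u v) S = pairProd h S * pairProd k S :=
  prod_mul_distrib

theorem pairProd_congr {h k : β → β → M} {S : Finset β}
    (e : ∀ u ∈ S, ∀ v ∈ S, u ≠ v → h u v = k u v) : pairProd h S = pairProd k S := by
  classical
  refine prod_congr rfl ?_
  grind

theorem pairProd_congr_symm {h k : β → β → M} {S : Finset β}
    (e : ∀ u ∈ S, ∀ v ∈ S, u ≠ v → h u v * h v u = k u v * k v u) :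
    pairProd h S = pairProd k S := by
  classical
  induction S using Finset.induction_on with
  | empty => simp [pairProd]
  | insert a S ha ih =>
    rw [insert_eq, pairProd_union h (disjoint_singleton_left.2 ha),
      pairProd_union k (disjoint_singleton_left.2 ha),
      ih fun u hu v hv => e u (mem_insert_of_mem hu) v (mem_insert_of_mem hv)]
    congr 1; refine prod_congr rfl fun u hu => prod_congr rfl fun v hv => ?_
    grind

theorem map_pairProd {M' : Type} [CommMonoid M'] (f : M →* M') (h : β → β → M) (S : Finset β) :
    f (pairProd h S) = pairProd (fun u v => f (h u v)) S := map_prod f _ _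

theorem pairProd_ne_zero {R : Type} [CommMonoidWithZero R] [Nontrivial R] [NoZeroDivisors R]
    {h : β → β → R} {S : Finset β} :
    pairProd h S ≠ 0 ↔ ∀ u ∈ S, ∀ v ∈ S, u ≠ v → h u v ≠ 0 := by
  simp [pairProd, prod_ne_zero_iff, mem_offDiag]; grind

theorem pairProd_eq_prod_prod [Fintype β] [DecidableEq β] (h : β → β → M) :
    pairProd h univ = ∏ u, ∏ v ∈ {u}ᶜ, h u v := by
  rw [prod_sigma']
  refine prod_bij' (fun p _ => ⟨p.1, p.2⟩) (fun p _ => (p.1, p.2)) ?_ ?_ ?_ ?_ ?_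
  · aesop
  · aesop
  all_goals intros; rfl

theorem prod_Ioi_eq_pairProd {n : ℕ} (h : Fin n → Fin n → M) :
    ∏ a, ∏ b ∈ Ioi a, h a b * h b a = pairProd h univ := by
  simp [pairProd_eq_prod_prod, prod_prod_Ioi_mul_eq_prod_prod_off_diag]

end PairProd

/-! ### Colors -/

section Colors

variable {m : ℕ}

theorem nextColor_eq_iff {i j : Fin m} : nextColor i = j ↔ i = prevColor j := by
  obtain ⟨i, hi⟩ := i; obtain ⟨j, hj⟩ := j; simp [nextColor, prevColor]
  rcases Nat.lt_or_ge (i + 1) m with h | h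
  · rw [Nat.mod_eq_of_lt h]
    constructor
    · rintro rfl
      rw [show i + 1 + (m - 1) = i + m by omega, Nat.add_mod_right, Nat.mod_eq_of_lt hi]
    · intro e
      rcases Nat.eq_zero_or_pos j with h0 | h0
      · subst h0; rw [Nat.zero_add, Nat.mod_eq_of_lt (by omega)] at e
        omega
      · rw [show j + (m - 1) = (j - 1) + m by omega, Nat.add_mod_right,
          Nat.mod_eq_of_lt (by omega)] at e
        omega
  · have e1 : i + 1 = m := by omega
    rw [e1, Nat.mod_self]
    constructor
    · aesop
    · intro e
      rcases Nat.eq_zero_or_pos j with h0 | h0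
      · exact h0.symm
      · rw [show j + (m - 1) = (j - 1) + m by omega, Nat.add_mod_right,
          Nat.mod_eq_of_lt (by omega)] at e
        omega

theorem nextColor_injective : Function.Injective (nextColor : Fin m → Fin m) := by
  intro i j h; rw [nextColor_eq_iff.1 h]; exact (nextColor_eq_iff.1 rfl).symm

theorem nextColor_ne (hm : m ≠ 1) (i : Fin m) : nextColor i ≠ i := by
  intro h; have h1 := congrArg Fin.val h; simp [nextColor] at h1
  rcases Nat.lt_or_ge (i + 1) m with h2 | h2
  · rw [Nat.mod_eq_of_lt h2] at h1; omega
  grind [Nat.mod_self]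

theorem nextColor_nextColor_ne (hm : 3 ≤ m) (i : Fin m) : nextColor (nextColor i) ≠ i := by
  intro h; have h1 := congrArg Fin.val h; simp [nextColor] at h1
  rcases Nat.lt_or_ge (i + 1 + 1) m with h2 | h2
  · rw [Nat.mod_eq_of_lt h2] at h1; omega
  · rw [show (i : ℕ) + 1 + 1 = (i + 2 - m) + m by omega, Nat.add_mod_right,
      Nat.mod_eq_of_lt (by omega)] at h1
    omega

end Colors

/-! ### Uniform description of the structure functions -/

namespace QParam

variable {P : QParam}

theorem Admissible.q1_ne (hP : P.Admissible) : P.q1 ≠ 0 := mul_ne_zero (inv_ne_zero hP.q_ne) hP.d_ne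

theorem Admissible.q2_ne (hP : P.Admissible) : P.q2 ≠ 0 := pow_ne_zero _ hP.q_ne

theorem Admissible.q3_ne (hP : P.Admissible) : P.q3 ≠ 0 :=
  mul_ne_zero (inv_ne_zero hP.q_ne) (inv_ne_zero hP.d_ne)

theorem Admissible.prod_eq_one (hP : P.Admissible) : P.q1 * P.q2 * P.q3 = 1 := by
  have h1 := hP.q_ne; have h2 := hP.d_ne; simp [q1, q2, q3]; field_simp

theorem Admissible.indep_q2_q3 (hP : P.Admissible) {a b : ℤ} (h : P.q2 ^ a * P.q3 ^ b = 1) :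
    a = 0 ∧ b = 0 := by
  have := hP.indep 0 a b (by simp_all)
  omega

/-- The constant in `ω_{i,i-1}`. -/
def colorConst (P : QParam) (m : ℕ) : ℂ := if m ≤ 2 then 1 else P.d

end QParam

theorem omega_eq (P : QParam) (m : ℕ) (u v : Fin m × ℂ) :
    omega P m u v = (if u.1 = v.1 then (u.2 - P.q2 * v.2) / (u.2 - v.2) else 1) *
      (if v.1 = nextColor u.1 then (u.2 - P.q1 * v.2) / (u.2 - v.2) else 1) *
      (if u.1 = nextColor v.1 then P.colorConst m * ((u.2 - P.q3 * v.2) / (u.2 - v.2)) else 1) := by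
  obtain ⟨i, x⟩ := u; obtain ⟨j, y⟩ := v; unfold omega QParam.colorConst
  by_cases h1 : m = 1
  · subst h1; have hij : i = j := Subsingleton.elim _ _
    have h2 : j = nextColor i := Subsingleton.elim _ _
    split_ifs <;> grind
  · by_cases h2 : m = 2
    · grind [nextColor]
    · by_cases hij : i = j
      · grind [nextColor_ne]
      · by_cases h3 : j = nextColor i
        · have h4 : i ≠ nextColor j := by rw [h3]; exact (nextColor_nextColor_ne (by omega) i).symm
          grind
        grind

/-- The pole factor of an ordered pair of colored points. -/
def poleFactor {m : ℕ} (u v : Fin m × ℂ) : ℂ := if v.1 = nextColor u.1 then u.2 - v.2 else 1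

theorem poleFactor_pt {m N : ℕ} (x : Fin m → Fin N → ℂ) (u v : Fin m × Fin N) :
    poleFactor (pt x u) (pt x v) = if v.1 = nextColor u.1 then x u.1 u.2 - x v.1 v.2 else 1 := rfl

/-- The normalized pole denominator of a configuration. -/
def poleProd {m : ℕ} (T : Finset (Fin m × ℂ)) : ℂ := pairProd poleFactor T

section Pole

variable {m N : ℕ}

theorem poleProd_ne_zero {T : Finset (Fin m × ℂ)} (hT : GenericSet T) : poleProd T ≠ 0 := by
  rw [poleProd, pairProd_ne_zero]; intro u hu v hv huv; unfold poleFactor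
  split_ifs
  · exact sub_ne_zero.2 fun h => huv (hT.2 hu hv h)
  · exact one_ne_zero

theorem pairProd_color (hm : m ≠ 1) {M : Type} [CommMonoid M] (h : Fin m → Fin N → Fin N → M) :
    pairProd (fun u v : Fin m × Fin N => if v.1 = nextColor u.1 then h u.1 u.2 v.2 else 1)
      univ = ∏ i, ∏ a, ∏ b, h i a b := by
  classical
  rw [pairProd_eq_prod_prod, Fintype.prod_prod_type]
  refine prod_congr rfl fun i _ => prod_congr rfl fun a _ => ?_
  have e : ∏ v ∈ ({(i, a)} : Finset (Fin m × Fin N))ᶜ,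
      (if v.1 = nextColor i then h i a v.2 else 1) =
      ∏ v : Fin m × Fin N, (if v.1 = nextColor i then h i a v.2 else 1) := by
    refine prod_subset (subset_univ _) fun v _ hv => ?_
    rw [mem_compl, not_not, mem_singleton] at hv; subst hv
    exact if_neg fun h => nextColor_ne hm _ h.symm
  rw [e, Fintype.prod_prod_type, Finset.prod_comm]; simp

theorem pairProd_sameColor {M : Type} [CommMonoid M] (h : Fin m → Fin N → Fin N → M) :
    pairProd (fun u v : Fin m × Fin N => if u.1 = v.1 then h u.1 u.2 v.2 else 1)
      univ = ∏ i, pairProd (h i) univ := by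
  classical
  rw [pairProd_eq_prod_prod, Fintype.prod_prod_type]
  refine prod_congr rfl fun i _ => ?_; rw [pairProd_eq_prod_prod]
  refine prod_congr rfl fun a _ => ?_; rw [← prod_filter]; symm
  refine prod_bij (fun b _ => (i, b)) ?_ ?_ ?_ ?_
  · simp
  · simp
  · simp_all
  · intros; rfl

theorem poleDenominator_eq (m N : ℕ) : ∃ c : ℂ, c ≠ 0 ∧ ∀ x : Fin m → Fin N → ℂ, GenericTuple x →
    poleDenominator x = c * poleProd (tupleSet x) := by
  by_cases hm : m = 1
  · subst hm
    refine ⟨∏ _i : Fin 1, ∏ a : Fin N, ∏ b ∈ Ioi a, (-1), ?_, fun x hx => ?_⟩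
    · simp [prod_ne_zero_iff]
    · rw [poleProd, tupleSet_eq_img, pairProd_img hx.pt_injective]
      have e : pairProd (fun u v => poleFactor (pt x u) (pt x v)) univ =
          pairProd (fun u v : Fin 1 × Fin N => if u.1 = v.1 then x u.1 u.2 - x u.1 v.2 else 1)
            univ := by
        refine pairProd_congr fun u _ v _ _ => ?_
        have h1 : v.1 = nextColor u.1 := Subsingleton.elim _ _
        have h2 : u.1 = v.1 := Subsingleton.elim _ _
        rw [poleFactor_pt, if_pos h1, if_pos h2, h2]
      rw [e, pairProd_sameColor (fun i a b => x i a - x i b), poleDenominator, if_pos rfl,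
        ← prod_mul_distrib]
      refine prod_congr rfl fun i _ => ?_
      rw [← prod_Ioi_eq_pairProd, ← prod_mul_distrib]
      refine prod_congr rfl fun a _ => ?_; rw [← prod_mul_distrib]; grind
  · refine ⟨1, one_ne_zero, fun x hx => ?_⟩
    rw [poleProd, tupleSet_eq_img, pairProd_img hx.pt_injective, poleDenominator, if_neg hm,
      one_mul, ← pairProd_color hm (fun i a b => x i a - x (nextColor i) b)]
    grind [pairProd_congr, poleFactor_pt]

/-- The points on which shuffle elements vanish, for arbitrary configurations. -/
def HasWheel (P : QParam) (T : Finset (Fin m × ℂ)) : Prop := ∃ (i : Fin m) (y : ℂ),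
    ((i, y) ∈ T ∧ (nextColor i, P.q3 * y) ∈ T ∧ (nextColor i, P.q2 * (P.q3 * y)) ∈ T) ∨
    ((i, y) ∈ T ∧ (i, P.q2 * y) ∈ T ∧ (nextColor i, P.q3 * (P.q2 * y)) ∈ T)

theorem onWheel_iff {P : QParam} {x : Fin m → Fin N → ℂ} :
    OnWheel P x ↔ HasWheel P (tupleSet x) := by
  have key : ∀ (i : Fin m) (y : ℂ), (i, y) ∈ tupleSet x ↔ ∃ a, x i a = y := by
    intro i y; rw [tupleSet_eq_img, mem_img]
    constructor
    · rintro ⟨⟨j, a⟩, -, e⟩; obtain ⟨rfl, e2⟩ := Prod.mk.inj e; exact ⟨a, e2⟩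
    · rintro ⟨a, rfl⟩; exact ⟨(i, a), mem_univ _, rfl⟩
  simp [OnWheel, HasWheel, key]; grind

theorem mem_shuffleComponent_iff {P : QParam} {F : ShuffleAmbient P m} :
    F ∈ shuffleComponent P m N ↔ HasSupport N F ∧ ∃ (p : MvPolynomial (Fin m × Fin N) ℂ) (e : ℕ),
        (∀ x : Fin m → Fin N → ℂ, GenericTuple x →
          eval x F * (∏ v : Fin m × Fin N, x v.1 v.2) ^ e * poleProd (tupleSet x) =
            MvPolynomial.eval (fun v => x v.1 v.2) p) ∧
        (∀ x : Fin m → Fin N → ℂ, (∀ i a, x i a ≠ 0) → OnWheel P x →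
          MvPolynomial.eval (fun v => x v.1 v.2) p = 0) := by
  obtain ⟨c, hc, hD⟩ := poleDenominator_eq m N
  have hprod : ∀ x : Fin m → Fin N → ℂ, (∏ v : Fin m × Fin N, x v.1 v.2) = ∏ i, ∏ a, x i a :=
    fun x => Fintype.prod_prod_type _
  have hne : ∀ x : Fin m → Fin N → ℂ, GenericTuple x → (∏ i, ∏ a, x i a) ≠ 0 := fun x hx =>
    prod_ne_zero_iff.2 fun i _ => prod_ne_zero_iff.2 fun a _ => hx.1 i a
  have hmem : F ∈ shuffleComponent P m N ↔ HasSupport N F ∧ IsShuffleElement P N F := by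
    rw [hasSupport_iff]; rfl
  rw [hmem]; refine and_congr_right fun _ => ?_
  constructor
  · rintro ⟨p, e, h1, h2⟩
    refine ⟨MvPolynomial.C c⁻¹ * p, e, fun x hx => ?_, fun x hx hw => ?_⟩
    · have := hne x hx; have := poleProd_ne_zero hx.genericSet
      rw [h1 x hx, hD x hx, hprod, map_mul, MvPolynomial.eval_C]; field_simp
    grind
  · rintro ⟨p, e, h1, h2⟩
    refine ⟨MvPolynomial.C c * p, e, fun x hx => ?_, fun x hx hw => ?_⟩
    · have := hne x hx; have := poleProd_ne_zero hx.genericSet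
      rw [hD x hx, map_mul, MvPolynomial.eval_C, ← h1 x hx, hprod]; field_simp
    grind

theorem value_eq_zero_of_wheel {P : QParam} {M : ℕ} {F : ShuffleAmbient P m}
    (hF : F ∈ shuffleComponent P m M) {T : Finset (Fin m × ℂ)} (hT : HasWheel P T) :
    F.value T = 0 := by
  obtain ⟨hs, p, e, h1, h2⟩ := mem_shuffleComponent_iff.1 hF
  by_cases hg : GenericSet T
  · by_cases hb : ColorBalanced M T
    · obtain ⟨x, hx, rfl⟩ := hb.exists_tuple hg; have h3 := h1 x hx
      rw [h2 x hx.1 (onWheel_iff.2 hT), eval_eq_value hx, ← tupleSet_eq_img] at h3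
      have h4 := poleProd_ne_zero hg
      have h5 : (∏ v : Fin m × Fin M, x v.1 v.2) ^ e ≠ 0 :=
        pow_ne_zero _ (prod_ne_zero_iff.2 fun v _ => hx.1 _ _)
      grind
    · exact hs T hb
  · exact value_of_not _ hg

end Pole

/-! ### Limits at zero and infinity with a given ratio -/

/-- `f` has limits at `0` and at `∞`, and the second is `r` times the first. -/
def LimRatio (f : ℂ → ℂ) (r : ℂ) : Prop :=
  ∃ l : ℂ, Tendsto f (𝓝[≠] 0) (𝓝 l) ∧ Tendsto f (Bornology.cobounded ℂ) (𝓝 (l * r))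

theorem eventually_notMem_of_finite {S : Set ℂ} (hS : S.Finite) :
    (∀ᶠ ξ in 𝓝[≠] (0 : ℂ), ξ ∉ S) ∧ ∀ᶠ ξ in Bornology.cobounded ℂ, ξ ∉ S := by
  constructor
  · have h1 : (S \ {0}).Finite := hS.subset Set.sdiff_subset
    have h2 : (S \ {0})ᶜ ∈ 𝓝 (0 : ℂ) := h1.isClosed.isOpen_compl.mem_nhds (by simp)
    filter_upwards [nhdsWithin_le_nhds h2, self_mem_nhdsWithin] with ξ h3 h4 h5
    exact h3 ⟨h5, h4⟩
  · exact Bornology.isBounded_def.1 hS.isBounded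

namespace LimRatio

variable {f g : ℂ → ℂ} {r r' : ℂ}

theorem congr (hf : LimRatio f r) {S : Set ℂ} (hS : S.Finite) (h : ∀ ξ ∉ S, f ξ = g ξ) :
    LimRatio g r := by
  obtain ⟨l, h0, h1⟩ := hf; obtain ⟨e0, e1⟩ := eventually_notMem_of_finite hS
  exact ⟨l, h0.congr' (e0.mono h), h1.congr' (e1.mono h)⟩

theorem const (c : ℂ) : LimRatio (fun _ => c) 1 :=
  ⟨c, tendsto_const_nhds, by rw [mul_one]; exact tendsto_const_nhds⟩

theorem zero (r : ℂ) : LimRatio (fun _ => 0) r :=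
  ⟨0, tendsto_const_nhds, by rw [zero_mul]; exact tendsto_const_nhds⟩

theorem mul (hf : LimRatio f r) (hg : LimRatio g r') : LimRatio (fun ξ => f ξ * g ξ) (r * r') := by
  obtain ⟨l, h0, h1⟩ := hf; obtain ⟨l', h0', h1'⟩ := hg
  refine ⟨l * l', h0.mul h0', ?_⟩
  rw [show l * l' * (r * r') = l * r * (l' * r') by ring]
  exact h1.mul h1'

theorem add (hf : LimRatio f r) (hg : LimRatio g r) : LimRatio (fun ξ => f ξ + g ξ) r := by
  obtain ⟨l, h0, h1⟩ := hf; obtain ⟨l', h0', h1'⟩ := hg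
  refine ⟨l + l', h0.add h0', ?_⟩; rw [add_mul]; exact h1.add h1'

theorem sum {ι : Type} {s : Finset ι} {f : ι → ℂ → ℂ} (h : ∀ i ∈ s, LimRatio (f i) r) :
    LimRatio (fun ξ => ∑ i ∈ s, f i ξ) r := by
  classical
  induction s using Finset.induction_on with
  | empty => simpa using zero r
  | insert a s ha ih => simp_all [sum_insert, add]

theorem prod {ι : Type} {s : Finset ι} {f : ι → ℂ → ℂ} {r : ι → ℂ}
    (h : ∀ i ∈ s, LimRatio (f i) (r i)) :
    LimRatio (fun ξ => ∏ i ∈ s, f i ξ) (∏ i ∈ s, r i) := by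
  classical
  induction s using Finset.induction_on with
  | empty => simpa using const 1
  | insert a s ha ih => grind [prod_insert, mem_insert_self, mul, mem_insert_of_mem]

end LimRatio

theorem tendsto_inv_nhdsNE_cobounded : Tendsto (fun ξ : ℂ => ξ⁻¹) (Bornology.cobounded ℂ)
    (𝓝 0) := tendsto_inv₀_cobounded

open Classical in
/-- `x` multiplied by `ξ` if `p` holds. -/
def scaleIf (p : Prop) (ξ x : ℂ) : ℂ := if p then ξ * x else x

open Classical in
/-- The indicator of a proposition. -/
def indic (p : Prop) : ℤ := if p then 1 else 0

theorem limRatio_linear {x y c : ℂ} (hx : x ≠ 0) (hy : y ≠ 0) (hxy : x ≠ y) (hc : c ≠ 0)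
    (p r : Prop) :
    LimRatio (fun ξ => (scaleIf p ξ x - c * scaleIf r ξ y) / (scaleIf p ξ x - scaleIf r ξ y))
      (c ^ (indic r - indic p)) := by
  have h0 : Tendsto (fun ξ : ℂ => ξ) (𝓝[≠] 0) (𝓝 0) := nhdsWithin_le_nhds
  have hi := tendsto_inv_nhdsNE_cobounded
  by_cases hp : p <;> by_cases hr : r
  · have e : c ^ (indic r - indic p) = 1 := by simp [indic, hp, hr]
    rw [e]
    refine (LimRatio.const ((x - c * y) / (x - y))).congr (Set.finite_singleton 0) ?_
    · simp [scaleIf, hp, hr]; grind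
  · refine ⟨c, ?_, ?_⟩
    · have : Tendsto (fun ξ : ℂ => (ξ * x - c * y) / (ξ * x - y)) (𝓝[≠] 0)
          (𝓝 ((0 * x - c * y) / (0 * x - y))) :=
        ((h0.mul_const x).sub_const _).div ((h0.mul_const x).sub_const _) (by simpa using hy)
      simpa [scaleIf, hp, hr, hy] using this
    · have : Tendsto (fun ξ : ℂ => (x - c * (y * ξ⁻¹)) / (x - y * ξ⁻¹)) (Bornology.cobounded ℂ)
          (𝓝 ((x - c * (y * 0)) / (x - y * 0))) :=
        (((hi.const_mul y).const_mul c).const_sub x).div ((hi.const_mul y).const_sub x)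
          (by simpa using hx)
      have h2 : c * c ^ (indic r - indic p) = (x - c * (y * 0)) / (x - y * 0) := by
        simp [indic, hp, hr, hx, hc]
      rw [h2]; refine this.congr' ?_
      filter_upwards [(eventually_notMem_of_finite (Set.finite_singleton (0 : ℂ))).2] with ξ hξ
      have hξ' : ξ ≠ 0 := hξ; simp [scaleIf, hp, hr]
      rw [← mul_div_mul_left _ _ hξ']; congr 1 <;> field_simp
  · refine ⟨1, ?_, ?_⟩
    · have : Tendsto (fun ξ : ℂ => (x - c * (ξ * y)) / (x - ξ * y)) (𝓝[≠] 0)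
          (𝓝 ((x - c * (0 * y)) / (x - 0 * y))) :=
        (((h0.mul_const y).const_mul c).const_sub x).div ((h0.mul_const y).const_sub x)
          (by simpa using hx)
      simpa [scaleIf, hp, hr, hx] using this
    · have : Tendsto (fun ξ : ℂ => (x * ξ⁻¹ - c * y) / (x * ξ⁻¹ - y)) (Bornology.cobounded ℂ)
          (𝓝 ((x * 0 - c * y) / (x * 0 - y))) :=
        ((hi.const_mul x).sub_const _).div ((hi.const_mul x).sub_const _) (by simpa using hy)
      have h2 : 1 * c ^ (indic r - indic p) = (x * 0 - c * y) / (x * 0 - y) := by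
        simp [indic, hp, hr, hy]
      rw [h2]; refine this.congr' ?_
      filter_upwards [(eventually_notMem_of_finite (Set.finite_singleton (0 : ℂ))).2] with ξ hξ
      have hξ' : ξ ≠ 0 := hξ; simp [scaleIf, hp, hr]
      rw [← mul_div_mul_left _ _ hξ']; congr 1 <;> field_simp
  · have e : c ^ (indic r - indic p) = 1 := by simp [indic, hp, hr]
    rw [e]
    refine (LimRatio.const ((x - c * y) / (x - y))).congr Set.finite_empty ?_
    intro ξ _; simp [scaleIf, hp, hr]

theorem scaleOn_generic_finite {m N : ℕ} {x : Fin m → Fin N → ℂ} (hx : GenericTuple x)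
    (U : Finset (Fin m × Fin N)) : {ξ | ¬ GenericTuple (scaleOn U ξ x)}.Finite := by
  classical
  have hfin : ({0} ∪ ⋃ p : (Fin m × Fin N) × (Fin m × Fin N),
      {x p.2.1 p.2.2 / x p.1.1 p.1.2} : Set ℂ).Finite :=
    (Set.finite_singleton _).union (Set.finite_iUnion fun _ => Set.finite_singleton _)
  refine hfin.subset fun ξ hξ => ?_; by_contra hcon
  simp only [Set.mem_union, Set.mem_singleton_iff, Set.mem_iUnion, not_or, not_exists] at hcon
  obtain ⟨h0, h1⟩ := hcon
  refine hξ ⟨fun i a => ?_, ?_⟩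
  · unfold scaleOn
    split_ifs
    · exact mul_ne_zero h0 (hx.1 i a)
    · exact hx.1 i a
  · rintro ⟨i, a⟩ ⟨j, b⟩ h; simp [scaleOn] at h
    split_ifs at h
    · exact hx.2 (mul_left_cancel₀ h0 h)
    · exact absurd ((eq_div_iff (hx.1 i a)).2 h) (h1 ((i, a), (j, b)))
    · exact absurd ((eq_div_iff (hx.1 j b)).2 h.symm) (h1 ((j, b), (i, a)))
    · exact hx.2 h

theorem hasBetheLimits_iff {P : QParam} {m N : ℕ} {s : Fin m → ℂ} {F : ShuffleAmbient P m} :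
    HasBetheLimits s N F ↔ ∀ (U : Finset (Fin m × Fin N)) (x : Fin m → Fin N → ℂ),
      GenericTuple x → LimRatio (fun ξ => eval (scaleOn U ξ x) F)
        (∏ i, s i ^ (U.filter fun u => u.1 = i).card) := Iff.rfl

/-! ### The shuffle product preserves the limit conditions -/

section MulLimits

variable {P : QParam} {m : ℕ}

/-- The ratio of the two limits of `ω(ξ u, v)`. -/
def omegaRatio (P : QParam) {m : ℕ} (i j : Fin m) : ℂ :=
  (if i = j then P.q2 else 1) * (if j = nextColor i then P.q1 else 1) *
    (if i = nextColor j then P.q3 else 1)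

theorem limRatio_omega (hP : P.Admissible) {x y : ℂ} (hx : x ≠ 0) (hy : y ≠ 0) (hxy : x ≠ y)
    (i j : Fin m) (p r : Prop) :
    LimRatio (fun ξ => omega P m (i, scaleIf p ξ x) (j, scaleIf r ξ y))
      (omegaRatio P i j ^ (indic r - indic p)) := by
  have e : ∀ ξ, omega P m (i, scaleIf p ξ x) (j, scaleIf r ξ y) =
    (if i = j then (scaleIf p ξ x - P.q2 * scaleIf r ξ y) / (scaleIf p ξ x - scaleIf r ξ y) else 1) *
    (if j = nextColor i then (scaleIf p ξ x - P.q1 * scaleIf r ξ y) /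
      (scaleIf p ξ x - scaleIf r ξ y) else 1) *
    (if i = nextColor j then P.colorConst m * ((scaleIf p ξ x - P.q3 * scaleIf r ξ y) /
      (scaleIf p ξ x - scaleIf r ξ y)) else 1) := fun ξ => omega_eq _ _ _ _
  simp only [e]; rw [omegaRatio, mul_zpow, mul_zpow]
  refine LimRatio.mul (LimRatio.mul ?_ ?_) ?_
  · split_ifs
    · exact limRatio_linear hx hy hxy hP.q2_ne p r
    · rw [one_zpow]; exact LimRatio.const 1
  · split_ifs
    · exact limRatio_linear hx hy hxy hP.q1_ne p r
    · rw [one_zpow]; exact LimRatio.const 1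
  · split_ifs
    · have := (LimRatio.const (P.colorConst m)).mul (limRatio_linear hx hy hxy hP.q3_ne p r)
      rwa [one_mul] at this
    · rw [one_zpow]; exact LimRatio.const 1

theorem prod_omegaRatio (hP : P.Admissible) {M : ℕ} {γ : Type} {I : Finset (Fin m × γ)}
    (hI : ColorBalanced M I) (j : Fin m) :
    (∏ u ∈ I, omegaRatio P u.1 j) = 1 ∧ (∏ u ∈ I, omegaRatio P j u.1) = 1 := by
  have key : ∀ (k : Fin m) (c : ℂ) (p : Fin m → Prop) [DecidablePred p], (∀ i, p i ↔ i = k) →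
      ∏ u ∈ I, (if p u.1 then c else 1) = c ^ M := by
    intro k c p _ hp; rw [prod_ite, prod_const, prod_const_one, mul_one, ← hI k]
    simp_all
  have hprod : P.q2 ^ M * P.q1 ^ M * P.q3 ^ M = 1 := by
    rw [← mul_pow, ← mul_pow, mul_comm P.q2, hP.prod_eq_one, one_pow]
  constructor
  · simp only [omegaRatio, prod_mul_distrib]
    rw [key j _ (fun i => i = j) fun i => Iff.rfl,
      key (prevColor j) _ (fun i => j = nextColor i) fun i => by rw [eq_comm, nextColor_eq_iff],
      key (nextColor j) _ (fun i => i = nextColor j) fun i => Iff.rfl, hprod]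
  · simp only [omegaRatio, prod_mul_distrib]
    rw [key j _ (fun i => j = i) fun i => eq_comm,
      key (nextColor j) _ (fun i => i = nextColor j) fun i => Iff.rfl,
      key (prevColor j) _ (fun i => j = nextColor i) fun i => by
        rw [eq_comm, nextColor_eq_iff], hprod]

theorem omegaRatio_ne (hP : P.Admissible) (i j : Fin m) : omegaRatio P i j ≠ 0 := by
  have h1 := hP.q1_ne; have h2 := hP.q2_ne; have h3 := hP.q3_ne
  unfold omegaRatio; grind

theorem prod_prod_omegaRatio (hP : P.Admissible) {M K : ℕ} {γ : Type} {I J : Finset (Fin m × γ)}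
    (hI : ColorBalanced M I) (hJ : ColorBalanced K J) (ε : Fin m × γ → ℤ) :
    ∏ u ∈ I, ∏ v ∈ J, omegaRatio P u.1 v.1 ^ (ε v - ε u) = 1 := by
  have e : ∀ u v : Fin m × γ, omegaRatio P u.1 v.1 ^ (ε v - ε u) =
      omegaRatio P u.1 v.1 ^ ε v * (omegaRatio P u.1 v.1 ^ ε u)⁻¹ := fun u v => by
    rw [zpow_sub₀ (omegaRatio_ne hP _ _), div_eq_mul_inv]
  simp only [e, prod_mul_distrib]; rw [Finset.prod_comm]
  have h1 : ∏ v ∈ J, ∏ u ∈ I, omegaRatio P u.1 v.1 ^ ε v = 1 := by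
    refine prod_eq_one fun v _ => ?_
    rw [prod_zpow, (prod_omegaRatio hP hI v.1).1, one_zpow]
  have h2 : ∏ u ∈ I, ∏ v ∈ J, (omegaRatio P u.1 v.1 ^ ε u)⁻¹ = 1 := by
    refine prod_eq_one fun u _ => ?_
    rw [prod_inv_distrib, prod_zpow, (prod_omegaRatio hP hJ u.1).2, one_zpow, inv_one]
  rw [h1, h2, one_mul]

theorem scaleOn_eq {N : ℕ} (U : Finset (Fin m × Fin N)) (ξ : ℂ) (x : Fin m → Fin N → ℂ)
    (v : Fin m × Fin N) : pt (scaleOn U ξ x) v = (v.1, scaleIf (v ∈ U) ξ (x v.1 v.2)) := by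
  simp [pt, scaleOn, scaleIf]

theorem limRatio_value_subset {M N : ℕ} {s : Fin m → ℂ} {F : ShuffleAmbient P m}
    (hF : HasBetheLimits s M F) {x : Fin m → Fin N → ℂ} (hx : GenericTuple x)
    (U : Finset (Fin m × Fin N)) {I : Finset (Fin m × Fin N)} (hI : ColorBalanced M I) :
    LimRatio (fun ξ => F.value (img (pt (scaleOn U ξ x)) I))
      (∏ i, s i ^ ((U ∩ I).filter fun u => u.1 = i).card) := by
  classical
  obtain ⟨e, he, hIe⟩ := hI.exists_enum
  have h1 := hF (univ.filter fun v => (v.1, e v.1 v.2) ∈ U) (fun i a => x i (e i a)) (hx.comp he)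
  have hinj : Function.Injective fun v : Fin m × Fin M => (v.1, e v.1 v.2) := by
    rintro ⟨i, a⟩ ⟨j, b⟩ h; grind
  have hc : ∀ i, ((univ.filter fun v : Fin m × Fin M => (v.1, e v.1 v.2) ∈ U).filter
      fun u => u.1 = i).card = ((U ∩ I).filter fun u => u.1 = i).card := by
    intro i; rw [← card_img hinj]; congr 1; ext v
    simp only [mem_img, mem_filter, mem_univ, true_and, mem_inter]
    constructor
    · rintro ⟨w, ⟨h2, h3⟩, rfl⟩; refine ⟨⟨h2, ?_⟩, h3⟩; rw [hIe]
      exact mem_img.2 ⟨w, mem_univ _, rfl⟩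
    · rintro ⟨⟨h2, h3⟩, h4⟩; rw [hIe] at h3; obtain ⟨w, -, rfl⟩ := mem_img.1 h3
      grind
  simp [hc] at h1
  refine LimRatio.congr (f := fun ξ => eval (scaleOn
    (univ.filter fun v => (v.1, e v.1 v.2) ∈ U) ξ (fun i a => x i (e i a))) F) h1
    (scaleOn_generic_finite hx U) ?_
  intro ξ hξ; have hξ' : GenericTuple (scaleOn U ξ x) := not_not.1 hξ
  rw [hIe, value_img_pt hξ' he]; congr 1; congr 1; funext i a; simp [scaleOn]

theorem HasBetheLimits.mul (hP : P.Admissible) {M K : ℕ} {s : Fin m → ℂ}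
    {F G : ShuffleAmbient P m} (hF : HasBetheLimits s M F) (hG : HasBetheLimits s K G)
    (hFs : HasSupport M F) : HasBetheLimits s (M + K) (F * G) := by
  classical
  intro U x hx
  have hfin := scaleOn_generic_finite hx U
  refine LimRatio.congr (S := {ξ | ¬ GenericTuple (scaleOn U ξ x)}) (f := fun ξ =>
    ∑ I : Finset (Fin m × Fin (M + K)), F.value (img (pt (scaleOn U ξ x)) I) *
      G.value (img (pt (scaleOn U ξ x)) Iᶜ) *
      ∏ u ∈ I, ∏ v ∈ Iᶜ, omega P m (pt (scaleOn U ξ x) u) (pt (scaleOn U ξ x) v)) ?_ hfin ?_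
  · refine LimRatio.sum fun I _ => ?_
    by_cases h1 : ColorBalanced M I
    · have h2 : ColorBalanced K Iᶜ := by
        exact h1.sdiff (colorBalanced_univ m (M + K)) (subset_univ _)
      have h3 : ∏ i, s i ^ (U.filter fun u => u.1 = i).card =
          (∏ i, s i ^ ((U ∩ I).filter fun u => u.1 = i).card) *
          (∏ i, s i ^ ((U ∩ Iᶜ).filter fun u => u.1 = i).card) *
          ∏ u ∈ I, ∏ v ∈ Iᶜ, omegaRatio P u.1 v.1 ^ (indic (v ∈ U) - indic (u ∈ U)) := by
        rw [prod_prod_omegaRatio hP h1 h2 (fun u => indic (u ∈ U)), mul_one, ← prod_mul_distrib]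
        refine prod_congr rfl fun i _ => ?_
        rw [← pow_add, ← card_union_of_disjoint, ← filter_union,
          ← inter_union_distrib_left, union_compl, inter_univ]
        grind [disjoint_filter_filter, disjoint_compl_right, inter_subset_right]
      rw [h3]
      refine ((limRatio_value_subset hF hx U h1).mul (limRatio_value_subset hG hx U h2)).mul ?_
      refine LimRatio.prod fun u hu => LimRatio.prod fun v hv => ?_
      simp [scaleOn_eq]
      refine limRatio_omega hP (hx.1 _ _) (hx.1 _ _) (fun h => ?_) _ _ _ _
      exact mem_compl.1 hv ((hx.2 h) ▸ hu)
    · refine (LimRatio.zero _).congr hfin fun ξ hξ => ?_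
      have hξ' : GenericTuple (scaleOn U ξ x) := not_not.1 hξ
      rw [hFs _ fun h => h1 ((colorBalanced_img_pt hξ').1 h)]; simp
  · intro ξ hξ; have hξ' : GenericTuple (scaleOn U ξ x) := not_not.1 hξ
    rw [eval_mul hξ']

end MulLimits

/-! ### The shuffle product preserves the pole and wheel conditions -/

section Density

open MvPolynomial

theorem eval_aeval {σ τ : Type} (a : τ → ℂ) (f : σ → MvPolynomial τ ℂ) (p : MvPolynomial σ ℂ) :
    eval a (aeval f p) = eval (fun v => eval a (f v)) p := by
  induction p using MvPolynomial.induction_on with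
  | C c => simp [algebraMap_eq]
  | add p q hp hq => rw [map_add, map_add, map_add, hp, hq]
  | mul_X p v hp => simp_all

theorem eval_eq_zero_of_generic_subst {m N : ℕ} {W : Type} (q : MvPolynomial (Fin m × Fin N) ℂ)
    (ρ : Fin m × Fin N → W) (c : Fin m × Fin N → ℂ) (hc : ∀ v, c v ≠ 0)
    (hinj : ∀ u v, ρ u = ρ v → c u = c v → u = v)
    (h : ∀ a : W → ℂ, GenericTuple (fun i k => c (i, k) * a (ρ (i, k))) →
      eval (fun v => c v * a (ρ v)) q = 0) (a : W → ℂ) : eval (fun v => c v * a (ρ v)) q = 0 := by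
  classical
  have hX : ∀ v, (C (c v) * X (ρ v) : MvPolynomial W ℂ) ≠ 0 := fun v =>
    mul_ne_zero (by simpa using hc v) (X_ne_zero _)
  have hr : (∏ v, (C (c v) * X (ρ v) : MvPolynomial W ℂ)) *
      pairProd (fun u v => (C (c u) * X (ρ u) - C (c v) * X (ρ v) : MvPolynomial W ℂ))
        univ ≠ 0 := by
    refine mul_ne_zero (prod_ne_zero_iff.2 fun v _ => hX v) (pairProd_ne_zero.2 ?_)
    intro u _ v _ huv
    by_cases hρ : ρ u = ρ v
    · rw [hρ, ← sub_mul, ← C_sub]; refine mul_ne_zero ?_ (X_ne_zero _)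
      rw [Ne, C_eq_zero]; grind
    · intro e; have := congrArg (eval (Pi.single (ρ u) 1)) e
      simp [Ne.symm hρ, hc u] at this
  have key := eq_zero_of_eval_generic (p := aeval (fun v => C (c v) * X (ρ v)) q) hr
    fun b hb => by
      rw [eval_aeval]; simp; refine h b ?_; rw [map_mul, map_prod] at hb
      have hb1 := left_ne_zero_of_mul hb; have hb2 := right_ne_zero_of_mul hb
      rw [show eval b (pairProd _ _) = _ from map_pairProd (eval b : MvPolynomial W ℂ →+* ℂ).toMonoidHom
        _ _, pairProd_ne_zero] at hb2
      refine ⟨fun i k => ?_, fun u v huv => ?_⟩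
      · have := prod_ne_zero_iff.1 hb1 (i, k) (mem_univ _); simpa using this
      · by_contra hne; have := hb2 u (mem_univ _) v (mem_univ _) hne; apply this
        simp [huv]
  have := congrArg (eval a) key; rw [eval_aeval] at this; simpa using this

theorem eval_eq_zero_of_generic {m N : ℕ} (q : MvPolynomial (Fin m × Fin N) ℂ)
    (h : ∀ x : Fin m → Fin N → ℂ, GenericTuple x → eval (fun v => x v.1 v.2) q = 0) : q = 0 := by
  refine MvPolynomial.funext fun a => ?_
  have := eval_eq_zero_of_generic_subst q (fun v => v) (fun _ => 1) (fun _ => one_ne_zero)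
    (fun u v h _ => h) (fun b hb => ?_) a
  · simpa using this
  grind

end Density

section MulPoly

open MvPolynomial

variable {P : QParam} {m : ℕ}

/-- The difference of two coordinates of the same color. -/
def samePoly {m N : ℕ} (u v : Fin m × Fin N) : MvPolynomial (Fin m × Fin N) ℂ :=
  if u.1 = v.1 then X u - X v else 1

/-- The numerator of the structure function, multiplied by the remaining factors. -/
def crossPoly (P : QParam) {m N : ℕ} (u v : Fin m × Fin N) : MvPolynomial (Fin m × Fin N) ℂ :=
  (if u.1 = v.1 then (X u - C P.q2 * X v) * (X v - X u) else 1) *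
  (if v.1 = nextColor u.1 then X u - C P.q1 * X v else 1) *
  (if u.1 = nextColor v.1 then C (-P.colorConst m) * (X u - C P.q3 * X v) else 1)

theorem eval_crossPoly {N : ℕ} (x : Fin m → Fin N → ℂ) (u v : Fin m × Fin N)
    (h : x u.1 u.2 ≠ x v.1 v.2) :
    eval (fun v => x v.1 v.2) (crossPoly P u v) = omega P m (pt x u) (pt x v) *
      (poleFactor (pt x u) (pt x v) * poleFactor (pt x v) (pt x u)) *
      (eval (fun v => x v.1 v.2) (samePoly u v) * eval (fun v => x v.1 v.2) (samePoly v u)) := by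
  have h2 : x v.1 v.2 - x u.1 u.2 = -(x u.1 u.2 - x v.1 v.2) := by ring
  have key : ∀ p : Prop, p = True ∨ p = False := fun p => Classical.propComplete p
  rw [omega_eq, poleFactor_pt, poleFactor_pt, crossPoly, samePoly, samePoly]
  simp [pt, eq_comm (a := v.1) (b := u.1)]
  rcases key (u.1 = v.1) with h3 | h3 <;> rcases key (v.1 = nextColor u.1) with h4 | h4 <;>
    rcases key (u.1 = nextColor v.1) with h5 | h5 <;>
    simp only [h3, h4, h5, if_true, if_false, map_mul, map_sub, eval_X, eval_C, map_one, map_neg,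
      h2] <;> field_simp

theorem exists_termPoly {M K : ℕ} {F G : ShuffleAmbient P m}
    (hF : F ∈ shuffleComponent P m M) (hG : G ∈ shuffleComponent P m K) :
    ∃ E : ℕ, ∀ (I : Finset (Fin m × Fin (M + K))), ∃ T : MvPolynomial (Fin m × Fin (M + K)) ℂ,
      (∀ x : Fin m → Fin (M + K) → ℂ, GenericTuple x → eval (fun v => x v.1 v.2) T =
        F.value (img (pt x) I) * G.value (img (pt x) Iᶜ) *
          (∏ u ∈ I, ∏ v ∈ Iᶜ, omega P m (pt x u) (pt x v)) *
        (∏ v : Fin m × Fin (M + K), x v.1 v.2) ^ E * poleProd (tupleSet x) *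
          eval (fun v => x v.1 v.2) (pairProd samePoly univ)) ∧
      ∀ u v, u ≠ v → u.1 = v.1 → ∀ a, a u = a v → eval a T = 0 := by
  classical
  obtain ⟨hFs, p, e, hp, -⟩ := mem_shuffleComponent_iff.1 hF
  obtain ⟨hGs, r, e', hr, -⟩ := mem_shuffleComponent_iff.1 hG
  refine ⟨e + e', fun I => ?_⟩
  by_cases h1 : ColorBalanced M I
  swap
  · refine ⟨0, fun x hx => ?_, fun u v _ _ a _ => map_zero _⟩
    rw [hFs _ fun h => h1 ((colorBalanced_img_pt hx).1 h)]; simp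
  have h2 : ColorBalanced K Iᶜ := by exact h1.sdiff (colorBalanced_univ m (M + K)) (subset_univ _)
  obtain ⟨f, hf, hIf⟩ := h1.exists_enum; obtain ⟨g, hg, hIg⟩ := h2.exists_enum
  have hinjf : Function.Injective fun v : Fin m × Fin M => (v.1, f v.1 v.2) := by
    rintro ⟨i, a⟩ ⟨j, b⟩ h; grind
  have hinjg : Function.Injective fun v : Fin m × Fin K => (v.1, g v.1 v.2) := by
    rintro ⟨i, a⟩ ⟨j, b⟩ h; grind
  refine ⟨rename (fun v : Fin m × Fin M => (v.1, f v.1 v.2)) p * (∏ v ∈ I, X v) ^ e' *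
    (rename (fun v : Fin m × Fin K => (v.1, g v.1 v.2)) r * (∏ v ∈ Iᶜ, X v) ^ e) *
    ((∏ u ∈ I, ∏ v ∈ Iᶜ, crossPoly P u v) * (pairProd samePoly I * pairProd samePoly Iᶜ)),
    fun x hx => ?_, fun u v huv hcol a ha => ?_⟩
  · have hp' := hp _ (hx.comp hf); have hr' := hr _ (hx.comp hg)
    have hFv := value_img_pt hx hf F; have hGv := value_img_pt hx hg G
    have eI : tupleSet (fun i a => x i (f i a)) = img (pt x) I := by
      rw [hIf, img_img, tupleSet_eq_img]; rfl
    have eJ : tupleSet (fun i a => x i (g i a)) = img (pt x) Iᶜ := by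
      rw [hIg, img_img, tupleSet_eq_img]; rfl
    rw [← hIf] at hFv; rw [← hIg] at hGv
    have pI : ∏ v : Fin m × Fin M, x v.1 (f v.1 v.2) = ∏ v ∈ I, x v.1 v.2 := by
      rw [hIf, prod_img hinjf]
    have pJ : ∏ v : Fin m × Fin K, x v.1 (g v.1 v.2) = ∏ v ∈ Iᶜ, x v.1 v.2 := by
      rw [hIg, prod_img hinjg]
    rw [← hFv, eI, pI] at hp'; rw [← hGv, eJ, pJ] at hr'
    have hunion : (univ : Finset (Fin m × Fin (M + K))) = I ∪ Iᶜ := by simp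
    have hpole : poleProd (tupleSet x) = poleProd (img (pt x) I) * poleProd (img (pt x) Iᶜ) *
        ∏ u ∈ I, ∏ v ∈ Iᶜ, (poleFactor (pt x u) (pt x v) * poleFactor (pt x v) (pt x u)) := by
      rw [tupleSet_eq_img, poleProd, poleProd, poleProd, pairProd_img hx.pt_injective,
        pairProd_img hx.pt_injective, pairProd_img hx.pt_injective, hunion,
        pairProd_union _ disjoint_compl_right]
    have hsame : pairProd samePoly (univ : Finset (Fin m × Fin (M + K))) =
        pairProd samePoly I * pairProd samePoly Iᶜ *
          ∏ u ∈ I, ∏ v ∈ Iᶜ, (samePoly u v * samePoly v u) := by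
      rw [hunion, pairProd_union _ disjoint_compl_right]
    have hall : (∏ v : Fin m × Fin (M + K), x v.1 v.2) =
        (∏ v ∈ I, x v.1 v.2) * ∏ v ∈ Iᶜ, x v.1 v.2 := (prod_mul_prod_compl I _).symm
    have hcross : eval (fun v => x v.1 v.2) (∏ u ∈ I, ∏ v ∈ Iᶜ, crossPoly P u v) =
        (∏ u ∈ I, ∏ v ∈ Iᶜ, omega P m (pt x u) (pt x v)) *
        (∏ u ∈ I, ∏ v ∈ Iᶜ, (poleFactor (pt x u) (pt x v) * poleFactor (pt x v) (pt x u))) *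
        eval (fun v => x v.1 v.2) (∏ u ∈ I, ∏ v ∈ Iᶜ, (samePoly u v * samePoly v u)) := by
      rw [map_prod, map_prod, ← prod_mul_distrib, ← prod_mul_distrib]
      refine prod_congr rfl fun u hu => ?_
      rw [map_prod, map_prod, ← prod_mul_distrib, ← prod_mul_distrib]
      refine prod_congr rfl fun v hv => ?_; rw [eval_crossPoly, map_mul]
      intro h; exact mem_compl.1 hv ((hx.2 h) ▸ hu)
    rw [hpole, hsame, hall]; simp only [map_mul] at hcross ⊢
    rw [hcross, map_pow, map_pow, map_prod, map_prod]; simp [eval_rename]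
    have e1 : eval ((fun v : Fin m × Fin (M + K) => x v.1 v.2) ∘
      fun v : Fin m × Fin M => (v.1, f v.1 v.2)) p =
      eval (fun v => x v.1 (f v.1 v.2)) p := rfl
    have e2 : eval ((fun v : Fin m × Fin (M + K) => x v.1 v.2) ∘
      fun v : Fin m × Fin K => (v.1, g v.1 v.2)) r =
      eval (fun v => x v.1 (g v.1 v.2)) r := rfl
    rw [e1, e2, ← hp', ← hr']; ring
  · have hz : ∀ S : Finset (Fin m × Fin (M + K)), u ∈ S → v ∈ S →
        eval a (pairProd samePoly S) = 0 := by
      intro S hu hv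
      rw [show eval a (pairProd samePoly S) = _ from
        map_pairProd (eval a : MvPolynomial _ ℂ →+* ℂ).toMonoidHom _ _]
      by_contra hne; refine pairProd_ne_zero.1 hne u hu v hv huv ?_
      simp [samePoly, hcol, ha]
    have hc : ∀ u v, u ∈ I → v ∈ Iᶜ → u.1 = v.1 → a u = a v →
        eval a (∏ u ∈ I, ∏ v ∈ Iᶜ, crossPoly P u v) = 0 := by
      intro u v hu hv hcol ha; rw [map_prod]; refine prod_eq_zero hu ?_
      rw [map_prod]; refine prod_eq_zero hv ?_
      rw [crossPoly, if_pos hcol, map_mul, map_mul, map_mul, map_sub, map_sub, eval_X, eval_X, ha]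
      ring
    grind [mem_compl]

theorem X_sub_X_eq {σ : Type} (u v : σ) :
    (X u - X v : MvPolynomial σ ℂ) = X u - C 1 * X v := by simp

theorem X_sub_X_sq_dvd {σ : Type} [DecidableEq σ] {Q : MvPolynomial σ ℂ} {u v : σ} (huv : u ≠ v)
    (hsymm : rename (Equiv.swap u v) Q = Q) (hvan : ∀ a, a u = a v → eval a Q = 0) :
    (X u - X v) ^ 2 ∣ Q := by
  obtain ⟨Q', hQ'⟩ : (X u - C 1 * X v : MvPolynomial σ ℂ) ∣ Q :=
    X_sub_dvd_of_eval (aeval_update_C_mul_X huv.symm 1) fun a ha => hvan a (by simpa using ha)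
  rw [← X_sub_X_eq] at hQ'
  have hne : (X u - X v : MvPolynomial σ ℂ) ≠ 0 := by grind [X_sub_X_eq, sub_ne_zero, X_ne_C_mul_X]
  have hsw : rename (Equiv.swap u v) Q' = -Q' := by
    rw [hQ', map_mul, map_sub, rename_X, rename_X, Equiv.swap_apply_left,
      Equiv.swap_apply_right] at hsymm
    have h5 : (X u - X v : MvPolynomial σ ℂ) * (rename (Equiv.swap u v) Q' + Q') = 0 := by grind
    grind [eq_neg_of_add_eq_zero_left, mul_eq_zero]
  obtain ⟨Q'', hQ''⟩ : (X u - C 1 * X v : MvPolynomial σ ℂ) ∣ Q' := by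
    refine X_sub_dvd_of_eval (aeval_update_C_mul_X huv.symm 1) fun a ha => ?_
    have ha' : a u = a v := by simpa using ha
    have h6 := congrArg (eval a) hsw; rw [eval_rename, map_neg] at h6
    have h7 : a ∘ Equiv.swap u v = a := by
      funext w
      by_cases h8 : w = u
      · subst h8; simp [ha']
      · by_cases h9 : w = v
        · subst h9; simp [ha']
        grind
    grind
  rw [← X_sub_X_eq] at hQ''; exact ⟨Q'', by rw [hQ', hQ'']; ring⟩

theorem exists_eval_X_sub_X {σ : Type} [DecidableEq σ] {u v u' v' : σ}
    (huv : u ≠ v) (hu'v' : u' ≠ v') (h1 : ¬ (u' = u ∧ v' = v)) (h2 : ¬ (u' = v ∧ v' = u)) :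
    ∃ a : σ → ℂ, eval a (X u - X v) = 0 ∧ eval a (X u' - X v') ≠ 0 := by
  refine ⟨fun w => if w = u ∨ w = v then 1 else (if w = u' then 2 else 3), by simp, ?_⟩
  simp; grind

theorem pairProd_samePoly_dvd {N : ℕ} {Q : MvPolynomial (Fin m × Fin N) ℂ}
    (hsymm : ∀ u v : Fin m × Fin N, u.1 = v.1 → rename (Equiv.swap u v) Q = Q)
    (hvan : ∀ u v, u ≠ v → u.1 = v.1 → ∀ a, a u = a v → eval a Q = 0) :
    pairProd samePoly univ ∣ Q := by
  classical
  obtain ⟨rk, hrk⟩ : ∃ rk : Fin m × Fin N → ℕ, Function.Injective rk :=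
    ⟨fun v => (Fintype.equivFin _ v : ℕ), fun u v h => by simpa using Fin.val_injective h⟩
  let k : Fin m × Fin N → Fin m × Fin N → MvPolynomial (Fin m × Fin N) ℂ := fun u v =>
    if u.1 = v.1 ∧ rk u < rk v then -(X u - X v) ^ 2 else 1
  have e1 : pairProd samePoly univ = pairProd k univ := by
    refine pairProd_congr_symm fun u _ v _ huv => ?_
    simp [samePoly, k, eq_comm (a := v.1)]; grind [lt_or_gt_of_ne]
  set B := (univ : Finset (Fin m × Fin N)).offDiag.filter
      fun p => p.1.1 = p.2.1 ∧ rk p.1 < rk p.2 with hB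
  have hmem : ∀ p ∈ B, p.1 ≠ p.2 ∧ p.1.1 = p.2.1 ∧ rk p.1 < rk p.2 := by
    grind
  have e2 : pairProd k univ = (∏ p ∈ B, (-1)) * ∏ p ∈ B, (X p.1 - X p.2) ^ 2 := by
    rw [pairProd_def, ← prod_mul_distrib, hB, prod_filter]
    refine prod_congr (by congr!) fun p _ => ?_
    simp only [k]
    split_ifs <;> ring
  have hu : IsUnit (∏ p ∈ B, (-1 : MvPolynomial (Fin m × Fin N) ℂ)) := by
    rw [prod_const]; exact isUnit_one.neg.pow _
  rw [e1, e2, hu.mul_left_dvd]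
  refine prod_pow_dvd_of_prime B (fun p => X p.1 - X p.2) 2 ?_ ?_ ?_
  · intro p hp; rw [X_sub_X_eq]
    exact X_sub_prime (aeval_update_C_mul_X (hmem p hp).1.symm 1)
      (X_ne_C_mul_X (hmem p hp).1.symm 1)
  · intro p hp p' hp' hne
    refine exists_eval_X_sub_X (hmem p hp).1 (hmem p' hp').1 ?_ ?_
    · grind
    · rintro ⟨h1, h2⟩; have h3 := (hmem p' hp').2.2; rw [h1, h2] at h3
      exact absurd (hmem p hp).2.2 h3.not_gt
  · intro p hp
    exact X_sub_X_sq_dvd (hmem p hp).1 (hsymm _ _ (hmem p hp).2.1)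
      (hvan _ _ (hmem p hp).1 (hmem p hp).2.1)

theorem HasWheel.split (hP : P.Admissible) {T I : Finset (Fin m × ℂ)} (hT : HasWheel P T)
    (h : ∀ u ∈ I, ∀ v ∈ T, v ∉ I → omega P m u v ≠ 0) :
    HasWheel P I ∨ ∀ J : Finset (Fin m × ℂ), (∀ v ∈ T, v ∉ I → v ∈ J) → HasWheel P J := by
  have z2 : ∀ (i : Fin m) (y : ℂ), (i, P.q2 * y) ∈ I → (i, y) ∈ T → (i, y) ∈ I := by
    intro i y h1 h2; by_contra h3; refine h _ h1 _ h2 h3 ?_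
    rw [omega_eq, if_pos rfl]; simp
  have z3 : ∀ (i : Fin m) (y : ℂ), (nextColor i, P.q3 * y) ∈ I → (i, y) ∈ T → (i, y) ∈ I := by
    grind [omega_eq]
  have z1 : ∀ (i : Fin m) (y : ℂ), (i, y) ∈ I → (nextColor i, P.q2 * (P.q3 * y)) ∈ T →
      (nextColor i, P.q2 * (P.q3 * y)) ∈ I := by
    intro i y h1 h2; by_contra h3; refine h _ h1 _ h2 h3 ?_; rw [omega_eq]
    have : y - P.q1 * (P.q2 * (P.q3 * y)) = 0 := by linear_combination (-y) * hP.prod_eq_one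
    simp [this]
  obtain ⟨i, y, ⟨h1, h2, h3⟩ | ⟨h1, h2, h3⟩⟩ := hT
  · have c1 := z3 i y; have c2 := z2 (nextColor i) (P.q3 * y); have c3 := z1 i y
    by_cases h4 : (i, y) ∈ I
    · exact Or.inl ⟨i, y, Or.inl ⟨h4, c2 (c3 h4 h3) h2, c3 h4 h3⟩⟩
    · refine Or.inr fun J hJ => ⟨i, y, Or.inl ⟨hJ _ h1 h4, hJ _ h2 fun h5 => h4 (c1 h5 h1),
        hJ _ h3 fun h5 => h4 (c1 (c2 h5 h2) h1)⟩⟩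
  · have e : P.q3 * (P.q2 * y) = P.q2 * (P.q3 * y) := by ring
    have c1 := z2 i y; have c2 := z3 i (P.q2 * y); have c3 := z1 i y
    rw [← e] at c3
    by_cases h4 : (i, y) ∈ I
    · exact Or.inl ⟨i, y, Or.inr ⟨h4, c2 (c3 h4 h3) h2, c3 h4 h3⟩⟩
    · refine Or.inr fun J hJ => ⟨i, y, Or.inr ⟨hJ _ h1 h4, hJ _ h2 fun h5 => h4 (c1 h5 h1),
        hJ _ h3 fun h5 => h4 (c1 (c2 h5 h2) h1)⟩⟩

theorem value_mul_eq_zero_of_wheel (hP : P.Admissible) {M K : ℕ} {F G : ShuffleAmbient P m}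
    (hF : F ∈ shuffleComponent P m M) (hG : G ∈ shuffleComponent P m K) {T : Finset (Fin m × ℂ)}
    (hg : GenericSet T) (hT : HasWheel P T) : (F * G).value T = 0 := by
  classical
  rw [value_mul F G hg]
  by_contra hne; obtain ⟨I, J, -, rfl, h1, h2, h3⟩ := exists_of_conv_ne_zero hne
  have hJ : ∀ v ∈ I ∪ J, v ∉ I → v ∈ J := fun v hv hvI => (mem_union.1 hv).resolve_left hvI
  rcases hT.split hP (fun u hu v hv hvI => h3 u hu v (hJ v hv hvI)) with h | h
  · exact h1 (value_eq_zero_of_wheel hF h)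
  grind [value_eq_zero_of_wheel]

theorem QParam.Admissible.q2_ne_one (hP : P.Admissible) : P.q2 ≠ 1 := by
  intro h; have := hP.indep_q2_q3 (a := 1) (b := 0) (by simp [h])
  omega

theorem eval_eq_zero_of_generic_proportional {N : ℕ} {q : MvPolynomial (Fin m × Fin N) ℂ}
    {x : Fin m → Fin N → ℂ} (hx0 : ∀ i a, x i a ≠ 0) (u v w : Fin m × Fin N) {b c : ℂ}
    (hb0 : b ≠ 0) (hc0 : c ≠ 0) (hb1 : b ≠ 1) (hc1 : c ≠ 1) (hbc : b ≠ c)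
    (hv : x v.1 v.2 = b * x u.1 u.2) (hw : x w.1 w.2 = c * x u.1 u.2)
    (h : ∀ y : Fin m → Fin N → ℂ, GenericTuple y → y v.1 v.2 = b * y u.1 u.2 →
      y w.1 w.2 = c * y u.1 u.2 → eval (fun v => y v.1 v.2) q = 0) :
    eval (fun v => x v.1 v.2) q = 0 := by
  classical
  have huv : v ≠ u := by grind
  have huw : w ≠ u := by grind
  have hvw : w ≠ v := by grind
  obtain ⟨ρ, hρv, hρw, hρ⟩ : ∃ ρ : Fin m × Fin N → Fin m × Fin N, ρ v = u ∧ ρ w = u ∧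
      ∀ t, t ≠ v → t ≠ w → ρ t = t :=
    ⟨fun t => if t = v ∨ t = w then u else t, if_pos (Or.inl rfl), if_pos (Or.inr rfl),
      fun t h1 h2 => if_neg (not_or.2 ⟨h1, h2⟩)⟩
  obtain ⟨cc, hcv, hcw, hcc⟩ : ∃ cc : Fin m × Fin N → ℂ, cc v = b ∧ cc w = c ∧
      ∀ t, t ≠ v → t ≠ w → cc t = 1 :=
    ⟨fun t => if t = v then b else if t = w then c else 1, if_pos rfl,
      (if_neg hvw).trans (if_pos rfl), fun t h1 h2 => (if_neg h1).trans (if_neg h2)⟩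
  have e1 : (fun t : Fin m × Fin N => x t.1 t.2) =
      fun t => cc t * (fun t : Fin m × Fin N => x t.1 t.2) (ρ t) := by
    funext t
    by_cases h1 : t = v
    · rw [h1, hρv, hcv, hv]
    · by_cases h2 : t = w
      · rw [h2, hρw, hcw, hw]
      grind
  rw [e1]
  refine eval_eq_zero_of_generic_subst q ρ cc ?_ ?_ ?_ (fun t => x t.1 t.2)
  · intro t
    by_cases h1 : t = v
    · rwa [h1, hcv]
    · by_cases h2 : t = w
      · rwa [h2, hcw]
      grind
  · intro t t' hh hcceq
    by_cases h1 : t = v <;> by_cases h2 : t' = v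
    · rw [h1, h2]
    · grind
    · grind
    · by_cases h4 : t = w <;> by_cases h5 : t' = w
      · rw [h4, h5]
      · grind
      · grind
      grind
  grind [Prod.mk.eta]

theorem mul_mem_shuffleComponent (hP : P.Admissible) {M K : ℕ} {F G : ShuffleAmbient P m}
    (hF : F ∈ shuffleComponent P m M) (hG : G ∈ shuffleComponent P m K) :
    F * G ∈ shuffleComponent P m (M + K) := by
  classical
  refine mem_shuffleComponent_iff.2 ⟨?_, ?_⟩
  · exact (mem_shuffleComponent_iff.1 hF).1.mul (mem_shuffleComponent_iff.1 hG).1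
  obtain ⟨E, hE⟩ := exists_termPoly hF hG
  choose T hT hT0 using hE
  have hQ : ∀ x : Fin m → Fin (M + K) → ℂ, GenericTuple x →
      eval (fun v => x v.1 v.2) (∑ I, T I) = eval x (F * G) *
        (∏ v : Fin m × Fin (M + K), x v.1 v.2) ^ E * poleProd (tupleSet x) *
          eval (fun v => x v.1 v.2) (pairProd samePoly univ) := by
    intro x hx; rw [map_sum, eval_mul hx, sum_mul, sum_mul, sum_mul]; grind
  have hsame : ∀ x : Fin m → Fin (M + K) → ℂ, GenericTuple x →
      eval (fun v => x v.1 v.2) (pairProd samePoly (univ : Finset (Fin m × Fin (M + K)))) =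
        pairProd (fun u v : Fin m × ℂ => if u.1 = v.1 then u.2 - v.2 else 1) (tupleSet x) := by
    intro x hx
    rw [show eval _ (pairProd samePoly _) = _ from
      map_pairProd (eval _ : MvPolynomial _ ℂ →+* ℂ).toMonoidHom _ _, tupleSet_eq_img,
      pairProd_img hx.pt_injective]
    refine pairProd_congr fun u _ v _ _ => ?_
    by_cases h : u.1 = v.1
    · rw [if_pos (show (pt x u).1 = (pt x v).1 from h), samePoly, if_pos h]
      simp [pt]
    · rw [if_neg (show ¬ (pt x u).1 = (pt x v).1 from h), samePoly, if_neg h]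
      simp
  obtain ⟨q, hq⟩ : pairProd samePoly univ ∣ ∑ I, T I := by
    refine pairProd_samePoly_dvd (fun u v huv => ?_) fun u v hne huv a ha => ?_
    · rw [← sub_eq_zero]; refine eval_eq_zero_of_generic _ fun x hx => ?_
      rw [map_sub, eval_rename, sub_eq_zero]; obtain ⟨i, a⟩ := u
      obtain ⟨j, b⟩ := v; obtain rfl : i = j := huv
      let e : Fin m → Equiv.Perm (Fin (M + K)) := fun j => if j = i then Equiv.swap a b else 1
      have he : ∀ w : Fin m × Fin (M + K), Equiv.swap (i, a) (i, b) w = (w.1, e w.1 w.2) := by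
        rintro ⟨j, c⟩
        by_cases hj : j = i
        · subst hj; simp [e, if_pos, Equiv.swap_apply_def]
          split_ifs <;> rfl
        · simp [e, if_neg hj, Equiv.Perm.one_apply]
          exact Equiv.swap_apply_of_ne_of_ne (fun h => hj (congrArg Prod.fst h))
            (fun h => hj (congrArg Prod.fst h))
      have hx' : GenericTuple fun i a => x i (e i a) :=
        hx.comp (e := fun i a => e i a) fun i => (e i).injective
      have h1 : ((fun v : Fin m × Fin (M + K) => x v.1 v.2) ∘ Equiv.swap (i, a) (i, b)) =
          fun v => (fun i a => x i (e i a)) v.1 v.2 := by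
        funext w; simp [he w]
      rw [h1, hQ _ hx, hQ _ hx', hsame _ hx, hsame _ hx', eval_perm, tupleSet_perm e]
      congr 3; rw [Fintype.prod_prod_type, Fintype.prod_prod_type]; congr 1
      exact prod_congr rfl fun j _ => Equiv.prod_comp (e j) fun a => x j a
    · rw [map_sum]; grind [sum_eq_zero]
  have hval : ∀ x : Fin m → Fin (M + K) → ℂ, GenericTuple x →
      eval x (F * G) * (∏ v : Fin m × Fin (M + K), x v.1 v.2) ^ E *
        poleProd (tupleSet x) = eval (fun v => x v.1 v.2) q := by
    intro x hx; have h1 := hQ x hx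
    have h2 : eval (fun v => x v.1 v.2)
        (pairProd samePoly (univ : Finset (Fin m × Fin (M + K)))) ≠ 0 := by
      rw [hsame x hx, pairProd_ne_zero]; intro u hu v hv huv
      split_ifs
      · exact sub_ne_zero.2 fun h => huv (hx.genericSet.2 hu hv h)
      · exact one_ne_zero
    rw [hq, map_mul, mul_comm] at h1; exact (mul_right_cancel₀ h2 h1).symm
  refine ⟨q, E, hval, fun x hx0 hw => ?_⟩
  have hqz : ∀ x : Fin m → Fin (M + K) → ℂ, GenericTuple x → HasWheel P (tupleSet x) →
      eval (fun v => x v.1 v.2) q = 0 := by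
    intro x hx hw
    rw [← hval x hx, eval_eq_value hx, ← tupleSet_eq_img,
      value_mul_eq_zero_of_wheel hP hF hG hx.genericSet hw]
    ring
  have h21 := hP.q2_ne_one; have h3 := hP.q3_ne; have h2 := hP.q2_ne
  have h321 : P.q2 * P.q3 ≠ 1 := by
    intro h; have := hP.indep_q2_q3 (a := 1) (b := 1) (by simpa using h)
    omega
  have h31 : P.q3 ≠ 1 := by
    intro h; have := hP.indep_q2_q3 (a := 0) (b := 1) (by simpa using h)
    omega
  obtain ⟨i, a, b, c, ⟨hw1, hw2⟩ | ⟨hw1, hw2⟩⟩ := hw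
  · refine eval_eq_zero_of_generic_proportional hx0 (i, a) (nextColor i, b) (nextColor i, c) h3
      (mul_ne_zero h2 h3) h31 h321 (fun h => h21 (mul_right_cancel₀ h3 (by rw [one_mul, ← h]))) hw1
      (by rw [hw2, hw1, mul_assoc]) fun y hy h1 h2 => hqz y hy (onWheel_iff.1 ⟨i, a, b, c, Or.inl ⟨h1, ?_⟩⟩)
    rw [h1, ← mul_assoc, ← h2]
  · refine eval_eq_zero_of_generic_proportional hx0 (i, a) (i, b) (nextColor i, c) h2
      (mul_ne_zero h3 h2) h21 (by rwa [mul_comm])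
      (fun h => h31 (mul_right_cancel₀ h2 (by rw [one_mul, ← h]))) hw1
      (by rw [hw2, hw1, mul_assoc]) fun y hy h1 h2 => hqz y hy (onWheel_iff.1 ⟨i, a, b, c, Or.inr ⟨h1, ?_⟩⟩)
    rw [h1, ← mul_assoc, ← h2]

theorem mul_mem_betheComponent (hP : P.Admissible) {s : Fin m → ℂ} {M K : ℕ}
    {F G : ShuffleAmbient P m} (hF : F ∈ betheComponent P s M) (hG : G ∈ betheComponent P s K) :
    F * G ∈ betheComponent P s (M + K) := by
  rw [mem_betheComponent_iff] at *
  exact ⟨mul_mem_shuffleComponent hP hF.1 hG.1, HasBetheLimits.mul hP hF.2 hG.2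
    (mem_shuffleComponent_iff.1 hF.1).1⟩

end MulPoly

/-! ### Configurations made of geometric progressions -/

section Strings

variable {P : QParam} {m N : ℕ} {L : Type}

theorem nextColor_eq_iff_emod {i j : Fin m} {a : ℤ} (ha : a % m = (i : ℕ)) :
    j = nextColor i ↔ (a + 1) % m = (j : ℕ) := by
  have h : (a + 1) % m = ((nextColor i : Fin m) : ℕ) := by
    simp [nextColor]; push_cast; rw [← ha]; simp
  grind

theorem eq_nextColor_iff_emod {i j : Fin m} {a : ℤ} (ha : a % m = (j : ℕ)) :
    j = nextColor i ↔ (a - 1) % m = (i : ℕ) := by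
  constructor
  · intro h
    have hi : ((i : ℕ) : ℤ) % m = (i : ℕ) := Int.emod_eq_of_lt (by positivity) (by exact_mod_cast i.2)
    rw [← hi]; refine Int.ModEq.add_right_cancel' 1 ?_; aesop
  · intro h; refine (nextColor_eq_iff_emod h).2 ?_; rw [sub_add_cancel, ha]

/-- The variables are distributed over labels, and the variables with a given label carry
consecutive positions, which are congruent to the colors. -/
structure IsStringConf (σ : Fin m × Fin N → L) (pos : Fin m × Fin N → ℤ) : Prop where
  color : ∀ v, pos v % m = (v.1 : ℕ)
  inj : ∀ u v, σ u = σ v → pos u = pos v → u = v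
  interval : ∀ u v j, σ u = σ v → pos u ≤ j → j ≤ pos v → ∃ w, σ w = σ u ∧ pos w = j

/-- The point with coordinates `q₃^{pos v} y_{σ v}`. -/
def stringPoint (P : QParam) (σ : Fin m × Fin N → L) (pos : Fin m × Fin N → ℤ) (y : L → ℂ)
    (v : Fin m × Fin N) : ℂ := P.q3 ^ pos v * y (σ v)

/-- The parameters of different labels are independent modulo the group generated by `q₂, q₃`. -/
structure Separated (P : QParam) (y : L → ℂ) : Prop where
  ne_zero : ∀ s, y s ≠ 0
  sep : ∀ s s' (a b : ℤ), s ≠ s' → P.q2 ^ a * P.q3 ^ b * y s ≠ y s'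

theorem Separated.stringPoint_eq (hP : P.Admissible) {y : L → ℂ} (hy : Separated P y)
    {σ : Fin m × Fin N → L} {pos : Fin m × Fin N → ℤ} {u v : Fin m × Fin N} {a b a' b' : ℤ}
    (h : P.q2 ^ a * P.q3 ^ b * stringPoint P σ pos y u =
      P.q2 ^ a' * P.q3 ^ b' * stringPoint P σ pos y v) :
    σ u = σ v ∧ a = a' ∧ b + pos u = b' + pos v := by
  have h2 := hP.q2_ne; have h3 := hP.q3_ne
  have key : P.q2 ^ (a - a') * P.q3 ^ (b + pos u - (b' + pos v)) * y (σ u) = y (σ v) := by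
    rw [zpow_sub₀ h2, zpow_sub₀ h3, zpow_add₀ h3, zpow_add₀ h3]
    grind [zpow_ne_zero, stringPoint]
  have hσ : σ u = σ v := by by_contra hne; exact hy.sep _ _ _ _ hne key
  refine ⟨hσ, ?_⟩; rw [hσ] at key
  have := hP.indep_q2_q3 (mul_right_cancel₀ (hy.ne_zero _) (key.trans (one_mul _).symm))
  omega

theorem stringPoint_ne_zero (hP : P.Admissible) {y : L → ℂ} (hy : ∀ s, y s ≠ 0)
    (σ : Fin m × Fin N → L) (pos : Fin m × Fin N → ℤ) (v : Fin m × Fin N) :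
    stringPoint P σ pos y v ≠ 0 :=
  mul_ne_zero (zpow_ne_zero _ hP.q3_ne) (hy _)

theorem Separated.genericTuple (hP : P.Admissible) {y : L → ℂ} (hy : Separated P y)
    {σ : Fin m × Fin N → L} {pos : Fin m × Fin N → ℤ} (hc : IsStringConf σ pos) :
    GenericTuple fun i a => stringPoint P σ pos y (i, a) := by
  refine ⟨fun i a => stringPoint_ne_zero hP hy.ne_zero _ _ _, fun u v h => ?_⟩
  obtain ⟨h1, -, h2⟩ := hy.stringPoint_eq hP (σ := σ) (pos := pos) (u := u) (v := v) (a := 0)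
    (a' := 0) (b := 0) (b' := 0) (by simpa using h)
  exact hc.inj u v h1 (by simpa using h2)

section Length

variable [DecidableEq L] {σ : Fin m × Fin N → L} {pos : Fin m × Fin N → ℤ}

/-- The number of variables with label `s`. -/
def stringLen (σ : Fin m × Fin N → L) (s : L) : ℕ := (univ.filter fun v => σ v = s).card

theorem IsStringConf.lt_stringLen (hc : IsStringConf σ pos) {v w : Fin m × Fin N}
    (h : σ v = σ w) : pos w - pos v < stringLen σ (σ v) := by
  by_cases hle : pos v ≤ pos w
  swap
  · grind
  have h1 : (Icc (pos v) (pos w)).card ≤ stringLen σ (σ v) := by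
    refine (card_le_card ?_).trans (card_image_le (f := pos)); intro j hj
    rw [mem_Icc] at hj; obtain ⟨z, hz1, hz2⟩ := hc.interval v w j h hj.1 hj.2
    grind
  rw [Int.card_Icc] at h1; omega

theorem IsStringConf.stringLen_le (hc : IsStringConf σ pos) {u u' : Fin m × Fin N}
    (h1 : ¬ ∃ w, σ w = σ u ∧ pos w = pos u - 1) (h : σ u = σ u')
    (h2 : ¬ ∃ w, σ w = σ u' ∧ pos w = pos u' + 1) :
    (stringLen σ (σ u) : ℤ) ≤ pos u' - pos u + 1 := by
  have hsub : stringLen σ (σ u) ≤ (Icc (pos u) (pos u')).card := by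
    refine card_le_card_of_injOn pos ?_ ?_
    · intro w hw; have hw' : σ w = σ u := by simpa using hw
      simp
      constructor
      · by_contra hlt
        obtain ⟨z, hz⟩ := hc.interval w u (pos u - 1) hw' (by omega) (by omega)
        grind
      · by_contra hlt
        obtain ⟨z, hz⟩ := hc.interval u' w (pos u' + 1) (by rw [hw', h]) (by omega) (by omega)
        exact h2 ⟨z, hz⟩
    · intro w hw w' hw' he; have e1 : σ w = σ u := by simpa using hw
      have e2 : σ w' = σ u := by simpa using hw'
      exact hc.inj _ _ (e1.trans e2.symm) he
  rw [Int.card_Icc] at hsub; have h3 := hc.lt_stringLen h.symm; grind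

theorem IsStringConf.first_unique (hc : IsStringConf σ pos) {u u' : Fin m × Fin N} (ε : ℤ)
    (hε : ε = 1 ∨ ε = -1) (h : σ u = σ u') (h1 : ¬ ∃ w, σ w = σ u ∧ pos w = pos u + ε)
    (h2 : ¬ ∃ w, σ w = σ u' ∧ pos w = pos u' + ε) : u = u' := by
  refine hc.inj _ _ h ?_
  rcases hε with rfl | rfl
  · rcases lt_trichotomy (pos u) (pos u') with h3 | h3 | h3
    · exact absurd (hc.interval u u' (pos u + 1) h (by omega) (by omega)) h1
    · exact h3
    · exact absurd (hc.interval u' u (pos u' + 1) h.symm (by omega) (by omega)) h2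
  · rcases lt_trichotomy (pos u) (pos u') with h3 | h3 | h3
    · obtain ⟨w, hw⟩ := hc.interval u u' (pos u' + -1) h (by omega) (by omega)
      grind
    · exact h3
    · obtain ⟨w, hw⟩ := hc.interval u' u (pos u + -1) h.symm (by omega) (by omega)
      grind

end Length

end Strings

/-! ### Polynomials with limits at zero and infinity -/

theorem nonneg_of_tendsto_zpow {g : Polynomial ℂ} (hg : g.eval 0 ≠ 0) {z : ℤ} {l : ℂ}
    (h : Tendsto (fun t : ℂ => g.eval t * t ^ z) (𝓝[≠] 0) (𝓝 l)) : 0 ≤ z := by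
  by_contra hz
  obtain ⟨n, hn⟩ : ∃ n : ℕ, z = -((n : ℤ) + 1) := ⟨(-z - 1).toNat, by omega⟩
  have h1 : Tendsto (fun t : ℂ => g.eval t * t ^ z * t ^ (n + 1)) (𝓝[≠] 0) (𝓝 (l * 0 ^ (n + 1))) :=
    h.mul ((continuous_pow (n + 1)).tendsto (0 : ℂ) |>.mono_left nhdsWithin_le_nhds)
  have h2 : Tendsto (fun t : ℂ => g.eval t * t ^ z * t ^ (n + 1)) (𝓝[≠] 0) (𝓝 (g.eval 0)) := by
    refine (g.continuous.tendsto 0 |>.mono_left nhdsWithin_le_nhds).congr' ?_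
    filter_upwards [self_mem_nhdsWithin] with t ht
    rw [hn, zpow_neg, mul_assoc]
    have : t ^ ((n : ℤ) + 1) = t ^ (n + 1) := by aesop
    simp_all
  have := tendsto_nhds_unique h1 h2; grind

theorem eval_eq_of_limRatio {r : Polynomial ℂ} {K : ℕ} {R : ℂ}
    (h : LimRatio (fun t => r.eval t / t ^ K) R) :
    ∃ a, (∀ t, r.eval t = a * t ^ K) ∧ (a = 0 ∨ R = 1) := by
  by_cases hr : r = 0
  · aesop
  obtain ⟨l, h0, h1⟩ := h
  obtain ⟨g, hg, hgd⟩ := Polynomial.exists_eq_pow_rootMultiplicity_mul_and_not_dvd r hr 0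
  set j := r.rootMultiplicity 0; simp at hg hgd
  have hg0 : g.eval 0 ≠ 0 := by
    intro h; apply hgd; have := Polynomial.dvd_iff_isRoot.2 h; simpa using this
  have hj : (K : ℤ) ≤ j := by
    have := nonneg_of_tendsto_zpow hg0 (z := (j : ℤ) - K) (l := l) (h0.congr' ?_)
    · omega
    filter_upwards [self_mem_nhdsWithin] with t ht
    have ht' : t ≠ 0 := ht; rw [hg]; simp
    rw [zpow_sub₀ ht', zpow_natCast, zpow_natCast]; field_simp
  have hn : (r.natDegree : ℤ) ≤ K := by
    have hrev : r.reverse.eval 0 ≠ 0 := by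
      grind [Polynomial.coeff_zero_eq_eval_zero, Polynomial.coeff_zero_reverse,
        Polynomial.leadingCoeff_ne_zero]
    have h2 := h1.comp tendsto_inv₀_nhdsNE_zero
    have := nonneg_of_tendsto_zpow hrev (z := (K : ℤ) - r.natDegree) (l := l * R) (h2.congr' ?_)
    · omega
    filter_upwards [self_mem_nhdsWithin] with t ht
    have ht' : t ≠ 0 := ht
    haveI := invertibleOfNonzero (inv_ne_zero ht')
    have h3 := Polynomial.eval₂_reverse_mul_pow (RingHom.id ℂ) t⁻¹ r
    rw [invOf_eq_inv, inv_inv] at h3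
    change r.reverse.eval t * t⁻¹ ^ r.natDegree = r.eval t⁻¹ at h3
    grind [zpow_sub₀, zpow_natCast, inv_pow]
  have hdeg : r.natDegree = j + g.natDegree := by
    grind [Polynomial.natDegree_mul, pow_ne_zero, Polynomial.X_ne_zero, Polynomial.natDegree_X_pow]
  have hg2 : g.natDegree = 0 := by omega
  rw [Polynomial.eq_C_of_natDegree_eq_zero hg2] at hg
  have hform : ∀ t, r.eval t = g.coeff 0 * t ^ K := by
    grind [Polynomial.eval_mul, Polynomial.eval_pow, Polynomial.eval_X, Polynomial.eval_C, mul_comm]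
  refine ⟨g.coeff 0, hform, ?_⟩; by_contra hne
  have hc : LimRatio (fun _ => g.coeff 0) R := by
    refine LimRatio.congr ⟨l, h0, h1⟩ (Set.finite_singleton 0) fun t ht => ?_
    have ht' : t ≠ 0 := ht; rw [hform t]; field_simp
  obtain ⟨l', a1, a2⟩ := hc
  have e1 := tendsto_nhds_unique a1 tendsto_const_nhds
  have e2 := tendsto_nhds_unique a2 tendsto_const_nhds; grind

/-! ### Scaling a block of geometric progressions -/

section Block

open MvPolynomial

variable {P : QParam} {m N : ℕ} {L : Type}

/-- A pair of variables of adjacent colors, with the direction of the adjacency. -/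
abbrev Slot (m N : ℕ) : Type := ((Fin m × Fin N) × (Fin m × Fin N)) × Bool

/-- The direction of a slot as a sign. -/
def Slot.sign (k : Slot m N) : ℤ := if k.2 then 1 else -1

theorem Slot.sign_eq (k : Slot m N) : k.sign = 1 ∨ k.sign = -1 := by
  unfold Slot.sign
  split_ifs <;> simp

/-- The string of the second variable continues in the direction of the slot. -/
def Slot.Inner (σ : Fin m × Fin N → L) (pos : Fin m × Fin N → ℤ) (k : Slot m N) : Prop :=
  ∃ w, σ w = σ k.1.2 ∧ pos w = pos k.1.2 + k.sign

open Classical in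
/-- The root attached to a slot, divided by the second coordinate. -/
def Slot.root (P : QParam) (σ : Fin m × Fin N → L) (pos : Fin m × Fin N → ℤ) (k : Slot m N) : ℂ :=
  P.q2 ^ (if k.Inner σ pos then k.sign else 0) * P.q3 ^ k.sign

open Classical in
/-- The slots between the variables with labels in `U` and the other ones. -/
def slots (σ : Fin m × Fin N → L) (pos : Fin m × Fin N → ℤ) (U : Finset L) : Finset (Slot m N) :=
  univ.filter fun k => σ k.1.1 ∈ U ∧ σ k.1.2 ∉ U ∧ (pos k.1.2 + k.sign) % m = (k.1.1.1 : ℕ)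

theorem mem_slots {σ : Fin m × Fin N → L} {pos : Fin m × Fin N → ℤ} {U : Finset L}
    {k : Slot m N} : k ∈ slots σ pos U ↔
      σ k.1.1 ∈ U ∧ σ k.1.2 ∉ U ∧ (pos k.1.2 + k.sign) % m = (k.1.1.1 : ℕ) := by
  simp [slots]

variable {σ : Fin m × Fin N → L} {pos : Fin m × Fin N → ℤ} {y : L → ℂ} {U : Finset L}

theorem Slot.root_inner {k : Slot m N} (h : k.Inner σ pos) :
    k.root P σ pos = P.q2 ^ k.sign * P.q3 ^ k.sign := by
  rw [Slot.root, if_pos h]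

theorem Slot.root_outer {k : Slot m N} (h : ¬ k.Inner σ pos) : k.root P σ pos = P.q3 ^ k.sign := by
  rw [Slot.root, if_neg h, zpow_zero, one_mul]

theorem Slot.root_ne_zero (hP : P.Admissible) (k : Slot m N) : k.root P σ pos ≠ 0 :=
  mul_ne_zero (zpow_ne_zero _ hP.q2_ne) (zpow_ne_zero _ hP.q3_ne)

theorem Slot.ext_sign {k k' : Slot m N} (h1 : k.1.1 = k'.1.1) (h2 : k.1.2 = k'.1.2)
    (h3 : k.sign = k'.sign) : k = k' := by
  grind [Slot.sign]

theorem eval_eq_zero_of_inner (hP : P.Admissible) (hc : IsStringConf σ pos)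
    {p : MvPolynomial (Fin m × Fin N) ℂ}
    (hw : ∀ x : Fin m → Fin N → ℂ, OnWheel P x → eval (fun v => x v.1 v.2) p = 0)
    {k : Slot m N} (hi : k.Inner σ pos) (hk : (pos k.1.2 + k.sign) % m = (k.1.1.1 : ℕ))
    {a : Fin m × Fin N → ℂ} (ha : ∀ w, σ w = σ k.1.2 → a w = stringPoint P σ pos y w)
    (hv : a k.1.1 = k.root P σ pos * stringPoint P σ pos y k.1.2) : eval a p = 0 := by
  have h3 := hP.q3_ne; rw [Slot.root_inner hi] at hv; obtain ⟨⟨v, u⟩, b⟩ := k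
  obtain ⟨w, hw1, hw2⟩ := hi
  have hwv : w.1 = v.1 := by have := hc.color w; grind
  have ew : (v.1, w.2) = w := by rw [← hwv]
  refine hw (fun i j => a (i, j)) ?_
  have hu : a u = P.q3 ^ pos u * y (σ u) := ha u rfl
  have hwa : a w = P.q3 ^ pos w * y (σ u) := by rw [ha w hw1, stringPoint, hw1]
  have hva : a v = P.q2 ^ Slot.sign ((v, u), b) * P.q3 ^ Slot.sign ((v, u), b) *
    (P.q3 ^ pos u * y (σ u)) := hv
  cases b
  · have hs : Slot.sign (((v, u), false) : Slot m N) = -1 := rfl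
    rw [hs] at hw2 hva hk
    have hcol : u.1 = nextColor v.1 := (eq_nextColor_iff_emod (hc.color u)).2 (by grind)
    refine ⟨v.1, v.2, w.2, u.2, Or.inr ⟨?_, ?_⟩⟩
    · change a (v.1, w.2) = P.q2 * a v; rw [ew, hwa, hva, hw2, zpow_add₀ h3]
      have := hP.q2_ne; field_simp
    · rw [← hcol]; change a u = P.q3 * a (v.1, w.2)
      rw [ew, hu, hwa, hw2, zpow_add₀ h3]; field_simp
  · have hs : Slot.sign (((v, u), true) : Slot m N) = 1 := rfl
    rw [hs] at hw2 hva hk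
    have hcol : v.1 = nextColor u.1 := (nextColor_eq_iff_emod (hc.color u)).2 hk
    refine ⟨u.1, u.2, w.2, v.2, Or.inl ⟨?_, ?_⟩⟩
    · rw [← hcol]; change a (v.1, w.2) = P.q3 * a u
      rw [ew, hwa, hu, hw2, zpow_add₀ h3, zpow_one]; ring
    · rw [← hcol]; change a v = P.q2 * a (v.1, w.2)
      rw [ew, hwa, hva, hw2, zpow_add₀ h3, zpow_one, zpow_one]; ring

section Divisibility

variable [DecidableEq L]

theorem exists_blockFactor (hP : P.Admissible) (hc : IsStringConf σ pos)
    (hy : Separated P y) {p : MvPolynomial (Fin m × Fin N) ℂ}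
    (hw : ∀ x : Fin m → Fin N → ℂ, OnWheel P x → eval (fun v => x v.1 v.2) p = 0)
    (hlen : ∀ u v, σ v ∈ U → σ u ∉ U → stringLen σ (σ v) ≤ stringLen σ (σ u))
    (hmerge : ∀ k : Slot m N, σ k.1.1 ≠ σ k.1.2 → stringLen σ (σ k.1.1) ≤ stringLen σ (σ k.1.2) →
      (pos k.1.2 + k.sign) % m = (k.1.1.1 : ℕ) → ¬ k.Inner σ pos → ∀ z : L → ℂ,
      stringPoint P σ pos z k.1.1 = P.q3 ^ k.sign * stringPoint P σ pos z k.1.2 →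
      eval (stringPoint P σ pos z) p = 0) :
    ∃ r : MvPolynomial L ℂ, ∀ b : L → ℂ,
      eval (fun v => if σ v ∈ U then stringPoint P σ pos y v * b (σ v)
        else stringPoint P σ pos y v) p =
      (∏ k ∈ slots σ pos U, (stringPoint P σ pos y k.1.1 * b (σ k.1.1) -
        k.root P σ pos * stringPoint P σ pos y k.1.2)) * eval b r := by
  classical
  set x := stringPoint P σ pos y with hx
  have hx0 : ∀ v, x v ≠ 0 := stringPoint_ne_zero hP hy.ne_zero σ pos
  have hr0 : ∀ k : Slot m N, k.root P σ pos ≠ 0 := fun k => Slot.root_ne_zero hP k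
  set Bi := (slots σ pos U).filter fun k => k.Inner σ pos with hBi
  set Bo := (slots σ pos U).filter fun k => ¬ k.Inner σ pos with hBo
  set p1 : MvPolynomial (Fin m × Fin N) ℂ := aeval (fun v => if σ v ∈ U then X v else C (x v)) p
    with hp1
  have hp1e : ∀ a, eval a p1 = eval (fun v => if σ v ∈ U then a v else x v) p := by
    intro a; rw [hp1, eval_aeval]; congr 2; funext v
    split_ifs <;> simp
  obtain ⟨r1, hr1⟩ : ∏ k ∈ Bi, (X k.1.1 - C (k.root P σ pos * x k.1.2) :
      MvPolynomial (Fin m × Fin N) ℂ) ^ 1 ∣ p1 := by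
    refine prod_pow_dvd_of_prime _ _ 1 ?_ ?_ ?_
    · grind [X_sub_prime, aeval_update_C, X_ne_C]
    · intro k hk k' hk' hne; simp [hBi, mem_slots] at hk hk'
      refine ⟨fun w => if w = k.1.1 then k.root P σ pos * x k.1.2 else
        k'.root P σ pos * x k'.1.2 + 1, by simp, ?_⟩
      simp
      by_cases hv : k'.1.1 = k.1.1
      · rw [if_pos hv, Slot.root_inner hk.2, Slot.root_inner hk'.2]; intro h0
        obtain ⟨h1, h2, h3⟩ := hy.stringPoint_eq hP (sub_eq_zero.1 h0)
        refine hne (Slot.ext_sign hv.symm (hc.inj _ _ h1 ?_) h2); omega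
      grind
    · intro k hk; simp [hBi, mem_slots] at hk; rw [pow_one]
      refine X_sub_dvd_of_eval (aeval_update_C _ _) fun a ha => ?_
      rw [eval_C] at ha; rw [hp1e]
      refine eval_eq_zero_of_inner (y := y) hP hc hw hk.2 hk.1.2.2 (fun w hw => ?_) ?_
      · grind
      grind
  set φ : MvPolynomial (Fin m × Fin N) ℂ →ₐ[ℂ] MvPolynomial L ℂ :=
    aeval (fun v => C (x v) * X (σ v)) with hφ
  have hφe : ∀ (b : L → ℂ) q, eval b (φ q) = eval (fun v => x v * b (σ v)) q := by
    intro b q; rw [hφ, eval_aeval]; simp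
  have hout : ∏ k ∈ Bo, (X (σ k.1.1) - C (k.root P σ pos * x k.1.2 / x k.1.1) :
      MvPolynomial L ℂ) ^ 1 ∣ φ r1 := by
    refine prod_pow_dvd_of_prime _ _ 1 ?_ ?_ ?_
    · simp [X_sub_prime, X_ne_C]
    · intro k hk k' hk' hne; simp [hBo, mem_slots] at hk hk'
      refine ⟨fun w => if w = σ k.1.1 then k.root P σ pos * x k.1.2 / x k.1.1 else
        k'.root P σ pos * x k'.1.2 / x k'.1.1 + 1, by simp, ?_⟩
      simp
      by_cases hv : σ k'.1.1 = σ k.1.1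
      · rw [if_pos hv, Slot.root_outer hk.2, Slot.root_outer hk'.2]; intro h0
        have hq3 := hP.q3_ne
        have hs' : P.q3 ^ (pos k'.1.1 - pos k.1.1) * x k.1.1 = x k'.1.1 := by
          rw [hx]; simp [stringPoint]; rw [hv, ← mul_assoc, ← zpow_add₀ hq3]
          congr 2; omega
        have h4 : P.q2 ^ (0 : ℤ) * P.q3 ^ (k.sign + (pos k'.1.1 - pos k.1.1)) * x k.1.2 =
            P.q2 ^ (0 : ℤ) * P.q3 ^ k'.sign * x k'.1.2 := by
          grind [mul_right_cancel₀, zpow_add₀]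
        obtain ⟨h1, -, h3⟩ := hy.stringPoint_eq hP h4
        have hin : ¬ ∃ w, σ w = σ k.1.2 ∧ pos w = pos k.1.2 + k.sign := hk.2
        have hin' : ¬ ∃ w, σ w = σ k'.1.2 ∧ pos w = pos k'.1.2 + k'.sign := hk'.2
        have hl := hlen k.1.2 k.1.1 hk.1.1 hk.1.2.1
        have hd1 := hc.lt_stringLen hv; have hd2 := hc.lt_stringLen hv.symm
        rw [hv] at hd1
        rcases k.sign_eq with e | e <;> rcases k'.sign_eq with e' | e'
        · rw [e] at hin h3; rw [e'] at hin' h3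
          have hu := hc.first_unique 1 (Or.inl rfl) h1 hin hin'; rw [hu] at h3
          exact hne (Slot.ext_sign (hc.inj _ _ hv.symm (by omega)) hu (e.trans e'.symm))
        · rw [e] at hin h3; rw [e'] at hin' h3
          have := hc.stringLen_le (u := k'.1.2) (u' := k.1.2)
            (by simpa [sub_eq_add_neg] using hin') h1.symm hin
          rw [← h1] at this; omega
        · rw [e] at hin h3; rw [e'] at hin' h3
          have := hc.stringLen_le (u := k.1.2) (u' := k'.1.2)
            (by simpa [sub_eq_add_neg] using hin) h1 hin'
          omega
        · rw [e] at hin h3; rw [e'] at hin' h3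
          have hu := hc.first_unique (-1) (Or.inr rfl) h1 hin hin'
          rw [hu] at h3
          exact hne (Slot.ext_sign (hc.inj _ _ hv.symm (by omega)) hu (e.trans e'.symm))
      · rw [if_neg hv]; simp
    · intro k hk; simp [hBo, mem_slots] at hk; rw [pow_one]
      set c := k.root P σ pos * x k.1.2 / x k.1.1 with hcdef
      have hprime : Prime (X (σ k.1.1) - C c : MvPolynomial L ℂ) :=
        X_sub_prime (aeval_update_C _ _) (X_ne_C _ _)
      have hall : (X (σ k.1.1) - C c : MvPolynomial L ℂ) ∣ φ p1 := by
        refine X_sub_dvd_of_eval (aeval_update_C _ _) fun b hb => ?_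
        rw [eval_C] at hb; rw [hφe, hp1e]
        have e1 : (fun v => if σ v ∈ U then x v * b (σ v) else x v) =
            stringPoint P σ pos fun l => if l ∈ U then y l * b l else y l := by
          funext v; simp [hx, stringPoint]
          split_ifs <;> ring
        rw [e1]
        refine hmerge k (fun h => hk.1.2.1 (h ▸ hk.1.1)) (hlen _ _ hk.1.1 hk.1.2.1) hk.1.2.2 hk.2 _ ?_
        have e2 := congrFun e1 k.1.1; have e3 := congrFun e1 k.1.2
        rw [← e2, ← e3, if_pos hk.1.1, if_neg hk.1.2.1, hb, hcdef, Slot.root_outer hk.2]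
        field_simp [hx0 k.1.1]
      rw [hr1, map_mul, map_prod] at hall
      refine (hprime.dvd_or_dvd hall).resolve_left fun h => ?_
      obtain ⟨k', hk', q, hq⟩ := (hprime.dvd_finsetProd_iff _).1 h
      simp [hBi, mem_slots] at hk'
      have h5 := congrArg (eval fun l => if l = σ k.1.1 then c else 0) hq
      rw [hφe] at h5
      simp only [map_mul, map_sub, eval_X, eval_C, if_true, sub_self, zero_mul, pow_one] at h5
      by_cases hv : σ k'.1.1 = σ k.1.1
      · rw [if_pos hv, hcdef, Slot.root_inner hk'.2, Slot.root_outer hk.2] at h5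
        have hq3 := hP.q3_ne
        have hs' : P.q3 ^ (pos k'.1.1 - pos k.1.1) * x k.1.1 = x k'.1.1 := by
          rw [hx]; simp [stringPoint]; rw [hv, ← mul_assoc, ← zpow_add₀ hq3]
          congr 2; omega
        have h4 : P.q2 ^ (0 : ℤ) * P.q3 ^ (k.sign + (pos k'.1.1 - pos k.1.1)) * x k.1.2 =
            P.q2 ^ k'.sign * P.q3 ^ k'.sign * x k'.1.2 := by
          rw [← hs'] at h5; rw [zpow_add₀ hq3]; have := hx0 k.1.1
          field_simp at h5; rw [zpow_zero]; linear_combination h5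
        obtain ⟨-, h6, -⟩ := hy.stringPoint_eq hP h4
        rcases k'.sign_eq with e | e <;> omega
      · rw [if_neg hv, mul_zero, zero_sub, neg_eq_zero] at h5
        exact mul_ne_zero (hr0 _) (hx0 _) h5
  obtain ⟨r2, hr2⟩ := hout
  have hX : ∏ k ∈ Bo, x k.1.1 ≠ 0 := prod_ne_zero_iff.2 fun k _ => hx0 _
  refine ⟨C (∏ k ∈ Bo, x k.1.1)⁻¹ * r2, fun b => ?_⟩
  have e1 : eval (fun v => if σ v ∈ U then x v * b (σ v) else x v) p = eval b (φ p1) := by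
    rw [hφe, hp1e]
  rw [e1, hr1, map_mul, hr2, map_mul, map_mul, map_mul, hφe,
    ← prod_filter_mul_prod_filter_not (slots σ pos U) fun k => k.Inner σ pos]
  have e2 : ∏ k ∈ Bo, (x k.1.1 * b (σ k.1.1) - k.root P σ pos * x k.1.2) =
      (∏ k ∈ Bo, eval b ((X (σ k.1.1) - C (k.root P σ pos * x k.1.2 / x k.1.1) :
      MvPolynomial L ℂ) ^ 1)) * ∏ k ∈ Bo, eval b (C (x k.1.1) : MvPolynomial L ℂ) := by
    rw [← prod_mul_distrib]; refine prod_congr rfl fun k _ => ?_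
    have := hx0 k.1.1; simp; field_simp
  rw [e2, ← hBi]; simp; field_simp

end Divisibility

end Block

section BlockLimits

open MvPolynomial

variable {P : QParam} {m N : ℕ} {L : Type}

/-- `p` is a numerator of the shuffle element `F`, vanishing on all wheels. -/
structure IsNumerator (F : ShuffleAmbient P m) (p : MvPolynomial (Fin m × Fin N) ℂ) (e : ℕ) :
    Prop where
  val : ∀ x : Fin m → Fin N → ℂ, GenericTuple x →
    eval x F * (∏ v : Fin m × Fin N, x v.1 v.2) ^ e * poleProd (tupleSet x) =
      eval (fun v => x v.1 v.2) p
  wheel : ∀ x : Fin m → Fin N → ℂ, OnWheel P x → eval (fun v => x v.1 v.2) p = 0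

theorem exists_isNumerator {F : ShuffleAmbient P m} (hF : F ∈ shuffleComponent P m N) :
    ∃ (p : MvPolynomial (Fin m × Fin N) ℂ) (e : ℕ), IsNumerator F p e := by
  obtain ⟨-, p, e, h1, h2⟩ := mem_shuffleComponent_iff.1 hF
  refine ⟨p * ∏ v, X v, e + 1, fun x hx => ?_, fun x hx => ?_⟩
  · grind [map_prod, eval_X]
  · rw [map_mul, map_prod]
    by_cases h0 : ∀ i a, x i a ≠ 0
    · grind
    · push Not at h0; obtain ⟨i, a, h0⟩ := h0
      rw [prod_eq_zero (mem_univ (i, a)) (by simpa using h0), mul_zero]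

variable [DecidableEq L]

/-- The parameters in `U` multiplied by `t`. -/
def scaleLabels (U : Finset L) (t : ℂ) (y : L → ℂ) : L → ℂ :=
  fun l => if l ∈ U then t * y l else y l

variable {σ : Fin m × Fin N → L} {pos : Fin m × Fin N → ℤ} {y : L → ℂ} {U : Finset L}

theorem prod_slots (hc : IsStringConf σ pos) (f : (Fin m × Fin N) → (Fin m × Fin N) → ℂ) :
    (∏ v ∈ univ.filter (fun v => σ v ∈ U), ∏ u ∈ (univ.filter fun v => σ v ∈ U)ᶜ,
      ((if u.1 = nextColor v.1 then f v u else 1) * (if v.1 = nextColor u.1 then -f v u else 1))) =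
      ∏ k ∈ slots σ pos U, (-(k.sign : ℂ)) * f k.1.1 k.1.2 := by
  classical
  have h : slots σ pos U = (((univ.filter fun v => σ v ∈ U) ×ˢ
      (univ.filter fun v => σ v ∈ U)ᶜ) ×ˢ univ).filter
      fun k : Slot m N => (pos k.1.2 + k.sign) % m = (k.1.1.1 : ℕ) := by
    ext k; simp [mem_slots]
    tauto
  generalize (univ.filter fun v => σ v ∈ U) = M at h ⊢
  rw [h, prod_filter, prod_product, prod_product]
  refine prod_congr rfl fun v _ => prod_congr rfl fun u _ => ?_
  rw [Fintype.prod_bool, mul_comm]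
  congr 1
  · refine if_congr ((nextColor_eq_iff_emod (hc.color u)).trans (by rfl)) ?_ rfl
    simp [Slot.sign]
  · refine if_congr ((eq_nextColor_iff_emod (hc.color u)).trans ?_) ?_ rfl
    · rfl
    · simp [Slot.sign]

theorem stringPoint_scaleLabels (t : ℂ) (v : Fin m × Fin N) :
    stringPoint P σ pos (scaleLabels U t y) v =
      if σ v ∈ U then t * stringPoint P σ pos y v else stringPoint P σ pos y v := by
  grind [stringPoint, scaleLabels]

theorem pairProd_ite_const {β : Type} (S : Finset β) (c : β → β → Prop)
    [∀ u v, Decidable (c u v)] : ∃ K : ℕ, ∀ t : ℂ,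
    pairProd (fun u v => if c u v then t else 1) S = t ^ K := by
  classical
  refine ⟨(S.offDiag.filter fun p => c p.1 p.2).card, fun t => ?_⟩
  rw [pairProd_def, ← prod_filter, prod_const]

theorem exists_poleProd_scale (hP : P.Admissible) (hc : IsStringConf σ pos) (hy : Separated P y) :
    ∃ (C : ℂ) (K : ℕ), C ≠ 0 ∧ ∀ t : ℂ,
      GenericTuple (fun i a => stringPoint P σ pos (scaleLabels U t y) (i, a)) →
      poleProd (tupleSet fun i a => stringPoint P σ pos (scaleLabels U t y) (i, a)) =
        C * t ^ K * ∏ k ∈ slots σ pos U,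
          (t * stringPoint P σ pos y k.1.1 - stringPoint P σ pos y k.1.2) := by
  classical
  set x : Fin m → Fin N → ℂ := fun i a => stringPoint P σ pos y (i, a) with hx
  have hxg : GenericTuple x := hy.genericTuple hP hc
  set M : Finset (Fin m × Fin N) := univ.filter fun v => σ v ∈ U with hM
  obtain ⟨K, hK⟩ := pairProd_ite_const M (fun u v : Fin m × Fin N => v.1 = nextColor u.1)
  have hne : ∀ S, pairProd (fun u v => poleFactor (pt x u) (pt x v)) S ≠ 0 := by
    intro S; rw [← pairProd_img hxg.pt_injective]
    exact poleProd_ne_zero (hxg.genericSet_img S)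
  refine ⟨pairProd (fun u v => poleFactor (pt x u) (pt x v)) M *
    pairProd (fun u v => poleFactor (pt x u) (pt x v)) Mᶜ *
    ∏ k ∈ slots σ pos U, (-(k.sign : ℂ)), K, ?_, fun t ht => ?_⟩
  · refine mul_ne_zero (mul_ne_zero (hne _) (hne _)) (prod_ne_zero_iff.2 fun k _ => ?_)
    rcases k.sign_eq with e | e <;> simp [e]
  set z : Fin m → Fin N → ℂ := fun i a => stringPoint P σ pos (scaleLabels U t y) (i, a) with hz
  have hzM : ∀ v ∈ M, pt z v = (v.1, t * x v.1 v.2) := by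
    intro v hv; have hv' : σ v ∈ U := by simpa [hM] using hv
    simp [pt, hz, stringPoint_scaleLabels, if_pos hv', hx]
  have hzM' : ∀ v ∈ Mᶜ, pt z v = pt x v := by
    intro v hv; have hv' : σ v ∉ U := by simpa [hM] using hv
    simp [pt, hz, stringPoint_scaleLabels, if_neg hv', hx]
  have hun : (univ : Finset (Fin m × Fin N)) = M ∪ Mᶜ := by simp
  rw [tupleSet_eq_img, poleProd, pairProd_img ht.pt_injective, hun,
    pairProd_union _ disjoint_compl_right]
  have e1 : pairProd (fun u v => poleFactor (pt z u) (pt z v)) M =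
      pairProd (fun u v => poleFactor (pt x u) (pt x v)) M * t ^ K := by
    rw [← hK, ← pairProd_mul]; grind [pairProd_congr, poleFactor_pt, poleFactor]
  have e2 : pairProd (fun u v => poleFactor (pt z u) (pt z v)) Mᶜ =
      pairProd (fun u v => poleFactor (pt x u) (pt x v)) Mᶜ := by
    grind [pairProd_congr]
  have e3 : ∏ u ∈ M, ∏ v ∈ Mᶜ, (poleFactor (pt z u) (pt z v) * poleFactor (pt z v) (pt z u)) =
      (∏ k ∈ slots σ pos U, (-(k.sign : ℂ))) * ∏ k ∈ slots σ pos U,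
          (t * stringPoint P σ pos y k.1.1 - stringPoint P σ pos y k.1.2) := by
    rw [← prod_mul_distrib, ← prod_slots hc (fun v u =>
      t * stringPoint P σ pos y v - stringPoint P σ pos y u)]
    refine prod_congr rfl fun v hv => prod_congr rfl fun u hu => ?_
    grind [poleFactor, pt, Prod.mk.eta, neg_sub]
  rw [e1, e2, e3]; ring

theorem block_eval (hP : P.Admissible) (hc : IsStringConf σ pos) (hy : Separated P y)
    {p : MvPolynomial (Fin m × Fin N) ℂ} {e : ℕ} {F : ShuffleAmbient P m} {s : Fin m → ℂ}
    (hF : IsNumerator F p e) (hlim : HasBetheLimits s N F)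
    (hlen : ∀ u v, σ v ∈ U → σ u ∉ U → stringLen σ (σ v) ≤ stringLen σ (σ u))
    (hmerge : ∀ k : Slot m N, σ k.1.1 ≠ σ k.1.2 → stringLen σ (σ k.1.1) ≤ stringLen σ (σ k.1.2) →
      (pos k.1.2 + k.sign) % m = (k.1.1.1 : ℕ) → ¬ k.Inner σ pos → ∀ z : L → ℂ,
      stringPoint P σ pos z k.1.1 = P.q3 ^ k.sign * stringPoint P σ pos z k.1.2 →
      eval (stringPoint P σ pos z) p = 0) :
    ∃ (a : ℂ) (K : ℕ), (∀ t, eval (stringPoint P σ pos (scaleLabels U t y)) p = a * t ^ K *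
        ∏ k ∈ slots σ pos U, (t * stringPoint P σ pos y k.1.1 -
          k.root P σ pos * stringPoint P σ pos y k.1.2)) ∧
      (a = 0 ∨ (∏ k ∈ slots σ pos U, k.root P σ pos) *
        ∏ i, s i ^ (univ.filter fun v => σ v ∈ U ∧ v.1 = i).card = 1) := by
  classical
  obtain ⟨r, hr⟩ := exists_blockFactor hP hc hy hF.wheel hlen hmerge
  obtain ⟨C, K, hC, hpole⟩ := exists_poleProd_scale (U := U) hP hc hy
  set x := stringPoint P σ pos y with hx
  have hx0 : ∀ v, x v ≠ 0 := stringPoint_ne_zero hP hy.ne_zero σ pos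
  have hxg : GenericTuple fun i a => x (i, a) := hy.genericTuple hP hc
  set M : Finset (Fin m × Fin N) := univ.filter fun v => σ v ∈ U with hM
  set r' : Polynomial ℂ := aeval (fun _ => Polynomial.X) r with hr'
  have hre : ∀ t, eval (fun _ => t) r = r'.eval t := by
    intro t; rw [hr']
    clear hr hr'
    induction r using MvPolynomial.induction_on with
    | C c => simp
    | add q q' hq hq' => rw [map_add, map_add, Polynomial.eval_add, hq, hq']
    | mul_X q v hq => grind [Polynomial.eval_mul, aeval_X, eval_X, Polynomial.eval_X]
  have hform : ∀ t, eval (stringPoint P σ pos (scaleLabels U t y)) p =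
      (∏ k ∈ slots σ pos U, (t * x k.1.1 - k.root P σ pos * x k.1.2)) * r'.eval t := by
    intro t
    have e1 : stringPoint P σ pos (scaleLabels U t y) =
        fun v => if σ v ∈ U then x v * t else x v := by
      grind [stringPoint_scaleLabels, mul_comm]
    grind
  have hroot : ∀ k ∈ slots σ pos U, x k.1.1 ≠ k.root P σ pos * x k.1.2 := by
    intro k hk h; have hk' := mem_slots.1 hk
    have h2 := (hy.stringPoint_eq hP (σ := σ) (pos := pos) (u := k.1.1) (v := k.1.2) (a := 0)
      (b := 0) (a' := if k.Inner σ pos then k.sign else 0) (b' := k.sign)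
      (by rw [zpow_zero, zpow_zero, one_mul, one_mul]; exact h)).1
    grind
  have hlimF := (hasBetheLimits_iff.1 hlim) M _ hxg
  have hprod : LimRatio (fun t => ∏ k ∈ slots σ pos U,
      ((t * x k.1.1 - x k.1.2) / (t * x k.1.1 - k.root P σ pos * x k.1.2)))
      (∏ k ∈ slots σ pos U, k.root P σ pos) := by
    refine LimRatio.prod fun k hk => ?_
    have hr0 : k.root P σ pos ≠ 0 := Slot.root_ne_zero hP k
    have := limRatio_linear (hx0 k.1.1) (mul_ne_zero hr0 (hx0 k.1.2)) (hroot k hk)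
      (inv_ne_zero hr0) True False
    simpa [scaleIf, indic, hr0] using this
  have hmain := (hlimF.mul hprod).mul (LimRatio.const ((∏ v, x v) ^ e * C))
  have hcong := hmain.congr (S := {ξ | ¬ GenericTuple (scaleOn M ξ fun i a => x (i, a))} ∪
      ({0} ∪ ⋃ k : Slot m N, {k.root P σ pos * x k.1.2 / x k.1.1})) (g := fun t =>
      r'.eval t / t ^ (M.card * e + K)) ?_ ?_
  rotate_left
  · exact (scaleOn_generic_finite hxg M).union ((Set.finite_singleton _).union
      (Set.finite_iUnion fun _ => Set.finite_singleton _))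
  · intro t ht
    simp only [Set.mem_union, Set.mem_ofPred_eq, not_or, not_not, Set.mem_iUnion,
      Set.mem_singleton_iff, not_exists] at ht
    obtain ⟨ht1, ht3, ht2⟩ := ht
    have esc : (scaleOn M t fun i a => x (i, a)) =
        fun i a => stringPoint P σ pos (scaleLabels U t y) (i, a) := by
      grind [stringPoint_scaleLabels, scaleOn]
    rw [esc] at ht1; have h1 := hF.val _ ht1
    have hprodx : ∏ v, stringPoint P σ pos (scaleLabels U t y) v = t ^ M.card * ∏ v, x v := by
      simp [stringPoint_scaleLabels]
      rw [← prod_const, hM, prod_filter, ← prod_mul_distrib]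
      refine prod_congr rfl fun v _ => ?_
      split_ifs <;> simp [hx]
    have hden : ∏ k ∈ slots σ pos U, (t * x k.1.1 - k.root P σ pos * x k.1.2) ≠ 0 := by
      grind [prod_ne_zero_iff, eq_div_iff, sub_eq_zero]
    rw [prod_div_distrib, esc]
    grind [pow_ne_zero, eq_div_iff, pow_add, pow_mul, mul_pow]
  rw [mul_one] at hcong; obtain ⟨a, ha, ha'⟩ := eval_eq_of_limRatio hcong
  refine ⟨a, M.card * e + K, fun t => ?_, ?_⟩
  · grind
  · refine ha'.imp_right fun h => ?_; rw [mul_comm, ← h]; congr 1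
    refine prod_congr rfl fun i _ => ?_; rw [hM, filter_filter]

end BlockLimits

/-! ### Vanishing of Bethe elements on configurations of geometric progressions -/

section Vanishing

open MvPolynomial

variable {P : QParam} {m N : ℕ} {L : Type}

theorem IsGeneric.exponent_eq (hP : P.Admissible) {s : Fin m → ℂ} (hs : IsGeneric P s) {A B : ℤ}
    {k : Fin m → ℕ} (h : P.q2 ^ A * P.q3 ^ B * ∏ i, s i ^ k i = 1) (i j : Fin m) : k i = k j := by
  have hm := i.pos
  let l : Fin m := ⟨m - 1, by omega⟩
  have h2 := hP.q2_ne
  have h3 : P.q3 = P.q1 ^ (-1 : ℤ) * P.q2 ^ (-1 : ℤ) := by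
    rw [zpow_neg_one, zpow_neg_one, ← mul_inv]
    exact eq_inv_of_mul_eq_one_right hP.prod_eq_one
  have h4 : ∏ i, s i ^ ((k i : ℤ) - k l) = ∏ i, s i ^ k i := by
    have e : ∀ i, s i ^ ((k i : ℤ) - k l) = s i ^ k i / s i ^ k l := fun i => by
      rw [zpow_sub₀ (hs.ne_zero i), zpow_natCast, zpow_natCast]
    simp only [e]
    rw [prod_div_distrib, prod_pow, hs.prod_eq_one, one_pow, div_one]
  have h5 := (hs.indep (-B) (A - B) (fun i => (k i : ℤ) - k l) (fun i hi => by
    grind) (by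
    grind [mul_zpow, zpow_mul, sub_eq_add_neg, zpow_add₀])).2.2
  grind

theorem exists_separated [Finite L] (P : QParam) : ∃ y : L → ℂ, Separated P y := by
  classical
  obtain ⟨a, ha⟩ := exists_eval_ne_zero (σ := L) (ι := L ⊕ (L × L × ℤ × ℤ))
    (Sum.elim (fun l => X l) fun q => if q.1 = q.2.1 then 1 else
      X q.2.1 - C (P.q2 ^ q.2.2.1 * P.q3 ^ q.2.2.2) * X q.1) (by
    grind [X_ne_zero, one_ne_zero, sub_ne_zero, X_ne_C_mul_X])
  refine ⟨a, fun l => by simpa using ha (Sum.inl l), fun l l' i j h => ?_⟩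
  have := ha (Sum.inr (l, l', i, j)); simp [if_neg h] at this; grind

variable [DecidableEq L] {σ : Fin m × Fin N → L} {pos : Fin m × Fin N → ℤ}

theorem exists_merge (hP : P.Admissible) [Fintype L] (hc : IsStringConf σ pos) (k : Slot m N)
    (hne : σ k.1.1 ≠ σ k.1.2) (hlen : stringLen σ (σ k.1.1) ≤ stringLen σ (σ k.1.2))
    (hcol : (pos k.1.2 + k.sign) % m = (k.1.1.1 : ℕ)) (hout : ¬ k.Inner σ pos) :
    ∃ σ' pos', IsStringConf σ' pos' ∧ (∑ l : L, stringLen σ l ^ 2 < ∑ l : L, stringLen σ' l ^ 2) ∧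
      ∀ z : L → ℂ, stringPoint P σ pos z k.1.1 = P.q3 ^ k.sign * stringPoint P σ pos z k.1.2 →
        ∃ z', stringPoint P σ pos z = stringPoint P σ' pos' z' := by
  classical
  obtain ⟨⟨v, u⟩, b⟩ := k; set ε := Slot.sign (((v, u), b) : Slot m N) with hε
  have hε1 : ε = 1 ∨ ε = -1 := Slot.sign_eq _
  have hout' : ¬ ∃ w, σ w = σ u ∧ pos w = pos u + ε := hout
  clear_value ε
  set T := σ v with hT
  set S := σ u with hS
  set d := pos u + ε - pos v with hd
  obtain ⟨pos', hpos'⟩ : ∃ pos' : Fin m × Fin N → ℤ, ∀ w,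
      pos' w = if σ w = T then pos w + d else pos w := ⟨_, fun _ => rfl⟩
  obtain ⟨σ', hσ'⟩ : ∃ σ' : Fin m × Fin N → L, ∀ w,
      σ' w = if σ w = T ∧ ¬ ∃ w', σ w' = S ∧ pos w' = pos' w then S else σ w := ⟨_, fun _ => rfl⟩
  have pT : ∀ w, σ w = T → pos' w = pos w + d := fun w h => by rw [hpos', if_pos h]
  have pN : ∀ w, σ w ≠ T → pos' w = pos w := fun w h => by rw [hpos', if_neg h]
  have sR : ∀ w, σ w = T → (¬ ∃ w', σ w' = S ∧ pos w' = pos' w) → σ' w = S := fun w h h' => by grind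
  have sK : ∀ w, σ w = T → (∃ w', σ w' = S ∧ pos w' = pos' w) → σ' w = T := fun w h h' => by grind
  have sS : ∀ w, σ' w = S → σ w = S ∨ (σ w = T ∧ ¬ ∃ w', σ w' = S ∧ pos w' = pos' w) := by grind
  have sT : ∀ w, σ' w = T → σ w = T ∧ ∃ w', σ w' = S ∧ pos w' = pos' w := by grind
  have sO : ∀ w l, l ≠ S → l ≠ T → σ' w = l → σ w = l := by grind
  have hST : S ≠ T := Ne.symm hne
  have pS : ∀ w, σ w = S → pos' w = pos w := fun w h => pN w (by rw [h]; exact hST)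
  have hp'v : pos' v = pos u + ε := by rw [pT v rfl, hd]; ring
  -- positions of the two strings
  have hTint : ∀ w w' j, σ w = T → σ w' = T → pos' w ≤ j → j ≤ pos' w' →
      ∃ z, σ z = T ∧ pos' z = j := by
    intro w w' j h h' h1 h2; rw [pT w h] at h1; rw [pT w' h'] at h2
    obtain ⟨z, hz1, hz2⟩ := hc.interval w w' (j - d) (h.trans h'.symm) (by omega) (by omega)
    grind
  have hSint : ∀ w w' j, σ w = S → σ w' = S → pos w ≤ j → j ≤ pos w' →
      ∃ z, σ z = S ∧ pos z = j := by
    intro w w' j h h' h1 h2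
    obtain ⟨z, hz1, hz2⟩ := hc.interval w w' j (h.trans h'.symm) h1 h2; grind
  have hfill : ∀ j, (∃ z, σ z = S ∧ pos z = j) ∨ (∃ z, σ z = T ∧ pos' z = j) →
      ∃ z, σ' z = S ∧ pos' z = j := by
    grind
  have hmix : ∀ w w' j, σ w = S → σ w' = T →
      (pos w ≤ j ∧ j ≤ pos' w' ∨ pos' w' ≤ j ∧ j ≤ pos w) → ∃ z, σ' z = S ∧ pos' z = j := by
    intro w w' j h h' hj; refine hfill j ?_
    rcases hj with ⟨h1, h2⟩ | ⟨h1, h2⟩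
    · by_cases h3 : j ≤ pos u
      · exact Or.inl (hSint w u j h rfl h1 h3)
      · exact Or.inr (hTint v w' j rfl h' (by omega) h2)
    · by_cases h3 : pos u ≤ j
      · exact Or.inl (hSint u w j rfl h h3 h2)
      · exact Or.inr (hTint w' v j h' rfl h1 (by omega))
  refine ⟨σ', pos', ⟨fun w => ?_, fun a b hab hpab => ?_, fun a b j hab h1 h2 => ?_⟩, ?_, fun z hz => ?_⟩
  · by_cases h : σ w = T
    · rw [pT w h, ← hc.color w]
      have hd0 : d % m = 0 := by
        have e : (pos u + ε) % m = pos v % m := by rw [hcol, hc.color v]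
        exact Int.emod_eq_zero_of_dvd (Int.ModEq.dvd (Int.ModEq.symm e))
      rw [Int.add_emod, hd0, add_zero, Int.emod_emod]
    · rw [pN w h, hc.color w]
  · by_cases hS' : σ' a = S
    · rcases sS a hS' with ha | ⟨ha, ha'⟩ <;> rcases sS b (hab ▸ hS') with hb | ⟨hb, hb'⟩
      · rw [pS a ha, pS b hb] at hpab; exact hc.inj _ _ (ha.trans hb.symm) hpab
      · grind [absurd]
      · grind [absurd]
      · rw [pT a ha, pT b hb] at hpab
        exact hc.inj _ _ (ha.trans hb.symm) (by omega)
    · by_cases hT' : σ' a = T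
      · obtain ⟨ha, -⟩ := sT a hT'; obtain ⟨hb, -⟩ := sT b (hab ▸ hT')
        rw [pT a ha, pT b hb] at hpab
        exact hc.inj _ _ (ha.trans hb.symm) (by omega)
      · have ha := sO a _ hS' hT' rfl; have hb := sO b _ hS' hT' hab.symm
        rw [pN a (by rw [ha]; exact hT'), pN b (by rw [hb]; exact hT')] at hpab
        exact hc.inj _ _ (ha.trans hb.symm) hpab
  · by_cases hS' : σ' a = S
    · rw [hS']
      rcases sS a hS' with ha | ⟨ha, ha'⟩ <;> rcases sS b (hab ▸ hS') with hb | ⟨hb, hb'⟩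
      · rw [pS a ha] at h1; rw [pS b hb] at h2
        exact hfill j (Or.inl (hSint a b j ha hb h1 h2))
      · rw [pS a ha] at h1; exact hmix a b j ha hb (Or.inl ⟨h1, h2⟩)
      · rw [pS b hb] at h2; exact hmix b a j hb ha (Or.inr ⟨h1, h2⟩)
      · exact hfill j (Or.inr (hTint a b j ha hb h1 h2))
    · by_cases hT' : σ' a = T
      · rw [hT']; obtain ⟨ha, a', ha1, ha2⟩ := sT a hT'
        obtain ⟨hb, b', hb1, hb2⟩ := sT b (hab ▸ hT')
        obtain ⟨z, hz1, hz2⟩ := hTint a b j ha hb h1 h2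
        exact ⟨z, sK z hz1 (by rw [hz2]; exact hSint a' b' j ha1 hb1 (by omega) (by omega)), hz2⟩
      · have ha := sO a _ hS' hT' rfl; have hb := sO b _ hS' hT' hab.symm
        rw [pN a (by rw [ha]; exact hT')] at h1
        rw [pN b (by rw [hb]; exact hT')] at h2
        obtain ⟨z, hz1, hz2⟩ := hc.interval a b j (ha.trans hb.symm) h1 h2
        grind
  · set R := univ.filter fun w => σ w = T ∧ ¬ ∃ w', σ w' = S ∧ pos w' = pos' w with hR
    have hRv : 0 < R.card := card_pos.2 ⟨v, by grind⟩
    have c1 : stringLen σ' S = stringLen σ S + R.card := by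
      rw [stringLen, stringLen, ← card_union_of_disjoint]
      · congr 1; grind
      · intro w h1 h2; grind
    have c2 : stringLen σ T = stringLen σ' T + R.card := by
      rw [stringLen, stringLen, ← card_union_of_disjoint]
      · congr 1; grind
      · rw [disjoint_left]; grind
    have c3 : ∀ l, l ≠ S → l ≠ T → stringLen σ' l = stringLen σ l := by
      intro l h1 h2; rw [stringLen, stringLen]; congr 1; grind
    have hTm : T ∈ univ.erase S := mem_erase.2 ⟨hne, mem_univ _⟩
    rw [← add_sum_erase _ _ (mem_univ S), ← add_sum_erase _ _ hTm,
      ← add_sum_erase _ (fun l => stringLen σ' l ^ 2) (mem_univ S),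
      ← add_sum_erase _ (fun l => stringLen σ' l ^ 2) hTm]
    have c4 : ∑ l ∈ (univ.erase S).erase T, stringLen σ' l ^ 2 =
        ∑ l ∈ (univ.erase S).erase T, stringLen σ l ^ 2 := by
      refine sum_congr rfl fun l hl => ?_; simp at hl; rw [c3 l hl.2 hl.1]
    nlinarith
  · refine ⟨Function.update z T (z S), ?_⟩; have h3 := hP.q3_ne
    have hz' : z T = P.q3 ^ d * z S := by grind [stringPoint, zpow_sub₀, zpow_add₀, zpow_ne_zero]
    grind [stringPoint, Function.update, Function.update_self, Function.update_of_ne, zpow_add₀]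

variable [Fintype L] {s : Fin m → ℂ} {F : ShuffleAmbient P m}
  {p : MvPolynomial (Fin m × Fin N) ℂ} {e : ℕ}

theorem sum_stringLen_sq_le (σ : Fin m × Fin N → L) :
    ∑ l, stringLen σ l ^ 2 ≤ Fintype.card (Fin m × Fin N) ^ 2 := by
  have h : ∀ l, stringLen σ l ≤ Fintype.card (Fin m × Fin N) := fun l => card_le_univ _
  have h2 : ∑ l, stringLen σ l = Fintype.card (Fin m × Fin N) :=
    (card_eq_sum_card_fiberwise (f := σ) (t := univ) (s := univ) (by simp)).symm
  calc ∑ l, stringLen σ l ^ 2 ≤ ∑ l, stringLen σ l * Fintype.card (Fin m × Fin N) :=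
        sum_le_sum fun l _ => by rw [sq]; exact Nat.mul_le_mul_left _ (h l)
    _ = _ := by rw [← sum_mul, h2, sq]

/-- The label `l` carries equally many variables of each color. -/
def LabelBalanced (σ : Fin m × Fin N → L) (l : L) : Prop :=
  ∀ i j, (univ.filter fun v => σ v = l ∧ v.1 = i).card =
    (univ.filter fun v => σ v = l ∧ v.1 = j).card

/-- The labels with strings not longer than that of `l`. -/
def shorterLabels (σ : Fin m × Fin N → L) (l : L) : Finset L :=
  univ.filter fun l' => stringLen σ l' ≤ stringLen σ l

theorem shorterLabels_le {l : L} {u v : Fin m × Fin N} (hv : σ v ∈ shorterLabels σ l)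
    (hu : σ u ∉ shorterLabels σ l) : stringLen σ (σ v) ≤ stringLen σ (σ u) := by
  simp [shorterLabels] at hv hu; omega

theorem shorterLabels_erase_le {l : L} {u v : Fin m × Fin N}
    (hv : σ v ∈ (shorterLabels σ l).erase l) (hu : σ u ∉ (shorterLabels σ l).erase l) :
    stringLen σ (σ v) ≤ stringLen σ (σ u) := by
  simp [shorterLabels] at hv hu; grind

theorem stringPoint_slot_ne (hP : P.Admissible) {y : L → ℂ} (hy : Separated P y) {U : Finset L}
    {k : Slot m N} (hk : k ∈ slots σ pos U) :
    stringPoint P σ pos y k.1.1 - k.root P σ pos * stringPoint P σ pos y k.1.2 ≠ 0 := by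
  classical
  intro h
  have hk' := mem_slots.1 hk
  have h2 := (hy.stringPoint_eq hP (σ := σ) (pos := pos) (u := k.1.1) (v := k.1.2) (a := 0)
    (b := 0) (a' := if k.Inner σ pos then k.sign else 0) (b' := k.sign)
    (by rw [zpow_zero, zpow_zero, one_mul, one_mul]; exact sub_eq_zero.1 h)).1
  grind

theorem scaleLabels_one (U : Finset L) (y : L → ℂ) : scaleLabels U 1 y = y := by
  funext l; simp [scaleLabels]

/-- `p` vanishes on all configurations with a larger sum of squares of lengths. -/
def VanishesAbove (P : QParam) (p : MvPolynomial (Fin m × Fin N) ℂ) (σ : Fin m × Fin N → L) :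
    Prop :=
  ∀ σ' pos', IsStringConf σ' pos' →
    (∑ l : L, stringLen σ l ^ 2 < ∑ l : L, stringLen σ' l ^ 2) → ∀ y : L → ℂ,
    eval (stringPoint P σ' pos' y) p = 0

theorem block_eval_of_vanishesAbove (hP : P.Admissible) (hF : IsNumerator F p e)
    (hlim : HasBetheLimits s N F) (hc : IsStringConf σ pos) (ih : VanishesAbove P p σ)
    {y : L → ℂ} (hy : Separated P y) {U : Finset L}
    (hlen : ∀ u v, σ v ∈ U → σ u ∉ U → stringLen σ (σ v) ≤ stringLen σ (σ u)) :
    ∃ (a : ℂ) (K : ℕ), (∀ t, eval (stringPoint P σ pos (scaleLabels U t y)) p = a * t ^ K *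
        ∏ k ∈ slots σ pos U, (t * stringPoint P σ pos y k.1.1 -
          k.root P σ pos * stringPoint P σ pos y k.1.2)) ∧
      (a = 0 ∨ (∏ k ∈ slots σ pos U, k.root P σ pos) *
        ∏ i, s i ^ (univ.filter fun v => σ v ∈ U ∧ v.1 = i).card = 1) := by
  refine block_eval hP hc hy hF hlim hlen fun k h1 h2 h3 h4 z hz => ?_
  obtain ⟨σ', pos', h5, h6, h7⟩ := exists_merge hP hc k h1 h2 h3 h4
  obtain ⟨z', hz'⟩ := h7 z hz; rw [hz']; exact ih σ' pos' h5 h6 z'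

theorem eval_scaleLabels_eq_zero (hP : P.Admissible) (hF : IsNumerator F p e)
    (hlim : HasBetheLimits s N F) (hc : IsStringConf σ pos) (ih : VanishesAbove P p σ)
    {y : L → ℂ} (hy : Separated P y) {U : Finset L}
    (hlen : ∀ u v, σ v ∈ U → σ u ∉ U → stringLen σ (σ v) ≤ stringLen σ (σ u))
    (h0 : eval (stringPoint P σ pos y) p = 0) (t : ℂ) :
    eval (stringPoint P σ pos (scaleLabels U t y)) p = 0 := by
  obtain ⟨a, K, h1, -⟩ := block_eval_of_vanishesAbove hP hF hlim hc ih hy hlen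
  have h2 := h1 1; rw [scaleLabels_one, h0, one_pow, mul_one] at h2
  have h3 := (mul_eq_zero.1 h2.symm).resolve_right (prod_ne_zero_iff.2 fun k hk => by
    grind [one_mul, stringPoint_slot_ne])
  rw [h1, h3]; ring

theorem block_balanced (hP : P.Admissible) (hs : IsGeneric P s) (hF : IsNumerator F p e)
    (hlim : HasBetheLimits s N F) (hc : IsStringConf σ pos) (ih : VanishesAbove P p σ)
    {y : L → ℂ} (hy : Separated P y) {U : Finset L}
    (hlen : ∀ u v, σ v ∈ U → σ u ∉ U → stringLen σ (σ v) ≤ stringLen σ (σ u))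
    (h0 : eval (stringPoint P σ pos y) p ≠ 0) (i j : Fin m) :
    (univ.filter fun v => σ v ∈ U ∧ v.1 = i).card =
      (univ.filter fun v => σ v ∈ U ∧ v.1 = j).card := by
  classical
  obtain ⟨a, K, h1, h2⟩ := block_eval_of_vanishesAbove hP hF hlim hc ih hy hlen
  have ha : a ≠ 0 := by have := h1 1; grind [scaleLabels_one]
  refine hs.exponent_eq hP (A := ∑ k ∈ slots σ pos U, if k.Inner σ pos then k.sign else 0)
    (B := ∑ k ∈ slots σ pos U, k.sign) (k := fun i =>
      (univ.filter fun v => σ v ∈ U ∧ v.1 = i).card) ?_ i j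
  rw [← h2.resolve_left ha]
  have hz : ∀ (c : ℂ), c ≠ 0 → ∀ (f : Slot m N → ℤ) (S : Finset (Slot m N)),
      c ^ ∑ k ∈ S, f k = ∏ k ∈ S, c ^ f k := by
    intro c hc f S
    induction S using Finset.induction_on with
    | empty => simp
    | insert a S ha ih => rw [sum_insert ha, prod_insert ha, zpow_add₀ hc, ih]
  rw [hz _ hP.q2_ne, hz _ hP.q3_ne, ← prod_mul_distrib]; rfl

theorem eval_eq_zero_of_not_balanced (hP : P.Admissible) (hs : IsGeneric P s)
    (hF : IsNumerator F p e) (hlim : HasBetheLimits s N F) (hc : IsStringConf σ pos)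
    (ih : VanishesAbove P p σ) {y : L → ℂ} (hy : Separated P y) {l : L}
    (hl : ¬ LabelBalanced σ l) : eval (stringPoint P σ pos y) p = 0 := by
  by_contra h0; apply hl
  have h1 := block_balanced hP hs hF hlim hc ih hy
    (fun u v hv hu => shorterLabels_le (l := l) hv hu) h0
  have h2 := block_balanced hP hs hF hlim hc ih hy
    (fun u v hv hu => shorterLabels_erase_le (l := l) hv hu) h0
  have key : ∀ i, (univ.filter fun v => σ v ∈ shorterLabels σ l ∧ v.1 = i).card =
      (univ.filter fun v => σ v ∈ (shorterLabels σ l).erase l ∧ v.1 = i).card +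
        (univ.filter fun v => σ v = l ∧ v.1 = i).card := by
    intro i
    rw [← card_union_of_disjoint]
    · congr 1; simp [shorterLabels]; grind
    · rw [disjoint_left]; grind
  intro i j; have := key i; have := key j; have := h1 i j; have := h2 i j; omega

theorem eval_update_eq_zero (hP : P.Admissible) (hF : IsNumerator F p e)
    (hlim : HasBetheLimits s N F) (hc : IsStringConf σ pos) (ih : VanishesAbove P p σ)
    {y : L → ℂ} (hy : Separated P y) (h0 : eval (stringPoint P σ pos y) p = 0) (l : L) :
    ∃ E : Set ℂ, E.Countable ∧ ∀ t ∉ E, Separated P (Function.update y l t) ∧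
      eval (stringPoint P σ pos (Function.update y l t)) p = 0 := by
  refine ⟨{0} ∪ ⋃ q : ℤ × ℤ × L × L, {P.q2 ^ q.1 * P.q3 ^ q.2.1 * y q.2.2.1 * y l / y q.2.2.2},
    (Set.countable_singleton _).union (Set.countable_iUnion fun _ => Set.countable_singleton _),
    fun t ht => ?_⟩
  simp only [Set.mem_union, Set.mem_singleton_iff, Set.mem_iUnion, not_or, not_exists] at ht
  obtain ⟨ht0, ht⟩ := ht; have h2 := hP.q2_ne; have h3 := hP.q3_ne
  have hyl := hy.ne_zero l
  have htn : ∀ (a b : ℤ) (l1 l2 : L), t * y l2 ≠ P.q2 ^ a * P.q3 ^ b * y l1 * y l := by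
    intro a b l1 l2 h
    exact ht (a, b, l1, l2) ((eq_div_iff (hy.ne_zero l2)).2 h)
  have hinv : ∀ (a b : ℤ) (z w : ℂ), P.q2 ^ a * P.q3 ^ b * z = w →
      z = P.q2 ^ (-a) * P.q3 ^ (-b) * w := by
    grind [zpow_neg, zpow_ne_zero]
  have htl : ∀ (a b : ℤ) (l1 : L), t ≠ P.q2 ^ a * P.q3 ^ b * y l1 := by grind
  have hsep : Separated P (Function.update y l t) := by
    refine ⟨fun l1 => ?_, fun l1 l2 a b hne h => ?_⟩
    · by_cases h : l1 = l
      · grind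
      · rw [Function.update_of_ne h]; exact hy.ne_zero l1
    · by_cases h1 : l1 = l
      · have h4 : l2 ≠ l := fun h5 => hne (h1.trans h5.symm)
        rw [h1, Function.update_self, Function.update_of_ne h4] at h
        exact htl _ _ _ (hinv _ _ _ _ h)
      · by_cases h4 : l2 = l
        · grind
        · rw [Function.update_of_ne h4, Function.update_of_ne h1] at h
          exact hy.sep _ _ _ _ hne h
  refine ⟨hsep, ?_⟩
  have hmem : l ∈ shorterLabels σ l := by simp [shorterLabels]
  have hsep1 : Separated P (scaleLabels (shorterLabels σ l) (t / y l) y) := by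
    refine ⟨fun l1 => ?_, fun l1 l2 a b hne h => ?_⟩
    · unfold scaleLabels
      split_ifs
      · exact mul_ne_zero (div_ne_zero ht0 hyl) (hy.ne_zero _)
      · exact hy.ne_zero _
    · unfold scaleLabels at h
      split_ifs at h with a1 a2 a2
      · refine hy.sep l1 l2 a b hne (mul_left_cancel₀ (div_ne_zero ht0 hyl) ?_)
        rw [← h]; ring
      · have h4 := hinv _ _ _ _ h; grind
      · grind
      · exact hy.sep l1 l2 a b hne h
  have e1 := eval_scaleLabels_eq_zero hP hF hlim hc ih hy
    (fun u v hv hu => shorterLabels_le (l := l) hv hu) h0 (t / y l)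
  have e2 := eval_scaleLabels_eq_zero hP hF hlim hc ih hsep1
    (fun u v hv hu => shorterLabels_erase_le (l := l) hv hu) e1 (t / y l)⁻¹
  have e3 : Function.update y l t = scaleLabels ((shorterLabels σ l).erase l) (t / y l)⁻¹
      (scaleLabels (shorterLabels σ l) (t / y l) y) := ?_
  · rw [e3, e2]
  grind [scaleLabels]

theorem eval_eq_zero_of_exists (hP : P.Admissible) (hF : IsNumerator F p e)
    (hlim : HasBetheLimits s N F) (hc : IsStringConf σ pos) (ih : VanishesAbove P p σ)
    {y : L → ℂ} (hy : Separated P y) (h0 : eval (stringPoint P σ pos y) p = 0) (w : L → ℂ) :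
    eval (stringPoint P σ pos w) p = 0 := by
  have key : ∀ (A : Finset L) (y : L → ℂ), Separated P y →
      eval (stringPoint P σ pos y) p = 0 → ∀ w : L → ℂ, (∀ l ∉ A, w l = y l) →
      eval (stringPoint P σ pos w) p = 0 := by
    intro A
    induction A using Finset.induction_on with
    | empty =>
      intro y _ h0 w hw; have : w = y := funext fun l => hw l (notMem_empty l)
      rw [this, h0]
    | insert l A _ ihA =>
      intro y hy h0 w hw
      obtain ⟨E, hE, hEt⟩ := eval_update_eq_zero hP hF hlim hc ih hy h0 l
      have hcont : Continuous fun t : ℂ => eval (stringPoint P σ pos (Function.update w l t)) p := by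
        refine (MvPolynomial.continuous_eval p).comp (continuous_pi fun v => ?_)
        have h1 : Continuous fun t : ℂ => Function.update w l t :=
          continuous_const.update l continuous_id
        exact continuous_const.mul (continuous_pi_iff.1 h1 (σ v))
      have hzero : (fun t : ℂ => eval (stringPoint P σ pos (Function.update w l t)) p) =
          fun _ => 0 := by
        refine hcont.ext_on (hE.dense_compl ℝ) continuous_const fun t ht => ?_
        grind
      have := congrFun hzero (w l); simpa using this
  exact key univ y hy h0 w fun l hl => absurd (mem_univ l) hl

theorem eval_eq_zero_of_balanced (hP : P.Admissible) (hs : IsGeneric P s)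
    (hF : IsNumerator F p e) (hlim : HasBetheLimits s N F)
    (hbal : ∀ (σ : Fin m × Fin N → L) (pos : Fin m × Fin N → ℤ), IsStringConf σ pos →
      (∀ l, LabelBalanced σ l) → ∃ y, Separated P y ∧ eval (stringPoint P σ pos y) p = 0)
    (hc : IsStringConf σ pos) (y : L → ℂ) : eval (stringPoint P σ pos y) p = 0 := by
  have key : ∀ (n : ℕ) (σ : Fin m × Fin N → L) (pos : Fin m × Fin N → ℤ), IsStringConf σ pos →
      Fintype.card (Fin m × Fin N) ^ 2 < ∑ l, stringLen σ l ^ 2 + n →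
      ∀ y : L → ℂ, eval (stringPoint P σ pos y) p = 0 := by
    intro n
    induction n with
    | zero => intro σ pos _ h; have := sum_stringLen_sq_le σ; omega
    | succ n ihn =>
      intro σ pos hc h y
      have ih : VanishesAbove P p σ := fun σ' pos' hc' h' z => ihn σ' pos' hc' (by omega) z
      grind [LabelBalanced, eval_eq_zero_of_exists, exists_separated, eval_eq_zero_of_not_balanced]
  exact key _ σ pos hc (Nat.lt_add_left _ (Nat.lt_succ_self _)) y

end Vanishing

/-! ### The types of balanced configurations -/

section Types

open MvPolynomial

variable {P : QParam} {m N : ℕ} {L : Type}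

/-- The string with label `l` is empty if `τ l = none`, and starts with the color `c` and has length
`m k` if `τ l = (c, k)`. -/
structure HasType (σ : Fin m × Fin N → L) (pos : Fin m × Fin N → ℤ)
    (τ : L → Option (Fin m × ℕ+)) : Prop where
  none : ∀ l, τ l = none → ∀ v, σ v ≠ l
  some : ∀ l c, τ l = some c → ∃ a : ℤ, a % m = (c.1 : ℕ) ∧
    ∀ j, (∃ v, σ v = l ∧ pos v = j) ↔ a ≤ j ∧ j < a + m * (c.2 : ℕ)

theorem exists_hasType [DecidableEq L] {σ : Fin m × Fin N → L} {pos : Fin m × Fin N → ℤ}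
    (hc : IsStringConf σ pos) (hb : ∀ l, LabelBalanced σ l) :
    ∃ τ, HasType σ pos τ ∧ ∀ l, (stringLen σ l : ℕ) = m * (τ l).elim 0 fun c => (c.2 : ℕ) := by
  have key : ∀ l, ∃ o : Option (Fin m × ℕ+), (o = none → ∀ v, σ v ≠ l) ∧ (∀ c, o = some c →
      ∃ a : ℤ, a % m = (c.1 : ℕ) ∧
        ∀ j, (∃ v, σ v = l ∧ pos v = j) ↔ a ≤ j ∧ j < a + m * (c.2 : ℕ)) ∧
      stringLen σ l = m * o.elim 0 fun c => (c.2 : ℕ) := by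
    intro l
    by_cases he : ∃ v, σ v = l
    swap
    · push Not at he; refine ⟨none, fun _ => he, by simp, ?_⟩
      simp [stringLen, he]
    obtain ⟨v0, hv0⟩ := he
    have hne : (univ.filter fun v => σ v = l).Nonempty := ⟨v0, by simp [hv0]⟩
    obtain ⟨u, hu, humin⟩ := exists_min_image _ pos hne
    obtain ⟨u', hu', humax⟩ := exists_max_image _ pos hne
    simp at hu hu' humin humax
    set k := (univ.filter fun v => σ v = l ∧ v.1 = u.1).card with hk
    have hk0 : 0 < k := card_pos.2 ⟨u, by simp [hu]⟩
    have hlen : stringLen σ l = m * k := by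
      rw [stringLen, card_eq_sum_card_fiberwise (f := Prod.fst) (t := univ) (by simp)]
      have : ∀ i ∈ (univ : Finset (Fin m)),
          ((univ.filter fun v => σ v = l).filter fun v => v.1 = i).card = k := by
        intro i _; rw [filter_filter]; exact hb l i u.1
      rw [sum_congr rfl this]; simp
    have h1 := hc.stringLen_le (u := u) (u' := u') (by
      grind) (hu.trans hu'.symm) (by
      grind)
    rw [hu] at h1
    refine ⟨some (u.1, ⟨k, hk0⟩), by simp, ?_, by simpa using hlen⟩
    intro c hcc; obtain rfl := Option.some.inj hcc
    refine ⟨pos u, hc.color u, fun j => ⟨?_, ?_⟩⟩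
    · rintro ⟨w, hw, rfl⟩
      have h2 := hc.lt_stringLen (v := u) (w := w) (hu.trans hw.symm)
      grind [PNat.mk_coe]
    · rintro ⟨h2, h3⟩; simp at h3
      obtain ⟨w, hw⟩ := hc.interval u u' j (hu.trans hu'.symm) h2 (by omega)
      grind
  choose τ h1 h2 h3 using key
  exact ⟨τ, ⟨h1, fun l => h2 l⟩, h3⟩

/-- The multiplicities of the types of strings. -/
def typeCount [Fintype L] (τ : L → Option (Fin m × ℕ+)) : (Fin m × ℕ+) →₀ ℕ :=
  ∑ l, (τ l).elim 0 fun c => Finsupp.single c 1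

theorem typeCount_apply [Fintype L] (τ : L → Option (Fin m × ℕ+)) (c : Fin m × ℕ+) :
    typeCount τ c = Fintype.card {l // τ l = some c} := by
  classical
  rw [typeCount, Finsupp.finset_sum_apply, Fintype.card_subtype, card_filter]
  refine sum_congr rfl fun l _ => ?_
  cases h : τ l with
  | none => simp
  | some c' => grind

theorem degree_typeCount [Fintype L] (τ : L → Option (Fin m × ℕ+)) :
    (typeCount τ).degree + Fintype.card {l // τ l = none} = Fintype.card L := by
  classical
  rw [typeCount, map_sum, Fintype.card_subtype, card_filter, ← sum_add_distrib,
    ← card_univ, card_eq_sum_ones]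
  refine sum_congr rfl fun l _ => ?_
  cases h : τ l with
  | none => simp
  | some c' => simp

theorem exists_equiv_of_typeCount_eq [Fintype L] {τ τ' : L → Option (Fin m × ℕ+)}
    (h : typeCount τ = typeCount τ') : ∃ π : L ≃ L, ∀ l, τ' (π l) = τ l := by
  classical
  have e : ∀ o, Nonempty ({l // τ l = o} ≃ {l // τ' l = o}) := by
    intro o; rw [← Fintype.card_eq]
    cases o with
    | none => have h1 := degree_typeCount τ; grind [degree_typeCount]
    | some c => rw [← typeCount_apply, ← typeCount_apply, h]
  exact ⟨Equiv.ofFiberEquiv fun o => (e o).some, fun l => Equiv.ofFiberEquiv_map _ l⟩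

theorem weight_typeCount [Fintype L] [DecidableEq L] {σ : Fin m × Fin N → L}
    {τ : L → Option (Fin m × ℕ+)} (hm : m ≠ 0)
    (h : ∀ l, (stringLen σ l : ℕ) = m * (τ l).elim 0 fun c => (c.2 : ℕ)) :
    Finsupp.weight (fun v : Fin m × ℕ+ => (v.2 : ℕ)) (typeCount τ) = N := by
  have h1 : Finsupp.weight (fun v : Fin m × ℕ+ => (v.2 : ℕ)) (typeCount τ) =
      ∑ l, (τ l).elim 0 fun c => (c.2 : ℕ) := by
    rw [typeCount, map_sum]; refine sum_congr rfl fun l _ => ?_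
    cases τ l with
    | none => simp
    | some c => simp [Finsupp.weight_single]
  have h2 : ∑ l, stringLen σ l = Fintype.card (Fin m × Fin N) :=
    (card_eq_sum_card_fiberwise (f := σ) (t := univ) (s := univ) (by simp)).symm
  rw [sum_congr rfl fun l _ => h l, ← mul_sum, ← h1] at h2
  simp_all [Fintype.card_prod, Fintype.card_fin]

theorem card_tupleSet {x : Fin m → Fin N → ℂ} (hx : GenericTuple x) :
    (tupleSet x).card = m * N := by
  rw [tupleSet_eq_img, card_img hx.pt_injective]; simp

theorem exists_tupleSet_eq (hP : P.Admissible) {σ σ' : Fin m × Fin N → L}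
    {pos pos' : Fin m × Fin N → ℤ} {τ τ' : L → Option (Fin m × ℕ+)} (hc : IsStringConf σ pos)
    (hc' : IsStringConf σ' pos') (ht : HasType σ pos τ) (ht' : HasType σ' pos' τ') {π : L ≃ L}
    (hπ : ∀ l, τ' (π l) = τ l) {y' : L → ℂ} (hy' : Separated P y') :
    ∃ y, Separated P y ∧ tupleSet (fun i a => stringPoint P σ pos y (i, a)) =
      tupleSet (fun i a => stringPoint P σ' pos' y' (i, a)) := by
  classical
  have h3 := hP.q3_ne
  have hd : ∀ l, ∃ d : ℤ, ∀ v, σ v = l → ∃ w, σ' w = π l ∧ pos' w = pos v + d ∧ w.1 = v.1 := by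
    intro l
    cases h : τ l with
    | none => exact ⟨0, fun v hv => absurd hv (ht.none l h v)⟩
    | some c =>
      obtain ⟨a, ha, hj⟩ := ht.some l c h
      obtain ⟨a', ha', hj'⟩ := ht'.some (π l) c ((hπ l).trans h)
      refine ⟨a' - a, fun v hv => ?_⟩; have h4 := (hj (pos v)).1 ⟨v, hv, rfl⟩
      obtain ⟨w, hw1, hw2⟩ := (hj' (pos v + (a' - a))).2 ⟨by omega, by omega⟩
      have h5 := hc'.color w; rw [hw2] at h5
      have h6 : (a' - a) % m = 0 :=
        Int.emod_eq_zero_of_dvd (Int.ModEq.dvd (show a % m = a' % m from ha.trans ha'.symm))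
      rw [Int.add_emod, h6, add_zero, Int.emod_emod, hc.color v] at h5; grind
  choose d hd using hd
  have hsep : Separated P fun l => P.q3 ^ d l * y' (π l) := by
    refine ⟨fun l => mul_ne_zero (zpow_ne_zero _ h3) (hy'.ne_zero _), fun l l' a b hne h => ?_⟩
    refine hy'.sep (π l) (π l') a (b + d l - d l') (fun h4 => hne (π.injective h4)) ?_
    grind [zpow_sub₀, zpow_add₀, zpow_ne_zero]
  refine ⟨_, hsep, ?_⟩
  refine eq_of_subset_of_card_le ?_ ?_
  · intro q hq; rw [tupleSet_eq_img, mem_img] at hq ⊢; obtain ⟨v, -, rfl⟩ := hq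
    obtain ⟨w, hw1, hw2, hw3⟩ := hd (σ v) v rfl
    refine ⟨w, mem_univ _, Prod.ext hw3 ?_⟩; simp [pt, stringPoint]
    rw [hw1, hw2, zpow_add₀ h3]; ring
  · rw [card_tupleSet (hy'.genericTuple hP hc'), card_tupleSet (hsep.genericTuple hP hc)]

theorem exists_separating_functionals (hP : P.Admissible) {s : Fin m → ℂ} (hs : IsGeneric P s)
    (hm : m ≠ 0) (N : ℕ) :
    ∃ ev : ((Fin m × ℕ+) →₀ ℕ) → (ShuffleAmbient P m →ₗ[ℂ] ℂ), ∀ F ∈ betheComponent P s N,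
      (∀ μ, Finsupp.weight (fun v : Fin m × ℕ+ => (v.2 : ℕ)) μ = N → ev μ F = 0) → F = 0 := by
  classical
  have key : ∀ μ : (Fin m × ℕ+) →₀ ℕ, ∃ f : ShuffleAmbient P m →ₗ[ℂ] ℂ,
      (∃ (σ : Fin m × Fin N → Fin m × Fin N) (pos : Fin m × Fin N → ℤ) (τ : _)
        (y : Fin m × Fin N → ℂ), IsStringConf σ pos ∧ HasType σ pos τ ∧ typeCount τ = μ ∧
        Separated P y) →
      ∃ (σ : Fin m × Fin N → Fin m × Fin N) (pos : Fin m × Fin N → ℤ) (τ : _)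
        (y : Fin m × Fin N → ℂ), IsStringConf σ pos ∧ HasType σ pos τ ∧ typeCount τ = μ ∧
        Separated P y ∧ f = ShuffleAmbient.eval fun i a => stringPoint P σ pos y (i, a) := by
    intro μ
    by_cases h : (∃ (σ : Fin m × Fin N → Fin m × Fin N) (pos : Fin m × Fin N → ℤ) (τ : _)
        (y : Fin m × Fin N → ℂ), IsStringConf σ pos ∧ HasType σ pos τ ∧ typeCount τ = μ ∧
        Separated P y)
    · obtain ⟨σ, pos, τ, y, h1, h2, h3, h4⟩ := h
      exact ⟨_, fun _ => ⟨σ, pos, τ, y, h1, h2, h3, h4, rfl⟩⟩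
    · exact ⟨0, fun h' => absurd h' h⟩
  choose ev hev using key
  refine ⟨ev, fun F hF hvan => ?_⟩
  obtain ⟨hFs, hlim⟩ := mem_betheComponent_iff.1 hF
  obtain ⟨p, e, hnum⟩ := exists_isNumerator hFs
  have hp : ∀ x : Fin m × Fin N → ℂ, GenericTuple (fun i a => x (i, a)) →
      eval (fun i a => x (i, a)) F = 0 → eval x p = 0 := by
    intro x hx h; have h1 := hnum.val _ hx; simp at h1; grind
  have hbal : ∀ (σ : Fin m × Fin N → Fin m × Fin N) (pos : Fin m × Fin N → ℤ),
      IsStringConf σ pos → (∀ l, LabelBalanced σ l) →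
      ∃ y, Separated P y ∧ eval (stringPoint P σ pos y) p = 0 := by
    intro σ pos hc hb; obtain ⟨τ, ht, hlen⟩ := exists_hasType hc hb
    obtain ⟨y0, hy0⟩ := exists_separated (L := Fin m × Fin N) P
    obtain ⟨σ', pos', τ', y', h1, h2, h3, h4, h5⟩ := hev (typeCount τ) ⟨σ, pos, τ, y0, hc, ht, rfl, hy0⟩
    have h6 := hvan (typeCount τ) (weight_typeCount hm hlen)
    obtain ⟨π, hπ⟩ := exists_equiv_of_typeCount_eq h3.symm
    obtain ⟨y, hy, hset⟩ := exists_tupleSet_eq hP hc h1 ht h2 hπ h4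
    refine ⟨y, hy, hp (stringPoint P σ pos y) (hy.genericTuple hP hc) ?_⟩
    rw [h5, eval_eq_value (h4.genericTuple hP h1), ← tupleSet_eq_img] at h6
    rw [eval_eq_value (hy.genericTuple hP hc), ← tupleSet_eq_img, hset, h6]
  have hall : ∀ x : Fin m → Fin N → ℂ, GenericTuple x → eval x F = 0 := by
    intro x hx
    have hc : IsStringConf (N := N) (fun v : Fin m × Fin N => v) (fun v => ((v.1 : ℕ) : ℤ)) := by
      refine ⟨fun v => Int.emod_eq_of_lt (by positivity) (by exact_mod_cast v.1.2),
        fun u v h _ => h, fun u v j h h1 h2 => ⟨u, rfl, ?_⟩⟩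
      grind
    have h1 := eval_eq_zero_of_balanced hP hs hnum hlim hbal hc
      (fun v => P.q3 ^ (-((v.1 : ℕ) : ℤ)) * x v.1 v.2)
    have h2 : stringPoint P (fun v : Fin m × Fin N => v) (fun v => ((v.1 : ℕ) : ℤ))
        (fun v => P.q3 ^ (-((v.1 : ℕ) : ℤ)) * x v.1 v.2) = fun v => x v.1 v.2 := by
      funext v; simp only [stringPoint]
      rw [← mul_assoc, ← zpow_add₀ hP.q3_ne, add_neg_cancel, zpow_zero, one_mul]
    rw [h2, ← hnum.val x hx] at h1; have h3 := poleProd_ne_zero hx.genericSet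
    have h4 : (∏ v : Fin m × Fin N, x v.1 v.2) ^ e ≠ 0 :=
      pow_ne_zero _ (prod_ne_zero_iff.2 fun v _ => hx.1 _ _)
    grind
  refine HasSupport.ext (mem_shuffleComponent_iff.1 hFs).1 (G := 0) (N := N) (fun T _ => ?_)
    fun x hx => ?_
  · exact value_zero T
  · rw [hall x hx, map_zero]

end Types

/-! ### The elements `G` belong to the shuffle algebra -/

section GMem

variable {P : QParam} {m N : ℕ}

theorem eval_ofSymmetric_eq {g : (Fin m → Fin N → ℂ) → ℂ} {h : Finset (Fin m × ℂ) → ℂ}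
    (hg : ∀ x, GenericTuple x → g x = h (tupleSet x)) {x : Fin m → Fin N → ℂ}
    (hx : GenericTuple x) :
    eval x (ofSymmetric P N g) = h (tupleSet x) := by
  have h1 : eval x (ofSymmetric P N g) = ofSymmetric P N g ⟨tupleSet x, hx.genericSet⟩ := dif_pos hx
  have hex : ∃ x' : Fin m → Fin N → ℂ, GenericTuple x' ∧ tupleSet x' = tupleSet x := ⟨x, hx, rfl⟩
  have h2 : ofSymmetric P N g ⟨tupleSet x, hx.genericSet⟩ = g hex.choose := dif_pos hex
  grind

/-- The contribution of a pair of points to the prefactor of the elements `G`. -/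
def gPair (P : QParam) {m : ℕ} (u v : Fin m × ℂ) : ℂ :=
  (if m = 1 then P.q⁻¹ else 1) * (if u.1 = v.1 then u.2 - P.q2 * v.2 else 1) *
    (if v.1 = nextColor u.1 then (u.2 - v.2)⁻¹ else 1)

theorem gPair_pt (x : Fin m → Fin N → ℂ) (u v : Fin m × Fin N) :
    gPair P (pt x u) (pt x v) = (if m = 1 then P.q⁻¹ else 1) *
      (if u.1 = v.1 then x u.1 u.2 - P.q2 * x v.1 v.2 else 1) *
      (if v.1 = nextColor u.1 then (x u.1 u.2 - x v.1 v.2)⁻¹ else 1) := rfl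

/-- The contribution of a point to the prefactor of the elements `G`. -/
def gDiag (P : QParam) {m : ℕ} (u : Fin m × ℂ) : ℂ := if m = 1 then 1 else (1 - P.q2) * u.2

/-- The prefactor of the elements `G` as a function of configurations. -/
def gPre (P : QParam) {m : ℕ} (T : Finset (Fin m × ℂ)) : ℂ :=
  (∏ u ∈ T, gDiag P u) * pairProd (gPair P) T

/-- The product of the points of color `i`. -/
def colorProd {m : ℕ} (T : Finset (Fin m × ℂ)) (i : Fin m) : ℂ := ∏ u ∈ T with u.1 = i, u.2

/-- The functions `t_i(s)` as functions of configurations. -/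
def tSet {m : ℕ} (s : Fin m → ℂ) (T : Finset (Fin m × ℂ)) (i : Fin m) : ℂ :=
  (∏ j ∈ Iio i, s j) * (colorProd T (prevColor i) / colorProd T i)

/-- Elementary symmetric functions of a finite family. -/
def esum {ι R : Type} [Fintype ι] [CommRing R] (r : ℕ) (t : ι → R) : R :=
  ∑ A ∈ powersetCard r univ, ∏ i ∈ A, t i

theorem colorProd_tupleSet {x : Fin m → Fin N → ℂ} (hx : GenericTuple x) (i : Fin m) :
    colorProd (tupleSet x) i = ∏ a, x i a := by
  classical
  rw [colorProd, prod_filter, tupleSet_eq_img, prod_img hx.pt_injective,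
    Fintype.prod_prod_type, prod_eq_single i]
  · simp [pt]
  · intro j _ hj; simp [pt, hj]
  · simp

theorem tSet_tupleSet {x : Fin m → Fin N → ℂ} (hx : GenericTuple x) (s : Fin m → ℂ) (i : Fin m) :
    tSet s (tupleSet x) i = tFun s x i := by
  grind [tSet, tFun, colorProd_tupleSet]

theorem prefactorP_eq (hP : P.Admissible) {x : Fin m → Fin N → ℂ} (hx : GenericTuple x) :
    prefactorP P x = gPre P (tupleSet x) := by
  classical
  rw [gPre, tupleSet_eq_img, prod_img hx.pt_injective, pairProd_img hx.pt_injective]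
  by_cases hm : m = 1
  · subst hm; have hq := hP.q_ne
    simp only [prefactorP, gDiag, if_true, prod_const_one, one_mul]
    have e : pairProd (fun u v : Fin 1 × Fin N => gPair P (pt x u) (pt x v)) univ =
      pairProd (fun u v : Fin 1 × Fin N => if u.1 = v.1 then
        P.q⁻¹ * (x u.1 u.2 - P.q2 * x u.1 v.2) * (x u.1 u.2 - x u.1 v.2)⁻¹ else 1) univ := by
      refine pairProd_congr fun u _ v _ _ => ?_
      have h1 : u.1 = v.1 := Subsingleton.elim _ _
      have h2 : v.1 = nextColor u.1 := Subsingleton.elim _ _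
      simp only [gPair_pt, if_true, if_pos h1, if_pos h2]; rw [h1]
    rw [e, pairProd_sameColor fun i a b => P.q⁻¹ * (x i a - P.q2 * x i b) * (x i a - x i b)⁻¹]
    refine prod_congr rfl fun i _ => ?_; rw [← prod_Ioi_eq_pairProd]
    refine prod_congr rfl fun a _ => prod_congr rfl fun b hb => ?_
    grind [sub_ne_zero, Prod.mk.inj, QParam.q2]
  · simp only [prefactorP, gDiag, if_neg hm]
    have e : pairProd (fun u v : Fin m × Fin N => gPair P (pt x u) (pt x v)) univ =
      pairProd (fun u v : Fin m × Fin N => if u.1 = v.1 then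
        (x u.1 u.2 - P.q2 * x u.1 v.2) else 1) univ *
      pairProd (fun u v : Fin m × Fin N => if v.1 = nextColor u.1 then
        (x u.1 u.2 - x (nextColor u.1) v.2)⁻¹ else 1) univ := by
      rw [← pairProd_mul]; refine pairProd_congr fun u _ v _ _ => ?_
      simp only [gPair_pt, if_neg hm, one_mul]; grind
    rw [e, pairProd_sameColor fun i a b => x i a - P.q2 * x i b,
      pairProd_color hm fun i a b => (x i a - x (nextColor i) b)⁻¹, ← mul_assoc,
      Fintype.prod_prod_type, ← prod_mul_distrib, ← prod_mul_distrib]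
    refine prod_congr rfl fun i _ => ?_
    rw [pairProd_eq_prod_prod, ← prod_mul_distrib, ← prod_mul_distrib]
    refine prod_congr rfl fun a _ => ?_
    have e2 : (1 - P.q2) * (pt x (i, a)).2 = x i a - P.q2 * x i a := by simp only [pt]; ring
    rw [e2, ← prod_mul_prod_compl {a} fun b => (x i a - P.q2 * x i b) /
      (x i a - x (nextColor i) b), prod_singleton]
    rw [← prod_mul_prod_compl {a} fun b => (x i a - x (nextColor i) b)⁻¹, prod_singleton]
    grind [div_eq_mul_inv, prod_mul_distrib]

/-- The values of the elements `G` on configurations. -/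
def gValue (P : QParam) {m : ℕ} (s : Fin m → ℂ) (r : ℕ) (T : Finset (Fin m × ℂ)) : ℂ :=
  gPre P T * esum r (tSet s T)

theorem eval_gElement (hP : P.Admissible) (s : Fin m → ℂ) (r : ℕ) {x : Fin m → Fin N → ℂ}
    (hx : GenericTuple x) :
    eval x (gElement P s r N) = gValue P s r (tupleSet x) := by
  refine eval_ofSymmetric_eq (h := gValue P s r) (fun y hy => ?_) hx
  simp_all [gValue, esum, prefactorP_eq, tSet_tupleSet]

theorem gElement_hasSupport (s : Fin m → ℂ) (r : ℕ) : HasSupport N (gElement P s r N) :=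
  ofSymmetric_hasSupport _

theorem value_gElement (hP : P.Admissible) (s : Fin m → ℂ) (r : ℕ) {T : Finset (Fin m × ℂ)}
    (hT : GenericSet T) (hb : ColorBalanced N T) :
    (gElement P s r N).value T = gValue P s r T := by
  obtain ⟨x, hx, rfl⟩ := hb.exists_tuple hT
  rw [← eval_gElement hP s r hx, eval_eq_value hx, tupleSet_eq_img]

theorem gElement_mem_shuffleComponent (hP : P.Admissible) (s : Fin m → ℂ) (r N : ℕ) :
    gElement P s r N ∈ shuffleComponent P m N := by
  classical
  rw [mem_shuffleComponent_iff]
  refine ⟨gElement_hasSupport s r, (∏ v : Fin m × Fin N,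
    (if m = 1 then 1 else MvPolynomial.C (1 - P.q2) * MvPolynomial.X v)) *
    pairProd (fun u v : Fin m × Fin N => MvPolynomial.C (if m = 1 then P.q⁻¹ else 1) *
      if u.1 = v.1 then MvPolynomial.X u - MvPolynomial.C P.q2 * MvPolynomial.X v else 1)
      univ *
    ∑ A ∈ powersetCard r (univ : Finset (Fin m)), (∏ i ∈ A,
      MvPolynomial.C (∏ j ∈ Iio i, s j) * ∏ a, MvPolynomial.X (prevColor i, a)) *
      ∏ i ∈ Aᶜ, ∏ a, MvPolynomial.X (i, a), 1, ?_, ?_⟩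
  · intro x hx
    rw [eval_gElement hP s r hx, gValue, gPre, pow_one, map_mul, map_mul, poleProd,
      tupleSet_eq_img, prod_img hx.pt_injective, pairProd_img hx.pt_injective,
      pairProd_img hx.pt_injective, ← tupleSet_eq_img]
    have e1 : ∀ A B C D E : ℂ, A * B * C * D * E = A * (B * E) * (C * D) := by intros; ring
    rw [e1]
    congr 1
    · congr 1
      · rw [map_prod]; refine prod_congr rfl fun v _ => ?_
        simp only [gDiag, pt]
        split_ifs <;> simp
      · rw [← pairProd_mul]
        rw [← MonoidHom.coe_coe (MvPolynomial.eval fun v : Fin m × Fin N => x v.1 v.2),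
          map_pairProd]
        refine pairProd_congr fun u _ v _ huv => ?_
        have hne : x u.1 u.2 - x v.1 v.2 ≠ 0 := sub_ne_zero.2 fun h => huv (hx.2 h)
        simp only [gPair_pt, poleFactor_pt, MonoidHom.coe_coe, map_mul, MvPolynomial.eval_C]
        rw [mul_assoc, mul_assoc]; congr 1
        have e2 : ((if v.1 = nextColor u.1 then (x u.1 u.2 - x v.1 v.2)⁻¹ else 1) *
          if v.1 = nextColor u.1 then x u.1 u.2 - x v.1 v.2 else 1) = 1 := by
          grind
        rw [e2, mul_one]
        split_ifs <;> simp
    · rw [esum, map_sum, sum_mul]; refine sum_congr rfl fun A _ => ?_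
      have hX : ∀ i, (∏ a, x i a) ≠ 0 := fun i => prod_ne_zero_iff.2 fun a _ => hx.1 i a
      rw [Fintype.prod_prod_type, ← prod_mul_prod_compl A, ← mul_assoc, ← prod_mul_distrib]
      simp only [map_mul, map_prod, MvPolynomial.eval_C, MvPolynomial.eval_X]
      congr 1; refine prod_congr rfl fun i _ => ?_
      rw [tSet_tupleSet hx, tFun, mul_assoc, div_mul_cancel₀ _ (hX i)]
  · intro x hx hw
    obtain ⟨u, v, huv, hc, he⟩ : ∃ u v : Fin m × Fin N, u ≠ v ∧ u.1 = v.1 ∧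
        x u.1 u.2 = P.q2 * x v.1 v.2 := by
      have key : ∀ (i : Fin m) (a b : Fin N), x i a = P.q2 * x i b → a ≠ b := by
        rintro i a b h rfl; refine hP.q2_ne_one (mul_right_cancel₀ (hx i a) ?_)
        rw [← h, one_mul]
      obtain ⟨i, a, b, c, ⟨-, h⟩ | ⟨h, -⟩⟩ := hw
      · exact ⟨(nextColor i, c), (nextColor i, b), fun e => key _ _ _ h (congrArg Prod.snd e),
          rfl, h⟩
      · exact ⟨(i, b), (i, a), fun e => key _ _ _ h (congrArg Prod.snd e), rfl, h⟩
    rw [map_mul, map_mul]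
    have e0 : MvPolynomial.eval (fun v : Fin m × Fin N => x v.1 v.2)
        (pairProd (fun u v : Fin m × Fin N => MvPolynomial.C (if m = 1 then P.q⁻¹ else 1) *
      if u.1 = v.1 then MvPolynomial.X u - MvPolynomial.C P.q2 * MvPolynomial.X v else 1)
      univ) = 0 := by
      rw [← MonoidHom.coe_coe (MvPolynomial.eval fun v : Fin m × Fin N => x v.1 v.2), map_pairProd]
      by_contra h
      refine pairProd_ne_zero.1 h u (mem_univ _) v (mem_univ _) huv ?_
      simp [hc, ← he]
    grind

end GMem

/-! ### Asymptotics of products of linear factors -/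

/-- `f ξ ∼ c ξ ^ e₀` as `ξ → 0` and `f ξ ∼ c exp(ρ) ξ ^ e₁` as `ξ → ∞`. -/
def HasAsymptotics (f : ℂ → ℂ) (e₀ e₁ : ℤ) (ρ c : ℂ) : Prop :=
  Tendsto (fun ξ => f ξ * ξ ^ (-e₀)) (𝓝[≠] 0) (𝓝 c) ∧
    Tendsto (fun ξ => f ξ * ξ ^ (-e₁)) (Bornology.cobounded ℂ) (𝓝 (c * exp ρ))

namespace HasAsymptotics

variable {f g : ℂ → ℂ} {e₀ e₁ e₀' e₁' : ℤ} {ρ ρ' c c' : ℂ}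

theorem eventually_ne : (∀ᶠ ξ in 𝓝[≠] (0 : ℂ), ξ ≠ 0) ∧ ∀ᶠ ξ in Bornology.cobounded ℂ, ξ ≠ 0 :=
  eventually_notMem_of_finite (Set.finite_singleton 0)

theorem mul (hf : HasAsymptotics f e₀ e₁ ρ c) (hg : HasAsymptotics g e₀' e₁' ρ' c') :
    HasAsymptotics (fun ξ => f ξ * g ξ) (e₀ + e₀') (e₁ + e₁') (ρ + ρ') (c * c') := by
  constructor
  · refine (hf.1.mul hg.1).congr' (eventually_ne.1.mono fun ξ hξ => ?_)
    grind [neg_add, zpow_add₀]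
  · rw [exp_add, show c * c' * (exp ρ * exp ρ') = c * exp ρ * (c' * exp ρ') by ring]
    refine (hf.2.mul hg.2).congr' (eventually_ne.2.mono fun ξ hξ => ?_)
    grind [neg_add, zpow_add₀]

theorem inv (hf : HasAsymptotics f e₀ e₁ ρ c) (hc : c ≠ 0) :
    HasAsymptotics (fun ξ => (f ξ)⁻¹) (-e₀) (-e₁) (-ρ) c⁻¹ := by
  constructor
  · refine (hf.1.inv₀ hc).congr fun ξ => ?_; rw [mul_inv, ← zpow_neg]
  · rw [exp_neg, ← mul_inv]
    refine (hf.2.inv₀ (mul_ne_zero hc (exp_ne_zero _))).congr fun ξ => ?_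
    rw [mul_inv, ← zpow_neg]

theorem const (c : ℂ) : HasAsymptotics (fun _ => c) 0 0 0 c := by constructor <;> simp

theorem prod {ι : Type} (s : Finset ι) {f : ι → ℂ → ℂ} {e₀ e₁ : ι → ℤ} {ρ : ι → ℂ}
    (h : ∀ i, ∃ c, HasAsymptotics (f i) (e₀ i) (e₁ i) (ρ i) c) :
    ∃ c, HasAsymptotics (fun ξ => ∏ i ∈ s, f i ξ) (∑ i ∈ s, e₀ i) (∑ i ∈ s, e₁ i)
      (∑ i ∈ s, ρ i) c := by
  classical
  induction s using Finset.induction_on with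
  | empty => exact ⟨1, by simpa using const 1⟩
  | insert a s ha ih =>
    obtain ⟨c, hc⟩ := ih; obtain ⟨c', hc'⟩ := h a; refine ⟨c' * c, ?_⟩
    simp [prod_insert ha, sum_insert ha]; exact hc'.mul hc

theorem congr_fun (hf : HasAsymptotics f e₀ e₁ ρ c) (h : ∀ ξ, f ξ = g ξ) :
    HasAsymptotics g e₀ e₁ ρ c := by
  rwa [← funext h]

theorem limRatio (hf : HasAsymptotics f 0 0 ρ c) : LimRatio f (exp ρ) := by
  refine ⟨c, ?_, ?_⟩
  · simpa using hf.1
  · simpa using hf.2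

theorem limRatio_of_pos (hf : HasAsymptotics f e₀ e₁ ρ c) (h0 : 0 < e₀) (h1 : e₁ < 0) (r : ℂ) :
    LimRatio f r := by
  refine ⟨0, ?_, ?_⟩
  · have h2 : Tendsto (fun ξ : ℂ => ξ ^ e₀) (𝓝[≠] 0) (𝓝 0) := by
      obtain ⟨n, rfl⟩ := Int.eq_ofNat_of_zero_le h0.le
      have hn : n ≠ 0 := by rintro rfl; simp at h0
      have := ((continuous_pow (M := ℂ) n).tendsto 0).mono_left (nhdsWithin_le_nhds (s := {0}ᶜ))
      simpa [hn] using this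
    have h3 := hf.1.mul h2; rw [mul_zero] at h3
    refine h3.congr' (eventually_ne.1.mono fun ξ hξ => ?_)
    rw [mul_assoc, ← zpow_add₀ hξ, neg_add_cancel, zpow_zero, mul_one]
  · have h2 : Tendsto (fun ξ : ℂ => ξ ^ e₁) (Bornology.cobounded ℂ) (𝓝 0) := by
      obtain ⟨n, hn⟩ := Int.eq_ofNat_of_zero_le (Int.neg_nonneg_of_nonpos h1.le)
      have hn0 : n ≠ 0 := by grind
      have := tendsto_inv_nhdsNE_cobounded.pow n; rw [zero_pow hn0] at this
      refine this.congr fun ξ => ?_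
      rw [show e₁ = -(n : ℤ) by omega, zpow_neg, zpow_natCast, inv_pow]
    have h3 := hf.2.mul h2; rw [mul_zero] at h3; rw [zero_mul]
    refine h3.congr' (eventually_ne.2.mono fun ξ hξ => ?_)
    rw [mul_assoc, ← zpow_add₀ hξ, neg_add_cancel, zpow_zero, mul_one]

theorem linear (a b γ : ℂ) (p r : Prop) : ∃ c, HasAsymptotics (fun ξ => scaleIf p ξ (exp a) -
      exp γ * scaleIf r ξ (exp b)) (indic p * indic r)
      (indic p + indic r - indic p * indic r)
      ((indic p - indic r) * (a - b + (Real.pi * Complex.I - γ))) c ∧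
      (exp a ≠ exp γ * exp b → c ≠ 0) := by
  have h0 : Tendsto (fun ξ : ℂ => ξ) (𝓝[≠] 0) (𝓝 0) := nhdsWithin_le_nhds
  have hi := tendsto_inv_nhdsNE_cobounded; have ha := exp_ne_zero a
  have hb := exp_ne_zero b; have hγ := exp_ne_zero γ
  have e1 : exp (a - b + (Real.pi * Complex.I - γ)) = -(exp a / (exp b * exp γ)) := by
    grind [exp_add, exp_sub, Complex.exp_pi_mul_I]
  by_cases hp : p <;> by_cases hr : r
  · refine ⟨exp a - exp γ * exp b, ⟨?_, ?_⟩, sub_ne_zero.2⟩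
    · refine tendsto_const_nhds.congr' (eventually_ne.1.mono fun ξ hξ => ?_)
      simp [scaleIf, indic, hp, hr]; field_simp
    · simp [indic, hp, hr]
      refine tendsto_const_nhds.congr' (eventually_ne.2.mono fun ξ hξ => ?_)
      simp [scaleIf]; field_simp
  · refine ⟨-(exp γ * exp b), ⟨?_, ?_⟩, fun _ => neg_ne_zero.2 (mul_ne_zero hγ hb)⟩
    · have := (h0.mul_const (exp a)).sub_const (exp γ * exp b)
      simpa [scaleIf, indic, hp, hr] using this
    · simp only [indic, hp, hr, if_true, if_false, Int.cast_one, Int.cast_zero, sub_zero, one_mul,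
        e1]
      have h2 := (hi.const_mul (exp γ * exp b)).const_sub (exp a)
      rw [show -(exp γ * exp b) * -(exp a / (exp b * exp γ))
        = exp a - exp γ * exp b * 0 by field_simp; ring]
      refine h2.congr' (eventually_ne.2.mono fun ξ hξ => ?_); simp [scaleIf]
      field_simp
  · refine ⟨exp a, ⟨?_, ?_⟩, fun _ => ha⟩
    · have := ((h0.mul_const (exp b)).const_mul (exp γ)).const_sub (exp a)
      simpa [scaleIf, indic, hp, hr] using this
    · have e2 : exp ((((0 : ℤ) : ℂ) - ((1 : ℤ) : ℂ)) * (a - b + (Real.pi * Complex.I - γ))) =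
          (-(exp a / (exp b * exp γ)))⁻¹ := by
        rw [← e1, ← exp_neg]; simp
      simp only [indic, hp, hr, if_true, if_false, e2]
      have h2 := (hi.const_mul (exp a)).sub_const (exp γ * exp b)
      rw [show exp a * (-(exp a / (exp b * exp γ)))⁻¹
        = exp a * 0 - exp γ * exp b by field_simp; ring]
      refine h2.congr' (eventually_ne.2.mono fun ξ hξ => ?_); simp [scaleIf]
      field_simp
  · refine ⟨exp a - exp γ * exp b, ?_, sub_ne_zero.2⟩
    grind [scaleIf, indic, const, exp]

theorem one_add (τ : ℂ) (d : ℤ) :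
    ∃ c, HasAsymptotics (fun ξ => 1 + exp τ * ξ ^ d) (min d 0) (max d 0) (d.sign * τ) c := by
  have h0 : ∀ n : ℕ, n ≠ 0 → Tendsto (fun ξ : ℂ => ξ ^ n) (𝓝[≠] 0) (𝓝 0) := fun n hn => by
    have := ((continuous_pow (M := ℂ) n).tendsto 0).mono_left (nhdsWithin_le_nhds (s := {0}ᶜ))
    simpa [hn] using this
  have hi : ∀ n : ℕ, n ≠ 0 → Tendsto (fun ξ : ℂ => (ξ ^ n)⁻¹) (Bornology.cobounded ℂ) (𝓝 0) :=
    fun n hn => by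
    have := tendsto_inv_nhdsNE_cobounded.pow n; grind [zero_pow, inv_pow]
  rcases lt_trichotomy d 0 with hd | rfl | hd
  · obtain ⟨n, hn⟩ := Int.eq_ofNat_of_zero_le (Int.neg_nonneg_of_nonpos hd.le)
    have hn0 : n ≠ 0 := by grind
    have hd' : d = -(n : ℤ) := by omega
    rw [Int.sign_eq_neg_one_of_neg hd, min_eq_left hd.le, max_eq_right hd.le, hd']
    refine ⟨exp τ, ?_, ?_⟩
    · have := (h0 n hn0).add_const (exp τ); rw [zero_add] at this
      refine this.congr' (eventually_ne.1.mono fun ξ hξ => ?_); simp; field_simp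
    · have := ((hi n hn0).const_mul (exp τ)).const_add 1; rw [← exp_add]
      simpa using this
  · exact ⟨1 + exp τ, by simpa using const (1 + exp τ)⟩
  · obtain ⟨n, rfl⟩ := Int.eq_ofNat_of_zero_le hd.le
    have hn0 : n ≠ 0 := by rintro rfl; simp at hd
    rw [Int.sign_eq_one_of_pos hd, min_eq_right hd.le, max_eq_left hd.le]
    refine ⟨1, ?_, ?_⟩
    · have := ((h0 n hn0).const_mul (exp τ)).const_add 1; simpa using this
    · have := (hi n hn0).add_const (exp τ); rw [zero_add] at this; simp
      refine this.congr' (eventually_ne.2.mono fun ξ hξ => ?_); field_simp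

end HasAsymptotics

/-! ### The limits of the elements `G` -/

section Cyclic

variable {m : ℕ} {A : Type} [AddCommGroup A]

theorem sum_nextColor (f : Fin m → A) : ∑ i, f (nextColor i) = ∑ i, f i :=
  Fintype.sum_bijective nextColor
    (Finite.injective_iff_bijective.1 nextColor_injective) _ _ fun _ => rfl

theorem sum_eq_of_telescope {f f' g : Fin m → A}
    (h : ∀ i, f i = f' i + (g (nextColor i) - g i)) : ∑ i, f i = ∑ i, f' i := by
  simp [h, sum_add_distrib, sum_nextColor]

theorem prevColor_nextColor (i : Fin m) : prevColor (nextColor i) = i :=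
  (nextColor_eq_iff.1 rfl).symm

theorem sum_prevColor_color (f : Fin m → Fin m → A) :
    ∑ i, f (prevColor i) i = ∑ i, f i (nextColor i) := by
  grind [sum_nextColor, prevColor_nextColor]

end Cyclic

theorem sum_sum_sub_mul {N : ℕ} (p l p' l' : Fin N → ℂ) (c : ℂ) :
    ∑ a, ∑ b, (p a - p' b) * (l a - l' b + c) =
      N * ∑ a, p a * l a - (∑ a, p a) * (∑ b, l' b) - (∑ a, l a) * (∑ b, p' b) +
      N * ∑ b, p' b * l' b + c * (N * ∑ a, p a - N * ∑ b, p' b) := by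
  have e : ∀ a b, (p a - p' b) * (l a - l' b + c) =
    p a * l a - p a * l' b - l a * p' b + p' b * l' b + c * (p a - p' b) := by intros; ring
  simp only [e, sum_add_distrib, sum_sub_distrib, ← mul_sum,
    ← sum_mul, sum_const, card_univ, Fintype.card_fin, nsmul_eq_mul]
  have e' : ∑ a, p a * (N * l a) = N * ∑ a, p a * l a := by rw [mul_sum]; grind
  grind

theorem sum_Iio_nextColor {m : ℕ} (σ k : Fin m → ℂ) (last : Fin m) (hl : (last : ℕ) + 1 = m) :
    ∑ i, k i * (∑ j ∈ Iio (nextColor i), σ j - ∑ j ∈ Iio i, σ j) =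
      ∑ i, k i * σ i - k last * ∑ i, σ i := by
  classical
  have h : ∀ i, k i * (∑ j ∈ Iio (nextColor i), σ j - ∑ j ∈ Iio i, σ j) =
      k i * σ i - if i = last then k i * ∑ i, σ i else 0 := by
    intro i
    have h1 : σ i + ∑ j ∈ Iio i, σ j = ∑ j ∈ Iic i, σ j := by grind [Finset.Iio_insert, sum_insert]
    by_cases hi : i = last
    · subst hi
      have h2 : Iio (nextColor i) = ∅ := by ext j; simp [Fin.lt_def, nextColor, hl]
      have h3 : Iic i = univ := by grind
      grind
    · have hi' : (i : ℕ) + 1 < m := by grind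
      have h2 : Iio (nextColor i) = Iic i := by
        ext j
        simp only [mem_Iio, mem_Iic, Fin.lt_def, Fin.le_def, nextColor, Nat.mod_eq_of_lt hi']
        omega
      grind
  simp_all

section GLimits

variable {P : QParam} {m N : ℕ}

theorem exists_esum_interpolation (m r : ℕ) : ∃ w : Fin (m + 1) → ℂ, ∀ t : Fin m → ℂ,
    esum r t = ∑ j : Fin (m + 1), w j * ∏ i, (1 + ((j : ℕ) + 1 : ℂ) * t i) := by
  classical
  set v : Fin (m + 1) → ℂ := fun j => (j : ℕ) + 1 with hv
  have hinj : Set.InjOn v (univ : Finset (Fin (m + 1))) := by intro i _ j _ h; aesop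
  refine ⟨fun j => (Lagrange.basis univ v j).coeff r, fun t => ?_⟩
  set p : Polynomial ℂ := ∏ i, (1 + Polynomial.C (t i) * Polynomial.X) with hp
  have hdeg : p.degree < (univ : Finset (Fin (m + 1))).card := by
    refine lt_of_le_of_lt (Polynomial.degree_prod_le _ _) ?_
    refine lt_of_le_of_lt (sum_le_sum (g := fun _ => 1) fun i _ => ?_) ?_
    · rw [add_comm]; exact Polynomial.degree_linear_le
    · simp
      exact_mod_cast Nat.lt_succ_self m
  have h1 := congrArg (Polynomial.coeff · r) (Lagrange.eq_interpolate hinj hdeg)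
  simp at h1
  have h2 : p.coeff r = esum r t := by
    rw [hp, prod_one_add, Polynomial.finsetSum_coeff, esum,
      ← sum_filter_add_sum_filter_not _ (fun A => A.card = r)]
    rw [add_eq_left.2, ← powersetCard_eq_filter]
    · refine sum_congr rfl fun A hA => ?_
      rw [prod_mul_distrib, prod_const, (mem_powersetCard.1 hA).2, ← map_prod,
        Polynomial.coeff_C_mul, Polynomial.coeff_X_pow, if_pos rfl, mul_one]
    · refine sum_eq_zero fun A hA => ?_
      rw [prod_mul_distrib, prod_const, ← map_prod,
        Polynomial.coeff_C_mul, Polynomial.coeff_X_pow, if_neg, mul_zero]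
      grind
  rw [← h2, h1]; refine sum_congr rfl fun j _ => ?_; rw [mul_comm]; congr 1
  rw [hp, Polynomial.eval_prod]; refine prod_congr rfl fun i _ => ?_; simp [hv]
  ring

theorem limRatio_prefactorP_mul (hP : P.Admissible) (hm : m ≠ 1) {s : Fin m → ℂ}
    (hs0 : ∀ i, s i ≠ 0) (hs1 : ∏ i, s i = 1) {x : Fin m → Fin N → ℂ} (hx : GenericTuple x)
    (U : Finset (Fin m × Fin N)) {z : ℂ} (hz : z ≠ 0) :
    LimRatio (fun ξ => prefactorP P (scaleOn U ξ x) * ∏ i, (1 + z * tFun s (scaleOn U ξ x) i))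
      (∏ i, s i ^ (U.filter fun u => u.1 = i).card) := by
  classical
  obtain ⟨l, hl⟩ : ∃ l : Fin m → Fin N → ℂ, ∀ i a, x i a = exp (l i a) :=
    ⟨fun i a => log (x i a), fun i a => (exp_log (hx.1 i a)).symm⟩
  obtain ⟨σ, hσ⟩ : ∃ σ : Fin m → ℂ, ∀ i, s i = exp (σ i) :=
    ⟨fun i => log (s i), fun i => (exp_log (hs0 i)).symm⟩
  obtain ⟨ζ, hζ⟩ : ∃ ζ, z = exp ζ := ⟨_, (exp_log hz).symm⟩
  obtain ⟨lam, hlam⟩ : ∃ lam, P.q2 = exp lam := ⟨_, (exp_log hP.q2_ne).symm⟩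
  set p : Fin m → Fin N → ℤ := fun i a => indic ((i, a) ∈ U) with hp
  set k : Fin m → ℤ := fun i => ∑ a, p i a with hk
  set L : Fin m → ℂ := fun i => ∑ a, l i a with hL
  set S : Fin m → ℂ := fun i => ∑ j ∈ Iio i, σ j with hS
  set K : Fin m → ℤ := fun i => k (prevColor i) - k i with hK
  set E₀ : Fin m → ℤ := fun i => ∑ a, ∑ b, (p i a * p i b + -(p i a * p (nextColor i) b)) with hE₀
  set E₁ : Fin m → ℤ := fun i => ∑ a, ∑ b, ((p i a + p i b - p i a * p i b) +
    -(p i a + p (nextColor i) b - p i a * p (nextColor i) b)) with hE₁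
  set R : Fin m → ℂ := fun i => ∑ a, ∑ b, (((p i a : ℂ) - p i b) *
    (l i a - l i b + (Real.pi * Complex.I - lam)) + -(((p i a : ℂ) - p (nextColor i) b) *
      (l i a - l (nextColor i) b + (Real.pi * Complex.I - 0)))) with hR
  set f : Fin m → ℂ → ℂ := fun i ξ => ∏ a, ∏ b, ((scaleOn U ξ x i a - P.q2 * scaleOn U ξ x i b) /
    (scaleOn U ξ x i a - scaleOn U ξ x (nextColor i) b)) with hf
  set g : Fin m → ℂ → ℂ := fun i ξ => 1 + exp (ζ + S i + L (prevColor i) - L i) * ξ ^ K i with hg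
  have hcard : ∀ i, k i = ((U.filter fun u => u.1 = i).card : ℤ) := by
    intro i
    have h1 : U.filter (fun u => u.1 = i) =
        (univ.filter fun a => (i, a) ∈ U).image fun a => (i, a) := by
      grind
    rw [h1, card_image_of_injective _ fun a b h => (Prod.mk.inj h).2, card_filter]
    push_cast; exact sum_congr rfl fun a _ => by simp only [hp, indic]; congr
  have hX : ∀ i, ∏ a, x i a = exp (L i) := fun i => by rw [hL, exp_sum]; grind
  have hscale : ∀ ξ i a, scaleOn U ξ x i a = scaleIf ((i, a) ∈ U) ξ (exp (l i a)) := by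
    intro ξ i a; rw [← hl]; exact congrArg Prod.snd (scaleOn_eq U ξ x (i, a))
  have hX' : ∀ ξ : ℂ, ξ ≠ 0 → ∀ i, ∏ a, scaleOn U ξ x i a = exp (L i) * ξ ^ k i := by
    intro ξ hξ i
    have h1 : ∀ a, scaleOn U ξ x i a = x i a * ξ ^ p i a := by
      intro a; rw [hscale, ← hl]
      by_cases h : (i, a) ∈ U
      · simp [scaleIf, hp, indic, h]; ring
      · simp [scaleIf, hp, indic, h]
    have h2 : ∀ A : Finset (Fin N), ∏ a ∈ A, ξ ^ p i a = ξ ^ ∑ a ∈ A, p i a := by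
      intro A
      induction A using Finset.induction_on with
      | empty => simp
      | insert a A ha ih => rw [prod_insert ha, sum_insert ha, zpow_add₀ hξ, ih]
    simp [h1, prod_mul_distrib, hX, h2]; rfl
  have hpre : ∀ i, ∃ c, HasAsymptotics (f i) (E₀ i) (E₁ i) (R i) c := by
    intro i
    refine HasAsymptotics.prod univ fun a => HasAsymptotics.prod univ fun b => ?_
    obtain ⟨c, hc, -⟩ := HasAsymptotics.linear (l i a) (l i b) lam ((i, a) ∈ U) ((i, b) ∈ U)
    obtain ⟨c', hc', hne⟩ := HasAsymptotics.linear (l i a) (l (nextColor i) b) 0 ((i, a) ∈ U)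
      ((nextColor i, b) ∈ U)
    have hne' : c' ≠ 0 := by
      refine hne ?_; rw [exp_zero, one_mul, ← hl, ← hl]; intro h
      exact nextColor_ne hm i (congrArg Prod.fst (hx.2 (a₁ := (i, a)) (a₂ := (nextColor i, b)) h)).symm
    refine ⟨_, (hc.mul (hc'.inv hne')).congr_fun fun ξ => ?_⟩
    grind [exp_zero, one_mul, div_eq_mul_inv]
  have ht : ∀ i, ∃ c, HasAsymptotics (g i) (min (K i) 0) (max (K i) 0)
      ((K i).sign * (ζ + S i + L (prevColor i) - L i)) c := fun i => HasAsymptotics.one_add _ _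
  obtain ⟨c, hc⟩ := HasAsymptotics.prod univ hpre
  obtain ⟨c', hc'⟩ := HasAsymptotics.prod univ ht; have htot := hc.mul hc'
  refine LimRatio.congr (S := {0}) ?_ (Set.finite_singleton 0) (f := fun ξ => (∏ i, f i ξ) * ∏ i, g i ξ) ?_
  swap
  · intro ξ hξ; simp only [prefactorP, if_neg hm]; congr 1
    refine prod_congr rfl fun i _ => ?_; rw [tFun, hX' ξ hξ, hX' ξ hξ, hg]
    simp [hK]
    rw [zpow_sub₀ hξ, exp_sub, exp_add, exp_add, ← hζ, hS, exp_sum]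
    simp [hσ]; field_simp
  have hE0 : (∑ i, E₀ i + ∑ i, min (K i) 0) * 2 = ∑ i, (K i ^ 2 - |K i|) := by
    have e1 : ∀ i, E₀ i = k i * k i - k i * k (nextColor i) := by
      simp [hE₀, ← sub_eq_add_neg, hk, sum_mul_sum]
    have e2 : ∀ d : ℤ, min d 0 * 2 = d - |d| := by grind
    rw [add_mul, sum_mul, sum_mul]; simp only [e1, e2, hK]
    rw [sum_prevColor_color (fun i j => k i - k j - |k i - k j|),
      sum_prevColor_color (fun i j => (k i - k j) ^ 2 - |k i - k j|), ← sum_add_distrib]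
    refine sum_eq_of_telescope (g := fun i => -(k i ^ 2 + k i)) fun i => ?_
    ring
  have hE1 : (∑ i, E₁ i + ∑ i, max (K i) 0) * 2 = -∑ i, (K i ^ 2 - |K i|) := by
    have e1 : ∀ i, E₁ i = N * k i - N * k (nextColor i) - k i * k i + k i * k (nextColor i) := by
      intro i
      have : ∀ a b, ((p i a + p i b - p i a * p i b) +
        -(p i a + p (nextColor i) b - p i a * p (nextColor i) b)) =
        p i b - p (nextColor i) b - p i a * p i b + p i a * p (nextColor i) b := by intros; ring
      simp only [hE₁]; simp only [this, sum_sub_distrib, sum_add_distrib, hk, sum_mul_sum,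
        sum_const, card_univ, Fintype.card_fin, nsmul_eq_mul]
    have e2 : ∀ d : ℤ, max d 0 * 2 = d + |d| := by grind
    rw [add_mul, sum_mul, sum_mul, ← sum_neg_distrib]; simp only [e1, e2, hK]
    rw [sum_prevColor_color (fun i j => k i - k j + |k i - k j|),
      sum_prevColor_color (fun i j => -((k i - k j) ^ 2 - |k i - k j|)), ← sum_add_distrib]
    refine sum_eq_of_telescope (g := fun i => k i ^ 2 - k i - N * k i * 2) fun i => ?_
    ring
  have hnn : ∀ d : ℤ, 0 ≤ d ^ 2 - |d| := fun d => by
    rw [← sq_abs]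
    rcases (abs_nonneg d).eq_or_lt with h | h
    · simp [← h]
    · nlinarith
  by_cases hall : ∀ i, K i ^ 2 - |K i| = 0
  · rw [sum_eq_zero fun i _ => hall i] at hE0 hE1
    rw [show ∑ i, E₀ i + ∑ i, min (K i) 0 = 0 by omega,
      show ∑ i, E₁ i + ∑ i, max (K i) 0 = 0 by omega] at htot
    have hsign : ∀ d : ℤ, d ^ 2 - |d| = 0 → d.sign = d := by
      intro d hd
      have h1 : |d| * (|d| - 1) = 0 := by rw [← sq_abs] at hd; linarith
      rcases mul_eq_zero.1 h1 with h | h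
      · rw [abs_eq_zero.1 h]; rfl
      · rcases (abs_eq zero_le_one).1 (sub_eq_zero.1 h) with rfl | rfl <;> rfl
    convert htot.limRatio using 1
    obtain rfl | hm0 := m.eq_zero_or_pos
    · simp
    obtain ⟨last, hlast⟩ : ∃ last : Fin m, (last : ℕ) + 1 = m := ⟨⟨m - 1, by omega⟩, by simp; omega⟩
    have e1 : ∑ i, R i + ∑ i, (K i).sign * (ζ + S i + L (prevColor i) - L i) =
        ∑ i, (k i : ℂ) * (S (nextColor i) - S i) := by
      simp [hsign _ (hall _)]; simp [hK]
      rw [sum_prevColor_color (fun i j => ((k i : ℂ) - k j) * (ζ + S j + L i - L j)),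
        ← sum_add_distrib]
      refine sum_eq_of_telescope (g := fun i => -(N * ∑ a, (p i a : ℂ) * l i a) + k i * L i
        - k i * ζ - k i * S i + Real.pi * Complex.I * N * k i) fun i => ?_
      simp [hR, sum_add_distrib, sum_sum_sub_mul]; simp [hk, hL]; ring
    rw [e1, sum_Iio_nextColor σ (fun i => (k i : ℂ)) last hlast, exp_sub, exp_sum,
      exp_int_mul, exp_sum]
    simp [← hσ, hs1]; refine prod_congr rfl fun i _ => ?_
    rw [exp_int_mul, ← hσ, hcard, zpow_natCast]
  · push Not at hall; obtain ⟨i, hi⟩ := hall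
    have h0 : 0 < ∑ i, (K i ^ 2 - |K i|) :=
      sum_pos' (fun i _ => hnn _) ⟨i, mem_univ _, lt_of_le_of_ne (hnn _) (Ne.symm hi)⟩
    exact htot.limRatio_of_pos (by omega) (by omega) _

theorem hasBetheLimits_gElement (hP : P.Admissible) {s : Fin m → ℂ} (hs0 : ∀ i, s i ≠ 0)
    (hs1 : ∏ i, s i = 1) (r : ℕ) : HasBetheLimits s N (gElement P s r N) := by
  classical
  rw [hasBetheLimits_iff]
  intro U x hx; have hfin := scaleOn_generic_finite hx U
  by_cases hm : m = 1
  · subst hm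
    have hs : ∀ i, s i = 1 := fun i => by rw [Subsingleton.elim i 0, ← hs1, Fin.prod_univ_one]
    have hr : LimRatio (fun ξ => ∏ p ∈ (univ : Finset (Fin 1 × Fin N)).offDiag, (P.q⁻¹ *
        ((scaleIf (p.1 ∈ U) ξ (x p.1.1 p.1.2) - P.q2 * scaleIf (p.2 ∈ U) ξ (x p.2.1 p.2.2)) /
        (scaleIf (p.1 ∈ U) ξ (x p.1.1 p.1.2) - scaleIf (p.2 ∈ U) ξ (x p.2.1 p.2.2)))))
        (∏ p ∈ (univ : Finset (Fin 1 × Fin N)).offDiag,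
          (1 * P.q2 ^ (indic (p.2 ∈ U) - indic (p.1 ∈ U)))) := by
      refine LimRatio.prod fun p hp => (LimRatio.const _).mul (limRatio_linear (hx.1 _ _) (hx.1 _ _)
        (fun h => (mem_offDiag.1 hp).2.2 (hx.2 h)) hP.q2_ne _ _)
    have hone : (∏ p ∈ (univ : Finset (Fin 1 × Fin N)).offDiag,
          (1 * P.q2 ^ (indic (p.2 ∈ U) - indic (p.1 ∈ U)))) = 1 := by
      rw [← pairProd_def (fun u v => 1 * P.q2 ^ (indic (v ∈ U) - indic (u ∈ U)))]
      rw [pairProd_congr_symm (k := fun _ _ => (1 : ℂ))]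
      · simp [pairProd]
      · intro u _ v _ _; rw [one_mul, one_mul, ← zpow_add₀ hP.q2_ne]; simp
    have h2 : LimRatio (fun ξ => eval (scaleOn U ξ x) (gElement P s r N)) 1 := by
      have h3 := hr.mul (LimRatio.const (esum r (fun _ : Fin 1 => (1 : ℂ))))
      rw [hone, one_mul] at h3; refine h3.congr hfin fun ξ hξ => ?_
      have hg : GenericTuple (scaleOn U ξ x) := by simpa using hξ
      rw [eval_gElement hP s r hg, gValue, gPre]
      congr 1
      · rw [tupleSet_eq_img, pairProd_img hg.pt_injective, pairProd_def]
        simp [gDiag]; refine prod_congr rfl fun p _ => ?_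
        have e1 : p.1.1 = p.2.1 := Subsingleton.elim _ _
        have e2 : p.2.1 = nextColor p.1.1 := Subsingleton.elim _ _
        rw [gPair_pt, if_pos rfl, if_pos e1, if_pos e2, mul_assoc, ← div_eq_mul_inv]
        have e3 : ∀ v, scaleOn U ξ x v.1 v.2 = scaleIf (v ∈ U) ξ (x v.1 v.2) := fun v =>
          congrArg Prod.snd (scaleOn_eq U ξ x v)
        rw [e3, e3]
      · congr 1; funext i
        rw [tSet_tupleSet hg, tFun, Subsingleton.elim (prevColor i) i, div_self, mul_one]
        · simp [prod_eq_one, symm]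
        · exact prod_ne_zero_iff.2 fun a _ => hg.1 i a
    simpa [hs] using h2
  · obtain ⟨w, hw⟩ := exists_esum_interpolation m r
    have h1 : LimRatio (fun ξ => ∑ j : Fin (m + 1), w j * (prefactorP P (scaleOn U ξ x) *
        ∏ i, (1 + ((j : ℕ) + 1 : ℂ) * tFun s (scaleOn U ξ x) i)))
        (∏ i, s i ^ (U.filter fun u => u.1 = i).card) := by
      refine LimRatio.sum fun j _ => ?_
      have h2 := (LimRatio.const (w j)).mul (limRatio_prefactorP_mul hP hm hs0 hs1 hx U
        (z := (j : ℕ) + 1) (Nat.cast_add_one_ne_zero _))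
      rwa [one_mul] at h2
    refine h1.congr hfin fun ξ hξ => ?_
    have hg : GenericTuple (scaleOn U ξ x) := by simpa using hξ
    have e : (tSet s (tupleSet (scaleOn U ξ x))) = tFun s (scaleOn U ξ x) :=
      funext fun i => tSet_tupleSet hg s i
    rw [eval_gElement hP s r hg, gValue, e, hw, prefactorP_eq hP hg, mul_sum]
    grind

theorem gElement_mem_betheComponent (hP : P.Admissible) {s : Fin m → ℂ} (hs : IsGeneric P s)
    (r N : ℕ) : gElement P s r N ∈ betheComponent P s N :=
  mem_betheComponent_iff.2 ⟨gElement_mem_shuffleComponent hP s r N,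
    hasBetheLimits_gElement hP hs.ne_zero hs.prod_eq_one r⟩

end GLimits

/-! ### The Bethe algebra as a polynomial algebra -/

section BetheSpace

variable {P : QParam} {m : ℕ} {s : Fin m → ℂ}

theorem one_mem_betheComponent : (1 : ShuffleAmbient P m) ∈ betheComponent P s 0 := by
  classical
  have hev : ∀ x : Fin m → Fin 0 → ℂ, eval x (1 : ShuffleAmbient P m) = 1 := by
    intro x
    have hx : GenericTuple x := ⟨fun _ a => a.elim0, fun v => v.2.elim0⟩
    rw [eval_eq_value hx, value_one, if_pos]; aesop
  refine mem_betheComponent_iff.2 ⟨mem_shuffleComponent_iff.2 ⟨?_, 1, 0, ?_, ?_⟩, ?_⟩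
  · intro T hT; rw [value_one, if_neg]; rintro rfl; exact hT fun i => by simp
  · intro x hx; rw [hev, pow_zero, poleProd, tupleSet_eq_img]; aesop
  · rintro x - ⟨i, a, -⟩; exact a.elim0
  · intro U x hx
    refine ⟨1, ?_, ?_⟩
    · simp [hev]
    · have : U = ∅ := by ext v; exact v.2.elim0
      simp [hev, this]

theorem mul_mem_betheSpace (hP : P.Admissible) {F G : ShuffleAmbient P m}
    (hF : F ∈ betheSpace P s) (hG : G ∈ betheSpace P s) : F * G ∈ betheSpace P s := by
  refine Submodule.iSup_induction _ (motive := fun F => F * G ∈ betheSpace P s) hF ?_ ?_ ?_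
  · intro M F hF
    refine Submodule.iSup_induction _ (motive := fun G => F * G ∈ betheSpace P s) hG ?_ ?_ ?_
    · intro K G hG
      exact Submodule.mem_iSup_of_mem (M + K) (mul_mem_betheComponent hP hF hG)
    · simp
    · intro G G' h h'; rw [mul_add]; aesop
  · simp
  · intro F F' h h'; rw [add_mul]; aesop

theorem toSubmodule_betheAlgebra (hP : P.Admissible) :
    Subalgebra.toSubmodule (betheAlgebra P s) = betheSpace P s := by
  let B : Subalgebra ℂ (ShuffleAmbient P m) := (betheSpace P s).toSubalgebra
    (Submodule.mem_iSup_of_mem 0 one_mem_betheComponent) fun _ _ => mul_mem_betheSpace hP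
  refine le_antisymm ?_ fun F hF => Algebra.subset_adjoin hF
  have : betheAlgebra P s ≤ B := Algebra.adjoin_le fun F hF => hF; exact this

theorem mem_betheAlgebra_iff (hP : P.Admissible) {F : ShuffleAmbient P m} :
    F ∈ betheAlgebra P s ↔ F ∈ betheSpace P s := by
  rw [← toSubmodule_betheAlgebra hP, Subalgebra.mem_toSubmodule]

theorem betheComponent_le_betheAlgebra {N : ℕ} {F : ShuffleAmbient P m}
    (hF : F ∈ betheComponent P s N) : F ∈ betheAlgebra P s :=
  Algebra.subset_adjoin (Submodule.mem_iSup_of_mem N hF)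

end BetheSpace

/-- The generators `G_{r,N}(s)`, `0 ≤ r ≤ m - 1`. -/
def gElements (P : QParam) {m : ℕ} (s : Fin m → ℂ) : Set (ShuffleAmbient P m) :=
  {F | ∃ r N : ℕ, r ≤ m - 1 ∧ F = gElement P s r N}

theorem finite_weight_eq (m N : ℕ) :
    {μ : (Fin m × ℕ+) →₀ ℕ | Finsupp.weight (fun v : Fin m × ℕ+ => (v.2 : ℕ)) μ = N}.Finite := by
  classical
  have hfin : {v : Fin m × ℕ+ | (v.2 : ℕ) ≤ N}.Finite := by
    refine (Set.finite_univ.prod (t := {k : ℕ+ | (k : ℕ) ≤ N}) ?_).subset fun v hv => ⟨trivial, hv⟩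
    exact Set.Finite.of_finite_image (f := fun k : ℕ+ => (k : ℕ))
      ((Set.finite_Iic N).subset (by grind))
      fun a _ b _ h => PNat.coe_injective h
  refine (Set.finite_Iic (Finsupp.indicator hfin.toFinset fun _ _ => N)).subset fun μ hμ => ?_
  have hμ' : ∑ v ∈ μ.support, μ v * (v.2 : ℕ) = N := by aesop
  intro v
  by_cases hv : μ v = 0
  · grind
  · have h1 : μ v * (v.2 : ℕ) ≤ N := by
      rw [← hμ']
      exact single_le_sum (f := fun v => μ v * (v.2 : ℕ)) (fun _ _ => Nat.zero_le _)
        (Finsupp.mem_support_iff.2 hv)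
    have h2 : (v.2 : ℕ) ≤ N := (Nat.le_mul_of_pos_left _ (Nat.pos_of_ne_zero hv)).trans h1
    rw [Finsupp.indicator_of_mem (hfin.mem_toFinset.2 h2)]
    exact (Nat.le_mul_of_pos_right _ v.2.pos).trans h1

section Assembly

variable {P : QParam} {m : ℕ} {s : Fin m → ℂ}

open MvPolynomial in
theorem exists_graded_iso (hP : P.Admissible) (hs : IsGeneric P s) (hm : m ≠ 0)
    (H : Submodule ℂ (ShuffleAmbient P m × MvPolynomial (Fin m × ℕ+) ℂ))
    (h_one : ((1, 1) : ShuffleAmbient P m × MvPolynomial (Fin m × ℕ+) ℂ) ∈ H)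
    (h_mul : ∀ F ∈ betheSpace P s, ∀ G ∈ betheSpace P s, ∀ p q, (F, p) ∈ H → (G, q) ∈ H →
      (F * G, p * q) ∈ H)
    (h_inj : ∀ p, (0, p) ∈ H → p = 0)
    (h_gen : ∀ v : Fin m × ℕ+, ∃ F ∈ betheComponent P s v.2,
      F ∈ Algebra.adjoin ℂ (gElements P s) ∧ (F, X v) ∈ H) :
    Algebra.adjoin ℂ (gElements P s) = betheAlgebra P s ∧
    ∃ e : MvPolynomial (Fin m × ℕ+) ℂ ≃ₐ[ℂ] betheAlgebra P s,
      (∀ p, ((e p : ShuffleAmbient P m), p) ∈ H) ∧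
      ∀ (N : ℕ) (p : MvPolynomial (Fin m × ℕ+) ℂ),
        IsWeightedHomogeneous (fun v : Fin m × ℕ+ => (v.2 : ℕ)) p N ↔
          (e p : ShuffleAmbient P m) ∈ betheComponent P s N := by
  classical
  set wt : (Fin m × ℕ+) → ℕ := fun v => (v.2 : ℕ) with hwt
  have h_mon : ∀ μ : (Fin m × ℕ+) →₀ ℕ, ∃ F ∈ betheComponent P s (Finsupp.weight wt μ),
      F ∈ Algebra.adjoin ℂ (gElements P s) ∧ (F, monomial μ (1 : ℂ)) ∈ H := by
    intro μ
    induction μ using Finsupp.induction_linear with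
    | zero => exact ⟨1, by simpa using one_mem_betheComponent, one_mem _, by simpa using h_one⟩
    | add μ ν h1 h2 =>
      obtain ⟨F, hF, hF', hFH⟩ := h1; obtain ⟨G, hG, hG', hGH⟩ := h2
      refine ⟨F * G, by rw [map_add]; exact mul_mem_betheComponent hP hF hG, mul_mem hF' hG', ?_⟩
      rw [← mul_one (1 : ℂ), ← monomial_mul]
      exact h_mul F (Submodule.mem_iSup_of_mem _ hF) G (Submodule.mem_iSup_of_mem _ hG) _ _ hFH hGH
    | single v k =>
      induction k with
      | zero => exact ⟨1, by simpa using one_mem_betheComponent, one_mem _, by simpa using h_one⟩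
      | succ k ih =>
        obtain ⟨F, hF, hF', hFH⟩ := ih; obtain ⟨G, hG, hG', hGH⟩ := h_gen v
        refine ⟨F * G, ?_, mul_mem hF' hG', ?_⟩
        · have : Finsupp.weight wt (Finsupp.single v (k + 1)) =
              Finsupp.weight wt (Finsupp.single v k) + v.2 := by
            simp [Finsupp.weight_single, hwt]
          rw [this]; exact mul_mem_betheComponent hP hF hG
        · rw [Finsupp.single_add, ← mul_one (1 : ℂ), ← monomial_mul]
          exact h_mul F (Submodule.mem_iSup_of_mem _ hF) G (Submodule.mem_iSup_of_mem _ hG) _ _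
            hFH hGH
  choose Fm hFm hFm_adj hFm_H using h_mon
  obtain ⟨Λ, hΛ⟩ : ∃ Λ : MvPolynomial (Fin m × ℕ+) ℂ →ₗ[ℂ] ShuffleAmbient P m,
      ∀ μ, Λ (monomial μ 1) = Fm μ :=
    ⟨(basisMonomials _ ℂ).constr ℂ Fm, fun μ => by
      exact ((basisMonomials _ ℂ).constr_basis ℂ Fm μ : _)⟩
  have hsum : ∀ p : MvPolynomial (Fin m × ℕ+) ℂ, p = ∑ μ ∈ p.support, p.coeff μ • monomial μ 1 := by
    intro p
    conv_lhs => rw [p.as_sum]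
    exact sum_congr rfl fun μ _ => by rw [smul_monomial, smul_eq_mul, mul_one]
  have hΛsum : ∀ p, Λ p = ∑ μ ∈ p.support, p.coeff μ • Fm μ := by
    intro p
    conv_lhs => rw [hsum p]
    simp [hΛ]
  have hΛH : ∀ p, (Λ p, p) ∈ H := by
    intro p
    have : (Λ p, p) = ∑ μ ∈ p.support, p.coeff μ • (Fm μ, monomial μ (1 : ℂ)) := by
      refine Prod.ext ?_ ?_
      · rw [Prod.fst_sum, hΛsum]; rfl
      · rw [Prod.snd_sum]; exact hsum p
    rw [this]
    exact Submodule.sum_mem _ fun μ _ => Submodule.smul_mem _ _ (hFm_H μ)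
  have hΛadj : ∀ p, Λ p ∈ Algebra.adjoin ℂ (gElements P s) := by
    intro p; rw [hΛsum]
    exact Subalgebra.sum_mem _ fun μ _ => Subalgebra.smul_mem _ (hFm_adj μ) _
  have hΛB : ∀ p, Λ p ∈ betheSpace P s := by
    intro p; rw [hΛsum]
    exact Submodule.sum_mem _ fun μ _ => Submodule.smul_mem _ _
      (Submodule.mem_iSup_of_mem _ (hFm μ))
  have hΛhom : ∀ N p, IsWeightedHomogeneous wt p N → Λ p ∈ betheComponent P s N := by
    intro N p hp; rw [hΛsum]
    refine Submodule.sum_mem _ fun μ hμ => Submodule.smul_mem _ _ ?_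
    rw [← hp (mem_support_iff.1 hμ)]; exact hFm μ
  have hΛinj : ∀ p, Λ p = 0 → p = 0 := fun p hp => h_inj p (hp ▸ hΛH p)
  have hsurj : ∀ N, ∀ F ∈ betheComponent P s N, ∃ p, IsWeightedHomogeneous wt p N ∧ Λ p = F := by
    intro N F hF; obtain ⟨ev, hev⟩ := exists_separating_functionals hP hs hm N
    have hfin := finite_weight_eq m N; set S := hfin.toFinset with hS
    let poly : (S → ℂ) →ₗ[ℂ] MvPolynomial (Fin m × ℕ+) ℂ :=
      { toFun := fun c => ∑ μ : S, c μ • monomial μ.1 1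
        map_add' := fun c c' => by simp [add_smul, sum_add_distrib]
        map_smul' := fun a c => by simp [mul_smul, smul_sum] }
    have hpoly : ∀ c, IsWeightedHomogeneous wt (poly c) N := by
      intro c; rw [← mem_weightedHomogeneousSubmodule]
      refine Submodule.sum_mem _ fun μ _ => Submodule.smul_mem _ _ ?_
      exact isWeightedHomogeneous_monomial _ _ _ (hfin.mem_toFinset.1 μ.2)
    have hpoly0 : ∀ c, poly c = 0 → c = 0 := by
      intro c hc; funext μ; have := congrArg (coeff μ.1) hc
      have e : ∀ ν : S, coeff μ.1 (c ν • monomial ν.1 (1 : ℂ)) = if ν = μ then c ν else 0 := by simp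
      rw [show poly c = ∑ μ : S, c μ • monomial μ.1 1 from rfl, coeff_sum] at this
      rw [sum_congr rfl fun ν _ => e ν, sum_ite_eq', if_pos (mem_univ _), coeff_zero] at this
      exact this
    let T : (S → ℂ) →ₗ[ℂ] (S → ℂ) := LinearMap.pi (fun μ => ev μ.1) ∘ₗ Λ ∘ₗ poly
    have hT : Function.Injective T := by
      rw [injective_iff_map_eq_zero]; intro c hc
      refine hpoly0 c (hΛinj _ (hev _ (hΛhom N _ (hpoly c)) fun μ hμ => ?_))
      exact congrFun hc ⟨μ, hfin.mem_toFinset.2 hμ⟩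
    obtain ⟨c, hc⟩ := (LinearMap.injective_iff_surjective.1 hT) fun μ => ev μ.1 F
    refine ⟨poly c, hpoly c, ?_⟩; rw [← sub_eq_zero]
    refine hev _ (Submodule.sub_mem _ (hΛhom N _ (hpoly c)) hF) fun μ hμ => ?_
    rw [map_sub, sub_eq_zero]; exact congrFun hc ⟨μ, hfin.mem_toFinset.2 hμ⟩
  have hsurj' : ∀ F ∈ betheSpace P s, ∃ p, Λ p = F := by
    have : betheSpace P s ≤ LinearMap.range Λ := iSup_le fun N F hF => by
      obtain ⟨p, -, h⟩ := hsurj N F hF; exact ⟨p, h⟩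
    exact fun F hF => this hF
  have huniq : ∀ F ∈ betheSpace P s, ∀ p, (F, p) ∈ H → F = Λ p := by
    intro F hF p hp; obtain ⟨p', rfl⟩ := hsurj' F hF
    have := h_inj (p' - p) (by simpa using Submodule.sub_mem _ (hΛH p') hp)
    rw [sub_eq_zero.1 this]
  have hΛone : Λ 1 = 1 :=
    (huniq 1 (Submodule.mem_iSup_of_mem 0 one_mem_betheComponent) 1 h_one).symm
  have hΛmul : ∀ p q, Λ (p * q) = Λ p * Λ q := fun p q =>
    (huniq _ (mul_mem_betheSpace hP (hΛB p) (hΛB q)) _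
      (h_mul _ (hΛB p) _ (hΛB q) _ _ (hΛH p) (hΛH q))).symm
  refine ⟨le_antisymm (Algebra.adjoin_le ?_) fun F hF => ?_, ?_⟩
  · rintro F ⟨r, N, -, rfl⟩
    exact betheComponent_le_betheAlgebra (gElement_mem_betheComponent hP hs r N)
  · obtain ⟨p, rfl⟩ := hsurj' F ((mem_betheAlgebra_iff hP).1 hF); exact hΛadj p
  · let f : MvPolynomial (Fin m × ℕ+) ℂ →ₐ[ℂ] betheAlgebra P s :=
      (AlgHom.ofLinearMap Λ hΛone hΛmul).codRestrict _ fun p => (mem_betheAlgebra_iff hP).2 (hΛB p)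
    have hf : ∀ p, ((f p : betheAlgebra P s) : ShuffleAmbient P m) = Λ p := fun p => rfl
    have hfb : Function.Bijective f := by
      constructor
      · rw [injective_iff_map_eq_zero]; intro p hp; refine hΛinj p ?_
        rw [← hf, hp]; rfl
      · rintro ⟨F, hF⟩
        obtain ⟨p, rfl⟩ := hsurj' F ((mem_betheAlgebra_iff hP).1 hF)
        exact ⟨p, rfl⟩
    refine ⟨AlgEquiv.ofBijective f hfb, fun p => hΛH p, fun N p => ⟨hΛhom N p, fun h => ?_⟩⟩
    obtain ⟨p', hp', h'⟩ := hsurj N _ h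
    have : p' - p = 0 := hΛinj _ (by rw [map_sub, h', sub_eq_zero]; rfl)
    rwa [← sub_eq_zero.1 this]

end Assembly

/-! ### One color: limits at strings with ratio `q₂` -/

section OneColor

variable {P : QParam} {n K : ℕ}

/-- The cells `(s, j)` with `a s ≤ j < a s + b s`. -/
def segCells (K : ℕ) {n : ℕ} (a b : Fin n → ℕ) : Finset (Fin n × Fin K) :=
  univ.filter fun v => a v.1 ≤ v.2 ∧ (v.2 : ℕ) < a v.1 + b v.1

theorem mem_segCells {a b : Fin n → ℕ} {v : Fin n × Fin K} :
    v ∈ segCells K a b ↔ a v.1 ≤ v.2 ∧ (v.2 : ℕ) < a v.1 + b v.1 := by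
  simp [segCells]

theorem prod_segCells {M : Type} [CommMonoid M] {a b : Fin n → ℕ} (h : ∀ s, a s + b s ≤ K)
    (f : Fin n → ℕ → M) :
    ∏ v ∈ segCells K a b, f v.1 v.2 = ∏ s, ∏ j ∈ range (b s), f s (a s + j) := by
  rw [segCells, prod_filter, Fintype.prod_prod_type]
  refine prod_congr rfl fun s _ => ?_
  rw [Fin.prod_univ_eq_prod_range (fun j => if a s ≤ j ∧ j < a s + b s then f s j else 1) K,
    ← prod_filter]
  have : (range K).filter (fun j => a s ≤ j ∧ j < a s + b s) = Ico (a s) (a s + b s) := by grind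
  rw [this, prod_Ico_eq_prod_range, Nat.add_sub_cancel_left]

/-- The points `q₂ ^ j ξ ^ (s + 1)`. -/
def qString (P : QParam) (ξ : ℂ) (v : Fin n × Fin K) : Fin 1 × ℂ :=
  (0, P.q2 ^ (v.2 : ℕ) * ξ ^ ((v.1 : ℕ) + 1))

theorem QParam.Admissible.q2_pow_injective (hP : P.Admissible) {i j : ℕ}
    (h : P.q2 ^ i = P.q2 ^ j) : i = j := by
  have := hP.indep 0 ((i : ℤ) - j) 0 (by
    rw [zpow_sub₀ hP.q2_ne, zpow_natCast, zpow_natCast, h]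
    simp [div_self (pow_ne_zero j hP.q2_ne)])
  omega

theorem eventually_qString (hP : P.Admissible) (n K : ℕ) : ∀ᶠ ξ in Bornology.cobounded ℂ,
    ξ ≠ 0 ∧ Function.Injective (qString (n := n) (K := K) P ξ) := by
  have hfin : ({0} ∪ ⋃ p : (Fin n × Fin K) × (Fin n × Fin K), {ξ : ℂ | p.1.1 ≠ p.2.1 ∧
      P.q2 ^ (p.1.2 : ℕ) * ξ ^ ((p.1.1 : ℕ) + 1) =
        P.q2 ^ (p.2.2 : ℕ) * ξ ^ ((p.2.1 : ℕ) + 1)}).Finite := by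
    refine (Set.finite_singleton _).union (Set.finite_iUnion fun p => ?_)
    by_cases hp : p.1.1 = p.2.1
    · simp [hp]
    · have hne : Polynomial.C (P.q2 ^ (p.1.2 : ℕ)) * Polynomial.X ^ ((p.1.1 : ℕ) + 1) -
          Polynomial.C (P.q2 ^ (p.2.2 : ℕ)) * Polynomial.X ^ ((p.2.1 : ℕ) + 1) ≠ 0 := by
        intro h; have h1 := congrArg (Polynomial.coeff · ((p.1.1 : ℕ) + 1)) h
        simp only [Polynomial.coeff_sub, Polynomial.coeff_C_mul, Polynomial.coeff_X_pow,
          if_true, Polynomial.coeff_zero, mul_one] at h1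
        rw [if_neg (by grind), mul_zero, sub_zero] at h1
        exact pow_ne_zero _ hP.q2_ne h1
      refine (Polynomial.finite_setOfPred_isRoot hne).subset fun ξ hξ => ?_
      simp_all
  filter_upwards [(eventually_notMem_of_finite hfin).2] with ξ hξ
  simp only [Set.mem_union, Set.mem_singleton_iff, Set.mem_iUnion, not_or, not_exists] at hξ
  refine ⟨hξ.1, fun u v huv => ?_⟩
  have h : P.q2 ^ (u.2 : ℕ) * ξ ^ ((u.1 : ℕ) + 1) = P.q2 ^ (v.2 : ℕ) * ξ ^ ((v.1 : ℕ) + 1) :=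
    congrArg Prod.snd huv
  have h1 : u.1 = v.1 := by by_contra h1; exact hξ.2 (u, v) ⟨h1, h⟩
  rw [h1] at h
  exact Prod.ext h1 (Fin.ext (hP.q2_pow_injective (mul_right_cancel₀ (pow_ne_zero _ hξ.1) h)))

theorem genericSet_qString (hP : P.Admissible) {ξ : ℂ} (hξ : ξ ≠ 0)
    (I : Finset (Fin n × Fin K)) : GenericSet (img (qString P ξ) I) := by
  constructor
  · intro p hp; obtain ⟨v, -, rfl⟩ := mem_img.1 hp
    exact mul_ne_zero (pow_ne_zero _ hP.q2_ne) (pow_ne_zero _ hξ)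
  simp

theorem tendsto_string_ratio {a b : ℂ} {i j : ℕ} (hij : i < j) :
    Tendsto (fun ξ : ℂ => b * ξ ^ i / (a * ξ ^ j)) (Bornology.cobounded ℂ) (𝓝 0) := by
  obtain ⟨k, hk, rfl⟩ : ∃ k, k ≠ 0 ∧ j = i + k := ⟨j - i, by omega, by omega⟩
  have h1 := (tendsto_inv_nhdsNE_cobounded.pow k).const_mul (b / a)
  grind [zero_pow, mul_zero, HasAsymptotics.eventually_ne, pow_ne_zero, pow_add, inv_pow]

theorem tendsto_linear_string {a b : ℂ} (ha : a ≠ 0) (hb : b ≠ 0) {i j : ℕ} (hij : i ≠ j) (c : ℂ) :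
    Tendsto (fun ξ : ℂ => (a * ξ ^ i - c * (b * ξ ^ j)) / (a * ξ ^ i - b * ξ ^ j))
      (Bornology.cobounded ℂ) (𝓝 (if j < i then 1 else c)) := by
  rcases Nat.lt_or_gt_of_ne hij with h | h
  · rw [if_neg (by omega)]
    have h1 : Tendsto (fun ξ : ℂ => a * ξ ^ i / (b * ξ ^ j)) _ _ := tendsto_string_ratio h
    have h2 := (h1.sub_const c).div (h1.sub_const 1) (by norm_num)
    rw [zero_sub, zero_sub, neg_div_neg_eq, div_one] at h2
    refine h2.congr' (HasAsymptotics.eventually_ne.2.mono fun ξ hξ => ?_)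
    have hy : b * ξ ^ j ≠ 0 := mul_ne_zero hb (pow_ne_zero _ hξ); simp; grind
  · rw [if_pos h]
    have h1 : Tendsto (fun ξ : ℂ => b * ξ ^ j / (a * ξ ^ i)) _ _ := tendsto_string_ratio h
    have h2 := ((h1.const_mul c).const_sub 1).div (h1.const_sub 1) (by norm_num)
    rw [mul_zero, sub_zero, div_one] at h2
    refine h2.congr' (HasAsymptotics.eventually_ne.2.mono fun ξ hξ => ?_)
    grind [mul_ne_zero, pow_ne_zero, Pi.div_apply]

/-- The structure function on points of a string. -/
def stringOmega (P : QParam) (i j : ℕ) : ℂ := omega P 1 (0, P.q2 ^ i) (0, P.q2 ^ j)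

theorem omega_one (x y : ℂ) : omega P 1 (0, x) (0, y) =
    (x - P.q1 * y) / (x - y) * ((x - P.q2 * y) / (x - y)) * ((x - P.q3 * y) / (x - y)) := by
  simp [omega]; grind

theorem omega_one_scale {c : ℂ} (hc : c ≠ 0) (x y : ℂ) :
    omega P 1 (0, c * x) (0, c * y) = omega P 1 (0, x) (0, y) := by
  grind [omega_one]

theorem stringOmega_shift (hP : P.Admissible) (a i j : ℕ) :
    stringOmega P (a + i) (a + j) = stringOmega P i j := by
  rw [stringOmega, pow_add, pow_add, omega_one_scale (pow_ne_zero _ hP.q2_ne)]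
  rfl

theorem stringOmega_succ (i : ℕ) : stringOmega P (i + 1) i = 0 := by
  rw [stringOmega, omega_one, pow_succ']; simp

theorem stringOmega_ne_zero (hP : P.Admissible) {i j : ℕ} (hij : i < j) : stringOmega P i j ≠ 0 := by
  have h2 := hP.q2_ne
  have key : ∀ a b c : ℤ, P.q1 ^ a * P.q2 ^ b * P.q3 ^ c * P.q2 ^ ((j : ℤ) - i) = 1 →
      a = b + (j - i) ∧ b + (j - i) = c := by
    intro a b c h; refine hP.indep a _ c ?_; rw [zpow_add₀ h2, ← h]; ring
  have key' : ∀ (r : ℂ) (a b c : ℤ), r = P.q1 ^ a * P.q2 ^ b * P.q3 ^ c →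
      ¬ (a = b + (j - i) ∧ b + (j - i) = c) → P.q2 ^ i - r * P.q2 ^ j ≠ 0 := by
    intro r a b c hr hn h; refine hn (key a b c ?_)
    rw [← hr, zpow_sub₀ h2, zpow_natCast, zpow_natCast, mul_div_assoc', ← sub_eq_zero.1 h,
      div_self (pow_ne_zero _ h2)]
  rw [stringOmega, omega_one]
  have e0 : P.q2 ^ i - P.q2 ^ j ≠ 0 := by
    have := key' 1 0 0 0 (by simp) (by omega)
    rwa [one_mul] at this
  refine mul_ne_zero (mul_ne_zero (div_ne_zero ?_ e0) (div_ne_zero ?_ e0)) (div_ne_zero ?_ e0)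
  · exact key' _ 1 0 0 (by simp) (by omega)
  · exact key' _ 0 1 0 (by simp) (by omega)
  · exact key' _ 0 0 1 (by simp) (by omega)

/-- The product of the structure functions over the ordered pairs of points of a string. -/
def stringWeight (P : QParam) (L : ℕ) : ℂ := ∏ j ∈ range L, ∏ i ∈ range j, stringOmega P i j

theorem stringWeight_ne_zero (hP : P.Admissible) (L : ℕ) : stringWeight P L ≠ 0 :=
  prod_ne_zero_iff.2 fun _ _ => prod_ne_zero_iff.2 fun _ hi =>
    stringOmega_ne_zero hP (mem_range.1 hi)

theorem stringWeight_add (hP : P.Admissible) (a b : ℕ) :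
    stringWeight P (a + b) = stringWeight P a * stringWeight P b *
      ∏ i ∈ range a, ∏ j ∈ range b, stringOmega P i (a + j) := by
  rw [stringWeight, prod_range_add, stringWeight, stringWeight, mul_assoc]
  congr 1; rw [Finset.prod_comm, ← prod_mul_distrib]
  refine prod_congr rfl fun j _ => ?_; rw [prod_range_add, mul_comm]; congr 1
  exact prod_congr rfl fun i _ => stringOmega_shift hP a i j

theorem tendsto_omega_qString (hP : P.Admissible) (u v : Fin n × Fin K) :
    Tendsto (fun ξ => omega P 1 (qString P ξ u) (qString P ξ v)) (Bornology.cobounded ℂ)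
      (𝓝 (if u.1 = v.1 then stringOmega P u.2 v.2 else 1)) := by
  have h2 := hP.q2_ne
  split_ifs with h
  · refine tendsto_const_nhds.congr' (HasAsymptotics.eventually_ne.2.mono fun ξ hξ => ?_)
    simp [qString]
    rw [h, mul_comm, mul_comm (P.q2 ^ (v.2 : ℕ)), omega_one_scale (pow_ne_zero _ hξ)]
    rfl
  · have hij : (u.1 : ℕ) + 1 ≠ v.1 + 1 := fun h' => h (Fin.ext (by omega))
    simp [qString, omega_one]
    have h3 := fun c => tendsto_linear_string (pow_ne_zero (u.2 : ℕ) h2) (pow_ne_zero (v.2 : ℕ) h2)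
      hij c
    have h4 := ((h3 P.q1).mul (h3 P.q2)).mul (h3 P.q3); convert h4 using 2
    split_ifs
    · simp
    · exact hP.prod_eq_one.symm

/-- The limits of the values of `F` at collections of `n` strings, as the strings are moved apart,
are given by the coefficients of `θ`. -/
def HasStringLimits (P : QParam) (n : ℕ) (F : ShuffleAmbient P 1) (θ : MvPolynomial (Fin n) ℂ) :
    Prop :=
  ∀ (K : ℕ) (a : Fin n → ℕ) (l : Fin n →₀ ℕ), (∀ s, a s + l s ≤ K) →
    Tendsto (fun ξ => F.value (img (qString P ξ) (segCells K a l))) (Bornology.cobounded ℂ)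
      (𝓝 ((∏ s, stringWeight P (l s)) * θ.coeff l))

namespace HasStringLimits

variable {F G : ShuffleAmbient P 1} {θ η : MvPolynomial (Fin n) ℂ}

theorem add (hF : HasStringLimits P n F θ) (hG : HasStringLimits P n G η) :
    HasStringLimits P n (F + G) (θ + η) := by
  intro K a l h; simp [value_add, mul_add]; exact (hF K a l h).add (hG K a l h)

theorem smul (c : ℂ) (hF : HasStringLimits P n F θ) : HasStringLimits P n (c • F) (c • θ) := by
  intro K a l h; simp [value_smul]; rw [mul_left_comm]
  exact (hF K a l h).const_mul c

theorem zero : HasStringLimits P n 0 0 := by intro K a l h; simp [value_zero]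

theorem eq_zero (hP : P.Admissible) (h : HasStringLimits P n 0 θ) : θ = 0 := by
  ext l
  obtain ⟨K, hK⟩ : ∃ K, ∀ s, l s ≤ K := ⟨∑ s, l s, fun s =>
    single_le_sum (f := fun s => l s) (fun _ _ => Nat.zero_le _) (mem_univ s)⟩
  have h1 := h K (fun _ => 0) l fun s => by simpa using hK s
  simp only [value_zero] at h1
  have h2 := tendsto_nhds_unique h1 tendsto_const_nhds
  grind [MvPolynomial.coeff_zero, mul_eq_zero, prod_ne_zero_iff, stringWeight_ne_zero]

theorem one : HasStringLimits P n 1 1 := by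
  classical
  intro K a l h
  simp [value_one, MvPolynomial.coeff_one]
  by_cases hl : l = 0
  · subst hl
    have e : ∀ ξ, img (qString P ξ) (segCells K a (0 : Fin n →₀ ℕ)) = ∅ := by
      intro ξ; ext w
      simp [mem_img, mem_segCells, notMem_empty, iff_false]
    simp only [e, if_true, Finsupp.zero_apply, stringWeight, range_zero,
      prod_empty, prod_const_one]
    exact tendsto_const_nhds
  · obtain ⟨s, hs⟩ := Finsupp.ne_iff.1 hl; rw [Finsupp.zero_apply] at hs
    have e : ∀ ξ, img (qString P ξ) (segCells K a l) ≠ ∅ := by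
      intro ξ h0; have h2 : a s < K := by have := h s; omega
      have h1 : qString P ξ (s, (⟨a s, h2⟩ : Fin K)) ∈ img (qString P ξ) (segCells K a l) :=
        mem_img.2 ⟨_, mem_segCells.2 ⟨le_refl (a s), show a s < a s + l s by omega⟩, rfl⟩
      grind
    simp only [e, if_false, if_neg (Ne.symm hl)]
    exact tendsto_const_nhds

end HasStringLimits

theorem exists_eq_segCells {a l : Fin n → ℕ} {I : Finset (Fin n × Fin K)} (hI : I ⊆ segCells K a l)
    (hlow : ∀ u ∈ I, ∀ v ∈ segCells K a l, u.1 = v.1 → (u.2 : ℕ) = v.2 + 1 → v ∈ I) :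
    ∃ b : Fin n → ℕ, (∀ s, b s ≤ l s) ∧ I = segCells K a b := by
  classical
  have hseg : ∀ (s : Fin n), ∀ (d j : ℕ) (hj : j + d < K), a s ≤ j → (s, ⟨j + d, hj⟩) ∈ I →
      (s, ⟨j, by omega⟩) ∈ I := by
    intro s d
    induction d with
    | zero => intro j hj _ h; exact h
    | succ d ih =>
      intro j hj ha h; refine ih j (by omega) ha ?_
      have h1 := mem_segCells.1 (hI h); simp only at h1
      exact hlow _ h (s, ⟨j + d, by omega⟩) (mem_segCells.2 ⟨by simp only; omega, by simp only; omega⟩)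
        rfl (by simp only; omega)
  refine ⟨fun s => (I.filter fun u => u.1 = s).sup fun u => (u.2 : ℕ) + 1 - a s, fun s => ?_, ?_⟩
  · refine Finset.sup_le fun u hu => ?_; grind [mem_segCells]
  · ext ⟨s, j⟩; rw [mem_segCells]
    constructor
    · intro hu; have h1 := mem_segCells.1 (hI hu)
      have h2 : (j : ℕ) + 1 - a s ≤ (I.filter fun u => u.1 = s).sup fun u => (u.2 : ℕ) + 1 - a s :=
        le_sup (s := I.filter fun u => u.1 = s)
          (f := fun u : Fin n × Fin K => (u.2 : ℕ) + 1 - a s) (b := (s, j))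
          (mem_filter.2 ⟨hu, rfl⟩)
      grind
    · rintro ⟨h1, h2⟩; simp only at h1 h2
      have h3 : (j : ℕ) - a s < (I.filter fun u => u.1 = s).sup fun u => (u.2 : ℕ) + 1 - a s := by
        omega
      obtain ⟨⟨s', k⟩, hu, hk⟩ := Finset.lt_sup_iff.1 h3; simp only at hk h1
      obtain ⟨d, hd⟩ : ∃ d, (k : ℕ) = j + d := ⟨k - j, by omega⟩
      grind

theorem HasStringLimits.mul (hP : P.Admissible) {F G : ShuffleAmbient P 1}
    {θ η : MvPolynomial (Fin n) ℂ} (hF : HasStringLimits P n F θ) (hG : HasStringLimits P n G η) :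
    HasStringLimits P n (F * G) (θ * η) := by
  classical
  intro K a l h
  have hb : ∀ p ∈ Finset.HasAntidiagonal.antidiagonal l, ∀ s, p.1 s + p.2 s = l s := fun p hp s => by
    aesop
  have hdiff : ∀ p ∈ Finset.HasAntidiagonal.antidiagonal l,
      segCells K a l \ segCells K a p.1 = segCells K (fun s => a s + p.1 s) p.2 := by
    intro p hp; grind [mem_segCells]
  have hsub : ∀ p ∈ Finset.HasAntidiagonal.antidiagonal l, segCells K a p.1 ⊆ segCells K a l := by
    intro p hp v; grind [mem_segCells]
  have hinj : ∀ p ∈ Finset.HasAntidiagonal.antidiagonal l, ∀ p' ∈ Finset.HasAntidiagonal.antidiagonal l,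
      segCells K a p.1 = segCells K a p'.1 → p = p' := by
    have key : ∀ p ∈ Finset.HasAntidiagonal.antidiagonal l,
        ∀ p' ∈ Finset.HasAntidiagonal.antidiagonal l,
        segCells K a p.1 = segCells K a p'.1 → ∀ s, p.1 s ≤ p'.1 s := by
      intro p hp p' hp' e s; by_contra hlt; have h1 := hb p hp s
      have h2 : a s + p'.1 s < K := by have := h s; omega
      have h3 : (s, (⟨a s + p'.1 s, h2⟩ : Fin K)) ∈ segCells K a p.1 :=
        mem_segCells.2 ⟨show a s ≤ a s + p'.1 s by omega, show a s + p'.1 s < a s + p.1 s by omega⟩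
      grind [mem_segCells]
    intro p hp p' hp' e
    have h1 : p.1 = p'.1 := Finsupp.ext fun s =>
      le_antisymm (key p hp p' hp' e s) (key p' hp' p hp e.symm s)
    refine Prod.ext h1 (Finsupp.ext fun s => ?_); grind
  have hsum : ∀ᶠ ξ in Bornology.cobounded ℂ,
      ∑ p ∈ Finset.HasAntidiagonal.antidiagonal l, F.value (img (qString P ξ) (segCells K a p.1)) *
        G.value (img (qString P ξ) (segCells K (fun s => a s + p.1 s) p.2)) *
        ∏ u ∈ segCells K a p.1, ∏ v ∈ segCells K (fun s => a s + p.1 s) p.2,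
          omega P 1 (qString P ξ u) (qString P ξ v) =
      (F * G).value (img (qString P ξ) (segCells K a l)) := by
    filter_upwards [eventually_qString hP n K] with ξ ⟨hξ, hi⟩
    rw [value_mul F G (genericSet_qString hP hξ _), conv_img _ _ _ hi]
    rw [← sum_subset (s₁ := (Finset.HasAntidiagonal.antidiagonal l).image fun p => segCells K a p.1),
      sum_image hinj]
    · refine sum_congr rfl fun p hp => ?_; grind
    · grind
    · intro I hI hn; rw [mem_powerset] at hI; by_contra hne; refine hn ?_
      obtain ⟨b, hbl, rfl⟩ := exists_eq_segCells hI (by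
        intro u hu v hv h1 h2; by_contra hv'; refine hne ?_
        refine mul_eq_zero_of_right _ (prod_eq_zero hu (prod_eq_zero
          ((@Finset.mem_sdiff _ (fun a b => Classical.propDecidable (a = b)) _ _ _).2 ⟨hv, hv'⟩) ?_))
        simp [qString]
        rw [h1, h2, mul_comm, mul_comm (P.q2 ^ (v.2 : ℕ)), omega_one_scale (pow_ne_zero _ hξ)]
        exact stringOmega_succ _)
      refine mem_image.2 ⟨(Finsupp.equivFunOnFinite.symm b,
        l - Finsupp.equivFunOnFinite.symm b), Finset.HasAntidiagonal.mem_antidiagonal.2 ?_, rfl⟩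
      ext s; have := hbl s; simp; omega
  refine Tendsto.congr' hsum ?_; rw [MvPolynomial.coeff_mul, mul_sum]
  refine tendsto_finsetSum _ fun p hp => ?_
  have hle : ∀ s, a s + p.1 s ≤ K := fun s => by grind
  have hle' : ∀ s, (a s + p.1 s) + p.2 s ≤ K := fun s => by grind
  have h1 := ((hF K a p.1 hle).mul (hG K _ p.2 hle')).mul
    (tendsto_finsetProd (segCells K a p.1) fun u _ =>
      tendsto_finsetProd (segCells K (fun s => a s + p.1 s) p.2) fun v _ =>
        tendsto_omega_qString hP u v)
  convert h1 using 2
  have h2 : ∏ u ∈ segCells K a p.1, ∏ v ∈ segCells K (fun s => a s + p.1 s) p.2,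
      (if u.1 = v.1 then stringOmega P u.2 v.2 else 1) =
      ∏ s, ∏ i ∈ range (p.1 s), ∏ j ∈ range (p.2 s), stringOmega P i (p.1 s + j) := by
    have e1 : ∀ u : Fin n × Fin K, ∏ v ∈ segCells K (fun s => a s + p.1 s) p.2,
        (if u.1 = v.1 then stringOmega P u.2 v.2 else 1) =
        ∏ j ∈ range (p.2 u.1), stringOmega P u.2 (a u.1 + p.1 u.1 + j) := by
      intro u
      rw [prod_segCells hle' fun t j => if u.1 = t then stringOmega P u.2 j else 1,
        prod_eq_single u.1]
      · simp
      · intro t _ ht; simp [ht.symm]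
      · simp
    simp [e1]
    rw [prod_segCells hle fun s i => ∏ j ∈ range (p.2 s), stringOmega P i (a s + p.1 s + j)]
    refine prod_congr rfl fun s _ => prod_congr rfl fun i _ => prod_congr rfl fun j _ => ?_
    rw [add_assoc, stringOmega_shift hP]
  rw [h2]
  have h3 : ∏ s, stringWeight P (l s) = (∏ s, stringWeight P (p.1 s)) *
      (∏ s, stringWeight P (p.2 s)) *
      ∏ s, ∏ i ∈ range (p.1 s), ∏ j ∈ range (p.2 s), stringOmega P i (p.1 s + j) := by
    rw [← prod_mul_distrib, ← prod_mul_distrib]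
    refine prod_congr rfl fun s _ => ?_; rw [← hb p hp s, stringWeight_add hP]
  rw [h3]; ring

theorem coeff_esymm (N : ℕ) (l : Fin n →₀ ℕ) : (MvPolynomial.esymm (Fin n) ℂ N).coeff l =
      if (∀ s, l s ≤ 1) ∧ ∑ s, l s = N then 1 else 0 := by
  classical
  have hind : ∀ (t : Finset (Fin n)) s, (∑ i ∈ t, Finsupp.single i 1 : Fin n →₀ ℕ) s =
      if s ∈ t then 1 else 0 := by
    simp [Finsupp.finsetSum_apply, Finsupp.single_apply]
  rw [MvPolynomial.esymm_eq_sum_monomial, MvPolynomial.coeff_sum]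
  simp only [MvPolynomial.coeff_monomial]
  split_ifs with h
  · obtain ⟨h1, h2⟩ := h
    have h01 : ∀ s, l s = if s ∈ l.support then 1 else 0 := by grind
    rw [sum_eq_single l.support]
    · grind
    · grind
    · intro hn
      exfalso
      refine hn (mem_powersetCard.2 ⟨subset_univ _, ?_⟩)
      rw [← h2, sum_congr rfl fun s _ => h01 s, sum_ite_mem, univ_inter, card_eq_sum_ones]
  · refine sum_eq_zero fun t ht => ?_; rw [if_neg]; rintro rfl
    refine h ⟨fun s => ?_, ?_⟩
    · grind
    · simp [hind]; grind

theorem card_segCells {a b : Fin n → ℕ} (h : ∀ s, a s + b s ≤ K) :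
    (segCells K a b).card = ∑ s, b s := by
  have h1 := prod_segCells h fun _ _ => 2
  simp_all [prod_const, card_range, prod_pow_eq_pow_sum]

theorem colorBalanced_one_iff {γ : Type} {N : ℕ} {T : Finset (Fin 1 × γ)} :
    ColorBalanced N T ↔ T.card = N := by
  have : ∀ i, T.filter (fun u => u.1 = i) = T := fun i =>
    filter_true_of_mem fun u _ => Subsingleton.elim _ _
  simp [ColorBalanced, this]

theorem gPair_one (u v : Fin 1 × ℂ) : gPair P u v = P.q⁻¹ * ((u.2 - P.q2 * v.2) / (u.2 - v.2)) := by
  have e1 : u.1 = v.1 := Subsingleton.elim _ _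
  have e2 : v.1 = nextColor u.1 := Subsingleton.elim _ _
  rw [gPair, if_pos rfl, if_pos e1, if_pos e2, mul_assoc, ← div_eq_mul_inv]

theorem hasStringLimits_gElement (hP : P.Admissible) (s : Fin 1 → ℂ) (N : ℕ) :
    HasStringLimits P n (gElement P s 0 N) (MvPolynomial.esymm (Fin n) ℂ N) := by
  classical
  intro K a l h
  rw [coeff_esymm]
  have hval : ∀ᶠ ξ in Bornology.cobounded ℂ,
      (if ∑ s, l s = N then pairProd (fun u v => gPair P (qString P ξ u) (qString P ξ v))
        (segCells K a l) else 0) =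
      (gElement P s 0 N).value (img (qString P ξ) (segCells K a l)) := by
    filter_upwards [eventually_qString hP n K] with ξ ⟨hξ, hi⟩
    have hc : (img (qString P ξ) (segCells K a l)).card = ∑ s, l s := by
      rw [card_img hi, card_segCells h]
    split_ifs with hN
    · simp_all [value_gElement, genericSet_qString, colorBalanced_one_iff, gValue, gPre,
        pairProd_img, esum, gDiag]
    · rw [gElement_hasSupport s 0 _ fun hb => hN (hc.symm.trans (colorBalanced_one_iff.1 hb))]
  refine Tendsto.congr' hval ?_
  by_cases hN : ∑ s, l s = N
  swap
  · simp only [if_neg hN]; rw [if_neg fun h => hN h.2, mul_zero]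
    exact tendsto_const_nhds
  simp only [if_pos hN]
  by_cases hl : ∀ s, l s ≤ 1
  · have hw : ∀ s, stringWeight P (l s) = 1 := by
      intro s; have := hl s
      interval_cases l s <;> simp [stringWeight]
    rw [if_pos ⟨hl, hN⟩, mul_one]; simp [hw]
    have h1 : Tendsto (fun ξ => pairProd (fun u v => gPair P (qString P ξ u) (qString P ξ v))
        (segCells K a l)) (Bornology.cobounded ℂ) (𝓝 (pairProd (fun u v : Fin n × Fin K =>
          P.q⁻¹ * (if (v.1 : ℕ) + 1 < u.1 + 1 then 1 else P.q2)) (segCells K a l))) := by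
      refine tendsto_finsetProd _ fun p hp => ?_
      have hcol : (p.1.1 : ℕ) + 1 ≠ p.2.1 + 1 := by grind [Fin.ext, Prod.ext, mem_segCells]
      refine ((tendsto_linear_string (pow_ne_zero (p.1.2 : ℕ) hP.q2_ne)
        (pow_ne_zero (p.2.2 : ℕ) hP.q2_ne) hcol P.q2).const_mul P.q⁻¹).congr fun ξ => ?_
      simp [gPair_one, qString, symm]
    rw [pairProd_congr_symm (k := fun _ _ => (1 : ℂ))] at h1
    · simpa [pairProd] using h1
    · intro u hu v hv hne
      have hcol : (u.1 : ℕ) ≠ v.1 := by grind [Fin.ext, Prod.ext, mem_segCells]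
      have hq := hP.q_ne; rw [QParam.q2]; grind
  · rw [if_neg fun h => hl h.1, mul_zero]; push Not at hl; obtain ⟨t, ht⟩ := hl
    have ht' := h t; refine tendsto_const_nhds.congr fun ξ => ?_; symm
    by_contra hne
    refine pairProd_ne_zero.1 hne (t, ⟨a t + 1, by omega⟩) (mem_segCells.2
      ⟨show a t ≤ a t + 1 by omega, show a t + 1 < a t + l t by omega⟩) (t, ⟨a t, by omega⟩)
      (mem_segCells.2 ⟨le_refl (a t), show a t < a t + l t by omega⟩) (by simp) ?_
    grind [gPair_one, qString]

open MvPolynomial in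
theorem exists_graded_iso_one (hP : P.Admissible) {s : Fin 1 → ℂ} (hs : IsGeneric P s) :
    Algebra.adjoin ℂ (gElements P s) = betheAlgebra P s ∧
    ∃ e : MvPolynomial (Fin 1 × ℕ+) ℂ ≃ₐ[ℂ] betheAlgebra P s,
      ∀ (N : ℕ) (p : MvPolynomial (Fin 1 × ℕ+) ℂ),
        IsWeightedHomogeneous (fun v : Fin 1 × ℕ+ => (v.2 : ℕ)) p N ↔
          (e p : ShuffleAmbient P 1) ∈ betheComponent P s N := by
  classical
  let θ : ∀ n, MvPolynomial (Fin 1 × ℕ+) ℂ →ₐ[ℂ] MvPolynomial (Fin n) ℂ := fun n =>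
    aeval fun v => esymm (Fin n) ℂ v.2
  let H : Submodule ℂ (ShuffleAmbient P 1 × MvPolynomial (Fin 1 × ℕ+) ℂ) :=
    { carrier := {X | ∀ n, HasStringLimits P n X.1 (θ n X.2)}
      zero_mem' := fun n => by simp [Prod.fst_zero, Prod.snd_zero, map_zero, HasStringLimits.zero]
      add_mem' := fun {X Y} hX hY n => by simp; exact (hX n).add (hY n)
      smul_mem' := fun c X hX n => by simp; exact (hX n).smul c }
  have h_one : ((1, 1) : ShuffleAmbient P 1 × MvPolynomial (Fin 1 × ℕ+) ℂ) ∈ H := by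
    intro n; simp [map_one, HasStringLimits.one]
  have key := exists_graded_iso hP hs one_ne_zero H h_one ?_ ?_ ?_
  · obtain ⟨h1, e, -, h2⟩ := key; exact ⟨h1, e, h2⟩
  · intro F _ G _ p q hp hq n; simp; exact (hp n).mul hP (hq n)
  · intro p hp; have hp' : ∀ n, θ n p = 0 := fun n => (hp n).eq_zero hP
    obtain ⟨n, hn⟩ : ∃ n : ℕ, ∀ v ∈ p.vars, (v.2 : ℕ) ≤ n :=
      ⟨p.vars.sup fun v => (v.2 : ℕ), fun v hv => le_sup (f := fun v => (v.2 : ℕ)) hv⟩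
    let ι : Fin n → Fin 1 × ℕ+ := fun i => (0, ⟨i + 1, Nat.succ_pos _⟩)
    have hι : Function.Injective ι := fun i j h => by
      have h1 : (i : ℕ) + 1 = j + 1 := congrArg (fun v : Fin 1 × ℕ+ => (v.2 : ℕ)) h
      exact Fin.ext (by omega)
    obtain ⟨p', rfl⟩ := exists_rename_eq_of_vars_subset_range p ι hι fun v hv => by
      have h1 := hn v hv; have h2 := v.2.pos
      refine ⟨⟨v.2 - 1, by omega⟩, Prod.ext (Subsingleton.elim _ _) (PNat.eq ?_)⟩
      simp [ι]; omega
    have h3 : (esymmAlgHom (Fin n) ℂ n p' : MvPolynomial (Fin n) ℂ) = 0 := by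
      rw [← hp' n]; simp only [θ, aeval_rename]; rw [esymmAlgHom_apply]; rfl
    have h4 : p' = 0 := by refine esymmAlgHom_injective ℂ (Fintype.card_fin n).ge ?_; simp_all
    rw [h4, map_zero]
  · intro v
    refine ⟨gElement P s 0 v.2, gElement_mem_betheComponent hP hs 0 _,
      Algebra.subset_adjoin ⟨0, v.2, Nat.zero_le _, rfl⟩, fun n => ?_⟩
    simp [θ]; exact hasStringLimits_gElement hP s v.2

end OneColor

/-! ### The fusion specialization: fibers and pair factors -/

/-- A square root. -/
def csqrt (z : ℂ) : ℂ := z ^ (1 / 2 : ℂ)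

theorem csqrt_mul_self (z : ℂ) : csqrt z * csqrt z = z := by
  rw [csqrt, ← sq, ← Complex.cpow_nat_mul]; norm_num

section Colors

variable {n : ℕ}

theorem nextColor_castSucc (k : Fin (n + 1)) : nextColor k.castSucc = k.succ :=
  Fin.ext (Nat.mod_eq_of_lt (Nat.succ_lt_succ k.2))

theorem nextColor_last : nextColor (Fin.last (n + 1)) = 0 := Fin.ext (Nat.mod_self _)

theorem prevColor_succ (k : Fin (n + 1)) : prevColor k.succ = k.castSucc :=
  (nextColor_eq_iff.1 (nextColor_castSucc k)).symm

theorem prevColor_zero : prevColor (0 : Fin (n + 2)) = Fin.last (n + 1) :=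
  (nextColor_eq_iff.1 nextColor_last).symm

end Colors

/-- The points on which the images under the fusion map are evaluated: the variables `y` (with
colors) and the variables `z`. -/
abbrev FusionVar (n : ℕ) : Type := (Fin (n + 1) × ℂ) ⊕ (Fin 1 × ℂ)

/-- The value of the variable. -/
def FusionVar.val {n : ℕ} : FusionVar n → ℂ := Sum.elim Prod.snd Prod.snd

section FusionSpecialization

variable (P : QParam) (ℓ : ℂ) {n : ℕ}

open Classical in
/-- The points of the specialization that depend on a given variable. -/
def fusionFiber : FusionVar n → Finset (Fin (n + 2) × ℂ)
  | .inl p => if p.1 = 0 then {(0, fusionScale ℓ n 1 * p.2), (Fin.last _, p.2)}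
      else {(p.1.castSucc, fusionScale ℓ n (p.1 + 1) * p.2)}
  | .inr p => univ.image fun k => (k, P.q3 ^ (k : ℕ) * p.2)

/-- The constant `δ`. -/
def fusionDelta (n : ℕ) : ℂ := if n = 0 then 1 else P.d

/-- The factor for two variables `y` of color `0`. -/
def fusionYY (n : ℕ) (y w : ℂ) : ℂ :=
  if n = 0 then ((y - P.q2 * w) * (y - P.q2⁻¹ * w) * (y - w) ^ 2) /
    ((y - P.q1 * w) ^ 2 * (y - P.q1⁻¹ * w) ^ 2)
  else P.d * (((y - P.q2 * w) * (y - P.q2⁻¹ * w)) / ((y - P.q1 * w) * (y - P.q1⁻¹ * w)))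

/-- The factor for two variables `z`. -/
def fusionZZ (n : ℕ) (z w : ℂ) : ℂ := (fusionDelta P n * (((z - P.q2 * w) * (z - P.q2⁻¹ * w)) /
      ((z - P.q3 * w) * (z - P.q3⁻¹ * w)))) ^ (n + 1) *
    (fusionDelta P n * ((z - w) ^ 2 / ((z - P.q3 ^ (n + 1) * w) * (z - (P.q3 ^ (n + 1))⁻¹ * w))))

/-- The factor for a variable `y` and a variable `z`. -/
def fusionYZ (p : Fin (n + 1) × ℂ) (z : ℂ) : ℂ := if p.1 = 0 then
    fusionDelta P n ^ 2 * (((p.2 - P.q1 ^ 2 * P.q3 * z) * (p.2 - P.q3⁻¹ * z)) /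
        ((p.2 - P.q1 * P.q3 * z) * (p.2 - z))) *
      (((p.2 - P.q1⁻¹ * P.q3 ^ n * z) * (p.2 - P.q1 * P.q3 ^ (n + 2) * z)) /
        ((p.2 - P.q3 ^ n * z) * (p.2 - P.q1 * P.q3 ^ (n + 1) * z)))
  else P.d * ((fusionScale ℓ n (p.1 + 1) * p.2 - P.q1 * P.q3 ^ ((p.1 : ℕ) + 1) * z) /
      (fusionScale ℓ n (p.1 + 1) * p.2 - P.q3 ^ ((p.1 : ℕ) + 1) * z)) *
    ((fusionScale ℓ n (p.1 + 1) * p.2 - P.q1⁻¹ * P.q3 ^ ((p.1 : ℕ) - 1) * z) /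
      (fusionScale ℓ n (p.1 + 1) * p.2 - P.q3 ^ ((p.1 : ℕ) - 1) * z))

/-- The contribution of an ordered pair of variables to the normalizing factor. -/
def fusionPair : FusionVar n → FusionVar n → ℂ
  | .inl p, .inl r => (if p.1 = 0 ∧ r.1 = 0 then csqrt (fusionYY P n p.2 r.2) else 1) *
      if n ≠ 0 ∧ r.1 = nextColor p.1 then (if p.1 = 0 then (if n = 1 then (P.tilde ℓ 3).d else 1)
        else 1) * ((p.2 - r.2) / (p.2 - exp (ℓ / (n + 1)) * r.2)) else 1
  | .inl p, .inr r => fusionYZ P ℓ p r.2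
  | .inr _, .inl _ => 1
  | .inr p, .inr r => csqrt (fusionZZ P n p.2 r.2)

/-- The structure functions of the tensor product. -/
def fusionOmega : FusionVar n → FusionVar n → ℂ
  | .inl p, .inl r => omega (P.tilde ℓ (n + 2)) (n + 1) p r
  | .inr p, .inr r => omega (P.second (n + 2)) 1 p r
  | _, _ => 1

variable {P ℓ}

theorem fusionScale_ne (j : ℕ) : fusionScale ℓ n j ≠ 0 := exp_ne_zero _

theorem fusionScale_succ (j : ℕ) :
    fusionScale ℓ n (j + 1) = exp (ℓ / (n + 1)) * fusionScale ℓ n j := by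
  rw [fusionScale, fusionScale, ← exp_add]; grind

theorem fusionScale_last : fusionScale ℓ n (n + 2) = 1 := by simp [fusionScale]

theorem fusionScale_one (hℓ : exp ℓ = P.q1) : fusionScale ℓ n 1 = P.q1⁻¹ := by
  rw [fusionScale, ← hℓ, ← exp_neg]; grind [Nat.cast_add_one_ne_zero]

theorem sub_mul_sub_inv_comm {c : ℂ} (hc : c ≠ 0) (y w : ℂ) :
    (y - c * w) * (y - c⁻¹ * w) = (w - c * y) * (w - c⁻¹ * y) := by
  field_simp; ring

theorem fusionYY_comm (hP : P.Admissible) (y w : ℂ) : fusionYY P n y w = fusionYY P n w y := by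
  have h1 := sub_mul_sub_inv_comm hP.q1_ne y w
  have h2 := sub_mul_sub_inv_comm hP.q2_ne y w; unfold fusionYY; grind

theorem fusionZZ_comm (hP : P.Admissible) (z w : ℂ) : fusionZZ P n z w = fusionZZ P n w z := by
  unfold fusionZZ
  rw [sub_mul_sub_inv_comm hP.q3_ne, sub_mul_sub_inv_comm hP.q2_ne,
    sub_mul_sub_inv_comm (pow_ne_zero _ hP.q3_ne), show (z - w) ^ 2 = (w - z) ^ 2 by ring]

section FiberProd

variable {M : Type} [CommMonoid M]

theorem prod_fusionFiber_inl (p : Fin (n + 1) × ℂ) (f : Fin (n + 2) × ℂ → M) :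
    ∏ u ∈ fusionFiber P ℓ (.inl p), f u = f (p.1.castSucc, fusionScale ℓ n (p.1 + 1) * p.2) *
      if p.1 = 0 then f (Fin.last _, p.2) else 1 := by
  classical
  by_cases h : p.1 = 0
  · simp_all [fusionFiber]
  · simp [fusionFiber, if_neg h]

theorem prod_fusionFiber_inr (p : Fin 1 × ℂ) (f : Fin (n + 2) × ℂ → M) :
    ∏ u ∈ fusionFiber P ℓ (.inr p), f u = ∏ k : Fin (n + 2), f (k, P.q3 ^ (k : ℕ) * p.2) := by
  classical
  exact prod_image fun _ _ _ _ h => (Prod.mk.inj h).1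

end FiberProd

theorem colorConst_eq_fusionDelta : P.colorConst (n + 2) = fusionDelta P n := by
  unfold QParam.colorConst fusionDelta; simp

theorem prod_omega_string (u : Fin (n + 2) × ℂ) (z : ℂ) :
    ∏ k : Fin (n + 2), omega P (n + 2) u (k, P.q3 ^ (k : ℕ) * z) =
      (u.2 - P.q2 * (P.q3 ^ (u.1 : ℕ) * z)) / (u.2 - P.q3 ^ (u.1 : ℕ) * z) *
      ((u.2 - P.q1 * (P.q3 ^ (nextColor u.1 : ℕ) * z)) / (u.2 - P.q3 ^ (nextColor u.1 : ℕ) * z)) *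
      (fusionDelta P n * ((u.2 - P.q3 * (P.q3 ^ (prevColor u.1 : ℕ) * z)) /
        (u.2 - P.q3 ^ (prevColor u.1 : ℕ) * z))) := by
  have h : ∀ k, (u.1 = nextColor k) = (k = prevColor u.1) := fun k =>
    propext (eq_comm.trans nextColor_eq_iff)
  simp only [omega_eq, prod_mul_distrib, h, prod_ite_eq, prod_ite_eq',
    mem_univ, if_true, colorConst_eq_fusionDelta]

theorem prod_string_omega (u : Fin (n + 2) × ℂ) (z : ℂ) :
    ∏ k : Fin (n + 2), omega P (n + 2) (k, P.q3 ^ (k : ℕ) * z) u =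
      (P.q3 ^ (u.1 : ℕ) * z - P.q2 * u.2) / (P.q3 ^ (u.1 : ℕ) * z - u.2) *
      ((P.q3 ^ (prevColor u.1 : ℕ) * z - P.q1 * u.2) / (P.q3 ^ (prevColor u.1 : ℕ) * z - u.2)) *
      (fusionDelta P n * ((P.q3 ^ (nextColor u.1 : ℕ) * z - P.q3 * u.2) /
        (P.q3 ^ (nextColor u.1 : ℕ) * z - u.2))) := by
  have h : ∀ k, (u.1 = nextColor k) = (k = prevColor u.1) := fun k =>
    propext (eq_comm.trans nextColor_eq_iff)
  simp only [omega_eq, prod_mul_distrib, h, prod_ite_eq',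
    mem_univ, if_true, colorConst_eq_fusionDelta]

theorem mul_div_pow_identity {e : ℂ} (he : e ≠ 0) (A B C D E F G H δ : ℂ) (k : ℕ) :
    (A / e) ^ (k + 1) * ((B / C) ^ k * (E / F)) * (δ * (G / H) * (δ * (e / D)) ^ k) =
      (δ * (A * B / (C * D))) ^ k * (δ * (e ^ 2 / (H * F))) * (E / e * (A / e) * (G / e)) := by
  have h1 : δ * (A * B / (C * D)) = A / e * (B / C) * (δ * (e / D)) := by grind
  grind [mul_pow, pow_succ]

theorem prod_omega_inr_inr (hP : P.Admissible) {z w : ℂ} (hzw : z ≠ w) :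
    ∏ k : Fin (n + 2), ∏ l : Fin (n + 2),
        omega P (n + 2) (k, P.q3 ^ (k : ℕ) * z) (l, P.q3 ^ (l : ℕ) * w) =
      fusionZZ P n z w * omega (P.second (n + 2)) 1 (0, z) (0, w) := by
  have h3 := hP.q3_ne; have h123 := hP.prod_eq_one; simp [prod_omega_string]
  rw [prod_mul_distrib, prod_mul_distrib]
  have hc : ∀ (c : ℂ) (k : ℕ) (r t : ℂ), (P.q3 ^ k * z - r * (P.q3 ^ k * w)) /
      (P.q3 ^ k * z - t * (P.q3 ^ k * w)) = (z - r * w) / (z - t * w) := by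
    grind [mul_div_mul_left, pow_ne_zero]
  have e1 : ∏ k : Fin (n + 2), (P.q3 ^ (k : ℕ) * z - P.q2 * (P.q3 ^ (k : ℕ) * w)) /
      (P.q3 ^ (k : ℕ) * z - P.q3 ^ (k : ℕ) * w) = ((z - P.q2 * w) / (z - w)) ^ (n + 2) := by
    rw [prod_congr rfl fun k _ => (by simpa using hc 1 k P.q2 1), prod_const,
      card_univ, Fintype.card_fin]
  have e2 : ∏ k : Fin (n + 2), (P.q3 ^ (k : ℕ) * z - P.q1 * (P.q3 ^ (nextColor k : ℕ) * w)) /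
      (P.q3 ^ (k : ℕ) * z - P.q3 ^ (nextColor k : ℕ) * w) =
      ((z - P.q2⁻¹ * w) / (z - P.q3 * w)) ^ (n + 1) *
      ((z - P.q1 * (P.q3 ^ (n + 1))⁻¹ * w) / (z - (P.q3 ^ (n + 1))⁻¹ * w)) := by
    rw [Fin.prod_univ_castSucc]
    congr 1
    · rw [prod_congr rfl (g := fun _ => (z - P.q2⁻¹ * w) / (z - P.q3 * w)),
        prod_const, card_univ, Fintype.card_fin]
      intro k _; have e : P.q2⁻¹ = P.q1 * P.q3 := by grind
      rw [nextColor_castSucc, e, ← hc 1 k]; grind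
    · rw [nextColor_last, ← hc 1 (n + 1)]; simp; grind [pow_ne_zero]
  have e3 : ∏ k : Fin (n + 2), (fusionDelta P n * ((P.q3 ^ (k : ℕ) * z -
      P.q3 * (P.q3 ^ (prevColor k : ℕ) * w)) /
      (P.q3 ^ (k : ℕ) * z - P.q3 ^ (prevColor k : ℕ) * w))) =
      fusionDelta P n * ((z - P.q3 ^ (n + 2) * w) / (z - P.q3 ^ (n + 1) * w)) *
      (fusionDelta P n * ((z - w) / (z - P.q3⁻¹ * w))) ^ (n + 1) := by
    rw [Fin.prod_univ_succ]
    congr 1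
    · rw [prevColor_zero]; simp; grind
    · rw [prod_congr rfl (g := fun _ => fusionDelta P n * ((z - w) / (z - P.q3⁻¹ * w))),
        prod_const, card_univ, Fintype.card_fin]
      intro k _; rw [prevColor_succ]; have := hc 1 (k + 1) 1 P.q3⁻¹; grind
  rw [e1, e2, e3, fusionZZ, omega_one, QParam.second_q1, QParam.second_q2, QParam.second_q3 _ hP]
  rw [show (((n + 2 : ℕ) : ℤ) - 1) = ((n + 1 : ℕ) : ℤ) by push_cast; ring, zpow_neg, zpow_natCast]
  grind [mul_div_pow_identity]

theorem tilde_exp (ℓ : ℂ) (n : ℕ) : ℓ / (((n + 2 : ℕ) : ℂ) - 1) = ℓ / (n + 1) := by grind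

theorem nextColor_eq_iff_val {k : ℕ} {i j : Fin (k + 1)} :
    j = nextColor i ↔ (j : ℕ) = i + 1 ∨ ((i : ℕ) = k ∧ (j : ℕ) = 0) := by
  rw [Fin.ext_iff, nextColor]; simp only
  rcases Nat.lt_or_ge (i + 1) (k + 1) with h | h
  · rw [Nat.mod_eq_of_lt h]; omega
  grind [Nat.mod_self]

theorem ite_fusionScale (X : ℂ → ℂ → ℂ) (hX : ∀ c : ℂ, c ≠ 0 → ∀ a b, X (c * a) (c * b) = X a b)
    {i j : Fin (n + 1)} (hij : i ≠ j) (y w : ℂ) :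
    (if j.castSucc = nextColor i.castSucc then
        X (fusionScale ℓ n (i + 1) * y) (fusionScale ℓ n (j + 1) * w) else 1) *
      (if j = 0 then (if Fin.last (n + 1) = nextColor i.castSucc then
        X (fusionScale ℓ n (i + 1) * y) w else 1) else 1) =
      if j = nextColor i then X y (exp (ℓ / (n + 1)) * w) else 1 := by
  have h1 : j.castSucc = nextColor i.castSucc ↔ (j : ℕ) = i + 1 := by
    rw [nextColor_castSucc, Fin.ext_iff]; rfl
  have h2 : Fin.last (n + 1) = nextColor i.castSucc ↔ (i : ℕ) = n := by
    rw [nextColor_castSucc, Fin.ext_iff, Fin.val_last, Fin.val_succ]; omega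
  have h3 : j = 0 ↔ (j : ℕ) = 0 := Fin.ext_iff
  simp only [h1, h2, h3, nextColor_eq_iff_val]
  by_cases hA : (j : ℕ) = i + 1
  · rw [if_pos hA, if_neg (by omega), mul_one, if_pos (Or.inl hA), hA,
      fusionScale_succ ((i : ℕ) + 1),
      mul_comm (exp _), mul_assoc, hX _ (fusionScale_ne _)]
  · by_cases hB : (j : ℕ) = 0 ∧ (i : ℕ) = n
    · have h4 := fusionScale_succ (ℓ := ℓ) (n := n) (n + 1)
      rw [fusionScale_last] at h4
      conv_lhs => rw [show w = fusionScale ℓ n (n + 1) * (exp (ℓ / (n + 1)) * w) by grind]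
      grind
    grind

theorem prod_omega_inl_inl_zero (hP : P.Admissible) (hℓ : exp ℓ = P.q1) {y w : ℂ} (hyw : y ≠ w) :
    ∏ u ∈ fusionFiber P ℓ (.inl ((0 : Fin (n + 1)), y)),
      ∏ v ∈ fusionFiber P ℓ (.inl ((0 : Fin (n + 1)), w)), omega P (n + 2) u v =
      fusionYY P n y w * omega (P.tilde ℓ (n + 2)) (n + 1) (0, y) (0, w) := by
  have h1 := hP.q1_ne; have h123 := hP.prod_eq_one
  have h3 : P.q3 = P.q1⁻¹ * P.q2⁻¹ := by grind
  have hyw' : y - w ≠ 0 := sub_ne_zero.2 hyw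
  have hsc : ∀ a b c : ℂ, (P.q1⁻¹ * a - b) / (P.q1⁻¹ * a - c) = (a - P.q1 * b) / (a - P.q1 * c) := by
    grind
  have c1 : ¬ ((0 : Fin (n + 2)) = nextColor 0) := fun h => nextColor_ne (by omega) _ h.symm
  have c2 : ¬ ((0 : Fin (n + 2)) = Fin.last (n + 1)) := by simp [Fin.ext_iff]
  have c3 : ¬ (Fin.last (n + 1) = (0 : Fin (n + 2))) := fun h => c2 h.symm
  have c4 : (0 : Fin (n + 2)) = nextColor (Fin.last (n + 1)) := nextColor_last.symm
  have c5 : ¬ (Fin.last (n + 1) = nextColor (Fin.last (n + 1))) := fun h => c3 (h.trans nextColor_last)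
  have c6 : Fin.last (n + 1) = nextColor (0 : Fin (n + 2)) ↔ n = 0 := by
    rw [nextColor_eq_iff_val]; simp
  simp [prod_fusionFiber_inl, fusionScale_one hℓ, omega_eq P (n + 2), if_neg c1, if_pos c4,
    if_neg c5, c6, colorConst_eq_fusionDelta, fusionDelta, fusionYY]
  have e1 : (P.q1⁻¹ * y - P.q2 * (P.q1⁻¹ * w)) / (P.q1⁻¹ * y - P.q1⁻¹ * w) =
      (y - P.q2 * w) / (y - w) := by
    grind
  rw [e1, hsc, hsc, h3]
  by_cases hn : n = 0
  · subst hn; have e2 : ℓ / (((0 + 2 : ℕ) : ℂ) - 1) = ℓ := by norm_num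
    rw [omega_one, QParam.tilde_q1, QParam.tilde_q2, QParam.tilde_q3, e2, exp_neg, hℓ, h3]
    have a1 : P.q1 * (P.q1⁻¹ * P.q2⁻¹ * w) = P.q2⁻¹ * w := by field_simp
    have a2 : P.q1 * (P.q1⁻¹ * w) = w := by field_simp
    rw [a1, a2]; simp [mul_assoc]; generalize hA : y - P.q2⁻¹ * w = A
    generalize hB : y - P.q1 * (P.q1 * w) = B
    generalize hC : y - P.q1⁻¹ * (P.q2⁻¹ * (P.q1⁻¹ * w)) = C
    generalize y - P.q2 * w = D; generalize y - P.q1 * w = E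
    generalize y - P.q1⁻¹ * w = F; simp [div_eq_mul_inv]
    have h0 : (y - w) * (y - w)⁻¹ = 1 := mul_inv_cancel₀ hyw'
    generalize (y - w)⁻¹ = g at *
    generalize y - w = f at *
    linear_combination (-(D ^ 2 * A * B * C * E⁻¹ ^ 2 * F⁻¹ ^ 2 * f * g ^ 2)) * h0
  · have c7 : ¬ ((0 : Fin (n + 1)) = nextColor 0) := fun h => nextColor_ne (by omega) _ h.symm
    simp [if_neg hn, omega_eq, if_neg c7, QParam.tilde_q2]
    simp [div_eq_mul_inv]; grind [mul_inv_cancel₀]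

theorem prod_omega_inl_inl (hP : P.Admissible) (hℓ : exp ℓ = P.q1)
    {p r : Fin (n + 1) × ℂ} (hpr : p.2 ≠ r.2) :
    ∏ u ∈ fusionFiber P ℓ (.inl p), ∏ v ∈ fusionFiber P ℓ (.inl r), omega P (n + 2) u v =
      fusionPair P ℓ (.inl p) (.inl r) * fusionPair P ℓ (.inl r) (.inl p) *
        omega (P.tilde ℓ (n + 2)) (n + 1) p r := by
  obtain ⟨i, y⟩ := p; obtain ⟨j, w⟩ := r
  have hyw' : y - w ≠ 0 := sub_ne_zero.2 hpr
  by_cases h00 : i = 0 ∧ j = 0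
  · obtain ⟨rfl, rfl⟩ := h00
    have hne : ¬ (n ≠ 0 ∧ (0 : Fin (n + 1)) = nextColor 0) := by grind [nextColor_ne]
    rw [prod_omega_inl_inl_zero hP hℓ hpr]
    simp only [fusionPair, if_neg hne, and_self, if_true, mul_one]
    rw [fusionYY_comm hP w y, csqrt_mul_self]
  · have h00' : ¬ (j = 0 ∧ i = 0) := fun h => h00 h.symm
    have hn : n ≠ 0 := by grind
    have hθ : exp (ℓ / (n + 1)) ≠ 0 := exp_ne_zero _
    have hlast : ∀ k : Fin (n + 1), k.castSucc ≠ Fin.last (n + 1) := fun k => (Fin.castSucc_lt_last k).ne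
    simp only [prod_fusionFiber_inl, fusionPair, if_neg h00, if_neg h00', one_mul, hn, ne_eq,
      not_false_eq_true, true_and]
    rw [omega_eq _ (n + 1)]
    simp only [QParam.tilde_q1, QParam.tilde_q2, QParam.tilde_q3, tilde_exp]
    by_cases hij : i = j
    · subst hij; have hi0 : i ≠ 0 := fun h => h00 ⟨h, h⟩
      have hni : i ≠ nextColor i := (nextColor_ne (by omega) i).symm
      have hni' : i.castSucc ≠ nextColor i.castSucc := (nextColor_ne (by omega) _).symm
      simp [omega_eq, if_neg hi0, if_neg hni, if_neg hni']
      grind [mul_div_mul_left, fusionScale_ne]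
    · have hB := ite_fusionScale (ℓ := ℓ) (fun a b => (a - P.q1 * b) / (a - b)) (by grind) hij y w
      have hC := ite_fusionScale (ℓ := ℓ) (fun a b => P.d * ((b - P.q3 * a) / (b - a))) (by
        grind) (Ne.symm hij) w y
      have hlhs : ∀ f : Fin (n + 2) × ℂ → Fin (n + 2) × ℂ → ℂ,
          (f (i.castSucc, fusionScale ℓ n (i + 1) * y) (j.castSucc, fusionScale ℓ n (j + 1) * w) *
            if j = 0 then f (i.castSucc, fusionScale ℓ n (i + 1) * y) (Fin.last _, w) else 1) *
          (if i = 0 then f (Fin.last _, y) (j.castSucc, fusionScale ℓ n (j + 1) * w) *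
            (if j = 0 then f (Fin.last _, y) (Fin.last _, w) else 1) else 1) =
          f (i.castSucc, fusionScale ℓ n (i + 1) * y) (j.castSucc, fusionScale ℓ n (j + 1) * w) *
            (if j = 0 then f (i.castSucc, fusionScale ℓ n (i + 1) * y) (Fin.last _, w) else 1) *
            (if i = 0 then f (Fin.last _, y) (j.castSucc, fusionScale ℓ n (j + 1) * w) else 1) := by
        grind
      have hci : i.castSucc ≠ j.castSucc := fun h => hij (Fin.castSucc_injective _ h)
      have l0 : ∀ k : Fin (n + 1), k.castSucc = nextColor (Fin.last (n + 1)) ↔ k = 0 := by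
        intro k; rw [nextColor_last, Fin.ext_iff, Fin.ext_iff]; rfl
      have f1 : omega P (n + 2) (i.castSucc, fusionScale ℓ n (i + 1) * y)
          (j.castSucc, fusionScale ℓ n (j + 1) * w) =
          (if j.castSucc = nextColor i.castSucc then (fusionScale ℓ n (i + 1) * y -
            P.q1 * (fusionScale ℓ n (j + 1) * w)) / (fusionScale ℓ n (i + 1) * y -
              fusionScale ℓ n (j + 1) * w) else 1) *
          (if i.castSucc = nextColor j.castSucc then P.d * ((fusionScale ℓ n (i + 1) * y -
            P.q3 * (fusionScale ℓ n (j + 1) * w)) / (fusionScale ℓ n (i + 1) * y -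
              fusionScale ℓ n (j + 1) * w)) else 1) := by
        rw [omega_eq, if_neg hci, one_mul, colorConst_eq_fusionDelta, fusionDelta, if_neg hn]
      have f2 : (if j = 0 then omega P (n + 2) (i.castSucc, fusionScale ℓ n (i + 1) * y)
          (Fin.last _, w) else 1) = (if j = 0 then (if Fin.last (n + 1) = nextColor i.castSucc then
            (fusionScale ℓ n (i + 1) * y - P.q1 * w) / (fusionScale ℓ n (i + 1) * y - w)
            else 1) else 1) := by
        refine if_ctx_congr Iff.rfl (fun hj => ?_) fun _ => rfl
        have hi : i ≠ 0 := fun h => h00 ⟨h, hj⟩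
        rw [omega_eq, if_neg (hlast i), one_mul]; simp [l0, if_neg hi]
      have f3 : (if i = 0 then omega P (n + 2) (Fin.last _, y)
          (j.castSucc, fusionScale ℓ n (j + 1) * w) else 1) =
          (if i = 0 then (if Fin.last (n + 1) = nextColor j.castSucc then
            P.d * ((y - P.q3 * (fusionScale ℓ n (j + 1) * w)) / (y - fusionScale ℓ n (j + 1) * w))
            else 1) else 1) := by
        refine if_ctx_congr Iff.rfl (fun hi => ?_) fun _ => rfl
        have hj : j ≠ 0 := fun h => h00 ⟨hi, h⟩
        rw [omega_eq, if_neg (hlast j).symm, one_mul, colorConst_eq_fusionDelta, fusionDelta,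
          if_neg hn]
        simp [l0, if_neg hj]
      rw [hlhs (omega P (n + 2)), f1, f2, f3]
      have e4 : ∀ a b c e : ℂ, a * b * c * e = (a * c) * (b * e) := by intros; ring
      rw [e4, hB, hC, if_neg hij, one_mul, exp_neg]
      generalize hθe : exp (ℓ / (n + 1)) = θ at *
      have k2 : (w - y) / (w - θ * y) = (y - w) / (θ * y - w) := by grind [neg_sub, neg_div_neg_eq]
      have hadj : n = 1 → ∀ a b : Fin (n + 1), a = nextColor b → b = nextColor a := by
        rintro rfl a b h; rw [nextColor_eq_iff_val] at h ⊢; omega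
      by_cases h1 : j = nextColor i <;> by_cases h2 : i = nextColor j
      · have hn1 : n = 1 := by grind [nextColor_nextColor_ne]
        subst hn1
        have hd : (P.tilde ℓ 3).d = P.d * θ := by
          rw [← hθe]; exact congrArg (fun t => P.d * exp t) (tilde_exp ℓ 1)
        have hcc : QParam.colorConst (P.tilde ℓ (1 + 2)) (1 + 1) = 1 := rfl
        have hκ : ((if i = 0 then P.d * θ else 1) * if j = 0 then P.d * θ else 1) = P.d * θ := by
          by_cases hi : i = 0
          · rw [if_pos hi, if_neg fun hj => h00 ⟨hi, hj⟩, mul_one]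
          · grind
        grind [mul_inv_cancel₀]
      · have hn1 : n ≠ 1 := by rintro rfl; exact h2 (hadj rfl j i h1)
        grind
      · have hn1 : n ≠ 1 := by rintro rfl; exact h1 (hadj rfl i j h2)
        have hcc : QParam.colorConst (P.tilde ℓ (n + 2)) (n + 1) = P.d * θ := by
          rw [QParam.colorConst, if_neg (by omega), QParam.tilde, tilde_exp, hθe]
        grind [mul_inv_cancel₀]
      · simp [if_neg h1, if_neg h2]

theorem neg_mul_div_neg (c x y : ℂ) : (-(c * x)) / (-y) = c * (x / y) := by grind

theorem prod_omega_inl_inr (hP : P.Admissible) (hℓ : exp ℓ = P.q1)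
    {p : Fin (n + 1) × ℂ} {r : Fin 1 × ℂ} (hpr : ∀ u ∈ fusionFiber P ℓ (.inl p),
      ∀ v ∈ fusionFiber (n := n) P ℓ (.inr r), u.2 ≠ v.2) :
    ∏ u ∈ fusionFiber P ℓ (.inl p), ∏ v ∈ fusionFiber P ℓ (.inr r), omega P (n + 2) u v =
        fusionYZ P ℓ p r.2 ∧
      ∏ v ∈ fusionFiber P ℓ (.inr r), ∏ u ∈ fusionFiber P ℓ (.inl p), omega P (n + 2) v u =
        fusionYZ P ℓ p r.2 := by
  obtain ⟨i, y⟩ := p; obtain ⟨c, z⟩ := r; have h1 := hP.q1_ne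
  have h123 := hP.prod_eq_one
  have hmem : ∀ k : Fin (n + 2), (k, P.q3 ^ (k : ℕ) * z) ∈ fusionFiber P ℓ (.inr (c, z)) := by
    simp [fusionFiber]
  rw [Finset.prod_comm (s := fusionFiber P ℓ (.inr (c, z)))]
  simp [prod_fusionFiber_inr, prod_fusionFiber_inl, prod_omega_string, prod_string_omega]
  by_cases hi : i = 0
  · subst hi
    have g0 : P.q1⁻¹ * y - z ≠ 0 := by
      have := hpr (0, P.q1⁻¹ * y) (by simp [fusionFiber, fusionScale_one hℓ]) _ (hmem 0)
      simp_all [sub_ne_zero]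
    have gl : y - P.q3 ^ (n + 1) * z ≠ 0 := by grind [Fin.last, fusionFiber]
    have g0' : y - P.q1 * z ≠ 0 := by grind
    simp [fusionYZ, fusionScale_one hℓ, prevColor_zero, nextColor_last,
      show nextColor (0 : Fin (n + 2)) = Fin.succ 0 from nextColor_castSucc 0, show prevColor (Fin.last (n + 1)) = (Fin.last n).castSucc from prevColor_succ (Fin.last n)]
    have hs : ∀ a b : ℂ, (P.q1⁻¹ * y - a) / (P.q1⁻¹ * y - b) = (y - P.q1 * a) / (y - P.q1 * b) := by
      intro a b; rw [← mul_div_mul_left _ _ h1]; congr 1 <;> field_simp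
    constructor
    · rw [hs, hs, hs]
      rw [show y - P.q1 * (P.q2 * z) = y - P.q3⁻¹ * z by grind,
        show y - P.q2 * (P.q3 ^ (n + 1) * z) = y - P.q1⁻¹ * P.q3 ^ n * z by grind,
        show y - P.q1 * (P.q1 * (P.q3 * z)) = y - P.q1 ^ 2 * P.q3 * z by ring,
        show y - P.q1 * (P.q3 * (P.q3 ^ (n + 1) * z)) = y - P.q1 * P.q3 ^ (n + 2) * z by ring,
        show y - P.q3 * (P.q3 ^ n * z) = y - P.q3 ^ (n + 1) * z by ring,
        ← mul_assoc P.q1 P.q3 z, ← mul_assoc P.q1 (P.q3 ^ (n + 1)) z]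
      simp [div_eq_mul_inv]
      grind
    · have r1 : ∀ c a : ℂ, (a - c * y) / (a - y) = (c * y - a) / (y - a) := by
        intro c a; rw [← neg_div_neg_eq, neg_sub, neg_sub]
      have r2 : ∀ c a : ℂ, (a - c * (P.q1⁻¹ * y)) / (a - P.q1⁻¹ * y) =
          (c * y - P.q1 * a) / (y - P.q1 * a) := by
        intro c a; rw [← mul_div_mul_left _ _ (neg_ne_zero.2 h1)]; grind
      simp [r1, r2]
      rw [show P.q2 * y - P.q1 * z = P.q2 * (y - P.q1 ^ 2 * P.q3 * z) by grind,
        show P.q1 * y - P.q1 * (P.q3 ^ (n + 1) * z) = P.q1 * (y - P.q3 ^ (n + 1) * z) by ring,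
        show P.q3 * y - P.q1 * (P.q3 * z) = P.q3 * (y - P.q1 * z) by ring,
        show P.q2 * y - P.q3 ^ (n + 1) * z = P.q2 * (y - P.q1 * P.q3 ^ (n + 2) * z) by grind,
        show P.q1 * y - P.q3 ^ n * z = P.q1 * (y - P.q1⁻¹ * P.q3 ^ n * z) by grind,
        show P.q3 * y - z = P.q3 * (y - P.q3⁻¹ * z) by grind,
        ← mul_assoc P.q1 P.q3 z, ← mul_assoc P.q1 (P.q3 ^ (n + 1)) z]
      simp [div_eq_mul_inv]
      generalize y - P.q3 ^ (n + 1) * z = a' at *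
      grind
  · obtain ⟨k, rfl⟩ : ∃ k : Fin n, i = ⟨k + 1, by omega⟩ := by
      have h0 : (i : ℕ) ≠ 0 := fun h => hi (Fin.ext h)
      exact ⟨⟨i - 1, by omega⟩, Fin.ext (by simp only; omega)⟩
    have hn : n ≠ 0 := fun h => by omega
    have hY : fusionScale ℓ n (k + 1 + 1) * y - P.q3 ^ ((k : ℕ) + 1) * z ≠ 0 := by
      have := hpr (Fin.castSucc ⟨k + 1, by omega⟩, fusionScale ℓ n (k + 1 + 1) * y)
        (by simp [fusionFiber]) _ (hmem (Fin.castSucc ⟨k + 1, by omega⟩))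
      grind
    have hprev : prevColor (Fin.castSucc (⟨k + 1, by omega⟩ : Fin (n + 1))) =
      (⟨k, by omega⟩ : Fin (n + 1)).castSucc := prevColor_succ ⟨k, by omega⟩
    simp only [if_neg hi, fusionYZ, nextColor_castSucc, hprev, Fin.val_castSucc,
      Fin.val_succ, fusionDelta, if_neg hn, Nat.add_sub_cancel]
    generalize fusionScale ℓ n (k + 1 + 1) * y = Y at *
    constructor
    · grind
    · rw [show P.q3 ^ ((k : ℕ) + 1) * z - P.q2 * Y =
          -(P.q2 * (Y - P.q1 * P.q3 ^ ((k : ℕ) + 1 + 1) * z)) by grind,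
        show P.q3 ^ (k : ℕ) * z - P.q1 * Y = -(P.q1 * (Y - P.q1⁻¹ * P.q3 ^ (k : ℕ) * z)) by grind,
        show P.q3 ^ ((k : ℕ) + 1 + 1) * z - P.q3 * Y = -(P.q3 * (Y - P.q3 ^ ((k : ℕ) + 1) * z)) by
            ring,
        ← neg_sub Y, ← neg_sub Y, ← neg_sub Y, neg_mul_div_neg, neg_mul_div_neg, neg_mul_div_neg]
      grind

theorem prod_omega_fusionFiber (hP : P.Admissible) (hℓ : exp ℓ = P.q1) {s t : FusionVar n}
    (hval : ∀ p r, s = .inl p → t = .inl r → p.2 ≠ r.2)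
    (hval' : ∀ p r, s = .inr p → t = .inr r → p.2 ≠ r.2)
    (hst : ∀ u ∈ fusionFiber P ℓ s, ∀ v ∈ fusionFiber P ℓ t, u.2 ≠ v.2) :
    ∏ u ∈ fusionFiber P ℓ s, ∏ v ∈ fusionFiber P ℓ t, omega P (n + 2) u v =
      fusionPair P ℓ s t * fusionPair P ℓ t s * fusionOmega P ℓ s t := by
  match s, t, hval, hval', hst with
  | .inl p, .inl r, hval, _, _ => exact prod_omega_inl_inl hP hℓ (hval p r rfl rfl)
  | .inl p, .inr r, _, _, hst => grind [prod_omega_inl_inr, fusionPair, fusionOmega, mul_one]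
  | .inr r, .inl p, _, _, hst =>
    exact (prod_omega_inl_inr hP hℓ fun u hu v hv => (hst v hv u hu).symm).2.trans
      (by simp [fusionPair, fusionOmega])
  | .inr p, .inr r, _, hval', _ =>
    obtain ⟨c, z⟩ := p; obtain ⟨c', w⟩ := r
    simp [prod_fusionFiber_inr, fusionPair, fusionOmega]
    rw [fusionZZ_comm hP w z, csqrt_mul_self]
    exact prod_omega_inr_inr hP (hval' _ _ rfl rfl)

end FusionSpecialization

/-! ### Multiplicativity of the fusion specialization -/

section FusionUnion

open Classical in
/-- The specialized configuration. -/
def fusionUnion (P : QParam) (ℓ : ℂ) {n : ℕ} (S : Finset (FusionVar n)) :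
    Finset (Fin (n + 2) × ℂ) :=
  S.biUnion (fusionFiber P ℓ)

/-- The configurations of variables `y`, `z` at which the fusion map is evaluated. -/
structure FusionGood (P : QParam) (ℓ : ℂ) {n : ℕ} (S : Finset (FusionVar n)) : Prop where
  left : GenericSet S.toLeft
  right : GenericSet S.toRight
  disj : (S : Set (FusionVar n)).PairwiseDisjoint (fusionFiber P ℓ)
  union : GenericSet (fusionUnion P ℓ S)
  ne_zero : pairProd (fusionPair P ℓ) S ≠ 0

/-- The fusion map in terms of configurations. -/
def fusionValue {P : QParam} (ℓ : ℂ) {n : ℕ} (F : ShuffleAmbient P (n + 2))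
    (S : Finset (FusionVar n)) : ℂ :=
  F.value (fusionUnion P ℓ S) / pairProd (fusionPair P ℓ) S

/-- The variable occurs in points of color `0` and of the last color. -/
def FusionVar.IsLong {n : ℕ} : FusionVar n → Prop
  | .inl p => p.1 = 0
  | .inr _ => True

/-- The point of color `0` of a fiber. -/
def fusionHead (ℓ : ℂ) {n : ℕ} : FusionVar n → Fin (n + 2) × ℂ
  | .inl p => (0, fusionScale ℓ n 1 * p.2)
  | .inr p => (0, p.2)

/-- The point of the last color of a fiber. -/
def fusionTail (P : QParam) {n : ℕ} : FusionVar n → Fin (n + 2) × ℂ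
  | .inl p => (Fin.last _, p.2)
  | .inr p => (Fin.last _, P.q3 ^ (n + 1) * p.2)

theorem ShuffleAmbient.conv_eq {α : Type} [DecidableEq α] (w : α → α → ℂ) (f g : Finset α → ℂ)
    (T : Finset α) : conv w f g T =
      ∑ I ∈ T.powerset, f I * g (T \ I) * ∏ u ∈ I, ∏ v ∈ T \ I, w u v := by
  unfold conv; congr!

variable {P : QParam} {ℓ : ℂ} {n : ℕ} {S : Finset (FusionVar n)}

theorem mem_fusionUnion {u : Fin (n + 2) × ℂ} :
    u ∈ fusionUnion P ℓ S ↔ ∃ s ∈ S, u ∈ fusionFiber P ℓ s := mem_biUnion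

theorem mem_fusionFiber_inl {p : Fin (n + 1) × ℂ} {u : Fin (n + 2) × ℂ} :
    u ∈ fusionFiber P ℓ (.inl p) ↔ u = (p.1.castSucc, fusionScale ℓ n (p.1 + 1) * p.2) ∨
      p.1 = 0 ∧ u = (Fin.last _, p.2) := by
  by_cases h : p.1 = 0
  · simp [fusionFiber, h]
  · simp [fusionFiber, h]

theorem mem_fusionFiber_inr {p : Fin 1 × ℂ} {u : Fin (n + 2) × ℂ} :
    u ∈ fusionFiber P ℓ (.inr p) ↔ ∃ k : Fin (n + 2), (k, P.q3 ^ (k : ℕ) * p.2) = u := by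
  simp [fusionFiber]

theorem castSucc_ne_last (k : Fin (n + 1)) : k.castSucc ≠ Fin.last (n + 1) :=
  (Fin.castSucc_lt_last k).ne

theorem fst_eq_zero_iff {s : FusionVar n} {u : Fin (n + 2) × ℂ} (hu : u ∈ fusionFiber P ℓ s) :
    u.1 = 0 ↔ s.IsLong ∧ u = fusionHead ℓ s := by
  match s, hu with
  | .inl p, hu =>
    rcases mem_fusionFiber_inl.1 hu with rfl | ⟨h, rfl⟩
    · aesop
    · exact iff_of_false (castSucc_ne_last 0).symm fun h => (castSucc_ne_last 0).symm
        (congrArg Prod.fst h.2)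
  | .inr p, hu =>
    obtain ⟨k, rfl⟩ := mem_fusionFiber_inr.1 hu
    simp_all [FusionVar.IsLong, fusionHead, true_and, Prod.mk.injEq]

theorem fst_eq_last_iff {s : FusionVar n} {u : Fin (n + 2) × ℂ} (hu : u ∈ fusionFiber P ℓ s) :
    u.1 = Fin.last _ ↔ s.IsLong ∧ u = fusionTail P s := by
  match s, hu with
  | .inl p, hu =>
    rcases mem_fusionFiber_inl.1 hu with rfl | ⟨h, rfl⟩
    · simp [fusionTail]
    aesop
  | .inr p, hu =>
    obtain ⟨k, rfl⟩ := mem_fusionFiber_inr.1 hu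
    simp_all [FusionVar.IsLong, fusionTail, true_and, Prod.mk.injEq]

theorem fusionHead_mem {s : FusionVar n} (hs : s.IsLong) : fusionHead ℓ s ∈ fusionFiber P ℓ s := by
  match s, hs with
  | .inl p, hs =>  have hs : p.1 = 0 := hs; simp_all [mem_fusionFiber_inl, fusionHead]
  | .inr p, _ => simp [mem_fusionFiber_inr, fusionHead]

theorem fusionTail_mem {s : FusionVar n} (hs : s.IsLong) : fusionTail P s ∈ fusionFiber P ℓ s := by
  match s, hs with
  | .inl p, hs => exact mem_fusionFiber_inl.2 (Or.inr ⟨hs, rfl⟩)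
  | .inr p, _ => exact mem_fusionFiber_inr.2 ⟨Fin.last _, rfl⟩

theorem fusionFiber_nonempty (s : FusionVar n) : (fusionFiber P ℓ s).Nonempty :=
  match s with
  | .inl _ => ⟨_, mem_fusionFiber_inl.2 (Or.inl rfl)⟩
  | .inr _ => ⟨_, mem_fusionFiber_inr.2 ⟨0, rfl⟩⟩

theorem fusionFiber_closed (hP : P.Admissible) (hℓ : exp ℓ = P.q1) (s : FusionVar n)
    {U : Finset (Fin (n + 2) × ℂ)} (hU : ∀ u ∈ fusionFiber P ℓ s, ∀ v ∈ fusionFiber P ℓ s,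
      u ∈ U → v ∉ U → omega P (n + 2) u v ≠ 0) {u : Fin (n + 2) × ℂ} (hu : u ∈ fusionFiber P ℓ s)
    (huU : u ∈ U) :
    (s.IsLong → fusionHead ℓ s ∈ U) ∧ ((s.IsLong → fusionTail P s ∈ U) → fusionFiber P ℓ s ⊆ U) := by
  have h11 : P.q1 * P.q1⁻¹ = 1 := mul_inv_cancel₀ hP.q1_ne
  match s, hU, hu with
  | .inl p, hU, hu =>
    have key : p.1 = 0 → (Fin.last (n + 1), p.2) ∈ U → (0, fusionScale ℓ n 1 * p.2) ∈ U := by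
      intro h0 ht; by_contra hh
      refine hU _ (fusionTail_mem (s := .inl p) h0) _ (fusionHead_mem (s := .inl p) h0) ht hh ?_
      simp [fusionHead, fusionTail]
      rw [omega_eq, if_pos (c := (0 : Fin (n + 2)) = _) nextColor_last.symm]
      grind [fusionScale_one]
    rcases mem_fusionFiber_inl.1 hu with rfl | ⟨h, rfl⟩
    · refine ⟨fun h => ?_, fun h v hv => ?_⟩
      · have h : p.1 = 0 := h; simpa [h, fusionHead] using huU
      · rcases mem_fusionFiber_inl.1 hv with rfl | ⟨h', rfl⟩
        exacts [huU, h h']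
    · refine ⟨fun _ => key h huU, fun _ v hv => ?_⟩
      rcases mem_fusionFiber_inl.1 hv with rfl | ⟨h', rfl⟩
      exacts [by simpa [h] using key h huU, huU]
  | .inr p, hU, hu =>
    have step : ∀ (k : ℕ) (hk : k + 1 < n + 2),
        ((⟨k + 1, hk⟩, P.q3 ^ (k + 1) * p.2) : Fin (n + 2) × ℂ) ∈ U →
          ((⟨k, by omega⟩, P.q3 ^ k * p.2) : Fin (n + 2) × ℂ) ∈ U := by
      intro k hk h; by_contra h'
      refine hU _ (mem_fusionFiber_inr.2 ⟨⟨k + 1, hk⟩, rfl⟩) _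
        (mem_fusionFiber_inr.2 ⟨⟨k, by omega⟩, rfl⟩) h h' ?_
      rw [omega_eq, if_pos (c := (⟨k + 1, hk⟩ : Fin (n + 2)) = nextColor ⟨k, by omega⟩)
        (nextColor_castSucc ⟨k, by omega⟩).symm]
      grind
    have down : ∀ (d k : ℕ) (hk : k + d < n + 2),
        ((⟨k + d, hk⟩, P.q3 ^ (k + d) * p.2) : Fin (n + 2) × ℂ) ∈ U →
          ((⟨k, by omega⟩, P.q3 ^ k * p.2) : Fin (n + 2) × ℂ) ∈ U := by
      intro d
      induction d with
      | zero => exact fun k hk h => h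
      | succ d ih => grind
    obtain ⟨k, rfl⟩ := mem_fusionFiber_inr.1 hu
    refine ⟨fun _ => ?_, fun ht v hv => ?_⟩
    · have := down k 0 (by omega) (by simpa using huU)
      simpa [fusionHead] using this
    · obtain ⟨j, rfl⟩ := mem_fusionFiber_inr.1 hv
      have hj : (j : ℕ) + (n + 1 - j) = n + 1 := by omega
      exact down (n + 1 - j) j (by omega) (by simp [hj]; exact ht trivial)

theorem fusionUnion_mono {I : Finset (FusionVar n)} (h : I ⊆ S) :
    fusionUnion P ℓ I ⊆ fusionUnion P ℓ S := fun _ hu => by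
  grind [mem_fusionUnion]

theorem FusionGood.mono (hS : FusionGood P ℓ S) {I : Finset (FusionVar n)} (h : I ⊆ S) :
    FusionGood P ℓ I where
  left := hS.left.mono (toLeft_subset_toLeft h)
  right := hS.right.mono (toRight_subset_toRight h)
  disj := hS.disj.subset (by exact_mod_cast h)
  union := hS.union.mono (fusionUnion_mono h)
  ne_zero := pairProd_ne_zero.2 fun u hu v hv => pairProd_ne_zero.1 hS.ne_zero u (h hu) v (h hv)

theorem prod_fusionUnion {M : Type} [CommMonoid M] (hS : FusionGood P ℓ S)
    (f : Fin (n + 2) × ℂ → M) :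
    ∏ u ∈ fusionUnion P ℓ S, f u = ∏ s ∈ S, ∏ u ∈ fusionFiber P ℓ s, f u := by
  classical
  exact (prod_congr (by aesop) fun _ _ => rfl).trans (prod_biUnion hS.disj)

theorem FusionGood.eq_of_mem (hS : FusionGood P ℓ S) {s t : FusionVar n} (hs : s ∈ S) (ht : t ∈ S)
    {u : Fin (n + 2) × ℂ} (hu : u ∈ fusionFiber P ℓ s) (hu' : u ∈ fusionFiber P ℓ t) : s = t := by
  by_contra h; exact disjoint_left.1 (hS.disj hs ht h) hu hu'

theorem FusionGood.sdiff [DecidableEq (Fin (n + 2) × ℂ)] [DecidableEq (FusionVar n)]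
    (hS : FusionGood P ℓ S) {I : Finset (FusionVar n)} (h : I ⊆ S) :
    fusionUnion P ℓ S \ fusionUnion P ℓ I = fusionUnion P ℓ (S \ I) := by
  ext u; simp only [Finset.mem_sdiff, mem_fusionUnion, not_exists, not_and]
  constructor
  · grind
  · rintro ⟨s, ⟨hs, hI⟩, hu⟩
    exact ⟨⟨s, hs, hu⟩, fun t ht hu' => hI (hS.eq_of_mem hs (h ht) hu hu' ▸ ht)⟩

theorem exists_eq_fusionUnion (hP : P.Admissible) (hℓ : exp ℓ = P.q1)
    (hS : FusionGood P ℓ S) {U : Finset (Fin (n + 2) × ℂ)} (hU : U ⊆ fusionUnion P ℓ S) {M : ℕ}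
    (hM : ColorBalanced M U)
    (hcl : ∀ u ∈ U, ∀ v ∈ fusionUnion P ℓ S, v ∉ U → omega P (n + 2) u v ≠ 0) :
    ∃ I ⊆ S, U = fusionUnion P ℓ I := by
  classical
  have hfc : ∀ s ∈ S, ∀ u ∈ fusionFiber P ℓ s, u ∈ U → (s.IsLong → fusionHead ℓ s ∈ U) ∧
      ((s.IsLong → fusionTail P s ∈ U) → fusionFiber P ℓ s ⊆ U) := fun s hs u hu huU =>
    fusionFiber_closed hP hℓ s (fun a _ b hb ha hb' =>
      hcl a ha b (mem_fusionUnion.2 ⟨s, hs, hb⟩) hb') hu huU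
  have hsub : S.filter (fun s => s.IsLong ∧ fusionTail P s ∈ U) ⊆
      S.filter (fun s => s.IsLong ∧ fusionHead ℓ s ∈ U) := by
    grind [fusionTail_mem]
  have hcard : (S.filter (fun s => s.IsLong ∧ fusionHead ℓ s ∈ U)).card ≤
      (S.filter (fun s => s.IsLong ∧ fusionTail P s ∈ U)).card := by
    calc _ = ((S.filter (fun s => s.IsLong ∧ fusionHead ℓ s ∈ U)).image (fusionHead ℓ)).card := by
          refine (card_image_of_injOn fun s hs t ht h => ?_).symm
          obtain ⟨hs, hl, -⟩ := mem_filter.1 hs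
          obtain ⟨ht, hl', -⟩ := mem_filter.1 ht
          exact hS.eq_of_mem hs ht (fusionHead_mem (P := P) hl) (h ▸ fusionHead_mem (P := P) hl')
      _ ≤ (U.filter fun u => u.1 = 0).card := by
          refine card_le_card fun u hu => ?_
          obtain ⟨s, hs, rfl⟩ := mem_image.1 hu
          obtain ⟨-, hl, hU'⟩ := mem_filter.1 hs
          exact mem_filter.2 ⟨hU', (fst_eq_zero_iff (fusionHead_mem (P := P) hl)).2 ⟨hl, rfl⟩⟩
      _ = (U.filter fun u => u.1 = Fin.last _).card := (hM _).trans (hM _).symm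
      _ ≤ ((S.filter (fun s => s.IsLong ∧ fusionTail P s ∈ U)).image (fusionTail P)).card := by
          refine card_le_card fun u hu => ?_
          obtain ⟨huU, hu1⟩ := mem_filter.1 hu
          obtain ⟨s, hs, hus⟩ := mem_fusionUnion.1 (hU huU)
          obtain ⟨hl, rfl⟩ := (fst_eq_last_iff hus).1 hu1; grind
      _ ≤ _ := card_image_le
  have heq := eq_of_subset_of_card_le hsub hcard
  refine ⟨S.filter fun s => fusionFiber P ℓ s ⊆ U, filter_subset _ _, ?_⟩; ext u
  rw [mem_fusionUnion]
  constructor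
  · intro hu; obtain ⟨s, hs, hus⟩ := mem_fusionUnion.1 (hU hu)
    have h := hfc s hs u hus hu
    refine ⟨s, mem_filter.2 ⟨hs, h.2 fun hl => ?_⟩, hus⟩
    have : s ∈ S.filter (fun s => s.IsLong ∧ fusionHead ℓ s ∈ U) := mem_filter.2 ⟨hs, hl, h.1 hl⟩
    grind
  grind

theorem FusionGood.omega_prod (hP : P.Admissible) (hℓ : exp ℓ = P.q1)
    (hS : FusionGood P ℓ S) {s t : FusionVar n} (hs : s ∈ S) (ht : t ∈ S) (hst : s ≠ t) :
    ∏ u ∈ fusionFiber P ℓ s, ∏ v ∈ fusionFiber P ℓ t, omega P (n + 2) u v =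
      fusionPair P ℓ s t * fusionPair P ℓ t s * fusionOmega P ℓ s t := by
  refine prod_omega_fusionFiber hP hℓ ?_ ?_ ?_
  · rintro p r rfl rfl h
    exact hst (congrArg _ (hS.left.2 (by simpa using hs) (by simpa using ht) h))
  · rintro p r rfl rfl h
    exact hst (congrArg _ (hS.right.2 (by simpa using hs) (by simpa using ht) h))
  · intro u hu v hv h
    have := hS.union.2 (mem_fusionUnion.2 ⟨s, hs, hu⟩) (mem_fusionUnion.2 ⟨t, ht, hv⟩) h
    exact hst (hS.eq_of_mem hs ht hu (this ▸ hv))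

theorem fusionValue_mul_of_hasSupport (hP : P.Admissible) (hℓ : exp ℓ = P.q1)
    (hS : FusionGood P ℓ S) {M : ℕ} {F : ShuffleAmbient P (n + 2)} (hF : HasSupport M F)
    (G : ShuffleAmbient P (n + 2)) :
    fusionValue ℓ (F * G) S =
      ShuffleAmbient.conv (fusionOmega P ℓ) (fusionValue ℓ F) (fusionValue ℓ G) S := by
  classical
  rw [fusionValue, value_mul F G hS.union, conv_eq, conv_eq, sum_div]
  symm
  refine sum_of_injOn (fusionUnion P ℓ) ?_ ?_ ?_ ?_
  · have key : ∀ I ⊆ S, ∀ J ⊆ S, fusionUnion P ℓ I = fusionUnion P ℓ J → I ⊆ J := by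
      intro I hI J hJ h s hs
      obtain ⟨u, hu⟩ := fusionFiber_nonempty (P := P) (ℓ := ℓ) s
      obtain ⟨t, ht, hut⟩ := mem_fusionUnion.1 (h ▸ mem_fusionUnion.2 ⟨s, hs, hu⟩)
      exact hS.eq_of_mem (hI hs) (hJ ht) hu hut ▸ ht
    intro I hI J hJ h; grind
  · intro I hI
    grind [coe_powerset, coe_subset, fusionUnion_mono]
  · intro U hU hnot; have hU := mem_powerset.1 hU; by_contra hne
    have h1 := left_ne_zero_of_mul (left_ne_zero_of_mul (div_ne_zero_iff.1 hne).1)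
    have h2 := right_ne_zero_of_mul (div_ne_zero_iff.1 hne).1
    obtain ⟨I, hI, rfl⟩ := exists_eq_fusionUnion hP hℓ hS hU (M := M)
      (by by_contra h; exact h1 (hF U h)) fun u hu v hv hv' =>
        prod_ne_zero_iff.1 (prod_ne_zero_iff.1 h2 u hu) v (Finset.mem_sdiff.2 ⟨hv, hv'⟩)
    grind
  · intro I hI; have hI := mem_powerset.1 hI
    have e1 : fusionUnion P ℓ S \ fusionUnion P ℓ I = fusionUnion P ℓ (S \ I) := hS.sdiff hI
    have e2 : pairProd (fusionPair P ℓ) S = pairProd (fusionPair P ℓ) I *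
        pairProd (fusionPair P ℓ) (S \ I) *
        ∏ s ∈ I, ∏ t ∈ S \ I, (fusionPair P ℓ s t * fusionPair P ℓ t s) := by
      rw [← pairProd_union _ disjoint_sdiff, union_sdiff_of_subset hI]
    have e3 : ∏ u ∈ fusionUnion P ℓ I, ∏ v ∈ fusionUnion P ℓ (S \ I), omega P (n + 2) u v =
        (∏ s ∈ I, ∏ t ∈ S \ I, (fusionPair P ℓ s t * fusionPair P ℓ t s)) *
          ∏ s ∈ I, ∏ t ∈ S \ I, fusionOmega P ℓ s t := by
      rw [← prod_mul_distrib, prod_fusionUnion (hS.mono hI)]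
      refine prod_congr rfl fun s hs => ?_; rw [← prod_mul_distrib]
      simp [prod_fusionUnion (hS.mono sdiff_subset)]; rw [Finset.prod_comm]
      refine prod_congr rfl fun t ht => ?_; have ht' := Finset.mem_sdiff.1 ht
      exact hS.omega_prod hP hℓ (hI hs) ht'.1 fun h => ht'.2 (h ▸ hs)
    have h0 := hS.ne_zero
    grind [left_ne_zero_of_mul, right_ne_zero_of_mul, fusionValue]

theorem fusionValue_add (F G : ShuffleAmbient P (n + 2)) :
    fusionValue ℓ (F + G) S = fusionValue ℓ F S + fusionValue ℓ G S := by
  rw [fusionValue, value_add, add_div]; rfl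

theorem fusionValue_smul (c : ℂ) (F : ShuffleAmbient P (n + 2)) :
    fusionValue ℓ (c • F) S = c * fusionValue ℓ F S := by
  rw [fusionValue, value_smul, mul_div_assoc]; rfl

theorem fusionValue_zero : fusionValue ℓ (0 : ShuffleAmbient P (n + 2)) S = 0 := by
  rw [fusionValue, value_zero, zero_div]

theorem fusionValue_mul (hP : P.Admissible) (hℓ : exp ℓ = P.q1)
    (hS : FusionGood P ℓ S) {s : Fin (n + 2) → ℂ} {F : ShuffleAmbient P (n + 2)}
    (hF : F ∈ betheSpace P s) (G : ShuffleAmbient P (n + 2)) :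
    fusionValue ℓ (F * G) S =
      ShuffleAmbient.conv (fusionOmega P ℓ) (fusionValue ℓ F) (fusionValue ℓ G) S := by
  refine Submodule.iSup_induction _ (motive := fun F => fusionValue ℓ (F * G) S =
    ShuffleAmbient.conv (fusionOmega P ℓ) (fusionValue ℓ F) (fusionValue ℓ G) S) hF ?_ ?_ ?_
  · exact fun N F hF => fusionValue_mul_of_hasSupport hP hℓ hS (hasSupport_of_mem hF) G
  · simp [ShuffleAmbient.conv, fusionValue_zero]
  simp_all [add_mul, fusionValue_add, ShuffleAmbient.conv, sum_add_distrib]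

end FusionUnion

/-! ### Values of elements of tensor products -/

section TensorValue

open Finset (toLeft toRight)

theorem sum_powerset_disjSum {α β : Type} {M : Type} [AddCommMonoid M] (A : Finset α) (B : Finset β)
    (h : Finset (α ⊕ β) → M) :
    ∑ I ∈ (A.disjSum B).powerset, h I = ∑ I ∈ A.powerset, ∑ J ∈ B.powerset, h (I.disjSum J) := by
  rw [← sum_product']; symm
  refine sum_nbij' (fun p => p.1.disjSum p.2) (fun I => (I.toLeft, I.toRight)) ?_ ?_ ?_ ?_ ?_
  · grind [disjSum_mono]
  · intro I hI; have hI := mem_powerset.1 hI; have h1 := toLeft_subset_toLeft hI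
    have h2 := toRight_subset_toRight hI; simp_all
  · simp
  · aesop
  · intro p _; rfl

theorem conv_disjSum {α β : Type} (w : α ⊕ β → α ⊕ β → ℂ) (h1 : ∀ a b, w (.inl a) (.inr b) = 1)
    (h2 : ∀ a b, w (.inr b) (.inl a) = 1) (f g : Finset α → ℂ) (f' g' : Finset β → ℂ)
    (S : Finset (α ⊕ β)) :
    ShuffleAmbient.conv w (fun S => f S.toLeft * f' S.toRight) (fun S => g S.toLeft * g' S.toRight) S =
      ShuffleAmbient.conv (fun a b => w (.inl a) (.inl b)) f g S.toLeft *
        ShuffleAmbient.conv (fun a b => w (.inr a) (.inr b)) f' g' S.toRight := by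
  classical
  obtain ⟨A, B, rfl⟩ : ∃ (A : Finset α) (B : Finset β), S = A.disjSum B := ⟨_, _, toLeft_disjSum_toRight.symm⟩
  rw [toLeft_disjSum, toRight_disjSum]
  simp [conv_eq, sum_powerset_disjSum, sum_mul_sum]
  refine sum_congr rfl fun I _ => sum_congr rfl fun J _ => ?_
  have e : A.disjSum B \ I.disjSum J = (A \ I).disjSum (B \ J) := by ext (a | b) <;> simp
  rw [e]; simp [h1, h2]; ring

variable {P P' : QParam} {m m' : ℕ}

/-- The value at a configuration as a linear functional. -/
def valueLin (T : Finset (Fin m × ℂ)) : ShuffleAmbient P m →ₗ[ℂ] ℂ where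
  toFun F := F.value T
  map_add' F G := F.value_add G T
  map_smul' c F := F.value_smul c T

/-- The value of an element of a tensor product at a pair of configurations. -/
def tensorValue (S : Finset ((Fin m × ℂ) ⊕ (Fin m' × ℂ))) :
    ShuffleAmbient P m ⊗[ℂ] ShuffleAmbient P' m' →ₗ[ℂ] ℂ :=
  LinearMap.mul' ℂ ℂ ∘ₗ TensorProduct.map (valueLin S.toLeft) (valueLin S.toRight)

theorem tensorValue_tmul (S : Finset ((Fin m × ℂ) ⊕ (Fin m' × ℂ))) (f : ShuffleAmbient P m)
    (g : ShuffleAmbient P' m') :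
    tensorValue S (f ⊗ₜ[ℂ] g) = f.value S.toLeft * g.value S.toRight := rfl

theorem tensorValue_mul {w : (Fin m × ℂ) ⊕ (Fin m' × ℂ) → (Fin m × ℂ) ⊕ (Fin m' × ℂ) → ℂ}
    (h1 : ∀ a b, w (.inl a) (.inr b) = 1) (h2 : ∀ a b, w (.inr b) (.inl a) = 1)
    (h3 : ∀ a b, w (.inl a) (.inl b) = omega P m a b)
    (h4 : ∀ a b, w (.inr a) (.inr b) = omega P' m' a b)
    {S : Finset ((Fin m × ℂ) ⊕ (Fin m' × ℂ))} (hl : GenericSet S.toLeft) (hr : GenericSet S.toRight)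
    (X Y : ShuffleAmbient P m ⊗[ℂ] ShuffleAmbient P' m') :
    tensorValue S (X * Y) = ShuffleAmbient.conv w (fun S => tensorValue S X)
      (fun S => tensorValue S Y) S := by
  classical
  rw [conv_eq]
  induction X using TensorProduct.induction_on with
  | zero => simp
  | add X X' h h' => simp [add_mul, h, h', sum_add_distrib]
  | tmul f g =>
    induction Y using TensorProduct.induction_on with
    | zero => simp
    | add Y Y' h h' => simp [mul_add, add_mul, h, h', sum_add_distrib]
    | tmul f' g' =>
      rw [Algebra.TensorProduct.tmul_mul_tmul, tensorValue_tmul, value_mul _ _ hl, value_mul _ _ hr]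
      refine Eq.trans ?_ ((conv_disjSum w h1 h2 f.value f'.value g.value g'.value S).symm.trans
        (conv_eq w _ _ S))
      simp [h3, h4]

/-- The inclusion of a tensor product of subalgebras. -/
def tensorVal (A : Subalgebra ℂ (ShuffleAmbient P m)) (B : Subalgebra ℂ (ShuffleAmbient P' m')) :
    A ⊗[ℂ] B →ₐ[ℂ] ShuffleAmbient P m ⊗[ℂ] ShuffleAmbient P' m' :=
  Algebra.TensorProduct.map A.val B.val

theorem evalTensor_eq (A : Subalgebra ℂ (ShuffleAmbient P m))
    (B : Subalgebra ℂ (ShuffleAmbient P' m')) {L M : ℕ} {y : Fin m → Fin L → ℂ}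
    {z : Fin m' → Fin M → ℂ} (hy : GenericTuple y) (hz : GenericTuple z) (X : A ⊗[ℂ] B) :
    evalTensor A B y z X = tensorValue ((tupleSet y).disjSum (tupleSet z)) (tensorVal A B X) := by
  induction X using TensorProduct.induction_on with
  | zero => simp
  | add X X' h h' => simp [h, h']
  | tmul f g =>
    have e : tensorVal A B (f ⊗ₜ[ℂ] g) = (f : ShuffleAmbient P m) ⊗ₜ[ℂ] (g : ShuffleAmbient P' m') :=
      Algebra.TensorProduct.map_tmul _ _ _ _
    rw [e, tensorValue_tmul, toLeft_disjSum, toRight_disjSum, tupleSet_eq_img,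
      tupleSet_eq_img, ← eval_eq_value hy, ← eval_eq_value hz]
    rfl

theorem HasSupport.tensorValue {N K : ℕ} {f : ShuffleAmbient P m} {g : ShuffleAmbient P' m'}
    (hf : HasSupport N f) (hg : HasSupport K g) {S : Finset ((Fin m × ℂ) ⊕ (Fin m' × ℂ))}
    (h : ¬ (ColorBalanced N S.toLeft ∧ ColorBalanced K S.toRight)) :
    tensorValue S (f ⊗ₜ[ℂ] g) = 0 := by
  rw [tensorValue_tmul]
  by_cases h1 : ColorBalanced N S.toLeft
  · aesop
  aesop

end TensorValue

/-! ### The fusion map at tuples of points -/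

section FusionTuple

variable {P : QParam} {ℓ : ℂ} {n L M : ℕ} {y : Fin (n + 1) → Fin L → ℂ} {z : Fin 1 → Fin M → ℂ}

theorem mem_fusionFiber_inl_iff {p : Fin (n + 1) × ℂ} {u : Fin (n + 2) × ℂ} :
    u ∈ fusionFiber P ℓ (.inl p) ↔
      Fin.ofNat (n + 1) (u.1 : ℕ) = p.1 ∧ u.2 = fusionScale ℓ n (u.1 + 1) * p.2 := by
  obtain ⟨i, x⟩ := u; rw [mem_fusionFiber_inl, Prod.mk.injEq, Prod.mk.injEq]
  induction i using Fin.lastCases with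
  | last =>
    simp [symm, false_and, false_or, true_and, Fin.val_last, fusionScale_last, one_mul, eq_comm]
  | cast i => simp_all

theorem fusionUnion_tuple :
    fusionUnion P ℓ ((tupleSet y).disjSum (tupleSet z)) = tupleSet (fusionPoint P ℓ y z) := by
  ext ⟨i, x⟩
  simp only [mem_fusionUnion, Sum.exists, inl_mem_disjSum, inr_mem_disjSum,
    mem_fusionFiber_inl_iff, mem_fusionFiber_inr, tupleSet_eq_img, mem_img, pt, mem_univ,
    true_and, Prod.exists, fusionPoint, Prod.mk.injEq]
  constructor
  · rintro (⟨j, w, ⟨_, a, rfl, rfl⟩, rfl, rfl⟩ | ⟨j, w, ⟨_, b, rfl, rfl⟩, k, rfl, rfl⟩)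
    · exact ⟨i, Fin.castAdd M a, rfl, by rw [Fin.append_left]⟩
    · exact ⟨k, Fin.natAdd L b, rfl, by
        rw [Fin.append_right]
        exact congrArg (fun i => _ * z i b) (Subsingleton.elim _ _)⟩
  · rintro ⟨_, c, rfl, rfl⟩
    induction c using Fin.addCases with
    | left a => exact Or.inl ⟨_, _, ⟨_, a, rfl, rfl⟩, rfl, by rw [Fin.append_left]⟩
    | right b => exact Or.inr ⟨_, _, ⟨0, b, rfl, rfl⟩, _, rfl, by rw [Fin.append_right]⟩

theorem fusionPair_inl (p r : Fin (n + 1) × ℂ) : fusionPair P ℓ (.inl p) (.inl r) =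
      (if p.1 = r.1 then (if p.1 = 0 then csqrt (fusionYY P n p.2 r.2) else 1) else 1) *
      if r.1 = nextColor p.1 then (if n = 0 then 1 else
        (if p.1 = 0 then (if n = 1 then (P.tilde ℓ 3).d else 1) else 1) *
          ((p.2 - r.2) / (p.2 - exp (ℓ / (n + 1)) * r.2))) else 1 := by
  grind [fusionPair]

theorem pairProd_fusionPair_inl (hP : P.Admissible) (hy : GenericTuple y) :
    pairProd (fun p r => fusionPair P ℓ (.inl p) (.inl r)) (tupleSet y) = fusionFactorY P ℓ y := by
  rw [tupleSet_eq_img, pairProd_img hy.pt_injective]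
  have e0 : ∀ u v : Fin (n + 1) × Fin L, fusionPair P ℓ (.inl (pt y u)) (.inl (pt y v)) =
      (if u.1 = v.1 then (if u.1 = 0 then csqrt (fusionYY P n (y u.1 u.2) (y u.1 v.2)) else 1)
        else 1) * if v.1 = nextColor u.1 then (if n = 0 then 1 else
        (if u.1 = 0 then (if n = 1 then (P.tilde ℓ 3).d else 1) else 1) *
          ((y u.1 u.2 - y (nextColor u.1) v.2) /
            (y u.1 u.2 - exp (ℓ / (n + 1)) * y (nextColor u.1) v.2))) else 1 := by
    grind [fusionPair_inl, pt]
  simp only [e0]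
  rw [pairProd_mul, pairProd_sameColor fun i a b => if i = 0 then
    csqrt (fusionYY P n (y i a) (y i b)) else 1]
  have e1 : ∏ i : Fin (n + 1), pairProd (fun a b => if i = 0 then
      csqrt (fusionYY P n (y i a) (y i b)) else 1) univ =
      ∏ a : Fin L, ∏ b ∈ Ioi a, fusionYY P n (y 0 a) (y 0 b) := by
    rw [prod_eq_single 0]
    · simp; rw [← prod_Ioi_eq_pairProd]
      refine prod_congr rfl fun a _ => prod_congr rfl fun b _ => ?_
      rw [fusionYY_comm hP (y 0 b), csqrt_mul_self]
    · intro i _ hi; simp [if_neg hi, pairProd]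
    · simp
  rw [e1, fusionFactorY]
  by_cases hn : n = 0
  · simp [hn, pairProd, fusionYY]
  · rw [pairProd_color (show n + 1 ≠ 1 by omega) fun i a b => if n = 0 then 1 else
        (if i = 0 then (if n = 1 then (P.tilde ℓ 3).d else 1) else 1) *
          ((y i a - y (nextColor i) b) / (y i a - exp (ℓ / (n + 1)) * y (nextColor i) b))]
    simp only [if_neg hn, fusionYY, prod_mul_distrib]
    congr 2
    · simp
    · rw [Finset.prod_comm]; exact prod_congr rfl fun a _ => Finset.prod_comm

theorem pairProd_fusionPair_inr (hP : P.Admissible) (hz : GenericTuple z) :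
    pairProd (fun p r => fusionPair (n := n) P ℓ (.inr p) (.inr r)) (tupleSet z) =
      fusionFactorZ P n (z 0) := by
  rw [tupleSet_eq_img, pairProd_img hz.pt_injective]
  have e : ∀ u ∈ (univ : Finset (Fin 1 × Fin M)), ∀ v ∈ univ, u ≠ v →
      fusionPair (n := n) P ℓ (.inr (pt z u)) (.inr (pt z v)) =
        if u.1 = v.1 then csqrt (fusionZZ P n (z u.1 u.2) (z u.1 v.2)) else 1 := by
    intro u _ v _ _; have h : u.1 = v.1 := Subsingleton.elim _ _; rw [if_pos h]
    simp [fusionPair, pt, h]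
  rw [pairProd_congr e, pairProd_sameColor fun i a b => csqrt (fusionZZ P n (z i a) (z i b)),
    Fin.prod_univ_one, ← prod_Ioi_eq_pairProd]
  refine prod_congr rfl fun a _ => prod_congr rfl fun b _ => ?_
  rw [fusionZZ_comm hP (z 0 b), csqrt_mul_self]; rfl

theorem prod_fusionYZ (hy : GenericTuple y) (hz : GenericTuple z) :
    ∏ p ∈ tupleSet y, ∏ r ∈ tupleSet z, fusionYZ P ℓ p r.2 = fusionFactorYZ P ℓ y (z 0) := by
  rw [tupleSet_eq_img, tupleSet_eq_img, prod_img hy.pt_injective]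
  simp [prod_img hz.pt_injective, Fintype.prod_prod_type, pt]
  rw [Finset.prod_comm, fusionFactorYZ]; refine prod_congr rfl fun a _ => ?_
  rw [Finset.prod_comm]; refine prod_congr rfl fun b _ => ?_
  rw [Fin.prod_univ_succ, mul_comm]; congr 1
  rw [← Finset.Ico_add_one_right_eq_Icc, prod_Ico_eq_prod_range,
    show n + 1 + 1 - 2 = n by omega, ← Fin.prod_univ_eq_prod_range (fun i => _ * _ * _)]
  refine prod_congr rfl fun k _ => ?_
  have e1 : Fin.ofNat (n + 1) (2 + (k : ℕ) - 1) = k.succ :=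
    Fin.ext ((Nat.mod_eq_of_lt (by omega)).trans (by grind))
  have e2 : (2 + (k : ℕ) - 2) = k := by omega
  have e3 : (2 + (k : ℕ)) = k + 1 + 1 := by omega
  simp only [e1, e2]; simp [fusionYZ, e3]

theorem pairProd_fusionPair (hP : P.Admissible) (hy : GenericTuple y) (hz : GenericTuple z) :
    pairProd (fusionPair P ℓ) ((tupleSet y).disjSum (tupleSet z)) = fusionFactor P ℓ y z := by
  classical
  have e : (tupleSet y).disjSum (tupleSet z) = img Sum.inl (tupleSet y) ∪ img Sum.inr (tupleSet z) := by
    ext (a | b) <;> simp [mem_img]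
  have hd : Disjoint (img (Sum.inl : _ → FusionVar n) (tupleSet y)) (img Sum.inr (tupleSet z)) := by
    rw [disjoint_left]; simp [mem_img]
  rw [e, pairProd_union _ hd, pairProd_img Sum.inl_injective, pairProd_img Sum.inr_injective,
    prod_img Sum.inl_injective, pairProd_fusionPair_inl hP hy, pairProd_fusionPair_inr hP hz,
    fusionFactor, ← prod_fusionYZ hy hz]
  congr 1; simp [prod_img, Sum.inr_injective, fusionPair, mul_one]

theorem FusionGeneric.fusionGood (hP : P.Admissible) (h : FusionGeneric P ℓ y z) :
    FusionGood P ℓ ((tupleSet y).disjSum (tupleSet z)) where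
  left := by rw [toLeft_disjSum]; exact h.1.genericSet
  right := by rw [toRight_disjSum]; exact h.2.1.genericSet
  disj := by
    have key : ∀ s ∈ (tupleSet y).disjSum (tupleSet z), ∀ u ∈ fusionFiber P ℓ s,
        ∃ c : Fin (L + M), u.2 = fusionPoint P ℓ y z u.1 c ∧
          s = Fin.addCases (fun a => Sum.inl (Fin.ofNat (n + 1) u.1, y (Fin.ofNat (n + 1) u.1) a))
            (fun b => Sum.inr (0, z 0 b)) c := by
      rintro (⟨j, w⟩ | ⟨j, w⟩) hs ⟨i, x⟩ hu
      · obtain ⟨h1, h2⟩ := mem_fusionFiber_inl_iff.1 hu; subst h1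
        rw [inl_mem_disjSum, tupleSet_eq_img, mem_img] at hs
        obtain ⟨⟨_, a⟩, -, ha⟩ := hs; obtain ⟨rfl, rfl⟩ := Prod.mk.inj ha
        exact ⟨Fin.castAdd M a, by rw [h2, fusionPoint, Fin.append_left], by rw [Fin.addCases_left]⟩
      · obtain ⟨k, hk⟩ := mem_fusionFiber_inr.1 hu
        obtain ⟨rfl, rfl⟩ := Prod.mk.inj hk
        rw [inr_mem_disjSum, tupleSet_eq_img, mem_img] at hs
        obtain ⟨⟨i', b⟩, -, hb⟩ := hs; obtain rfl := Subsingleton.elim 0 i'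
        obtain ⟨rfl, rfl⟩ := Prod.mk.inj hb
        exact ⟨Fin.natAdd L b, by rw [fusionPoint, Fin.append_right], by rw [Fin.addCases_right]⟩
    intro s hs t ht hst; refine disjoint_left.2 fun u hu hu' => hst ?_
    obtain ⟨c, hc, rfl⟩ := key s hs u hu
    obtain ⟨c', hc', rfl⟩ := key t ht u hu'
    have := h.2.2.1.2 (a₁ := (u.1, c)) (a₂ := (u.1, c')) (hc.symm.trans hc')
    grind
  union := by rw [fusionUnion_tuple]; exact h.2.2.1.genericSet
  ne_zero := by rw [pairProd_fusionPair hP h.1 h.2.1]; exact h.2.2.2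

theorem fusion_eq_fusionValue (hP : P.Admissible) (h : FusionGeneric P ℓ y z)
    (F : ShuffleAmbient P (n + 2)) :
    fusion P ℓ F y z = fusionValue ℓ F ((tupleSet y).disjSum (tupleSet z)) := by
  rw [fusion, fusionValue, fusionUnion_tuple, pairProd_fusionPair hP h.1 h.2.1,
    eval_eq_value h.2.2.1, tupleSet_eq_img]

end FusionTuple

/-! ### Injectivity of the evaluation at good configurations -/

section Density

variable {P : QParam} {m : ℕ}

theorem exists_components [NeZero m] {W : ℕ → Submodule ℂ (ShuffleAmbient P m)}
    (hW : ∀ N, ∀ F ∈ W N, HasSupport N F) {F : ShuffleAmbient P m} (hF : F ∈ ⨆ N, W N) :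
    ∃ f : ℕ →₀ ShuffleAmbient P m, (∀ N, f N ∈ W N) ∧ (f.sum fun _ x => x) = F ∧
      ∀ N T, ColorBalanced N T → F.value T = (f N).value T := by
  obtain ⟨f, hf, rfl⟩ := (Submodule.mem_iSup_iff_exists_finsupp _ _).1 hF
  refine ⟨f, hf, rfl, fun N T hT => ?_⟩
  have e : (f.sum fun _ x => x).value T = f.sum fun _ x => x.value T :=
    map_finsuppSum (valueLin T) f _
  rw [e, Finsupp.sum, sum_eq_single N]
  · intro K _ hK; exact hW K _ (hf K) T fun h => hK ((h 0).symm.trans (hT 0))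
  grind [Finsupp.notMem_support_iff, value_zero]

/-- The ratios of the points, and the points themselves, avoid `K`. -/
def IsSeparated (K : Set ℂ) (T : Finset (Fin m × ℂ)) : Prop :=
  (∀ u ∈ T, u.2 ∉ K) ∧ ∀ u ∈ T, ∀ v ∈ T, u ≠ v → ∀ c ∈ K, u.2 ≠ c * v.2

open MvPolynomial in
theorem eq_zero_of_separated [NeZero m] {s : Fin m → ℂ} {F : ShuffleAmbient P m}
    (hF : F ∈ betheSpace P s) {K : Set ℂ} (hK : K.Countable) (h0 : 0 ∈ K) (h1 : 1 ∈ K)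
    (h : ∀ T : Finset (Fin m × ℂ), IsSeparated K T → F.value T = 0) : F = 0 := by
  classical
  obtain ⟨f, hf, rfl, hval⟩ := exists_components (fun N F hF => hasSupport_of_mem hF) hF
  suffices hz : ∀ N, f N = 0 by simp [Finsupp.sum, hz]
  intro N; obtain ⟨hS, p, e, hp, -⟩ := mem_shuffleComponent_iff.1 (hf N).1
  refine HasSupport.ext hS (fun T _ => value_zero T) fun x hx => ?_
  have : Countable K := hK.to_subtype
  have hp0 : p = 0 := by
    by_contra hne
    obtain ⟨a, ha⟩ := exists_eval_ne_zero
      (fun i : Option ((Fin m × Fin N) × Option (Fin m × Fin N) × K) => match i with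
        | none => p
        | some (u, none, c) => X u - C (c : ℂ)
        | some (u, some v, c) => if v = u then 1 else X u - C (c : ℂ) * X v) (by
        grind [sub_ne_zero, X_ne_C, X_ne_C_mul_X])
    have hu : ∀ u, a u ∉ K := fun u hu => ha (some (u, none, ⟨a u, hu⟩)) (by simp)
    have huv : ∀ u v, u ≠ v → ∀ c ∈ K, a u ≠ c * a v := by
      intro u v huv c hc h; refine ha (some (u, some v, ⟨c, hc⟩)) ?_
      simp [if_neg (Ne.symm huv), h]
    have hx : GenericTuple fun i k => a (i, k) := by
      refine ⟨fun i k h => hu (i, k) ((show a (i, k) = 0 from h) ▸ h0), fun u v h => ?_⟩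
      grind
    have hsep : IsSeparated K (tupleSet fun i k => a (i, k)) := by
      rw [tupleSet_eq_img]
      constructor
      · intro u hu'; obtain ⟨v, -, rfl⟩ := mem_img.1 hu'; exact hu v
      · intro u hu' v hv' hne; obtain ⟨u, -, rfl⟩ := mem_img.1 hu'
        obtain ⟨v, -, rfl⟩ := mem_img.1 hv'
        exact huv u v fun h => hne (h ▸ rfl)
    have hb : ColorBalanced N (tupleSet fun i k => a (i, k)) := by
      grind [tupleSet_eq_img, colorBalanced_img_pt, colorBalanced_univ]
    refine ha none ?_; have := hp _ hx
    rw [eval_eq_value hx, ← tupleSet_eq_img, ← hval N _ hb, h _ hsep] at this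
    simpa using this.symm
  have := hp x hx; rw [hp0, map_zero, mul_assoc] at this; rw [map_zero]
  exact (mul_eq_zero.1 this).resolve_right (mul_ne_zero
    (pow_ne_zero _ (prod_ne_zero_iff.2 fun v _ => hx.1 _ _))
    (poleProd_ne_zero hx.genericSet))

end Density

section FusionSeparated

variable {P : QParam} {ℓ : ℂ} {n : ℕ} {K : Subfield ℂ}

theorem csqrt_ne_zero {x : ℂ} (hx : x ≠ 0) : csqrt x ≠ 0 := fun h =>
  hx (by rw [← csqrt_mul_self x, h, mul_zero])

/-- The field contains all constants of the fusion specialization. -/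
structure ContainsFusion (P : QParam) (ℓ : ℂ) (n : ℕ) (K : Subfield ℂ) : Prop where
  q1 : P.q1 ∈ K
  q2 : P.q2 ∈ K
  q3 : P.q3 ∈ K
  exp : exp (ℓ / (n + 1)) ∈ K
  scale : ∀ j, fusionScale ℓ n j ∈ K

theorem fusionPair_ne_zero (hP : P.Admissible) (hK : ContainsFusion P ℓ n K) {s t : FusionVar n}
    (h : ∀ c ∈ K, s.val ≠ c * t.val) : fusionPair P ℓ s t ≠ 0 := by
  obtain ⟨k1, k2, k3, kθ, ks⟩ := hK; have k1' := inv_mem k1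
  have k2' := inv_mem k2; have k3' := inv_mem k3
  have hne : ∀ c ∈ K, s.val - c * t.val ≠ 0 := fun c hc => sub_ne_zero.2 (h c hc)
  have hne1 : s.val - t.val ≠ 0 := by simpa using hne 1 (one_mem K)
  have hδ : fusionDelta P n ≠ 0 := by
    unfold fusionDelta
    split_ifs
    exacts [one_ne_zero, hP.d_ne]
  match s, t, hne, hne1 with
  | .inl p, .inl r, hne, hne1 =>
    refine mul_ne_zero ?_ ?_
    · split_ifs
      · refine csqrt_ne_zero ?_; unfold fusionYY; have g1 := hne _ k1
        have g2 := hne _ k2; have g3 := hne _ k1'; have g4 := hne _ k2'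
        have := hP.d_ne; positivity
      · exact one_ne_zero
    · have hd : (P.tilde ℓ 3).d ≠ 0 := mul_ne_zero hP.d_ne (exp_ne_zero _)
      have g : (p.2 - r.2) / (p.2 - exp (ℓ / (n + 1)) * r.2) ≠ 0 := div_ne_zero hne1 (hne _ kθ)
      split_ifs <;> simp [g, hd]
  | .inl p, .inr r, hne, hne1 =>
    simp [FusionVar.val] at hne hne1
    have hne' : ∀ j, ∀ c ∈ K, fusionScale ℓ n j * p.2 - c * r.2 ≠ 0 := by
      intro j c hc
      have := hne ((fusionScale ℓ n j)⁻¹ * c) (mul_mem (inv_mem (ks j)) hc)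
      grind [fusionScale, fusionScale_ne, mul_ne_zero]
    have := hP.d_ne; simp [fusionPair, fusionYZ]
    split_ifs
    · have g1 := hne (P.q1 ^ 2 * P.q3) (mul_mem (pow_mem k1 _) k3)
      have g2 := hne P.q3⁻¹ k3'; have g3 := hne (P.q1 * P.q3) (mul_mem k1 k3)
      have g4 := hne (P.q1⁻¹ * P.q3 ^ n) (mul_mem k1' (pow_mem k3 _))
      have g5 := hne (P.q1 * P.q3 ^ (n + 2)) (mul_mem k1 (pow_mem k3 _))
      have g6 := hne (P.q3 ^ n) (pow_mem k3 _)
      have g7 := hne (P.q1 * P.q3 ^ (n + 1)) (mul_mem k1 (pow_mem k3 _))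
      positivity
    · have g1 := hne' (p.1 + 1) (P.q1 * P.q3 ^ ((p.1 : ℕ) + 1)) (mul_mem k1 (pow_mem k3 _))
      have g3 := hne' (p.1 + 1) (P.q1⁻¹ * P.q3 ^ ((p.1 : ℕ) - 1)) (mul_mem k1' (pow_mem k3 _))
      simp_all [pow_mem]
  | .inr _, .inl _, _, _ => exact one_ne_zero
  | .inr p, .inr r, hne, hne1 =>
    simp [FusionVar.val] at hne hne1; refine csqrt_ne_zero ?_
    simp_all [pow_mem, fusionZZ]

theorem fusionFiber_snd (hP : P.Admissible) (hK : ContainsFusion P ℓ n K) {s : FusionVar n}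
    {u : Fin (n + 2) × ℂ} (hu : u ∈ fusionFiber P ℓ s) : ∃ c ∈ K, c ≠ 0 ∧ u.2 = c * s.val := by
  match s, hu with
  | .inl p, hu => exact ⟨_, hK.scale _, fusionScale_ne _, (mem_fusionFiber_inl_iff.1 hu).2⟩
  | .inr p, hu =>
    obtain ⟨k, rfl⟩ := mem_fusionFiber_inr.1 hu
    exact ⟨_, pow_mem hK.q3 _, pow_ne_zero _ hP.q3_ne, rfl⟩

theorem fusionFiber_injOn (hℓ : exp ℓ = P.q1) (hP : P.Admissible) {s : FusionVar n}
    (hs : s.val ≠ 0) : Set.InjOn Prod.snd (fusionFiber P ℓ s : Set (Fin (n + 2) × ℂ)) := by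
  intro u hu v hv h
  match s, hs, hu, hv with
  | .inl p, hs, hu, hv =>
    have hs : p.2 ≠ 0 := hs
    have hq : P.q1⁻¹ ≠ 1 := by
      intro h; have := hP.indep 1 0 0 (by simp [inv_eq_one.1 h])
      omega
    have key : p.1 = 0 → fusionScale ℓ n (p.1 + 1) * p.2 ≠ p.2 := by
      intro h0; rw [h0, Fin.val_zero, zero_add, fusionScale_one hℓ]; grind
    rcases mem_fusionFiber_inl.1 hu with rfl | ⟨h1, rfl⟩ <;>
      rcases mem_fusionFiber_inl.1 hv with rfl | ⟨h2, rfl⟩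
    · rfl
    · exact absurd h (key h2)
    · grind
    · rfl
  | .inr p, hs, hu, hv =>
    obtain ⟨k, rfl⟩ := mem_fusionFiber_inr.1 hu
    obtain ⟨l, rfl⟩ := mem_fusionFiber_inr.1 hv
    have h' := mul_right_cancel₀ hs h
    have := hP.indep 0 0 ((k : ℤ) - l) (by
      rw [zpow_zero, zpow_zero, one_mul, one_mul, zpow_sub₀ hP.q3_ne, zpow_natCast, zpow_natCast,
        h',
        div_self (pow_ne_zero _ hP.q3_ne)])
    grind

theorem fusionGood_of_separated (hP : P.Admissible) (hℓ : exp ℓ = P.q1)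
    (hK : ContainsFusion P ℓ n K) {S : Finset (FusionVar n)} (h0 : ∀ s ∈ S, s.val ≠ 0)
    (h : ∀ s ∈ S, ∀ t ∈ S, s ≠ t → ∀ c ∈ K, s.val ≠ c * t.val) : FusionGood P ℓ S := by
  have h1 : ∀ s ∈ S, ∀ t ∈ S, s.val = t.val → s = t := by
    intro s hs t ht hst; by_contra hne
    exact h s hs t ht hne 1 (one_mem K) (by rw [one_mul, hst])
  have h2 : ∀ s ∈ S, ∀ t ∈ S, ∀ u ∈ fusionFiber P ℓ s, ∀ v ∈ fusionFiber P ℓ t, u.2 = v.2 →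
      s = t := by
    intro s hs t ht u hu v hv huv; by_contra hne
    obtain ⟨c, hc, hc0, hcu⟩ := fusionFiber_snd hP hK hu
    obtain ⟨e, he, -, hev⟩ := fusionFiber_snd hP hK hv
    refine h s hs t ht hne (c⁻¹ * e) (mul_mem (inv_mem hc) he) ?_; grind
  refine ⟨⟨fun p hp => h0 _ (mem_toLeft.1 hp), fun p hp r hr e => Sum.inl_injective
    (h1 _ (mem_toLeft.1 hp) _ (mem_toLeft.1 hr) e)⟩,
    ⟨fun p hp => h0 _ (mem_toRight.1 hp), fun p hp r hr e => Sum.inr_injective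
    (h1 _ (mem_toRight.1 hp) _ (mem_toRight.1 hr) e)⟩, ?_, ⟨?_, ?_⟩, ?_⟩
  · exact fun s hs t ht hst => disjoint_left.2 fun u hu hu' => hst (h2 s hs t ht u hu u hu' rfl)
  · grind [mem_fusionUnion, fusionFiber_snd]
  · intro u hu v hv huv; obtain ⟨s, hs, hu⟩ := mem_fusionUnion.1 hu
    obtain ⟨t, ht, hv⟩ := mem_fusionUnion.1 hv
    obtain rfl := h2 s hs t ht u hu v hv huv
    exact fusionFiber_injOn hℓ hP (h0 s hs) hu hv huv
  grind [pairProd_ne_zero, fusionPair_ne_zero]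

theorem countable_closure {s : Set ℂ} (hs : s.Countable) :
    (Subfield.closure s : Set ℂ).Countable := by
  rw [← Cardinal.le_aleph0_iff_set_countable] at hs ⊢
  exact (Subfield.cardinalMk_closure_le_max s).trans (max_le hs le_rfl)

variable {P' P'' : QParam} {s' : Fin (n + 1) → ℂ} {s'' : Fin 1 → ℂ}

theorem eq_zero_of_tensorValue (hP : P.Admissible) (hℓ : exp ℓ = P.q1)
    (hP' : P'.Admissible) (hP'' : P''.Admissible)
    (X : betheAlgebra P' s' ⊗[ℂ] betheAlgebra P'' s'')
    (hX : ∀ S : Finset (FusionVar n), FusionGood P ℓ S →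
      tensorValue S (tensorVal (betheAlgebra P' s') (betheAlgebra P'' s'') X) = 0) :
    X = 0 := by
  classical
  set b := Module.Basis.ofVectorSpace ℂ (betheAlgebra P'' s'')
  set c := TensorProduct.equivFinsuppOfBasisRight b X with hc
  have hXc : X = c.sum fun j f => f ⊗ₜ[ℂ] b j := by
    rw [← TensorProduct.equivFinsuppOfBasisRight_symm_apply, hc, LinearEquiv.symm_apply_apply]
  suffices h : c = 0 by rw [hXc, h, Finsupp.sum_zero_index]
  let gen : Set ℂ := {P.q1, P.q2, P.q3, exp (ℓ / (n + 1))} ∪ Set.range (fusionScale ℓ n)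
  have hgen : gen.Countable := ((Set.toFinite _).countable).union (Set.countable_range _)
  have hsub : ∀ {g : Set ℂ}, gen ⊆ g → ContainsFusion P ℓ n (Subfield.closure g) := fun hg =>
    ⟨Subfield.subset_closure (hg (by simp [gen])), Subfield.subset_closure (hg (by simp [gen])),
      Subfield.subset_closure (hg (by simp [gen])), Subfield.subset_closure (hg (by simp [gen])),
      fun j => Subfield.subset_closure (hg (Or.inr ⟨j, rfl⟩))⟩
  have key : ∀ T, IsSeparated (Subfield.closure gen : Set ℂ) T → ∀ j,
      (c j : ShuffleAmbient P' (n + 1)).value T = 0 := by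
    intro T hT
    let g := gen ∪ (T.image Prod.snd : Finset ℂ)
    have hg : g.Countable := hgen.union (countable_toSet _)
    have hle : Subfield.closure gen ≤ Subfield.closure g := Subfield.closure_mono Set.subset_union_left
    have hTg : ∀ u ∈ T, u.2 ∈ Subfield.closure g := fun u hu =>
      Subfield.subset_closure (Or.inr (by exact_mod_cast mem_image_of_mem _ hu))
    let d : _ →₀ ℂ := c.mapRange (fun f : betheAlgebra P' s' =>
      (f : ShuffleAmbient P' (n + 1)).value T) (value_zero T)
    have hd : ∀ T', ((d.linearCombination ℂ b : betheAlgebra P'' s'') : ShuffleAmbient P'' 1).value T' =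
        tensorValue (T.disjSum T') (tensorVal (betheAlgebra P' s') (betheAlgebra P'' s'') X) := by
      intro T'; rw [hXc, map_finsuppSum, map_finsuppSum]
      have e : ∀ j f, tensorValue (T.disjSum T')
          (tensorVal (betheAlgebra P' s') (betheAlgebra P'' s'') (f ⊗ₜ[ℂ] b j)) =
          (f : ShuffleAmbient P' (n + 1)).value T * (b j : ShuffleAmbient P'' 1).value T' := by
        simp [tensorVal, Algebra.TensorProduct.map_tmul, tensorValue_tmul, toLeft_disjSum,
          toRight_disjSum]
      simp [e]
      have e2 : ((d.linearCombination ℂ b : betheAlgebra P'' s'') : ShuffleAmbient P'' 1).value T' =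
          d.sum fun j a => a * (b j : ShuffleAmbient P'' 1).value T' := by
        refine (map_finsuppSum ((valueLin T').comp (betheAlgebra P'' s'').val.toLinearMap) d _).trans
          (Finsupp.sum_congr fun j _ => map_smul _ _ _)
      rw [e2, Finsupp.sum_mapRange_index fun j => zero_mul _]
    have hz : ((d.linearCombination ℂ b : betheAlgebra P'' s'') : ShuffleAmbient P'' 1) = 0 := by
      refine eq_zero_of_separated ((mem_betheAlgebra_iff hP'').1 (Subtype.prop _))
        (countable_closure hg) (zero_mem _) (one_mem _) fun T' hT' => ?_
      rw [hd]
      refine hX _ (fusionGood_of_separated hP hℓ (hsub Set.Subset.rfl) ?_ ?_)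
      · rintro (u | u) hu h0
        · exact hT.1 u (inl_mem_disjSum.1 hu) (by rw [show u.2 = 0 from h0]; simp)
        · exact hT'.1 u (inr_mem_disjSum.1 hu) (by rw [show u.2 = 0 from h0]; simp)
      · rintro (u | u) hu (v | v) hv hne e he h
        · exact hT.2 u (inl_mem_disjSum.1 hu) v (inl_mem_disjSum.1 hv)
            (fun h => hne (h ▸ rfl)) e he h
        · have h : u.2 = e * v.2 := h; have hu := inl_mem_disjSum.1 hu
          by_cases he0 : e = 0
          · exact hT.1 u hu (by rw [h, he0, zero_mul]; simp)
          · refine hT'.1 v (inr_mem_disjSum.1 hv) ?_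
            rw [show v.2 = e⁻¹ * u.2 by rw [h, inv_mul_cancel_left₀ he0]]
            exact mul_mem (inv_mem (hle he)) (hTg u hu)
        · have h : u.2 = e * v.2 := h
          exact hT'.1 u (inr_mem_disjSum.1 hu) (h ▸ mul_mem (hle he) (hTg v (inl_mem_disjSum.1 hv)))
        · exact hT'.2 u (inr_mem_disjSum.1 hu) v (inr_mem_disjSum.1 hv)
            (fun h => hne (h ▸ rfl)) e (hle he) h
    have hd0 : d = 0 := (linearIndependent_iff.1 b.linearIndependent) d (Subtype.ext hz)
    intro j; exact DFunLike.congr_fun hd0 j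
  ext1 j
  refine Subtype.ext (eq_zero_of_separated ((mem_betheAlgebra_iff hP').1 (c j).2)
    (countable_closure hgen) (zero_mem _) (one_mem _) fun T hT => key T hT j)

end FusionSeparated

/-! ### The prefactor of the generators under the fusion specialization -/

section InvariantPair

variable {P : QParam} {m : ℕ}

/-- A form of the pair factor of the generators that is invariant under dilations. -/
def gInv (P : QParam) {m : ℕ} (u v : Fin m × ℂ) : ℂ :=
  (if m = 1 then P.q⁻¹ else 1) * (if u.1 = v.1 then 1 - P.q2 * (v.2 / u.2) else 1) *
    if v.1 = nextColor u.1 then (1 - v.2 / u.2)⁻¹ else 1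

theorem prod_prod_eq_pairProd {β M : Type} [CommMonoid M] (k : β → β → M) (S : Finset β) :
    ∏ u ∈ S, ∏ v ∈ S, k u v = (∏ u ∈ S, k u u) * pairProd k S := by
  classical
  rw [pairProd_def, ← prod_product', ← diag_union_offDiag,
    prod_union (disjoint_diag_offDiag S), prod_diag]

theorem ColorBalanced.prod_fst {γ M : Type} [CommMonoid M] {N : ℕ} {T : Finset (Fin m × γ)}
    (hT : ColorBalanced N T) (f : Fin m → M) : ∏ u ∈ T, f u.1 = (∏ i, f i) ^ N := by
  classical
  rw [← prod_fiberwise T Prod.fst, ← prod_pow]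
  refine prod_congr rfl fun i _ => ?_
  rw [prod_congr rfl fun u hu => by rw [(mem_filter.1 hu).2], prod_const]
  congr 1; convert hT i

theorem ColorBalanced.prod_ite {γ : Type} {N : ℕ} {T : Finset (Fin m × γ)}
    (hT : ColorBalanced N T) (i : Fin m) (c : ℂ) :
    ∏ u ∈ T, (if u.1 = i then c else 1) = c ^ N := by
  rw [hT.prod_fst fun j => if j = i then c else 1, prod_ite_eq' univ i, if_pos (mem_univ _)]

theorem gPre_eq {N : ℕ} {T : Finset (Fin m × ℂ)} (hT : GenericSet T) (hb : ColorBalanced N T) :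
    gPre P T = (if m = 1 then 1 else 1 - P.q2) ^ T.card * pairProd (gInv P) T := by
  by_cases hm : m = 1
  · subst hm
    have e : ∀ u ∈ T, ∀ v ∈ T, u ≠ v → gPair P u v = gInv P u v := by
      intro u hu v hv _; have h0 := hT.1 u hu
      have h1 : u.1 = v.1 := Subsingleton.elim _ _
      have h2 : v.1 = nextColor u.1 := Subsingleton.elim _ _
      simp [gPair, gInv, if_pos h1, if_pos h2]; grind
    rw [gPre, pairProd_congr e]; simp [gDiag]
  · have e : ∀ u ∈ T, ∀ v ∈ T, u ≠ v → gPair P u v = gInv P u v *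
        ((if v.1 = u.1 then u.2 else 1) * if v.1 = nextColor u.1 then u.2⁻¹ else 1) := by
      intro u hu v hv _; have h0 := hT.1 u hu
      simp [gPair, gInv, if_neg hm, eq_comm (a := v.1) (b := u.1)]; grind
    have h1 := prod_prod_eq_pairProd (fun u v : Fin m × ℂ => if v.1 = u.1 then u.2 else 1) T
    have h2 := prod_prod_eq_pairProd
      (fun u v : Fin m × ℂ => if v.1 = nextColor u.1 then u.2⁻¹ else 1) T
    simp [hb.prod_ite, if_neg (nextColor_ne hm _).symm] at h1 h2
    rw [gPre, pairProd_congr e, pairProd_mul, pairProd_mul, ← h2]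
    simp [gDiag, if_neg hm, prod_mul_distrib]
    have h3 : (∏ u ∈ T, u.2 ^ N) * ∏ u ∈ T, u.2⁻¹ ^ N = 1 := by
      rw [← prod_mul_distrib]; refine prod_eq_one fun u hu => ?_
      rw [← mul_pow, mul_inv_cancel₀ (hT.1 u hu), one_pow]
    grind

theorem gInv_scale {c : ℂ} (hc : c ≠ 0) (u v : Fin m × ℂ) :
    gInv P (u.1, c * u.2) (v.1, c * v.2) = gInv P u v := by
  grind [gInv, mul_div_mul_left]

end InvariantPair

section FusionPrefactor

variable {P : QParam} {ℓ : ℂ} {n : ℕ}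

theorem gInv_eq (u v : Fin (n + 2) × ℂ) :
    gInv P u v = (if u.1 = v.1 then 1 - P.q2 * (v.2 / u.2) else 1) *
      if v.1 = nextColor u.1 then (1 - v.2 / u.2)⁻¹ else 1 := by
  rw [gInv, if_neg (by omega), one_mul]

/-- The type of a variable: its color, or being a variable `z`. -/
def FusionVar.type (s : FusionVar n) : Fin (n + 1) ⊕ Unit := Sum.map Prod.fst (fun _ => ()) s

/-- The constants in the pair factors. -/
def fusionConst (P : QParam) (ℓ : ℂ) : Fin (n + 1) ⊕ Unit → Fin (n + 1) ⊕ Unit → ℂ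
  | .inl i, .inl j => (if i = 0 ∧ j = 0 then (if n = 0 then P.q2 else csqrt P.q) else 1) *
      if n ≠ 0 ∧ j = nextColor i then (if i = 0 then (if n = 1 then (P.tilde ℓ 3).d⁻¹ else 1) else 1)
        else 1
  | .inl i, .inr _ => if i = 0 then P.q2 ^ 2 * P.q3 ^ n * (fusionDelta P n ^ 2)⁻¹
      else P.q2 * P.q3⁻¹ * P.d⁻¹
  | .inr _, .inl _ => 1
  | .inr _, .inr _ => csqrt ((P.q2 * (fusionDelta P n)⁻¹) ^ (n + 2))

/-- The pair factors of the tensor product. -/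
def fusionGInv (P : QParam) (ℓ : ℂ) : FusionVar n → FusionVar n → ℂ
  | .inl p, .inl r => gInv (P.tilde ℓ (n + 2)) p r
  | .inr p, .inr r => gInv (P.second (n + 2)) p r
  | _, _ => 1

theorem one_sub_mul_inv {c r : ℂ} (hc : c ≠ 0) (hr : r ≠ 0) :
    1 - c * r⁻¹ = -(c * r⁻¹) * (1 - c⁻¹ * r) := by
  field_simp; ring

theorem prod_gInv_string (u : Fin (n + 2) × ℂ) (z : ℂ) :
    ∏ k : Fin (n + 2), gInv P u (k, P.q3 ^ (k : ℕ) * z) =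
      (1 - P.q2 * (P.q3 ^ (u.1 : ℕ) * z / u.2)) *
      (1 - P.q3 ^ (nextColor u.1 : ℕ) * z / u.2)⁻¹ := by
  simp only [gInv_eq, prod_mul_distrib, prod_ite_eq, prod_ite_eq', mem_univ, if_true]

theorem prod_string_gInv (u : Fin (n + 2) × ℂ) (z : ℂ) :
    ∏ k : Fin (n + 2), gInv P (k, P.q3 ^ (k : ℕ) * z) u =
      (1 - P.q2 * (u.2 / (P.q3 ^ (u.1 : ℕ) * z))) *
      (1 - u.2 / (P.q3 ^ (prevColor u.1 : ℕ) * z))⁻¹ := by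
  have h : ∀ k, (u.1 = nextColor k) = (k = prevColor u.1) := fun k =>
    propext (eq_comm.trans nextColor_eq_iff)
  simp only [gInv_eq, prod_mul_distrib, h, prod_ite_eq', mem_univ, if_true]

theorem prod_gInv_inr_inr (hP : P.Admissible) {z w : ℂ} (hz : z ≠ 0) :
    ∏ k : Fin (n + 2), ∏ l : Fin (n + 2), gInv P (k, P.q3 ^ (k : ℕ) * z) (l, P.q3 ^ (l : ℕ) * w) =
      (1 - P.q2 * (w / z)) ^ (n + 2) * ((1 - P.q3 * (w / z))⁻¹ ^ (n + 1) *
        (1 - (P.q3 ^ (n + 1))⁻¹ * (w / z))⁻¹) := by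
  have h3 := hP.q3_ne; simp only [prod_gInv_string]
  rw [prod_mul_distrib, Fin.prod_univ_castSucc (fun k : Fin (n + 2) => (_ : ℂ)⁻¹)]
  have e1 : ∀ k : ℕ, P.q3 ^ k * w / (P.q3 ^ k * z) = w / z := fun k =>
    mul_div_mul_left _ _ (pow_ne_zero _ h3)
  have e2 : ∀ k : ℕ, P.q3 ^ (k + 1) * w / (P.q3 ^ k * z) = P.q3 * (w / z) := fun k => by grind
  simp only [e1, nextColor_castSucc, nextColor_last, Fin.val_castSucc, Fin.val_succ, e2,
    prod_const, card_univ, Fintype.card_fin, Fin.val_last, Fin.val_zero, pow_zero,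
    one_mul]
  field_simp

theorem fusionGInv_inr_inr (hP : P.Admissible) {p r : Fin 1 × ℂ} (hp : p.2 ≠ 0) (hr : r.2 ≠ 0)
    (hpr : p.2 ≠ r.2) :
    (∏ u ∈ fusionFiber (n := n) P ℓ (.inr p), ∏ v ∈ fusionFiber P ℓ (.inr r), gInv P u v) *
      ∏ u ∈ fusionFiber (n := n) P ℓ (.inr r), ∏ v ∈ fusionFiber P ℓ (.inr p), gInv P u v =
    (P.q2 * (fusionDelta P n)⁻¹) ^ (n + 2) * fusionZZ P n p.2 r.2 *
      (gInv (P.second (n + 2)) p r * gInv (P.second (n + 2)) r p) := by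
  obtain ⟨i, z⟩ := p; obtain ⟨j, w⟩ := r
  have hij : i = j := Subsingleton.elim _ _
  have hij' : j = nextColor i := Subsingleton.elim _ _
  have hji' : i = nextColor j := Subsingleton.elim _ _
  simp only [prod_fusionFiber_inr, prod_gInv_inr_inr hP hp, prod_gInv_inr_inr hP hr]
  have h3 := hP.q3_ne; have h2 := hP.q2_ne
  have hδ : fusionDelta P n ≠ 0 := by
    unfold fusionDelta
    split_ifs
    exacts [one_ne_zero, hP.d_ne]
  obtain ⟨ρ, hρ, rfl⟩ : ∃ ρ, ρ ≠ 0 ∧ w = ρ * z := ⟨w / z, div_ne_zero hr hp, by field_simp⟩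
  have hρ1 : 1 - ρ ≠ 0 := fun h => hpr (by grind)
  have e1 : ρ * z / z = ρ := by field_simp
  have e2 : z / (ρ * z) = ρ⁻¹ := by field_simp
  have e3 : ∀ c : ℂ, z - c * (ρ * z) = z * (1 - c * ρ) := by intro c; ring
  have e4 : z - ρ * z = z * (1 - ρ) := by ring
  have hc : P.q3 ^ (n + 1) ≠ 0 := pow_ne_zero _ h3
  have e5 : 1 - ρ⁻¹ = -ρ⁻¹ * (1 - ρ) := by field_simp; ring
  simp only [gInv, if_pos hij, if_pos hij', if_pos hij.symm, if_pos hji', if_true, e1, e2,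
    QParam.second_q2, fusionZZ, e3, e4, mul_div_mul_comm, one_sub_mul_inv h2 hρ,
    one_sub_mul_inv h3 hρ, one_sub_mul_inv (inv_ne_zero hc) hρ, inv_inv, mul_inv, mul_pow, e5,
    div_self hp]
  have hq : (P.second (n + 2)).q⁻¹ * (P.second (n + 2)).q⁻¹ * P.q2 = 1 := by
    grind [QParam.second, QParam.q2]
  generalize (P.second (n + 2)).q⁻¹ = a at *
  have hk : (-(P.q2 * ρ⁻¹)) ^ (n + 2) * (-(P.q3 * ρ⁻¹))⁻¹ ^ (n + 1) *
      (-((P.q3 ^ (n + 1))⁻¹ * ρ⁻¹))⁻¹ = P.q2 ^ (n + 2) := by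
    have k1 : -(P.q2 * ρ⁻¹) * (-(P.q3 * ρ⁻¹))⁻¹ = P.q2 * P.q3⁻¹ := by field_simp
    have k2 : -(P.q2 * ρ⁻¹) * (-((P.q3 ^ (n + 1))⁻¹ * ρ⁻¹))⁻¹ = P.q2 * P.q3 ^ (n + 1) := by
      field_simp
    have k3 : P.q3⁻¹ ^ (n + 1) * P.q3 ^ (n + 1) = 1 := by
      rw [← mul_pow, inv_mul_cancel₀ h3, one_pow]
    have k4 : ∀ x y w : ℂ, x ^ (n + 2) * y ^ (n + 1) * w = (x * y) ^ (n + 1) * (x * w) := by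
      intros; ring
    rw [k4, k1, k2, mul_pow]; grind
  have hall : ((fusionDelta P n)⁻¹ ^ (n + 2) * fusionDelta P n ^ (n + 1) * fusionDelta P n) *
      (z ^ 2 * z⁻¹ * z⁻¹) * ((1 - ρ) ^ 2 * (1 - ρ)⁻¹ * (1 - ρ)⁻¹) *
      (a * a * -(P.q2 * ρ⁻¹) * (-ρ⁻¹)⁻¹) = 1 := by
    have k1 : (fusionDelta P n)⁻¹ ^ (n + 2) * fusionDelta P n ^ (n + 1) * fusionDelta P n = 1 := by
      rw [mul_assoc, ← pow_succ, ← mul_pow, inv_mul_cancel₀ hδ, one_pow]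
    grind
  simp only [div_eq_mul_inv, mul_inv, one_pow, one_mul, mul_pow]
  generalize (1 - P.q2 * ρ) = A; grind

theorem fusionGInv_inl_inr (hP : P.Admissible) (hℓ : exp ℓ = P.q1)
    {p : Fin (n + 1) × ℂ} {r : Fin 1 × ℂ} (hp : p.2 ≠ 0) (hr : r.2 ≠ 0) :
    (∏ u ∈ fusionFiber P ℓ (.inl p), ∏ v ∈ fusionFiber P ℓ (.inr r), gInv P u v) *
      ∏ v ∈ fusionFiber P ℓ (.inr r), ∏ u ∈ fusionFiber P ℓ (.inl p), gInv P v u =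
    fusionConst P ℓ (.inl p.1) (.inr ()) * fusionYZ P ℓ p r.2 := by
  obtain ⟨i, y⟩ := p; obtain ⟨c, z⟩ := r; have h1 := hP.q1_ne
  have h2 := hP.q2_ne; have h3 := hP.q3_ne; have hd := hP.d_ne
  have h123 : P.q1 = P.q2⁻¹ * P.q3⁻¹ := by have := hP.prod_eq_one; grind
  have hδ : fusionDelta P n ≠ 0 := by unfold fusionDelta; grind
  rw [Finset.prod_comm (s := fusionFiber P ℓ (.inr (c, z)))]
  simp [prod_fusionFiber_inr, prod_fusionFiber_inl, prod_gInv_string, prod_string_gInv]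
  by_cases hi : i = 0
  · subst hi
    obtain ⟨ρ, hρ, rfl⟩ : ∃ ρ, ρ ≠ 0 ∧ z = ρ * y := ⟨z / y, div_ne_zero hr hp, by field_simp⟩
    simp [fusionYZ, fusionScale_one hℓ, prevColor_zero, nextColor_last,
      show nextColor (0 : Fin (n + 2)) = Fin.succ 0 from nextColor_castSucc 0, show prevColor (Fin.last (n + 1)) = (Fin.last n).castSucc from prevColor_succ (Fin.last n), fusionConst]
    have ht : P.q3 ^ n ≠ 0 := pow_ne_zero _ h3; simp [pow_succ]
    generalize P.q3 ^ n = t at *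
    have e1 : ∀ c : ℂ, y - c * (ρ * y) = y * (1 - c * ρ) := by intro c; ring
    have e2 : y - ρ * y = y * (1 - ρ) := by ring
    have e3 : P.q2 * (ρ * y / (P.q1⁻¹ * y)) = P.q3⁻¹ * ρ := by rw [h123]; field_simp
    have e4 : P.q3 * (ρ * y) / (P.q1⁻¹ * y) = P.q1 * P.q3 * ρ := by field_simp
    have e5 : P.q2 * (t * P.q3 * (ρ * y) / y) = P.q1⁻¹ * t * ρ := by rw [h123]; field_simp
    have e6 : ρ * y / y = ρ := by field_simp
    have e7 : P.q2 * (P.q1⁻¹ * y / (ρ * y)) = P.q2 * P.q1⁻¹ * ρ⁻¹ := by field_simp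
    have e8 : P.q1⁻¹ * y / (t * P.q3 * (ρ * y)) = P.q1⁻¹ * t⁻¹ * P.q3⁻¹ * ρ⁻¹ := by field_simp
    have e9 : P.q2 * (y / (t * P.q3 * (ρ * y))) = P.q2 * t⁻¹ * P.q3⁻¹ * ρ⁻¹ := by field_simp
    have e10 : y / (t * (ρ * y)) = t⁻¹ * ρ⁻¹ := by field_simp
    rw [e3, e4, e5, e6, e7, e8, e9, e10, one_sub_mul_inv (by positivity) hρ,
      one_sub_mul_inv (by positivity) hρ, one_sub_mul_inv (by positivity) hρ,
      one_sub_mul_inv (by positivity) hρ, e1, e1, e1, e1, e1, e1, e1, e2,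
      show (P.q2 * P.q1⁻¹)⁻¹ = P.q1 * P.q1 * P.q3 by rw [h123]; field_simp,
      show (P.q1⁻¹ * t⁻¹ * P.q3⁻¹)⁻¹ = P.q1 * (t * P.q3) by field_simp,
      show (P.q2 * t⁻¹ * P.q3⁻¹)⁻¹ = P.q1 * (t * P.q3 * P.q3) by rw [h123]; field_simp, inv_inv]
    simp [div_eq_mul_inv]; field_simp
  · obtain ⟨k, rfl⟩ : ∃ k : Fin n, i = ⟨k + 1, by omega⟩ := by
      have h0 : (i : ℕ) ≠ 0 := fun h => hi (Fin.ext h)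
      exact ⟨⟨i - 1, by omega⟩, Fin.ext (by simp only; omega)⟩
    have hprev : prevColor (Fin.castSucc (⟨k + 1, by omega⟩ : Fin (n + 1))) =
      (⟨k, by omega⟩ : Fin (n + 1)).castSucc := prevColor_succ ⟨k, by omega⟩
    have hY : fusionScale ℓ n (k + 1 + 1) * y ≠ 0 := mul_ne_zero (fusionScale_ne _) hp
    simp only [if_neg hi, fusionYZ, nextColor_castSucc, hprev, Fin.val_castSucc,
      Fin.val_succ, Nat.add_sub_cancel, fusionConst]
    generalize fusionScale ℓ n (k + 1 + 1) * y = Y at *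
    obtain ⟨ρ, hρ, rfl⟩ : ∃ ρ, ρ ≠ 0 ∧ z = ρ * Y := ⟨z / Y, div_ne_zero hr hY, by field_simp⟩
    have ht : P.q3 ^ (k : ℕ) ≠ 0 := pow_ne_zero _ h3; simp [pow_succ]
    generalize P.q3 ^ (k : ℕ) = t at *
    have e1 : ∀ c : ℂ, Y - c * (ρ * Y) = Y * (1 - c * ρ) := by intro c; ring
    have e3 : P.q2 * (t * P.q3 * (ρ * Y) / Y) = P.q1⁻¹ * t * ρ := by rw [h123]; field_simp
    have e4 : t * P.q3 * P.q3 * (ρ * Y) / Y = t * P.q3 * P.q3 * ρ := by field_simp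
    have e5 : P.q2 * (Y / (t * P.q3 * (ρ * Y))) = P.q2 * t⁻¹ * P.q3⁻¹ * ρ⁻¹ := by field_simp
    have e6 : Y / (t * (ρ * Y)) = t⁻¹ * ρ⁻¹ := by field_simp
    rw [e3, e4, e5, e6, one_sub_mul_inv (by positivity) hρ, one_sub_mul_inv (by positivity) hρ,
      e1, e1, e1, e1, inv_inv,
      show (P.q2 * t⁻¹ * P.q3⁻¹)⁻¹ = P.q1 * (t * P.q3 * P.q3) by rw [h123]; field_simp]
    simp [div_eq_mul_inv]; grind

theorem fusionGInv_inl_inl_zero (hP : P.Admissible) (hℓ : exp ℓ = P.q1) {y w : ℂ}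
    (hy : y ≠ 0) (hw : w ≠ 0) (hyw : y ≠ w) :
    (∏ u ∈ fusionFiber P ℓ (.inl ((0 : Fin (n + 1)), y)),
      ∏ v ∈ fusionFiber P ℓ (.inl ((0 : Fin (n + 1)), w)), gInv P u v) *
    (∏ u ∈ fusionFiber P ℓ (.inl ((0 : Fin (n + 1)), w)),
      ∏ v ∈ fusionFiber P ℓ (.inl ((0 : Fin (n + 1)), y)), gInv P u v) =
    (if n = 0 then P.q2 ^ 2 else P.q) * fusionYY P n y w *
      (gInv (P.tilde ℓ (n + 2)) ((0 : Fin (n + 1)), y) (0, w) *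
        gInv (P.tilde ℓ (n + 2)) ((0 : Fin (n + 1)), w) (0, y)) := by
  have h1 := hP.q1_ne; have h2 := hP.q2_ne
  have c1 : ¬ ((0 : Fin (n + 2)) = nextColor 0) := fun h => nextColor_ne (by omega) _ h.symm
  have c2 : ¬ ((0 : Fin (n + 2)) = Fin.last (n + 1)) := by simp [Fin.ext_iff]
  have c3 : ¬ (Fin.last (n + 1) = (0 : Fin (n + 2))) := fun h => c2 h.symm
  have c4 : (0 : Fin (n + 2)) = nextColor (Fin.last (n + 1)) := nextColor_last.symm
  have c5 : ¬ (Fin.last (n + 1) = nextColor (Fin.last (n + 1))) := fun h => c3 (h.trans nextColor_last)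
  have c6 : Fin.last (n + 1) = nextColor (0 : Fin (n + 2)) ↔ n = 0 := by
    rw [nextColor_eq_iff_val]; simp
  obtain ⟨ρ, hρ, rfl⟩ : ∃ ρ, ρ ≠ 0 ∧ w = ρ * y := ⟨w / y, div_ne_zero hw hy, by field_simp⟩
  have hρ1 : 1 - ρ ≠ 0 := fun h => hyw (by grind)
  have e1 : ∀ c : ℂ, y - c * (ρ * y) = y * (1 - c * ρ) := by intro c; ring
  have e2 : y - ρ * y = y * (1 - ρ) := by ring
  have e3 : P.q1⁻¹ * (ρ * y) / (P.q1⁻¹ * y) = ρ := by field_simp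
  have e4 : ρ * y / (P.q1⁻¹ * y) = P.q1 * ρ := by field_simp
  have e5 : P.q1⁻¹ * (ρ * y) / y = P.q1⁻¹ * ρ := by field_simp
  have e6 : ρ * y / y = ρ := by field_simp
  have e3' : P.q1⁻¹ * y / (P.q1⁻¹ * (ρ * y)) = ρ⁻¹ := by field_simp
  have e4' : y / (P.q1⁻¹ * (ρ * y)) = P.q1 * ρ⁻¹ := by field_simp
  have e5' : P.q1⁻¹ * y / (ρ * y) = P.q1⁻¹ * ρ⁻¹ := by field_simp
  have e6' : y / (ρ * y) = ρ⁻¹ := by field_simp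
  have e7 : 1 - ρ⁻¹ = -ρ⁻¹ * (1 - ρ) := by field_simp; ring
  simp [prod_fusionFiber_inl, fusionScale_one hℓ, gInv_eq, if_neg c1, if_pos c4, if_neg c5, c6,
    fusionYY, e1, e2, e3, e4, e5, e6, e3', e4', e5', e6', one_sub_mul_inv h2 hρ, one_sub_mul_inv h1 hρ, one_sub_mul_inv (inv_ne_zero h1) hρ]
  by_cases hn : n = 0
  · subst hn; have c7 : (0 : Fin (0 + 1)) = nextColor 0 := rfl
    simp [gInv, if_pos c7, e6, e6', e7, QParam.tilde_q2, one_sub_mul_inv h2 hρ]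
    have hq2 : P.q2 = P.q * P.q := by rw [QParam.q2, sq]
    simp only [QParam.tilde, mul_pow, div_eq_mul_inv, mul_inv, ← inv_pow]
    rw [hq2]; field_simp
  · have c7 : ¬ ((0 : Fin (n + 1)) = nextColor 0) := fun h => nextColor_ne (by omega) _ h.symm
    have hq2 : P.q2 = P.q * P.q := by rw [QParam.q2, sq]
    simp [gInv, if_neg hn, if_neg c7, e6, e6', QParam.tilde_q2, one_sub_mul_inv h2 hρ]
    simp [div_eq_mul_inv]
    rw [QParam.q1, hq2]; field_simp

end FusionPrefactor

section FusionPrefactorProduct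

variable {P : QParam} {ℓ : ℂ} {n : ℕ}

theorem gInv_tilde_of_ne {p r : Fin (n + 1) × ℂ} (h : p.1 ≠ r.1) : gInv (P.tilde ℓ (n + 2)) p r =
      if r.1 = nextColor p.1 then (1 - r.2 / p.2)⁻¹ else 1 := by
  have hn : n + 1 ≠ 1 := by grind
  simp_all [gInv, one_mul]

theorem prod_gInv_inl_inl (hP : P.Admissible) {p r : Fin (n + 1) × ℂ} (hp : p.2 ≠ 0)
    (hpr : p.2 ≠ r.2) (h00 : ¬ (p.1 = 0 ∧ r.1 = 0)) :
    ∏ u ∈ fusionFiber P ℓ (.inl p), ∏ v ∈ fusionFiber P ℓ (.inl r), gInv P u v =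
      fusionConst P ℓ (.inl p.1) (.inl r.1) * fusionPair P ℓ (.inl p) (.inl r) *
        gInv (P.tilde ℓ (n + 2)) p r := by
  obtain ⟨i, y⟩ := p; obtain ⟨j, w⟩ := r; have hn : n ≠ 0 := by grind
  have hlast : ∀ k : Fin (n + 1), k.castSucc ≠ Fin.last (n + 1) := fun k =>
    (Fin.castSucc_lt_last k).ne
  simp only [prod_fusionFiber_inl, fusionPair, fusionConst, if_neg h00, one_mul, hn, ne_eq,
    not_false_eq_true, true_and]
  by_cases hij : i = j
  · subst hij; have hni : i ≠ nextColor i := (nextColor_ne (by omega) i).symm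
    have hni' : i.castSucc ≠ nextColor i.castSucc := (nextColor_ne (by omega) _).symm
    simp_all [gInv, mul_one, one_mul, QParam.tilde_q2, mul_div_mul_left, fusionScale_ne]
  · have hB := ite_fusionScale (ℓ := ℓ) (fun a b => (1 - b / a)⁻¹) (by grind) hij y w
    have hci : i.castSucc ≠ j.castSucc := fun h => hij (Fin.castSucc_injective _ h)
    have l0 : ∀ k : Fin (n + 1), k.castSucc = nextColor (Fin.last (n + 1)) ↔ k = 0 := by
      grind [nextColor_last, Fin.ext_iff]
    have f1 : gInv P (i.castSucc, fusionScale ℓ n (i + 1) * y)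
        (j.castSucc, fusionScale ℓ n (j + 1) * w) =
        (if j.castSucc = nextColor i.castSucc then
          (1 - fusionScale ℓ n (j + 1) * w / (fusionScale ℓ n (i + 1) * y))⁻¹ else 1) := by
      rw [gInv_eq, if_neg hci, one_mul]
    have f2 : (if j = 0 then gInv P (i.castSucc, fusionScale ℓ n (i + 1) * y)
        (Fin.last _, w) else 1) = (if j = 0 then (if Fin.last (n + 1) = nextColor i.castSucc then
          (1 - w / (fusionScale ℓ n (i + 1) * y))⁻¹ else 1) else 1) := by
      rw [gInv_eq, if_neg (hlast i), one_mul]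
    have f3 : (if i = 0 then gInv P (Fin.last (n + 1), y)
        (j.castSucc, fusionScale ℓ n (j + 1) * w) *
          (if j = 0 then gInv P (Fin.last (n + 1), y) (Fin.last (n + 1), w) else 1) else 1) = 1 := by
      simp [mul_one, gInv_eq, symm, one_mul]; grind
    rw [f1, f2, f3, mul_one, hB, gInv_tilde_of_ne hij]
    by_cases h1 : j = nextColor i
    · have hd : (P.tilde ℓ 3).d ≠ 0 := mul_ne_zero hP.d_ne (exp_ne_zero _)
      grind [sub_ne_zero, exp]
    grind

theorem fusionGInv_inl_inl (hP : P.Admissible) (hℓ : exp ℓ = P.q1)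
    {p r : Fin (n + 1) × ℂ} (hp : p.2 ≠ 0) (hr : r.2 ≠ 0) (hpr : p.2 ≠ r.2) :
    (∏ u ∈ fusionFiber P ℓ (.inl p), ∏ v ∈ fusionFiber P ℓ (.inl r), gInv P u v) *
      (∏ u ∈ fusionFiber P ℓ (.inl r), ∏ v ∈ fusionFiber P ℓ (.inl p), gInv P u v) =
    (fusionConst P ℓ (.inl p.1) (.inl r.1) * fusionPair P ℓ (.inl p) (.inl r) *
        gInv (P.tilde ℓ (n + 2)) p r) *
    (fusionConst P ℓ (.inl r.1) (.inl p.1) * fusionPair P ℓ (.inl r) (.inl p) *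
        gInv (P.tilde ℓ (n + 2)) r p) := by
  by_cases h00 : p.1 = 0 ∧ r.1 = 0
  · obtain ⟨i, y⟩ := p; obtain ⟨j, w⟩ := r; obtain ⟨hi, hj⟩ := h00; subst hi hj
    have hne : ¬ (n ≠ 0 ∧ (0 : Fin (n + 1)) = nextColor 0) := by grind [nextColor_ne]
    rw [fusionGInv_inl_inl_zero hP hℓ hp hr hpr]
    simp [fusionPair, fusionConst, if_neg hne]
    grind [csqrt, csqrt_mul_self, fusionYY_comm]
  grind [prod_gInv_inl_inl]

theorem fusionGInv_comm (hP : P.Admissible) (hℓ : exp ℓ = P.q1)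
    {S : Finset (FusionVar n)} (hS : FusionGood P ℓ S) {s t : FusionVar n} (hs : s ∈ S)
    (ht : t ∈ S) (hst : s ≠ t) :
    (∏ u ∈ fusionFiber P ℓ s, ∏ v ∈ fusionFiber P ℓ t, gInv P u v) *
      (∏ u ∈ fusionFiber P ℓ t, ∏ v ∈ fusionFiber P ℓ s, gInv P u v) =
    (fusionConst P ℓ s.type t.type * fusionPair P ℓ s t * fusionGInv P ℓ s t) *
    (fusionConst P ℓ t.type s.type * fusionPair P ℓ t s * fusionGInv P ℓ t s) := by
  match s, t, hs, ht, hst with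
  | .inl p, .inl r, hs, ht, hst =>
    have h1 : p ∈ S.toLeft := by simpa using hs
    have h2 : r ∈ S.toLeft := by simpa using ht
    exact fusionGInv_inl_inl hP hℓ (hS.left.1 _ h1) (hS.left.1 _ h2)
      fun h => hst (congrArg _ (hS.left.2 h1 h2 h))
  | .inr p, .inr r, hs, ht, hst =>
    have h1 : p ∈ S.toRight := by simpa using hs
    have h2 : r ∈ S.toRight := by simpa using ht
    rw [fusionGInv_inr_inr hP (hS.right.1 _ h1) (hS.right.1 _ h2)
      fun h => hst (congrArg _ (hS.right.2 h1 h2 h))]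
    simp [fusionConst, fusionPair, fusionGInv, FusionVar.type]
    grind [csqrt_mul_self, fusionZZ, fusionDelta, fusionZZ_comm]
  | .inl p, .inr r, hs, ht, hst =>
    have h1 : p ∈ S.toLeft := by simpa using hs
    have h2 : r ∈ S.toRight := by simpa using ht
    rw [fusionGInv_inl_inr hP hℓ (hS.left.1 _ h1) (hS.right.1 _ h2)]
    simp [fusionConst, fusionPair, fusionGInv, FusionVar.type]
  | .inr r, .inl p, hs, ht, hst =>
    have h1 : p ∈ S.toLeft := by simpa using ht
    have h2 : r ∈ S.toRight := by simpa using hs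
    rw [mul_comm, fusionGInv_inl_inr hP hℓ (hS.left.1 _ h1) (hS.right.1 _ h2)]
    simp [fusionConst, fusionPair, fusionGInv, FusionVar.type]

theorem pairProd_fusionUnion (k : Fin (n + 2) × ℂ → Fin (n + 2) × ℂ → ℂ)
    {S : Finset (FusionVar n)} (hS : (S : Set (FusionVar n)).PairwiseDisjoint (fusionFiber P ℓ)) :
    pairProd k (fusionUnion P ℓ S) = (∏ s ∈ S, pairProd k (fusionFiber P ℓ s)) *
      pairProd (fun s t => ∏ u ∈ fusionFiber P ℓ s, ∏ v ∈ fusionFiber P ℓ t, k u v) S := by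
  classical
  induction S using Finset.induction_on with
  | empty => aesop
  | insert a S ha ih =>
    have hS' : (S : Set (FusionVar n)).PairwiseDisjoint (fusionFiber P ℓ) := hS.subset (by simp)
    have hd : Disjoint (fusionFiber P ℓ a) (fusionUnion P ℓ S) := by
      rw [disjoint_left]; intro u hu hu'
      obtain ⟨s, hs, hu'⟩ := mem_fusionUnion.1 hu'
      have hne : a ≠ s := by rintro rfl; exact ha hs
      exact disjoint_left.1 (hS (by simp) (by simp [hs]) hne) hu hu'
    have e : fusionUnion P ℓ (insert a S) = fusionFiber P ℓ a ∪ fusionUnion P ℓ S := by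
      ext u; simp [mem_fusionUnion]
    have hd' : Disjoint ({a} : Finset (FusionVar n)) S := by simpa using ha
    have hpr : ∀ f : Fin (n + 2) × ℂ → ℂ, ∏ u ∈ fusionUnion P ℓ S, f u =
        ∏ s ∈ S, ∏ u ∈ fusionFiber P ℓ s, f u := fun f =>
      (prod_congr (by aesop) fun _ _ => rfl).trans (prod_biUnion hS')
    rw [e, pairProd_union _ hd, ih hS', prod_insert ha, insert_eq, pairProd_union _ hd']
    have h1 : pairProd (fun s t => ∏ u ∈ fusionFiber P ℓ s, ∏ v ∈ fusionFiber P ℓ t, k u v)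
        {a} = 1 := by simp [pairProd]
    have h2 : ∏ u ∈ fusionFiber P ℓ a, ∏ v ∈ fusionUnion P ℓ S, (k u v * k v u) =
        ∏ s ∈ S, ((∏ u ∈ fusionFiber P ℓ a, ∏ v ∈ fusionFiber P ℓ s, k u v) *
          ∏ u ∈ fusionFiber P ℓ s, ∏ v ∈ fusionFiber P ℓ a, k u v) := by
      simp [hpr]; rw [Finset.prod_comm]; refine prod_congr rfl fun s _ => ?_
      rw [Finset.prod_comm (s := fusionFiber P ℓ s), ← prod_mul_distrib]
      exact prod_congr rfl fun u _ => prod_mul_distrib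
    grind

theorem pairProd_disjSum {β γ : Type} (k : β ⊕ γ → β ⊕ γ → ℂ) (S : Finset (β ⊕ γ)) :
    pairProd k S = pairProd (fun p r => k (.inl p) (.inl r)) S.toLeft *
      pairProd (fun p r => k (.inr p) (.inr r)) S.toRight *
      ∏ p ∈ S.toLeft, ∏ r ∈ S.toRight, (k (.inl p) (.inr r) * k (.inr r) (.inl p)) := by
  classical
  have e : S = img Sum.inl S.toLeft ∪ img Sum.inr S.toRight := by ext (a | b) <;> simp [mem_img]
  have hd : Disjoint (img (Sum.inl : β → β ⊕ γ) S.toLeft) (img Sum.inr S.toRight) := by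
    rw [disjoint_left]; simp [mem_img]
  conv_lhs => rw [e]
  rw [pairProd_union _ hd, pairProd_img Sum.inl_injective, pairProd_img Sum.inr_injective,
    prod_img Sum.inl_injective]
  congr 1; exact prod_congr rfl fun p _ => prod_img Sum.inr_injective _ _

theorem pairProd_fusionGInv (S : Finset (FusionVar n)) :
    pairProd (fusionGInv P ℓ) S = pairProd (gInv (P.tilde ℓ (n + 2))) S.toLeft *
      pairProd (gInv (P.second (n + 2))) S.toRight := by
  rw [pairProd_disjSum]; simp [fusionGInv]

/-- The product of a function of the types over the variables of a balanced configuration. -/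
def typeProd (f : Fin (n + 1) ⊕ Unit → ℂ) (L M : ℕ) : ℂ := (∏ i, f (.inl i)) ^ L * f (.inr ()) ^ M

theorem prod_type {S : Finset (FusionVar n)} {L M : ℕ} (hL : ColorBalanced L S.toLeft)
    (hM : ColorBalanced M S.toRight) (f : Fin (n + 1) ⊕ Unit → ℂ) :
    ∏ s ∈ S, f s.type = typeProd f L M := by
  have e : S = S.toLeft.disjSum S.toRight := by ext (a | b) <;> simp
  conv_lhs => rw [e]
  rw [prod_disjSum, typeProd, ← hL.prod_fst]; congr 1
  have h1 := hM.prod_fst fun _ => f (.inr ()); simpa [FusionVar.type] using h1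

theorem pairProd_type {S : Finset (FusionVar n)} {L M : ℕ} (hL : ColorBalanced L S.toLeft)
    (hM : ColorBalanced M S.toRight) {K : Fin (n + 1) ⊕ Unit → Fin (n + 1) ⊕ Unit → ℂ}
    (hK : ∀ s t, K s t ≠ 0) :
    pairProd (fun s t : FusionVar n => K s.type t.type) S =
      typeProd (fun τ => typeProd (K τ) L M) L M / typeProd (fun τ => K τ τ) L M := by
  have h := prod_prod_eq_pairProd (fun s t : FusionVar n => K s.type t.type) S
  simp [prod_type hL hM] at h
  grind [prod_type, typeProd, mul_div_cancel_left₀, mul_ne_zero, pow_ne_zero, prod_ne_zero_iff]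

theorem typeProd_ne_zero {f : Fin (n + 1) ⊕ Unit → ℂ} (hf : ∀ τ, f τ ≠ 0) (L M : ℕ) :
    typeProd f L M ≠ 0 :=
  mul_ne_zero (pow_ne_zero _ (prod_ne_zero_iff.2 fun _ _ => hf _)) (pow_ne_zero _ (hf _))

theorem fusionConst_ne_zero (hP : P.Admissible) (σ τ : Fin (n + 1) ⊕ Unit) :
    fusionConst P ℓ σ τ ≠ 0 := by
  have h2 := hP.q2_ne; have h3 := hP.q3_ne; have hd := hP.d_ne
  have hd' : (P.tilde ℓ 3).d ≠ 0 := mul_ne_zero hP.d_ne (exp_ne_zero _)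
  have hδ : fusionDelta P n ≠ 0 := by unfold fusionDelta; grind
  have hq := csqrt_ne_zero hP.q_ne
  rcases σ with i | i <;> rcases τ with j | j <;> unfold fusionConst
  · grind
  · positivity
  · exact one_ne_zero
  · exact csqrt_ne_zero (by positivity)

/-- The variable of a given type with value `1`. -/
def unitVar : Fin (n + 1) ⊕ Unit → FusionVar n
  | .inl i => .inl (i, 1)
  | .inr _ => .inr (0, 1)

theorem pairProd_gInv_fusionFiber {s : FusionVar n} (hs : s.val ≠ 0) :
    pairProd (gInv P) (fusionFiber P ℓ s) = pairProd (gInv P) (fusionFiber P ℓ (unitVar s.type)) := by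
  have hφ : Function.Injective fun u : Fin (n + 2) × ℂ => (u.1, s.val * u.2) := by
    rintro ⟨a, b⟩ ⟨c, e⟩ h; grind
  have e : fusionFiber P ℓ s = img (fun u : Fin (n + 2) × ℂ => (u.1, s.val * u.2))
      (fusionFiber P ℓ (unitVar s.type)) := by
    ext u; rw [mem_img]
    match s with
    | .inl p =>
      simp only [mem_fusionFiber_inl, FusionVar.type, Sum.map_inl, unitVar, FusionVar.val,
        Sum.elim_inl]
      constructor
      · grind
      grind
    | .inr p =>
      simp only [mem_fusionFiber_inr, FusionVar.type, Sum.map_inr, unitVar, FusionVar.val,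
        Sum.elim_inr]
      grind
  simp_all [pairProd_img, gInv_scale]

theorem pairProd_gInv_unitVar_ne_zero (hP : P.Admissible) (hℓ : exp ℓ = P.q1)
    (τ : Fin (n + 1) ⊕ Unit) : pairProd (gInv P) (fusionFiber P ℓ (unitVar τ)) ≠ 0 := by
  have hv : (unitVar τ).val ≠ 0 := by rcases τ with i | i <;> exact one_ne_zero
  have hinj := fusionFiber_injOn hℓ hP hv
  have hcol : ∀ u ∈ fusionFiber P ℓ (unitVar τ), ∀ v ∈ fusionFiber P ℓ (unitVar τ),
      u.1 = v.1 → u = v := by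
    intro u hu v hv h
    match τ with
    | .inl i =>
      rcases mem_fusionFiber_inl.1 hu with rfl | ⟨h0, rfl⟩ <;>
      rcases mem_fusionFiber_inl.1 hv with rfl | ⟨h0', rfl⟩
      · rfl
      · grind
      · grind
      · rfl
    | .inr i =>
      obtain ⟨k, rfl⟩ := mem_fusionFiber_inr.1 hu
      obtain ⟨l, rfl⟩ := mem_fusionFiber_inr.1 hv; grind
  refine pairProd_ne_zero.2 fun u hu v hv huv => ?_
  rw [gInv_eq, if_neg fun h => huv (hcol u hu v hv h), one_mul]
  split_ifs
  · refine inv_ne_zero fun h => huv (hinj hu hv ?_); grind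
  · exact one_ne_zero

theorem one_sub_q2_ne_zero (hP : P.Admissible) : 1 - P.q2 ≠ 0 := fun h => by
  have := hP.indep 0 1 0 (by grind [zpow_zero, zpow_one, one_mul, mul_one])
  omega

theorem exists_gPre_fusion (hP : P.Admissible) (hℓ : exp ℓ = P.q1) :
    ∃ c : ℕ → ℕ → ℂ, (∀ L M, c L M ≠ 0) ∧ ∀ (L M N : ℕ) (S : Finset (FusionVar n)),
      FusionGood P ℓ S → ColorBalanced L S.toLeft → ColorBalanced M S.toRight →
      ColorBalanced N (fusionUnion P ℓ S) →
      gPre P (fusionUnion P ℓ S) = c L M * pairProd (fusionPair P ℓ) S *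
        (gPre (P.tilde ℓ (n + 2)) S.toLeft * gPre (P.second (n + 2)) S.toRight) := by
  have h2 := one_sub_q2_ne_zero hP
  set D : Fin (n + 1) ⊕ Unit → ℂ := fun τ => (1 - P.q2) ^ (fusionFiber P ℓ (unitVar τ)).card *
    pairProd (gInv P) (fusionFiber P ℓ (unitVar τ)) with hD
  have hD0 : ∀ τ, D τ ≠ 0 := fun τ =>
    mul_ne_zero (pow_ne_zero _ h2) (pairProd_gInv_unitVar_ne_zero hP hℓ τ)
  set E : Fin (n + 1) ⊕ Unit → ℂ := fun τ =>
    Sum.elim (fun _ => if n + 1 = 1 then 1 else 1 - P.q2) (fun _ => 1) τ with hE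
  have hE0 : ∀ τ, E τ ≠ 0 := by grind
  have hK := fusionConst_ne_zero (n := n) (ℓ := ℓ) hP
  refine ⟨fun L M => typeProd D L M *
    (typeProd (fun τ : Fin (n + 1) ⊕ Unit => typeProd (fusionConst P ℓ τ) L M) L M /
      typeProd (fun τ : Fin (n + 1) ⊕ Unit => fusionConst P ℓ τ τ) L M) / typeProd E L M, fun L M => ?_, ?_⟩
  · simp_all [typeProd_ne_zero]
  · intro L M N S hS hL hM hN
    have hval : ∀ s ∈ S, s.val ≠ 0 := by
      rintro (p | p) hs
      · exact hS.left.1 p (by simpa using hs)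
      · exact hS.right.1 p (by simpa using hs)
    have hcard : (fusionUnion P ℓ S).card = ∑ s ∈ S, (fusionFiber P ℓ (unitVar s.type)).card := by
      have h1 : (fusionUnion P ℓ S).card = ∑ s ∈ S, (fusionFiber P ℓ s).card := by
        unfold fusionUnion; classical
        convert card_biUnion fun s hs t ht hst => hS.disj hs ht hst
      rw [h1]; refine sum_congr rfl fun s _ => ?_
      match s with
      | .inl p =>
        by_cases h : p.1 = 0 <;> simp [fusionFiber, FusionVar.type, unitVar, h, Fin.ext_iff]
      | .inr p =>
        simp [fusionFiber, FusionVar.type, unitVar]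
        rw [card_image_of_injective _ fun a b h => (Prod.mk.inj h).1,
          card_image_of_injective _ fun a b h => (Prod.mk.inj h).1]
    rw [gPre_eq hS.union hN, gPre_eq hS.left hL, gPre_eq hS.right hM,
      pairProd_fusionUnion _ hS.disj, hcard, if_neg (by omega), ← prod_pow_eq_pow_sum,
      ← mul_assoc, ← prod_mul_distrib]
    have e1 : ∏ s ∈ S, (1 - P.q2) ^ (fusionFiber P ℓ (unitVar s.type)).card *
        pairProd (gInv P) (fusionFiber P ℓ s) = typeProd D L M := by
      rw [← prod_type hL hM]
      exact prod_congr rfl fun s hs => by rw [pairProd_gInv_fusionFiber (hval s hs)]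
    have e2 : pairProd (fun s t => ∏ u ∈ fusionFiber P ℓ s, ∏ v ∈ fusionFiber P ℓ t, gInv P u v) S =
        (typeProd (fun τ : Fin (n + 1) ⊕ Unit => typeProd (fusionConst P ℓ τ) L M) L M /
          typeProd (fun τ : Fin (n + 1) ⊕ Unit => fusionConst P ℓ τ τ) L M) * pairProd (fusionPair P ℓ) S *
          (pairProd (gInv (P.tilde ℓ (n + 2))) S.toLeft *
            pairProd (gInv (P.second (n + 2))) S.toRight) := by
      rw [pairProd_congr_symm fun s hs t ht hst => fusionGInv_comm hP hℓ hS hs ht hst,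
        pairProd_mul, pairProd_mul, pairProd_type hL hM hK, pairProd_fusionGInv]
    have e3 : (if n + 1 = 1 then 1 else 1 - (P.tilde ℓ (n + 2)).q2) ^ S.toLeft.card =
        typeProd E L M := by
      rw [typeProd, hE]
      have h := hL.prod_fst fun _ => if n + 1 = 1 then 1 else 1 - P.q2
      rw [prod_const] at h
      simp only [Sum.elim_inl, Sum.elim_inr, one_pow, mul_one]; rw [← h]; rfl
    rw [e1, e2, e3, if_pos rfl, one_pow, one_mul]; grind [typeProd_ne_zero]

end FusionPrefactorProduct

/-! ### The generators under the fusion specialization -/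

section ElementarySymmetric

variable {R : Type} [CommRing R] {k : ℕ}

theorem esum_eq_esymm {ι : Type} [Fintype ι] (r : ℕ) (t : ι → R) :
    esum r t = (univ.val.map t).esymm r := (esymm_map_val t _ r).symm

theorem esum_zero {ι : Type} [Fintype ι] (t : ι → R) : esum 0 t = 1 := by simp [esum]

theorem esum_of_card_lt {ι : Type} [Fintype ι] {r : ℕ} (h : Fintype.card ι < r) (t : ι → R) :
    esum r t = 0 := by
  grind [esum, powersetCard_eq_empty, sum_empty]

theorem esum_card {ι : Type} [Fintype ι] (t : ι → R) : esum (Fintype.card ι) t = ∏ i, t i := by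
  rw [esum, ← card_univ, powersetCard_self, sum_singleton]

theorem esum_succ (r : ℕ) (t : Fin (k + 1) → R) :
    esum (r + 1) t = esum (r + 1) (fun i : Fin k => t i.succ) + t 0 * esum r fun i : Fin k => t i.succ := by
  simp only [esum_eq_esymm, Multiset.esymm, Fin.univ_succ, cons_val, map_val,
    Multiset.map_cons, Multiset.map_map, Multiset.powersetCard_cons, Multiset.map_add,
    Multiset.sum_add]
  simp [Multiset.sum_map_mul_left]

theorem esum_equiv {ι : Type} [Fintype ι] (σ : ι ≃ ι) (r : ℕ) (t : ι → R) :
    esum r (fun i => t (σ i)) = esum r t := by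
  rw [esum_eq_esymm, esum_eq_esymm]
  conv_rhs => rw [← Multiset.map_univ_val_equiv σ, Multiset.map_map]
  rfl

theorem esum_smul {ι : Type} [Fintype ι] (r : ℕ) (c : R) (t : ι → R) :
    esum r (fun i => c * t i) = c ^ r * esum r t := by
  rw [esum, esum, mul_sum]; refine sum_congr rfl fun A hA => ?_
  rw [prod_mul_distrib, prod_const, (mem_powersetCard.1 hA).2]

theorem sum_pow_mul_esum {ι : Type} [Fintype ι] (x : R) (t : ι → R) :
    ∑ r ∈ range (Fintype.card ι + 1), x ^ r * esum r t = ∏ i, (1 + x * t i) := by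
  rw [prod_one_add, sum_powerset, card_univ]; refine sum_congr rfl fun r _ => ?_
  rw [← esum_smul]; rfl

end ElementarySymmetric

section FusionColors

variable {P : QParam} {ℓ : ℂ} {n : ℕ} {S : Finset (FusionVar n)}

theorem prod_color_fusionUnion {M : Type} [CommMonoid M] (hS : FusionGood P ℓ S) (k : Fin (n + 2))
    (f : Fin (n + 2) × ℂ → M) :
    ∏ u ∈ fusionUnion P ℓ S with u.1 = k, f u =
      (∏ p ∈ S.toLeft with p.1 = Fin.ofNat (n + 1) k, f (k, fusionScale ℓ n (k + 1) * p.2)) *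
        ∏ r ∈ S.toRight, f (k, P.q3 ^ (k : ℕ) * r.2) := by
  have e : S = S.toLeft.disjSum S.toRight := by ext (a | b) <;> simp
  rw [prod_filter, prod_fusionUnion hS]
  conv_lhs => rw [e]
  rw [prod_disjSum, prod_filter]
  congr 1
  · refine prod_congr rfl fun p _ => ?_; rw [prod_fusionFiber_inl]
    induction k using Fin.lastCases with
    | last =>
      have h1 : Fin.ofNat (n + 1) (Fin.last (n + 1) : ℕ) = 0 := Fin.ext (Nat.mod_self _)
      rw [h1, if_neg (castSucc_ne_last _), one_mul, Fin.val_last, fusionScale_last, one_mul,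
        if_pos rfl]
    | cast i =>
      have h1 : Fin.ofNat (n + 1) (i.castSucc : ℕ) = i := Fin.ext (Nat.mod_eq_of_lt i.2)
      have h2 : (p.1.castSucc = i.castSucc) = (p.1 = i) := propext (Fin.castSucc_injective _).eq_iff
      grind
  · refine prod_congr rfl fun r _ => ?_
    rw [prod_fusionFiber_inr, prod_ite_eq' univ k, if_pos (mem_univ _)]

theorem card_color_fusionUnion (hS : FusionGood P ℓ S) (k : Fin (n + 2)) :
    ((fusionUnion P ℓ S).filter fun u => u.1 = k).card =
      (S.toLeft.filter fun p => p.1 = Fin.ofNat (n + 1) k).card + S.toRight.card := by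
  have h := prod_color_fusionUnion hS k fun _ => 2; simp [← pow_add] at h
  simp_all

theorem colorBalanced_fusionUnion (hS : FusionGood P ℓ S) {L M : ℕ}
    (hL : ColorBalanced L S.toLeft) (hM : ColorBalanced M S.toRight) :
    ColorBalanced (L + M) (fusionUnion P ℓ S) := by
  intro k; have h := hM 0
  rw [filter_true_of_mem fun u _ => Subsingleton.elim _ _] at h
  rw [card_color_fusionUnion hS, hL, h]

theorem exists_colorBalanced (hS : FusionGood P ℓ S) {N : ℕ}
    (hN : ColorBalanced N (fusionUnion P ℓ S)) :
    ∃ L M, L + M = N ∧ ColorBalanced L S.toLeft ∧ ColorBalanced M S.toRight := by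
  have h : ∀ i : Fin (n + 1), (S.toLeft.filter fun p => p.1 = i).card + S.toRight.card = N := by
    intro i
    have h1 : Fin.ofNat (n + 1) (i.castSucc : ℕ) = i := Fin.ext (Nat.mod_eq_of_lt i.2)
    have h2 := card_color_fusionUnion hS i.castSucc; rw [hN, h1] at h2
    exact h2.symm
  refine ⟨N - S.toRight.card, S.toRight.card, by have := h 0; omega, fun i => ?_, fun i => ?_⟩
  · have := h i; omega
  · rw [filter_true_of_mem fun u _ => Subsingleton.elim _ _]

theorem colorProd_fusionUnion (hS : FusionGood P ℓ S) {L M : ℕ} (hL : ColorBalanced L S.toLeft)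
    (hM : ColorBalanced M S.toRight) (k : Fin (n + 2)) :
    colorProd (fusionUnion P ℓ S) k = fusionScale ℓ n (k + 1) ^ L * P.q3 ^ ((k : ℕ) * M) *
      (colorProd S.toLeft (Fin.ofNat (n + 1) k) * ∏ r ∈ S.toRight, r.2) := by
  have h := hM 0; rw [filter_true_of_mem fun u _ => Subsingleton.elim _ _] at h
  rw [colorProd, prod_color_fusionUnion hS, prod_mul_distrib, prod_mul_distrib,
    prod_const, prod_const, h, hL, colorProd, pow_mul]
  ring

theorem colorProd_ne_zero {m : ℕ} {T : Finset (Fin m × ℂ)} (hT : GenericSet T) (i : Fin m) :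
    colorProd T i ≠ 0 :=
  prod_ne_zero_iff.2 fun u hu => hT.1 u (mem_filter.1 hu).1

theorem prod_Iio_succ {k : ℕ} (f : Fin (k + 1) → ℂ) (i : Fin k) :
    ∏ j ∈ Iio i.succ, f j = f 0 * ∏ j ∈ Iio i, f j.succ := by
  have h : ∀ {l : ℕ} (a : Fin l) (g : Fin l → ℂ), ∏ j ∈ Iio a, g j =
      ∏ j, if j < a then g j else 1 := fun a g => by
    rw [← prod_filter]; congr 1; ext j; simp
  rw [h, h, Fin.prod_univ_succ, if_pos (Fin.succ_pos i)]; simp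

theorem prod_Iio_castSucc {k : ℕ} (f : Fin (k + 1) → ℂ) (i : Fin k) :
    ∏ j ∈ Iio i.castSucc, f j = ∏ j ∈ Iio i, f j.castSucc := by
  rw [← Fin.map_castSuccEmb_Iio, prod_map]; rfl

theorem prod_Iio_sTilde {s : Fin (n + 2) → ℂ} (hs : ∀ i, s i ≠ 0) (i : Fin (n + 1)) :
    ∏ j ∈ Iio i.succ, s j =
      (∏ j : Fin (n + 1), s j.castSucc) * ∏ j ∈ Iio (nextColor i), sTilde s j := by
  induction i using Fin.lastCases with
  | last =>
    have h : nextColor (Fin.last n) = 0 := Fin.ext (Nat.mod_self _)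
    rw [h, show Iio (0 : Fin (n + 1)) = ∅ from by ext; simp, prod_empty, mul_one,
      Fin.succ_last, Fin.Iio_last_eq_map, prod_map]
    rfl
  | cast k =>
    have h : nextColor k.castSucc = k.succ := Fin.ext (Nat.mod_eq_of_lt (Nat.succ_lt_succ k.2))
    have h0 : ∏ j : Fin n, s j.succ.castSucc ≠ 0 := prod_ne_zero_iff.2 fun j _ => hs _
    rw [h, prod_Iio_succ, prod_Iio_succ, Fin.prod_univ_succ, prod_Iio_castSucc]
    simp only [sTilde, if_true, if_neg (Fin.succ_ne_zero _), Fin.castSucc_zero, Fin.succ_castSucc]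
    field_simp

theorem tSet_fusionUnion_zero (hP : P.Admissible) (hℓ : exp ℓ = P.q1)
    (hS : FusionGood P ℓ S) {L M : ℕ} (hL : ColorBalanced L S.toLeft)
    (hM : ColorBalanced M S.toRight) (s : Fin (n + 2) → ℂ) :
    tSet s (fusionUnion P ℓ S) 0 = P.q1 ^ L * P.q3 ^ ((n + 1) * M) := by
  have h2 := colorProd_ne_zero hS.left 0
  have h3 : ∏ r ∈ S.toRight, r.2 ≠ 0 := prod_ne_zero_iff.2 fun r hr => hS.right.1 r hr
  have h4 : Fin.ofNat (n + 1) (Fin.last (n + 1) : ℕ) = 0 := Fin.ext (Nat.mod_self _)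
  have h5 : Fin.ofNat (n + 1) ((0 : Fin (n + 2)) : ℕ) = 0 := rfl
  rw [tSet, prevColor_zero, colorProd_fusionUnion hS hL hM, colorProd_fusionUnion hS hL hM, h4, h5,
    show Iio (0 : Fin (n + 2)) = ∅ from by ext; simp]
  simp [fusionScale_last, fusionScale_one hℓ]; field_simp

/-- The factor relating the functions `t_i` for `m` and for `m - 1` colors. -/
def fusionT (P : QParam) (ℓ : ℂ) (s : Fin (n + 2) → ℂ) (L M : ℕ) : ℂ :=
  (∏ j : Fin (n + 1), s j.castSucc) * (exp (ℓ / (n + 1)) ^ L)⁻¹ * (P.q3 ^ M)⁻¹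

theorem tSet_fusionUnion_succ (hP : P.Admissible) (hS : FusionGood P ℓ S) {L M : ℕ}
    (hL : ColorBalanced L S.toLeft) (hM : ColorBalanced M S.toRight) {s : Fin (n + 2) → ℂ}
    (hs : ∀ i, s i ≠ 0) (i : Fin (n + 1)) :
    tSet s (fusionUnion P ℓ S) i.succ =
      fusionT P ℓ s L M * tSet (sTilde s) S.toLeft (nextColor i) := by
  have h1 : Fin.ofNat (n + 1) (i.castSucc : ℕ) = i := Fin.ext (Nat.mod_eq_of_lt i.2)
  have h2 : Fin.ofNat (n + 1) (i.succ : ℕ) = nextColor i := rfl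
  have h3 : ∏ r ∈ S.toRight, r.2 ≠ 0 := prod_ne_zero_iff.2 fun r hr => hS.right.1 r hr
  have h5 := hP.q3_ne
  rw [tSet, tSet, prevColor_succ, colorProd_fusionUnion hS hL hM, colorProd_fusionUnion hS hL hM,
    h1, h2, prod_Iio_sTilde hs, prevColor_nextColor, fusionT, Fin.val_castSucc, Fin.val_succ,
    fusionScale_succ ((i : ℕ) + 1)]
  have h6 := fusionScale_ne (ℓ := ℓ) (n := n) (i + 1)
  rw [mul_pow, add_mul, pow_add, one_mul]; field_simp

theorem esum_fusion (c₁ c₂ : ℂ) {t : Fin (n + 2) → ℂ} {t' : Fin (n + 1) → ℂ} (h0 : t 0 = c₁)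
    (h1 : ∀ i, t i.succ = c₂ * t' (nextColor i)) (r : ℕ) :
    esum r t = c₂ ^ r * esum r t' + if r = 0 then 0 else c₁ * c₂ ^ (r - 1) * esum (r - 1) t' := by
  have e : ∀ r, esum r (fun i : Fin (n + 1) => t i.succ) = c₂ ^ r * esum r t' := fun r => by
    rw [← esum_equiv (⟨nextColor, prevColor, prevColor_nextColor, fun _ => nextColor_eq_iff.2 rfl⟩ :
      Fin (n + 1) ≃ Fin (n + 1)) r t', ← esum_smul]
    simp_all
  cases r with
  | zero => simp [esum_zero]
  | succ r => rw [esum_succ, e, e, h0, if_neg (Nat.succ_ne_zero r), Nat.add_sub_cancel, mul_assoc]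

end FusionColors

section Generators

variable {P : QParam} {m N : ℕ} {s : Fin m → ℂ}

theorem ShuffleAmbient.ext_value {F G : ShuffleAmbient P m}
    (h : ∀ T, GenericSet T → F.value T = G.value T) : F = G := by
  funext T; rw [← value_coe F T, ← value_coe G T, h T.1 T.2]

theorem gElement_of_lt (hP : P.Admissible) {r : ℕ} (h : m < r) : gElement P s r N = 0 := by
  refine ext_value fun T hT => ?_; rw [value_zero]
  by_cases hb : ColorBalanced N T
  · simp_all [value_gElement, gValue, esum_of_card_lt, mul_zero]
  · exact gElement_hasSupport s r T hb

theorem prod_tSet {T : Finset (Fin m × ℂ)} (hT : GenericSet T) :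
    ∏ i, tSet s T i = ∏ i, ∏ j ∈ Iio i, s j := by
  simp [tSet, prod_mul_distrib]
  have h : ∏ i, colorProd T (prevColor i) = ∏ i, colorProd T i :=
    Equiv.prod_comp (⟨prevColor, nextColor, fun _ => nextColor_eq_iff.2 rfl, prevColor_nextColor⟩ :
      Fin m ≃ Fin m) (colorProd T)
  grind [div_self, prod_ne_zero_iff, colorProd_ne_zero, mul_one]

theorem gElement_card (hP : P.Admissible) :
    gElement P s m N = (∏ i, ∏ j ∈ Iio i, s j) • gElement P s 0 N := by
  refine ext_value fun T hT => ?_; rw [value_smul]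
  by_cases hb : ColorBalanced N T
  · rw [value_gElement hP s m hT hb, value_gElement hP s 0 hT hb, gValue, gValue, esum_zero,
      ← prod_tSet hT]
    have h := esum_card (tSet s T); grind [Fintype.card_fin]
  · rw [gElement_hasSupport s m T hb, gElement_hasSupport s 0 T hb, mul_zero]

theorem colorBalanced_zero_iff {γ : Type} {T : Finset (Fin m × γ)} : ColorBalanced 0 T ↔ T = ∅ := by
  constructor
  · intro h; by_contra hT; obtain ⟨u, hu⟩ := nonempty_iff_ne_empty.2 hT
    have := card_eq_zero.1 (h u.1)
    exact notMem_empty u (this ▸ mem_filter.2 ⟨hu, rfl⟩)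
  · rintro rfl i; simp

theorem gElement_zero (hP : P.Admissible) (r : ℕ) :
    gElement P s r 0 = esum r (fun i => ∏ j ∈ Iio i, s j) • 1 := by
  classical
  refine ext_value fun T hT => ?_
  rw [value_smul, value_one]
  by_cases hb : T = ∅
  · subst hb
    rw [value_gElement hP s r hT (colorBalanced_zero_iff.2 rfl), if_pos rfl, mul_one, gValue]
    have h : tSet s ∅ = fun i => ∏ j ∈ Iio i, s j := by funext i; simp [tSet, colorProd]
    simp [h, gPre, pairProd]
  · rw [if_neg hb, mul_zero]
    exact gElement_hasSupport s r T fun h => hb (colorBalanced_zero_iff.1 h)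

theorem gElement_mem_adjoin (hP : P.Admissible) (hm : m ≠ 0) (r N : ℕ) :
    gElement P s r N ∈ Algebra.adjoin ℂ (gElements P s) := by
  have h : ∀ r ≤ m - 1, gElement P s r N ∈ Algebra.adjoin ℂ (gElements P s) := fun r hr =>
    Algebra.subset_adjoin ⟨r, N, hr, rfl⟩
  rcases lt_trichotomy r m with hr | rfl | hr
  · exact h r (by omega)
  · simp_all [gElement_card, Subalgebra.smul_mem]
  · rw [gElement_of_lt hP hr]; simp

theorem adjoin_gElements_le (hP : P.Admissible) (hs : IsGeneric P s) :
    Algebra.adjoin ℂ (gElements P s) ≤ betheAlgebra P s := by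
  refine Algebra.adjoin_le ?_; rintro _ ⟨r, N, -, rfl⟩
  exact betheComponent_le_betheAlgebra (gElement_mem_betheComponent hP hs r N)

end Generators

section Lifting

variable {P : QParam} {ℓ : ℂ} {n : ℕ} {s : Fin (n + 2) → ℂ}

/-- The function `F` has the image `X` under the fusion map. -/
def IsLift (P : QParam) (ℓ : ℂ) {n : ℕ} (F : ShuffleAmbient P (n + 2))
    (X : ShuffleAmbient (P.tilde ℓ (n + 2)) (n + 1) ⊗[ℂ] ShuffleAmbient (P.second (n + 2)) 1) : Prop :=
  ∀ S : Finset (FusionVar n), FusionGood P ℓ S → fusionValue ℓ F S = tensorValue S X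

theorem IsLift.add {F G : ShuffleAmbient P (n + 2)} {X Y} (hF : IsLift P ℓ F X)
    (hG : IsLift P ℓ G Y) : IsLift P ℓ (F + G) (X + Y) := fun S hS => by
  rw [fusionValue_add, hF S hS, hG S hS, map_add]

theorem IsLift.smul {F : ShuffleAmbient P (n + 2)} {X} (c : ℂ) (hF : IsLift P ℓ F X) :
    IsLift P ℓ (c • F) (c • X) := fun S hS => by
  rw [fusionValue_smul, hF S hS, map_smul, smul_eq_mul]

theorem IsLift.mul (hP : P.Admissible) (hℓ : exp ℓ = P.q1) {F G : ShuffleAmbient P (n + 2)}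
    {X Y} (hF' : F ∈ betheSpace P s) (hF : IsLift P ℓ F X) (hG : IsLift P ℓ G Y) :
    IsLift P ℓ (F * G) (X * Y) := fun S hS => by
  rw [fusionValue_mul hP hℓ hS hF', tensorValue_mul (w := fusionOmega P ℓ) (fun _ _ => rfl)
    (fun _ _ => rfl) (fun _ _ => rfl) (fun _ _ => rfl) hS.left hS.right]
  exact conv_congr _ (fun I hI => hF I (hS.mono hI)) fun I hI => hG I (hS.mono hI)

theorem isLift_zero : IsLift P ℓ (0 : ShuffleAmbient P (n + 2)) 0 := fun S _ => by
  rw [fusionValue_zero, map_zero]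

theorem isLift_one : IsLift P ℓ (1 : ShuffleAmbient P (n + 2)) 1 := fun S _ => by
  classical
  rw [Algebra.TensorProduct.one_def, tensorValue_tmul, fusionValue, value_one, value_one, value_one]
  by_cases h : S = ∅
  · simp_all [FusionVar, toLeft, toRight, fusionUnion, pairProd]
  · have h1 : fusionUnion P ℓ S ≠ ∅ := by
      obtain ⟨t, ht⟩ := nonempty_iff_ne_empty.2 h
      obtain ⟨u, hu⟩ := fusionFiber_nonempty (P := P) (ℓ := ℓ) t
      exact nonempty_iff_ne_empty.1 ⟨u, mem_fusionUnion.2 ⟨t, ht, hu⟩⟩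
    have h2 : S.toLeft = ∅ → S.toRight ≠ ∅ := fun h2 h3 => h (by
      rw [← toLeft_disjSum_toRight (u := S), h2, h3]; rfl)
    grind

/-- The generators of the target of the fusion map. -/
def leftGen (P : QParam) (ℓ : ℂ) {n : ℕ} (s : Fin (n + 2) → ℂ) (r N : ℕ) :
    ShuffleAmbient (P.tilde ℓ (n + 2)) (n + 1) := gElement _ (sTilde s) r N

/-- The generators of the second factor of the target of the fusion map. -/
def rightGen (P : QParam) (n N : ℕ) : ShuffleAmbient (P.second (n + 2)) 1 :=
  gElement _ (fun _ => 1) 0 N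

theorem exists_isLift_gElement (hP : P.Admissible) (hP' : (P.tilde ℓ (n + 2)).Admissible)
    (hP'' : (P.second (n + 2)).Admissible) (hℓ : exp ℓ = P.q1) (hs : ∀ i, s i ≠ 0) :
    ∃ c : ℕ → ℕ → ℂ, (∀ L M, c L M ≠ 0) ∧ ∀ r N, IsLift P ℓ (gElement P s r N) (∑ q ∈
        Finset.HasAntidiagonal.antidiagonal N, c q.1 q.2 •
        (fusionT P ℓ s q.1 q.2 ^ r • (leftGen P ℓ s r q.1 ⊗ₜ[ℂ] rightGen P n q.2) +
          (if r = 0 then 0 else P.q1 ^ q.1 * P.q3 ^ ((n + 1) * q.2) * fusionT P ℓ s q.1 q.2 ^ (r - 1)) •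
            (leftGen P ℓ s (r - 1) q.1 ⊗ₜ[ℂ] rightGen P n q.2))) := by
  obtain ⟨c, hc, h⟩ := exists_gPre_fusion (n := n) hP hℓ
  refine ⟨c, hc, fun r N S hS => ?_⟩
  have hz : ∀ r L M, ¬ (ColorBalanced L S.toLeft ∧ ColorBalanced M S.toRight) →
      tensorValue S (leftGen P ℓ s r L ⊗ₜ[ℂ] rightGen P n M) = 0 := fun r L M =>
    HasSupport.tensorValue (gElement_hasSupport _ _) (gElement_hasSupport _ _)
  simp only [map_sum, map_smul, map_add, smul_eq_mul]
  by_cases hN : ColorBalanced N (fusionUnion P ℓ S)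
  · obtain ⟨L, M, hLM, hL, hM⟩ := exists_colorBalanced hS hN
    rw [sum_eq_single (L, M)]
    · simp [tensorValue_tmul, leftGen, rightGen]
      rw [value_gElement hP' _ _ hS.left hL, value_gElement hP' _ _ hS.left hL,
        value_gElement hP'' _ _ hS.right hM, fusionValue, value_gElement hP _ _ hS.union hN, gValue,
        gValue, gValue, gValue, h L M N S hS hL hM hN, esum_zero,
        esum_fusion _ _ (tSet_fusionUnion_zero hP hℓ hS hL hM s)
          (tSet_fusionUnion_succ hP hS hL hM hs)]
      have h0 := hS.ne_zero; grind
    · intro q _ hq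
      have : ¬ (ColorBalanced q.1 S.toLeft ∧ ColorBalanced q.2 S.toRight) := fun hb =>
        hq (Prod.ext ((hb.1 0).symm.trans (hL 0)) ((hb.2 0).symm.trans (hM 0)))
      grind
    aesop
  · rw [fusionValue, gElement_hasSupport s r _ hN, zero_div]
    refine (sum_eq_zero fun q hq => ?_).symm
    grind [ColorBalanced, Finset.HasAntidiagonal.mem_antidiagonal, colorBalanced_fusionUnion]

/-- The functions that are images under the fusion map of polynomials in the generators. -/
def liftable (hP : P.Admissible) (hℓ : exp ℓ = P.q1) (hs : IsGeneric P s) :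
    Subalgebra ℂ (ShuffleAmbient (P.tilde ℓ (n + 2)) (n + 1) ⊗[ℂ]
      ShuffleAmbient (P.second (n + 2)) 1) where
  carrier := {X | ∃ F ∈ Algebra.adjoin ℂ (gElements P s), IsLift P ℓ F X}
  mul_mem' := by
    rintro X Y ⟨F, hF, hX⟩ ⟨G, hG, hY⟩
    exact ⟨F * G, mul_mem hF hG,
      hX.mul hP hℓ ((mem_betheAlgebra_iff hP).1 (adjoin_gElements_le hP hs hF)) hY⟩
  add_mem' := by rintro X Y ⟨F, hF, hX⟩ ⟨G, hG, hY⟩; exact ⟨F + G, add_mem hF hG, hX.add hY⟩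
  algebraMap_mem' c := ⟨c • 1, Subalgebra.smul_mem _ (one_mem _) c, by exact isLift_one.smul c⟩

theorem mem_of_relations {V : Type} [AddCommGroup V] [Module ℂ V] (K : Submodule ℂ V) {x : ℕ → V}
    {y : V} {a b c₁ c₂ : ℂ} (ha : a ≠ 0) (hb : b ≠ 0) (hc₁ : c₁ ≠ 0) (hc₂ : c₂ ≠ 0) {e : ℕ → ℂ}
    {k : ℕ} (hk : x k = 0) (he : ∑ r ∈ range (k + 1), (-c₁⁻¹) ^ r * e r ≠ 0)
    (h : ∀ r, a • (c₂ ^ r • x r + (if r = 0 then 0 else c₁ * c₂ ^ (r - 1)) • x (r - 1)) +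
      (b * e r) • y ∈ K) : y ∈ K ∧ ∀ r, x r ∈ K := by
  have hsum : ∀ j, ∑ r ∈ range (j + 1), (-c₁⁻¹) ^ r • (a • (c₂ ^ r • x r +
      (if r = 0 then 0 else c₁ * c₂ ^ (r - 1)) • x (r - 1)) + (b * e r) • y) =
      (a * (-c₁⁻¹ * c₂) ^ j) • x j + (b * ∑ r ∈ range (j + 1), (-c₁⁻¹) ^ r * e r) • y := by
    intro j
    induction j with
    | zero => simp
    | succ j ih =>
      rw [sum_range_succ, ih, sum_range_succ _ (j + 1), if_neg (Nat.succ_ne_zero j),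
        Nat.add_sub_cancel]
      have h2 : a * (-c₁⁻¹ * c₂) ^ j + (-c₁⁻¹) ^ (j + 1) * (a * (c₁ * c₂ ^ j)) = 0 := by
        rw [mul_pow, pow_succ]; grind
      have h3 : (a * (-c₁⁻¹ * c₂) ^ j) • x j = (-((-c₁⁻¹) ^ (j + 1) * (a * (c₁ * c₂ ^ j)))) • x j := by
        grind
      rw [h3, mul_pow]
      module
  have hy : y ∈ K := by
    have h1 := K.sum_mem fun r (_ : r ∈ range (k + 1)) => K.smul_mem ((-c₁⁻¹) ^ r) (h r)
    rw [hsum, hk, smul_zero, zero_add] at h1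
    exact (K.smul_mem_iff (mul_ne_zero hb he)).1 h1
  have h2 : ∀ r, c₂ ^ r • x r + (if r = 0 then 0 else c₁ * c₂ ^ (r - 1)) • x (r - 1) ∈ K := fun r =>
    (K.smul_mem_iff ha).1 ((K.add_mem_iff_left (K.smul_mem _ hy)).1 (h r))
  refine ⟨hy, fun r => ?_⟩
  induction r with
  | zero => simpa using h2 0
  | succ r ih =>
    exact (K.smul_mem_iff (pow_ne_zero _ hc₂)).1 ((K.add_mem_iff_left (K.smul_mem _ ih)).1 (h2 (r + 1)))

end Lifting

section Parameters

variable {P : QParam} {ℓ : ℂ} {n : ℕ} {s : Fin (n + 2) → ℂ}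

theorem exp_pow_eq (hℓ : exp ℓ = P.q1) (n : ℕ) : exp (ℓ / (n + 1)) ^ (n + 1) = P.q1 := by
  have h : (n + 1 : ℂ) ≠ 0 := Nat.cast_add_one_ne_zero n
  rw [← Complex.exp_nat_mul, ← hℓ]; grind

theorem QParam.Admissible.tilde (hP : P.Admissible) (hℓ : exp ℓ = P.q1) (n : ℕ) :
    (P.tilde ℓ (n + 2)).Admissible where
  q_ne := hP.q_ne
  d_ne := mul_ne_zero hP.d_ne (exp_ne_zero _)
  indep n₁ n₂ n₃ h := by
    rw [QParam.tilde_q1, QParam.tilde_q2, QParam.tilde_q3, tilde_exp, exp_neg] at h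
    have h1 := exp_pow_eq hℓ n; have h0 := exp_ne_zero (ℓ / (n + 1))
    generalize exp (ℓ / (n + 1)) = θ at *
    have h2 : ((P.q1 * θ) ^ n₁ * P.q2 ^ n₂ * (P.q3 * θ⁻¹) ^ n₃) ^ (n + 1) = 1 := by rw [h, one_pow]
    have h3 : P.q1 ^ ((n + 2) * n₁ - n₃) * P.q2 ^ ((n + 1) * n₂) * P.q3 ^ ((n + 1) * n₃) = 1 := by
      refine Eq.trans ?_ h2
      simp only [← zpow_natCast, ← zpow_mul, mul_zpow, inv_zpow', ← h1]
      rw [show ((n + 1 : ℕ) : ℤ) * ((n + 2) * n₁ - n₃) =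
        (((n + 1 : ℕ) : ℤ) * (n₁ * (n + 1 : ℕ)) + n₁ * (n + 1 : ℕ)) +
          -(n₃ * (n + 1 : ℕ)) by push_cast; ring, zpow_add₀ h0, zpow_add₀ h0]
      push_cast
      ring_nf
    obtain ⟨h4, h5⟩ := hP.indep _ _ _ h3
    have hn : (n + 1 : ℤ) ≠ 0 := by positivity
    have h6 := mul_left_cancel₀ hn h5
    refine ⟨mul_left_cancel₀ (show (n + 2 : ℤ) ≠ 0 by positivity) ?_, h6⟩
    grind

theorem QParam.Admissible.second (hP : P.Admissible) (n : ℕ) : (P.second (n + 2)).Admissible where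
  q_ne := hP.q_ne
  d_ne := mul_ne_zero hP.d_ne (zpow_ne_zero _ hP.q3_ne)
  indep n₁ n₂ n₃ h := by
    have h3 := hP.q3_ne
    rw [QParam.second_q1, QParam.second_q2, QParam.second_q3 _ hP] at h
    have h4 : P.q1 ^ n₁ * P.q2 ^ n₂ * P.q3 ^ (-(((n + 2 : ℕ) : ℤ) - 1) * n₁ + (n + 2 : ℕ) * n₃) = 1 := by
      rw [← h, zpow_add₀ h3, zpow_mul, zpow_mul, zpow_natCast, mul_zpow]; ring
    obtain ⟨h5, h6⟩ := hP.indep _ _ _ h4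
    have h7 : n₁ = n₃ := mul_left_cancel₀ (show (n + 2 : ℤ) ≠ 0 by positivity) (by grind)
    grind

theorem isGeneric_second (hP : P.Admissible) (n : ℕ) :
    IsGeneric (P.second (n + 2)) (fun _ : Fin 1 => (1 : ℂ)) where
  ne_zero _ := one_ne_zero
  prod_eq_one := by simp
  indep a₁ a₂ b hb h := by
    have h1 := (hP.second n).indep a₁ a₂ 0 (by simpa using h)
    grind

theorem prod_sTilde_zpow (s : Fin (n + 2) → ℂ) (hs : ∀ i, s i ≠ 0) (b : Fin (n + 1) → ℤ) :
    ∏ i, sTilde s i ^ b i = ∏ i : Fin (n + 1), s i.castSucc ^ (b i - b 0) := by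
  rw [Fin.prod_univ_succ, Fin.prod_univ_succ]
  simp only [sTilde, if_true, if_neg (Fin.succ_ne_zero _), sub_self, zpow_zero, one_mul, inv_zpow',
    ← prod_zpow]
  rw [← prod_mul_distrib]; refine prod_congr rfl fun i _ => ?_
  rw [sub_eq_neg_add, zpow_add₀ (hs _)]

theorem IsGeneric.sTilde (hs : IsGeneric P s) (hℓ : exp ℓ = P.q1) :
    IsGeneric (P.tilde ℓ (n + 2)) (sTilde s) where
  ne_zero i := by
    unfold _root_.sTilde
    split_ifs
    exacts [inv_ne_zero (prod_ne_zero_iff.2 fun _ _ => hs.ne_zero _), hs.ne_zero _]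
  prod_eq_one := by have := prod_sTilde_zpow s hs.ne_zero fun _ => 1; simpa using this
  indep a₁ a₂ b hb h := by
    rw [QParam.tilde_q1, QParam.tilde_q2, tilde_exp, prod_sTilde_zpow s hs.ne_zero] at h
    have h1 := exp_pow_eq hℓ n; have h0 := exp_ne_zero (ℓ / (n + 1))
    let B : Fin (n + 2) → ℤ := Fin.lastCases 0 fun i => (b i - b 0) * (n + 1 : ℕ)
    have hB : ∀ i : Fin (n + 1), B i.castSucc = (b i - b 0) * (n + 1 : ℕ) := fun i =>
      Fin.lastCases_castSucc ..
    have hB' : B (Fin.last _) = 0 := Fin.lastCases_last ..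
    have h2 : P.q1 ^ ((n + 2) * a₁) * P.q2 ^ (a₂ * (n + 1 : ℕ)) * ∏ i, s i ^ B i = 1 := by
      refine Eq.trans ?_ ((congrArg (· ^ (n + 1)) h).trans (one_pow _))
      rw [Fin.prod_univ_castSucc]
      simp only [hB, hB', zpow_zero, mul_one, zpow_mul _ _ ((n + 1 : ℕ) : ℤ), zpow_natCast,
        prod_pow, mul_pow]
      congr 2
      rw [show ((n : ℤ) + 2) * a₁ = a₁ * (n + 1 : ℕ) + a₁ by push_cast; ring,
        zpow_add₀ (h1 ▸ pow_ne_zero _ h0), zpow_mul, zpow_natCast, mul_zpow, mul_pow]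
      congr 1
      rw [← h1, ← zpow_natCast, ← zpow_natCast, ← zpow_mul, ← zpow_mul, mul_comm]
    obtain ⟨h3, h4, h5⟩ := hs.indep _ _ B (fun i hi => by grind) h2
    have hn : ((n + 1 : ℕ) : ℤ) ≠ 0 := by positivity
    have h6 : ∀ i, b i = b 0 := fun i => by grind [sub_eq_zero, mul_eq_zero]
    refine ⟨(mul_eq_zero.1 h3).resolve_left (by positivity), (mul_eq_zero.1 h4).resolve_right hn,
      fun i => ?_⟩
    rw [h6 i, ← h6 (Fin.last n)]; exact hb _ rfl

end Parameters

section Surjectivity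

variable {P : QParam} {ℓ : ℂ} {n : ℕ} {s : Fin (n + 2) → ℂ}

theorem prod_one_sub_ne_zero (hP : P.Admissible) (hs : IsGeneric P s) {N : ℕ} (hN : N ≠ 0)
    {t : Fin (n + 2) → ℂ} (h0 : t 0 = P.q3 ^ ((n + 1) * N))
    (h1 : ∀ i, t i.succ = fusionT P ℓ s 0 N * ∏ j ∈ Iio (nextColor i), sTilde s j) :
    ∏ i, (1 + -(P.q1 ^ N)⁻¹ * t i) ≠ 0 := by
  refine prod_ne_zero_iff.2 fun i _ => ?_
  induction i using Fin.cases with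
  | zero =>
    intro h
    have := hP.indep (-N) 0 ((n + 1) * N) (by grind [zpow_neg, zpow_natCast, zpow_zero])
    omega
  | succ i =>
    rw [h1, fusionT, pow_zero, inv_one, mul_one, mul_right_comm, ← prod_Iio_sTilde hs.ne_zero]
    intro h
    have h2 : ∏ j, s j ^ (if j < i.succ then (1 : ℤ) else 0) = ∏ j ∈ Iio i.succ, s j := by
      rw [← filter_gt_eq_Iio, prod_filter]; simp
    have h3 : P.q2 ^ N * (P.q1 ^ N * P.q3 ^ N) = 1 := by
      rw [← mul_pow, ← mul_pow, ← one_pow N, ← hP.prod_eq_one]; ring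
    have := (hs.indep 0 N (fun j => if j < i.succ then 1 else 0) (fun j hj => if_neg (by
      grind)) (by
      grind [zpow_zero, one_mul, zpow_natCast])).2.1
    grind

theorem gens_mem_liftable (hP : P.Admissible) (hℓ : exp ℓ = P.q1) (hs : IsGeneric P s)
    (N : ℕ) : 1 ⊗ₜ[ℂ] rightGen P n N ∈ liftable hP hℓ hs ∧
      ∀ r, leftGen P ℓ s r N ⊗ₜ[ℂ] 1 ∈ liftable hP hℓ hs := by
  classical
  have hP' := hP.tilde hℓ n
  have hP'' := hP.second n
  have hr0 : rightGen P n 0 = 1 := by rw [rightGen, gElement_zero hP'', esum_zero, one_smul]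
  have hl0 : ∀ r, leftGen P ℓ s r 0 =
      esum r (fun i => ∏ j ∈ Iio i, sTilde s j) • 1 := fun r => gElement_zero hP' r
  obtain ⟨c, hc, hrow⟩ := exists_isLift_gElement (s := s) hP hP' hP'' hℓ hs.ne_zero
  induction N using Nat.strong_induction_on with
  | _ N ih =>
  rcases Nat.eq_zero_or_pos N with rfl | hN
  · rw [hr0]; refine ⟨one_mem _, fun r => ?_⟩
    rw [hl0, ← TensorProduct.smul_tmul']
    exact Subalgebra.smul_mem _ (one_mem _) _
  let t : Fin (n + 2) → ℂ := Fin.cons (P.q3 ^ ((n + 1) * N)) fun i =>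
    fusionT P ℓ s 0 N * ∏ j ∈ Iio (nextColor i), sTilde s j
  have ht := esum_fusion (t := t) (t' := fun i => ∏ j ∈ Iio i, sTilde s j) _ _ rfl fun _ => rfl
  refine mem_of_relations (Subalgebra.toSubmodule (liftable hP hℓ hs)) (hc N 0) (hc 0 N)
    (pow_ne_zero N hP.q1_ne) (c₂ := fusionT P ℓ s N 0) ?_ (e := fun r => esum r t) (k := n + 2)
    ?_ ?_ fun r => ?_
  · exact mul_ne_zero (mul_ne_zero (prod_ne_zero_iff.2 fun i _ => hs.ne_zero _)
      (inv_ne_zero (pow_ne_zero _ (exp_ne_zero _)))) (inv_ne_zero (pow_ne_zero _ hP.q3_ne))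
  · rw [leftGen, gElement_of_lt hP' (by omega), TensorProduct.zero_tmul]
  · have h := sum_pow_mul_esum (-(P.q1 ^ N)⁻¹) t; rw [Fintype.card_fin] at h
    rw [h]; exact prod_one_sub_ne_zero hP hs hN.ne' rfl fun _ => rfl
  · have hmem : (∑ q ∈ Finset.HasAntidiagonal.antidiagonal N, _) ∈ Subalgebra.toSubmodule (liftable hP hℓ hs) :=
      ⟨_, gElement_mem_adjoin hP (by omega) r N, hrow r N⟩
    have hsub : ({(N, 0), (0, N)} : Finset (ℕ × ℕ)) ⊆ Finset.HasAntidiagonal.antidiagonal N := by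
      intro q hq; rw [Finset.HasAntidiagonal.mem_antidiagonal]
      rcases mem_insert.1 hq with rfl | hq
      · rfl
      · rw [mem_singleton.1 hq]; exact zero_add N
    rw [← sum_sdiff hsub, Submodule.add_mem_iff_right, sum_pair] at hmem
    · convert hmem using 2
      · simp [hr0]
      · simp [hl0, ht, ← TensorProduct.smul_tmul']
        rw [show t 0 = P.q3 ^ ((n + 1) * N) from rfl]
        split_ifs <;> module
    · exact fun h => hN.ne' (congrArg Prod.fst h)
    · refine Submodule.sum_mem _ fun q hq => ?_
      rw [Finset.mem_sdiff, Finset.HasAntidiagonal.mem_antidiagonal] at hq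
      simp [Prod.ext_iff] at hq; have h1 := ih q.1 (by omega)
      have h2 := ih q.2 (by omega)
      have h3 : ∀ r, leftGen P ℓ s r q.1 ⊗ₜ[ℂ] rightGen P n q.2 ∈
          Subalgebra.toSubmodule (liftable hP hℓ hs) := fun r => by
        have := mul_mem (h1.2 r) h2.1
        rwa [Algebra.TensorProduct.tmul_mul_tmul, mul_one, one_mul] at this
      exact Submodule.smul_mem _ _ (Submodule.add_mem _ (Submodule.smul_mem _ _ (h3 _))
        (Submodule.smul_mem _ _ (h3 _)))

theorem tensorVal_mem_liftable (hP : P.Admissible) (hℓ : exp ℓ = P.q1) (hs : IsGeneric P s)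
    (h1 : Algebra.adjoin ℂ (gElements (P.tilde ℓ (n + 2)) (sTilde s)) = betheAlgebra _ (sTilde s))
    (h2 : Algebra.adjoin ℂ (gElements (P.second (n + 2)) fun _ : Fin 1 => (1 : ℂ)) =
      betheAlgebra _ fun _ => 1)
    (X : betheAlgebra (P.tilde ℓ (n + 2)) (sTilde s) ⊗[ℂ]
      betheAlgebra (P.second (n + 2)) fun _ : Fin 1 => (1 : ℂ)) :
    tensorVal (betheAlgebra _ _) (betheAlgebra _ _) X ∈ liftable hP hℓ hs := by
  have hl : betheAlgebra (P.tilde ℓ (n + 2)) (sTilde s) ≤ (liftable hP hℓ hs).comap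
      Algebra.TensorProduct.includeLeft := by
    rw [← h1]; refine Algebra.adjoin_le ?_; rintro _ ⟨r, N, -, rfl⟩
    exact (gens_mem_liftable hP hℓ hs N).2 r
  have hr : (betheAlgebra (P.second (n + 2)) fun _ : Fin 1 => (1 : ℂ)) ≤
      (liftable hP hℓ hs).comap Algebra.TensorProduct.includeRight := by
    rw [← h2]; refine Algebra.adjoin_le ?_; rintro _ ⟨r, N, hr, rfl⟩
    obtain rfl : r = 0 := by omega
    exact (gens_mem_liftable hP hℓ hs N).1
  induction X using TensorProduct.induction_on with
  | zero => simp
  | add X Y hX hY => rw [map_add]; exact add_mem hX hY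
  | tmul f g =>
    have hf : (f : ShuffleAmbient (P.tilde ℓ (n + 2)) (n + 1)) ⊗ₜ[ℂ] 1 ∈ liftable hP hℓ hs := hl f.2
    have hg : 1 ⊗ₜ[ℂ] (g : ShuffleAmbient (P.second (n + 2)) 1) ∈ liftable hP hℓ hs := hr g.2
    have := mul_mem hf hg
    rwa [Algebra.TensorProduct.tmul_mul_tmul, mul_one, one_mul] at this

end Surjectivity

section GradedPieces

open MvPolynomial

theorem mem_of_isWeightedHomogeneous {σ : Type} {w : σ → ℕ} (C : ℕ → Submodule ℂ (MvPolynomial σ ℂ))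
    [SetLike.GradedMonoid C] (hX : ∀ v, X v ∈ C (w v)) {p : MvPolynomial σ ℂ} {N : ℕ}
    (hp : IsWeightedHomogeneous w p N) : p ∈ C N := by
  rw [p.as_sum]; refine Submodule.sum_mem _ fun μ hμ => ?_
  rw [monomial_eq, ← smul_eq_C_mul, ← hp (mem_support_iff.1 hμ), Finsupp.weight_apply]
  exact Submodule.smul_mem _ _ (SetLike.prod_pow_mem_graded C _ _ _ fun v _ => hX v)

theorem tmul_mem_tensorComponent {P P' : QParam} {m m' : ℕ} {s : Fin m → ℂ} {s' : Fin m' → ℂ}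
    {L M : ℕ} {f : betheAlgebra P s} {g : betheAlgebra P' s'}
    (hf : (f : ShuffleAmbient P m) ∈ betheComponent P s L)
    (hg : (g : ShuffleAmbient P' m') ∈ betheComponent P' s' M) :
    f ⊗ₜ[ℂ] g ∈ tensorComponent s s' (L + M) :=
  Submodule.subset_span ⟨L, M, rfl, f, g, hf, hg, rfl⟩

theorem tensorComponent_gradedMonoid {P P' : QParam} (hP : P.Admissible) (hP' : P'.Admissible)
    {m m' : ℕ} (s : Fin m → ℂ) (s' : Fin m' → ℂ) :
    SetLike.GradedMonoid (tensorComponent (P := P) (P' := P') s s') where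
  one_mem := tmul_mem_tensorComponent (L := 0) (M := 0) one_mem_betheComponent one_mem_betheComponent
  mul_mem {i j X Y} hX hY := by
    have : tensorComponent (P := P) (P' := P') s s' i * tensorComponent s s' j ≤
        tensorComponent s s' (i + j) := by
      rw [tensorComponent, tensorComponent, Submodule.span_mul_span, Submodule.span_le]
      rintro _ ⟨_, ⟨L, M, rfl, f, g, hf, hg, rfl⟩, _, ⟨L', M', rfl, f', g', hf', hg', rfl⟩, rfl⟩
      rw [add_add_add_comm]
      simp_all [tmul_mem_tensorComponent, mul_mem_betheComponent]
    exact this (Submodule.mul_mem_mul hX hY)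

/-- Polynomial rings in `n + 2` families of variables as tensor products. -/
def splitLast (n : ℕ) : MvPolynomial (Fin (n + 2) × ℕ+) ℂ ≃ₐ[ℂ]
    MvPolynomial (Fin (n + 1) × ℕ+) ℂ ⊗[ℂ] MvPolynomial (Fin 1 × ℕ+) ℂ :=
  AlgEquiv.ofAlgHom
    (aeval fun v => Fin.lastCases (motive := fun _ => _) (1 ⊗ₜ X (0, v.2)) (fun i => X (i, v.2) ⊗ₜ 1) v.1)
    (Algebra.TensorProduct.lift (rename fun v => (v.1.castSucc, v.2))
      (rename fun v => (Fin.last _, v.2)) fun _ _ => Commute.all _ _)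
    (by
      ext v
      · simp
      · obtain ⟨i, ν⟩ := v; obtain rfl : i = 0 := Subsingleton.elim _ _; simp)
    (by
      ext ⟨i, ν⟩ : 1
      induction i using Fin.lastCases <;> simp)

theorem splitLast_X_last (n : ℕ) (ν : ℕ+) : splitLast n (X (Fin.last _, ν)) = 1 ⊗ₜ X (0, ν) := by
  simp [splitLast]

theorem splitLast_X_castSucc (n : ℕ) (i : Fin (n + 1)) (ν : ℕ+) :
    splitLast n (X (i.castSucc, ν)) = X (i, ν) ⊗ₜ 1 := by
  simp [splitLast]

theorem isWeightedHomogeneous_rename {σ τ : Type} {w : σ → ℕ} {w' : τ → ℕ} {f : σ → τ}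
    (hf : ∀ v, w' (f v) = w v) {p : MvPolynomial σ ℂ} {N : ℕ} (hp : IsWeightedHomogeneous w p N) :
    IsWeightedHomogeneous w' (rename f p) N := by
  have h : p ∈ (weightedHomogeneousSubmodule ℂ w' N).comap (rename f).toLinearMap := by
    have : SetLike.GradedMonoid fun N =>
        (weightedHomogeneousSubmodule ℂ w' N).comap (rename (R := ℂ) f).toLinearMap :=
      { one_mem := by
          simp [Submodule.mem_comap, AlgHom.toLinearMap_apply, map_one, isWeightedHomogeneous_one]
        mul_mem := fun {i j p q} hp hq => by
          simp_all [Submodule.mem_comap, AlgHom.toLinearMap_apply, map_mul,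
            IsWeightedHomogeneous.mul] }
    refine mem_of_isWeightedHomogeneous (fun N =>
      (weightedHomogeneousSubmodule ℂ w' N).comap (rename (R := ℂ) f).toLinearMap) (fun v => ?_) hp
    simp [← hf v]; exact isWeightedHomogeneous_X ℂ w' _
  exact h

end GradedPieces

open MvPolynomial in
/-- The algebra `B_m(s)` is generated by the elements `G_{r,N}(s)` and is a graded polynomial
algebra. -/
def BetheStructure (P : QParam) {m : ℕ} (s : Fin m → ℂ) : Prop :=
  Algebra.adjoin ℂ (gElements P s) = betheAlgebra P s ∧
    ∃ e : MvPolynomial (Fin m × ℕ+) ℂ ≃ₐ[ℂ] betheAlgebra P s,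
      ∀ (N : ℕ) (p : MvPolynomial (Fin m × ℕ+) ℂ),
        IsWeightedHomogeneous (fun v : Fin m × ℕ+ => (v.2 : ℕ)) p N ↔
          (e p : ShuffleAmbient P m) ∈ betheComponent P s N

section FusionIso

open MvPolynomial

variable {P : QParam} {ℓ : ℂ} {n : ℕ} {s : Fin (n + 2) → ℂ}

theorem exists_tensor_iso {P P' : QParam} (hP : P.Admissible) (hP' : P'.Admissible)
    {s : Fin (n + 1) → ℂ} {s' : Fin 1 → ℂ} (h : BetheStructure P s) (h' : BetheStructure P' s') :
    ∃ θ : MvPolynomial (Fin (n + 2) × ℕ+) ℂ ≃ₐ[ℂ] betheAlgebra P s ⊗[ℂ] betheAlgebra P' s',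
      ∀ N p, IsWeightedHomogeneous (fun v : Fin (n + 2) × ℕ+ => (v.2 : ℕ)) p N ↔
        θ p ∈ tensorComponent s s' N := by
  obtain ⟨-, e, he⟩ := h; obtain ⟨-, e', he'⟩ := h'
  let θ := (splitLast n).trans (Algebra.TensorProduct.congr e e')
  have := tensorComponent_gradedMonoid hP hP' s s'
  refine ⟨θ, fun N p => ⟨fun hp => ?_, fun hp => ?_⟩⟩
  · have : SetLike.GradedMonoid fun N =>
        (tensorComponent (P := P) (P' := P') s s' N).comap θ.toLinearMap :=
      { one_mem := by simp; exact SetLike.GradedOne.one_mem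
        mul_mem := fun {i j p q} hp hq => by
          simp at *
          exact SetLike.GradedMul.mul_mem hp hq }
    have h1 := (he 0 1).1 (isWeightedHomogeneous_one ℂ _)
    have h2 := (he' 0 1).1 (isWeightedHomogeneous_one ℂ _)
    refine mem_of_isWeightedHomogeneous (fun N => (tensorComponent s s' N).comap θ.toLinearMap)
      (fun v => ?_) hp
    obtain ⟨i, ν⟩ := v
    rw [Submodule.mem_comap, AlgEquiv.toLinearMap_apply, AlgEquiv.trans_apply]
    induction i using Fin.lastCases with
    | last =>
      rw [splitLast_X_last, Algebra.TensorProduct.congr_apply, Algebra.TensorProduct.map_tmul]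
      have := tmul_mem_tensorComponent h1 ((he' ν (X (0, ν))).1 (isWeightedHomogeneous_X ℂ _ _))
      rwa [zero_add] at this
    | cast i =>
      rw [splitLast_X_castSucc, Algebra.TensorProduct.congr_apply, Algebra.TensorProduct.map_tmul]
      have := tmul_mem_tensorComponent ((he ν (X (i, ν))).1 (isWeightedHomogeneous_X ℂ _ _)) h2
      rwa [add_zero] at this
  · have key : tensorComponent s s' N ≤ (weightedHomogeneousSubmodule ℂ
        (fun v : Fin (n + 2) × ℕ+ => (v.2 : ℕ)) N).comap θ.symm.toLinearMap := by
      refine Submodule.span_le.2 ?_; rintro _ ⟨L, M, rfl, f, g, hf, hg, rfl⟩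
      have h1 : IsWeightedHomogeneous _ (e.symm f) L := (he L _).2 (by simp_all)
      have h2 : IsWeightedHomogeneous _ (e'.symm g) M := (he' M _).2 (by simp_all)
      have h3 : θ.symm (f ⊗ₜ g) = (splitLast n).symm (e.symm f ⊗ₜ e'.symm g) := by aesop
      let wt : Fin (n + 2) × ℕ+ → ℕ := fun v => v.2
      exact (isWeightedHomogeneous_rename (w' := wt)
        (f := fun v : Fin (n + 1) × ℕ+ => (v.1.castSucc, v.2)) (fun _ => rfl) h1).mul
        (isWeightedHomogeneous_rename (w' := wt)
          (f := fun v : Fin 1 × ℕ+ => (Fin.last (n + 1), v.2)) (fun _ => rfl) h2)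
    have := key hp
    rwa [Submodule.mem_comap, AlgEquiv.toLinearMap_apply, θ.symm_apply_apply] at this

theorem tensorValue_eq_zero_of_mem {P P' : QParam} {m m' : ℕ} {s : Fin m → ℂ} {s' : Fin m' → ℂ}
    {N : ℕ} {X : betheAlgebra P s ⊗[ℂ] betheAlgebra P' s'} (hX : X ∈ tensorComponent s s' N)
    {S : Finset ((Fin m × ℂ) ⊕ (Fin m' × ℂ))}
    (hS : ∀ L M, L + M = N → ¬ (ColorBalanced L S.toLeft ∧ ColorBalanced M S.toRight)) :
    tensorValue S (tensorVal (betheAlgebra P s) (betheAlgebra P' s') X) = 0 := by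
  have key : tensorComponent s s' N ≤ LinearMap.ker
      (tensorValue S ∘ₗ (tensorVal (betheAlgebra P s) (betheAlgebra P' s')).toLinearMap) := by
    refine Submodule.span_le.2 ?_; rintro _ ⟨L, M, h, f, g, hf, hg, rfl⟩
    exact (hasSupport_of_mem hf).tensorValue (hasSupport_of_mem hg) (hS L M h)
  exact key hX

theorem adjoin_gElements_le_iSup (hP : P.Admissible) {m : ℕ} {s : Fin m → ℂ} (hs : IsGeneric P s) :
    Subalgebra.toSubmodule (Algebra.adjoin ℂ (gElements P s)) ≤
      ⨆ N, betheComponent P s N ⊓ Subalgebra.toSubmodule (Algebra.adjoin ℂ (gElements P s)) := by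
  set A := Algebra.adjoin ℂ (gElements P s) with hA
  set W := fun N => betheComponent P s N ⊓ Subalgebra.toSubmodule A
  have hmul : (⨆ N, W N) * (⨆ N, W N) ≤ ⨆ N, W N := by
    rw [Submodule.iSup_mul]; refine iSup_le fun i => ?_; rw [Submodule.mul_iSup]
    refine iSup_le fun j => (Submodule.mul_le.2 fun F hF G hG => ?_).trans (le_iSup W (i + j))
    exact Submodule.mem_inf.2 ⟨mul_mem_betheComponent hP hF.1 hG.1, A.mul_mem hF.2 hG.2⟩
  let B := (⨆ N, W N).toSubalgebra (Submodule.mem_iSup_of_mem 0 ⟨one_mem_betheComponent, A.one_mem⟩)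
    fun _ _ hx hy => hmul (Submodule.mul_mem_mul hx hy)
  have : A ≤ B := by
    refine Algebra.adjoin_le ?_; rintro _ ⟨r, N, hr, rfl⟩
    exact Submodule.mem_iSup_of_mem N ⟨gElement_mem_betheComponent hP hs r N,
      Algebra.subset_adjoin ⟨r, N, hr, rfl⟩⟩
  exact this

theorem exists_fusion_iso (hP : P.Admissible) (hℓ : exp ℓ = P.q1) (hs : IsGeneric P s)
    (h1 : BetheStructure (P.tilde ℓ (n + 2)) (sTilde s))
    (h2 : BetheStructure (P.second (n + 2)) fun _ : Fin 1 => (1 : ℂ)) :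
    BetheStructure P s ∧ ∃ Φ : betheAlgebra P s ≃ₐ[ℂ] (betheAlgebra (P.tilde ℓ (n + 2)) (sTilde s) ⊗[ℂ]
        betheAlgebra (P.second (n + 2)) fun _ : Fin 1 => (1 : ℂ)),
      (∀ F : betheAlgebra P s, IsLift P ℓ (F : ShuffleAmbient P (n + 2)) (tensorVal (betheAlgebra _ _) (betheAlgebra _ _) (Φ F))) ∧
      ∀ (N : ℕ) (F : betheAlgebra P s), (F : ShuffleAmbient P (n + 2)) ∈ betheComponent P s N ↔
        Φ F ∈ tensorComponent (sTilde s) (fun _ : Fin 1 => (1 : ℂ)) N := by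
  have hP' := hP.tilde hℓ n; have hP'' := hP.second n
  obtain ⟨θ, hθ⟩ := exists_tensor_iso hP' hP'' h1 h2
  let H : Submodule ℂ (ShuffleAmbient P (n + 2) × MvPolynomial (Fin (n + 2) × ℕ+) ℂ) :=
    { carrier := {p | IsLift P ℓ p.1 (tensorVal (betheAlgebra _ _) (betheAlgebra _ _) (θ p.2))}
      zero_mem' := by simp [Set.mem_ofPred_eq, Prod.fst_zero, Prod.snd_zero, map_zero, isLift_zero]
      add_mem' := fun {X Y} hX hY => by simp; exact IsLift.add hX hY
      smul_mem' := fun c X hX => by simp; exact IsLift.smul c hX }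
  have key := exists_graded_iso hP hs (by omega) H ?_ ?_ ?_ ?_
  · obtain ⟨h3, e, he, he'⟩ := key
    refine ⟨⟨h3, e, he'⟩, e.symm.trans θ, fun F => ?_, fun N F => ?_⟩
    · have := he (e.symm F); aesop
    · have := (he' N (e.symm F)).symm.trans (hθ N (e.symm F)); simp_all
  · show IsLift P ℓ _ _
    simp [map_one, isLift_one]
  · intro F hF G _ p q hp hq
    show IsLift P ℓ _ _
    simp; exact IsLift.mul hP hℓ hF hp hq
  · intro p hp
    have := eq_zero_of_tensorValue hP hℓ hP' hP'' (θ p) fun S hS => by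
      rw [← hp S hS, fusionValue_zero]
    simp_all
  · intro v; have hv := (hθ v.2 (X v)).1 (isWeightedHomogeneous_X ℂ _ _)
    obtain ⟨F, hF, hFv⟩ := tensorVal_mem_liftable hP hℓ hs h1.1 h2.1 (θ (X v))
    obtain ⟨f, hf, -, hfv⟩ := exists_components (W := fun N => betheComponent P s N ⊓
      Subalgebra.toSubmodule (Algebra.adjoin ℂ (gElements P s))) (fun N F hF => hasSupport_of_mem hF.1)
      (adjoin_gElements_le_iSup hP hs hF)
    refine ⟨f v.2, (hf _).1, (hf _).2, fun S hS => ?_⟩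
    by_cases hb : ColorBalanced (v.2 : ℕ) (fusionUnion P ℓ S)
    · rw [← hFv S hS, fusionValue, fusionValue, hfv _ _ hb]
    · rw [fusionValue, hasSupport_of_mem (hf v.2).1 _ hb, zero_div]
      refine (tensorValue_eq_zero_of_mem hv fun L M hLM h => hb ?_).symm
      grind [colorBalanced_fusionUnion]

theorem betheStructure : ∀ {m : ℕ} (_ : m ≠ 0) {P : QParam} (_ : P.Admissible) {s : Fin m → ℂ}
    (_ : IsGeneric P s), BetheStructure P s
  | 0, hm, _, _, _, _ => absurd rfl hm
  | 1, _, _, hP, _, hs => exists_graded_iso_one hP hs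
  | n + 2, _, P, hP, _, hs => by
    have hℓ : exp (log P.q1) = P.q1 := exp_log hP.q1_ne
    exact (exists_fusion_iso hP hℓ hs (betheStructure (Nat.succ_ne_zero n) (hP.tilde hℓ n)
      (hs.sTilde hℓ)) (exists_graded_iso_one (hP.second n) (isGeneric_second hP n))).1

end FusionIso

end

theorem mainTheorem2 (P : QParam) (hP : P.Admissible) :
    (∀ (m : ℕ), 1 ≤ m → ∀ s : Fin m → ℂ, IsGeneric P s →
      -- `B_m(s)` is a subalgebra
      Subalgebra.toSubmodule (betheAlgebra P s) = betheSpace P s ∧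
      -- (i) generators
      Algebra.adjoin ℂ {F | ∃ r N : ℕ, r ≤ m - 1 ∧ F = gElement P s r N} = betheAlgebra P s ∧
      -- (iii) commutativity, and the isomorphism with the graded polynomial algebra
      (∀ F G : betheAlgebra P s, F * G = G * F) ∧
      (∃ e : MvPolynomial (Fin m × ℕ+) ℂ ≃ₐ[ℂ] betheAlgebra P s,
        ∀ (N : ℕ) (p : MvPolynomial (Fin m × ℕ+) ℂ),
          MvPolynomial.IsWeightedHomogeneous (fun v : Fin m × ℕ+ => (v.2 : ℕ)) p N ↔
            (e p : ShuffleAmbient P m) ∈ betheComponent P s N)) ∧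
    -- (ii) the fusion isomorphism for `m = n + 2`
    (∀ ℓ : ℂ, Complex.exp ℓ = P.q1 → ∀ (n : ℕ) (s : Fin (n + 2) → ℂ), IsGeneric P s →
      Subalgebra.toSubmodule (betheAlgebra (P.tilde ℓ (n + 2)) (sTilde s)) =
        betheSpace (P.tilde ℓ (n + 2)) (sTilde s) ∧
      Subalgebra.toSubmodule (betheAlgebra (P.second (n + 2)) (fun _ : Fin 1 => (1 : ℂ))) =
        betheSpace (P.second (n + 2)) (fun _ : Fin 1 => (1 : ℂ)) ∧
      ∃ Φ : betheAlgebra P s ≃ₐ[ℂ] (betheAlgebra (P.tilde ℓ (n + 2)) (sTilde s) ⊗[ℂ]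
          betheAlgebra (P.second (n + 2)) (fun _ : Fin 1 => (1 : ℂ))),
        -- `Φ` is the restriction of the fusion map
        (∀ (F : betheAlgebra P s) (L M : ℕ) (y : Fin (n + 1) → Fin L → ℂ) (z : Fin 1 → Fin M → ℂ),
          FusionGeneric P ℓ y z →
            evalTensor _ _ y z (Φ F) = fusion P ℓ (F : ShuffleAmbient P (n + 2)) y z) ∧
        -- `Φ` is graded
        (∀ (N : ℕ) (F : betheAlgebra P s),
          (F : ShuffleAmbient P (n + 2)) ∈ betheComponent P s N ↔
            Φ F ∈ tensorComponent (sTilde s) (fun _ : Fin 1 => (1 : ℂ)) N)) := by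
  refine ⟨fun m hm s hs => ?_, fun ℓ hℓ n s hs => ?_⟩
  · obtain ⟨h, e, he⟩ := betheStructure (by omega) hP hs
    refine ⟨toSubmodule_betheAlgebra hP, h, fun F G => ?_, e, he⟩
    exact e.symm.injective (by rw [map_mul, map_mul, mul_comm])
  · obtain ⟨-, Φ, h1, h2⟩ := exists_fusion_iso hP hℓ hs
      (betheStructure (Nat.succ_ne_zero n) (hP.tilde hℓ n) (hs.sTilde hℓ))
      (betheStructure one_ne_zero (hP.second n) (isGeneric_second hP n))
    refine ⟨toSubmodule_betheAlgebra (hP.tilde hℓ n), toSubmodule_betheAlgebra (hP.second n), Φ,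
      fun F L M y z h => ?_, h2⟩
    rw [evalTensor_eq _ _ h.1 h.2.1, fusion_eq_fusionValue hP h]
    exact (h1 F _ (h.fusionGood hP)).symm
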